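/- **Setting.** Let $(M,g)$ be an $n$-dimensional smooth Riemannian manifold and let $\exp$ be a regular exponential map on $M$, defined on an open set $\mathcal D\subset TM$ that contains the zero section and is star-shaped in every fibre. Regular means the following. Here $d$ is the differential in $v$, $\gamma_{p,v}(t)=\exp_p(tv)$, and $N_p(v)=\ker d\exp_p(v)$, whose dimension is the order of $v$. * (R1) $\exp$ is smooth in $(p,v)\in\mathcal D$, $v\neq0$, and $\dot\gamma_{p,v}(t)\ne0$ for $v\ne0$. * (R2) For $v\neq0$ the Hessian $d^2\exp_p(v)$ maps $\mathbf R v\times N_p(v)$ isomorphically onto $T_{\exp_p(v)}M/\operatorname{Im} d\exp_p(v)$. * (R3) Every $v\ne0$ has a convex neighborhood $U$ in $T_pM$ such that on every ray that meets $U$ the number of singularities of $\exp_p$ in $U$, counted with multiplicity, equals the order of $v$. * (R4) $\exp_p(0)=p$; for $v\ne 0$, $\exp_p(tv)$ is smooth in $(p,t,v)$ for small $|t|$, and $\dot\gamma_{p,v}(0)=v$. * (R5) If $q=\exp_p(v)$ and $w=-\dot\gamma_{p,v}(1)$, then $\exp_q(w)=p$ and $\dot\gamma_{q,w}(1)=-v$.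 Let $S(p)\subset T_pM\setminus0$ be the set of conjugate vectors, those at which $d\exp_p$ is not an isomorphism. Let $v_0$ be a fold conjugate vector at $p_0$. That is, some neighborhood of $v_0$ contains at most one conjugate vector on each radial ray, $N_{p_0}(v_0)$ is one-dimensional, and it is transversal to $S(p_0)$. Put $q_0=\exp_{p_0}(v_0)$. Let $\kappa,\kappa^\sharp$ be smooth complex functions on $TM\setminus0$, and let $$Nf(p)=\int_{S_pM}\kappa^\sharp(p,\theta)\int\kappa\big(\gamma_{p,\theta}(t),\dot\gamma_{p,\theta}(t)\big)f(\gamma_{p,\theta}(t))\,dt\,d\sigma_p(\theta),$$ where $t$ runs over the maximal interval on which $\exp_p(t\theta)$ is defined. Let $\mathcal O$ be any sufficiently small open neighborhood of $(p_0,v_0)$ in $TM$. Assume that the weights are localized near $(p_0,v_0)$: for $(p,q)$ near $(p_0,q_0)$, the product $\kappa^\sharp(p,\theta)\,\kappa(\gamma_{p,\theta}(t),\dot\gamma_{p,\theta}(t))$ with $\gamma_{p,\theta}(t)=q$, $|\theta|=1$, is nonzero only if $t>0$ and $(p,t\theta)\in\mathcal O$. (For arbitrary weights the conclusions hold for the part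 of $N$ obtained by integrating only over $t>0$ with $(p,t\theta)\in\mathcal O$.) Denote by $\Sigma(p)$ the image under $\exp_p$ of the $v\in S(p)$ with $(p,v)\in\mathcal O$, and by $\Sigma$ the set of $(p,q)$ with $q\in\Sigma(p)$. Let $z'(p,q)$ be the signed distance from $q$ to $\Sigma(p)$, positive if $q=\exp_p(v)$ for some $(p,v)\in\mathcal O$, and negative otherwise. For $v\in S(p)$ and $q=\exp_p(v)$ let * $A=|d\det d\exp_p(v)|$, where the determinant is taken with respect to the Riemannian volumes of $T_pM$ and $M$, and the norm with respect to $g(p)$; * $D=\det\big(d\exp_p|_{T_vS(p)}\big)>0$, with respect to the induced metrics on $S(p)$ and $\Sigma(p)$; * $W_\Sigma=|v|^{1-n}\,\kappa^\sharp(p,v/|v|)\,\kappa\big(q,\dot\gamma_{p,v}(1)/|v|\big)$. **Theorem.** Near $(p_0,q_0)$ the function $z'$ is smooth, $\Sigma=\{z'=0\}$, and $d_qz'(p_0,q_0)\neq0$. Let $z''$ be any smooth $\mathbf R^{2n-1}$-valued function near $(p_0,q_0)$ such that $(z',z'')$ are coordinates there. Then $S$ near $(p_0,v_0)$, and with it $\Sigma$,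 is smoothly parametrized by $z''$, so that $W_\Sigma,A,D$ are functions of $z''$, with $A,D>0$. The Schwartz kernel $N(p,q)$ of $N$ with respect to the Riemannian volume is, near $(p_0,q_0)$, locally integrable in $q$, zero for $z'<0$, and for $z'>0$ of the form $$N=\frac{\sqrt2}{\sqrt{A\,D\,z'}}\Big(W_\Sigma+\sqrt{z'}\,R(\sqrt{z'},z'')\Big)$$ with a smooth function $R$. If $W_\Sigma\ne0$ at $(p_0,q_0)$, then also, with another smooth function $R$, $$N=W_\Sigma\,\frac{\sqrt2}{\sqrt{A\,D\,z'}}\Big(1+\sqrt{z'}\,R(\sqrt{z'},z'')\Big).$$ Thus the kernel has a one-sided conormal singularity at $\Sigma$ of type $(z'_+)^{-1/2}$. -/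

import Mathlib

open Set Filter Topology MeasureTheory
open scoped Manifold ContDiff ENNReal

noncomputable section

namespace FoldCaustic

/-- The model space `ℝⁿ`. -/
abbrev Eu (n : ℕ) : Type := EuclideanSpace ℝ (Fin n)

/-- A smooth (`C^∞`) Riemannian metric on the manifold `M` modelled on `ℝⁿ`. -/
abbrev RiemMetric (n : ℕ) (M : Type*) [TopologicalSpace M] [ChartedSpace (Eu n) M]
    [IsManifold (𝓡 n) ∞ M] : Type _ :=
  Bundle.ContMDiffRiemannianMetric (𝓡 n) ∞ (Eu n) (fun x : M => TangentSpace (𝓡 n) x)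

/-! ### Maps `exp : TM → M` defined on a part of the tangent bundle -/

section Exp

variable {n : ℕ} {M : Type*} [TopologicalSpace M] [ChartedSpace (Eu n) M]

/-- The map `exp_p : T_pM → M`. As a set, `T_pM` is the model space `ℝⁿ` (the identification being
the linear one given by the preferred chart at `p`). -/
def expAt (exp : TangentBundle (𝓡 n) M → M) (p : M) (v : Eu n) : M :=
  exp ⟨p, v⟩

/-- The "geodesic" `γ_{p,v}(t) = exp_p (t v)` together with its velocity:
the tangent vector `(γ_{p,v}(t), γ̇_{p,v}(t))`. -/
def velocity (exp : TangentBundle (𝓡 n) M → M) (p : M) (v : Eu n) (t : ℝ) :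
    TangentBundle (𝓡 n) M :=
  ⟨expAt exp p (t • v), mfderiv 𝓘(ℝ, ℝ) (𝓡 n) (fun s : ℝ => expAt exp p (s • v)) t (1 : ℝ)⟩

/-- The differential `d exp_p (v) : T_v T_pM = T_pM → T_q M`, `q = exp_p v`. -/
def dexp (exp : TangentBundle (𝓡 n) M → M) (p : M) (v : Eu n) : Eu n →L[ℝ] Eu n :=
  mfderiv 𝓘(ℝ, Eu n) (𝓡 n) (expAt exp p) v

/-- The order of `v` as a singularity of `exp_p`: the dimension of `N_p(v) = ker d exp_p (v)`. -/
def order (exp : TangentBundle (𝓡 n) M → M) (p : M) (v : Eu n) : ℕ :=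
  Module.finrank ℝ (LinearMap.ker (dexp exp p v : Eu n →ₗ[ℝ] Eu n))

/-- `exp_p` near `v`, read in the preferred chart at `exp_p v`. -/
def expChart (exp : TangentBundle (𝓡 n) M → M) (p : M) (v : Eu n) : Eu n → Eu n :=
  fun u => extChartAt (𝓡 n) (expAt exp p v) (expAt exp p u)

/-- Regular exponential maps. `D ⊆ TM` is the domain on which `exp` is defined; it is open, contains
the zero section and is star-shaped in every fibre. -/
structure IsRegularExp [IsManifold (𝓡 n) ∞ M] (D : Set (TangentBundle (𝓡 n) M))
    (exp : TangentBundle (𝓡 n) M → M) : Prop where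
  isOpen_domain : IsOpen D
  zero_mem : ∀ p : M, (⟨p, 0⟩ : TangentBundle (𝓡 n) M) ∈ D
  smul_mem : ∀ (p : M) (v : Eu n) (t : ℝ), 0 ≤ t → t ≤ 1 →
    (⟨p, v⟩ : TangentBundle (𝓡 n) M) ∈ D → (⟨p, t • v⟩ : TangentBundle (𝓡 n) M) ∈ D
  /-- Smoothness away from the zero section. -/
  smooth : ContMDiffOn (𝓡 n).tangent (𝓡 n) ∞ exp {x | x ∈ D ∧ x.2 ≠ 0}
  /-- Nonvanishing velocity, `d exp_p (t v) / dt ≠ 0` for `v ≠ 0`. -/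
  velocity_ne_zero : ∀ (p : M) (v : Eu n) (t : ℝ), v ≠ 0 →
    (⟨p, t • v⟩ : TangentBundle (𝓡 n) M) ∈ D → (velocity exp p v t).2 ≠ 0
  /-- The Hessian maps `r_v × N_p(v)` isomorphically onto `T_qM / Im d exp_p (v)`. -/
  hessian : ∀ (p : M) (v : Eu n), v ≠ 0 → (⟨p, v⟩ : TangentBundle (𝓡 n) M) ∈ D →
    Function.Bijective (fun α : LinearMap.ker (dexp exp p v : Eu n →ₗ[ℝ] Eu n) =>
      (Submodule.Quotient.mk (fderiv ℝ (fderiv ℝ (expChart exp p v)) v v (α : Eu n)) :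
        Eu n ⧸ LinearMap.range (dexp exp p v : Eu n →ₗ[ℝ] Eu n)))
  /-- Local constancy along rays of the number of singularities, with multiplicity. -/
  multiplicity : ∀ (p : M) (v : Eu n), v ≠ 0 → (⟨p, v⟩ : TangentBundle (𝓡 n) M) ∈ D →
    ∃ U ∈ 𝓝 v, Convex ℝ U ∧
      (∀ u ∈ U, u ≠ 0 ∧ (⟨p, u⟩ : TangentBundle (𝓡 n) M) ∈ D) ∧
      ∀ u ∈ U, ∑' t : {t : ℝ // t • u ∈ U}, (order exp p ((t : ℝ) • u) : ℝ≥0∞) = order exp p v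
  /-- `exp_p 0 = p`. -/
  exp_zero : ∀ p : M, expAt exp p 0 = p
  /-- Smoothness of `exp_p (t v)` in `p`, `t`, `v` for small `t` and `v ≠ 0`. -/
  smooth_zero : ∀ (p : M) (v : Eu n), v ≠ 0 →
    ∃ s ∈ 𝓝 ((0 : ℝ), (⟨p, v⟩ : TangentBundle (𝓡 n) M)),
      ContMDiffOn (𝓘(ℝ, ℝ).prod (𝓡 n).tangent) (𝓡 n) ∞
        (fun x : ℝ × TangentBundle (𝓡 n) M => expAt exp x.2.1 (x.1 • x.2.2)) s
  /-- `d exp_p (t v) / dt = v` at `t = 0`. -/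
  velocity_zero : ∀ (p : M) (v : Eu n), v ≠ 0 → velocity exp p v 0 = ⟨p, v⟩
  /-- With `q = exp_p v` and `w = - γ̇_{p,v}(1)`, `exp_q w = p` and `γ̇_{q,w}(1) = -v`. -/
  reversible : ∀ (p : M) (v : Eu n), v ≠ 0 → (⟨p, v⟩ : TangentBundle (𝓡 n) M) ∈ D →
    (⟨expAt exp p v, -(velocity exp p v 1).2⟩ : TangentBundle (𝓡 n) M) ∈ D ∧
    velocity exp (expAt exp p v) (-(velocity exp p v 1).2) 1 = ⟨p, -v⟩

/-- The tangent conjugate locus `S(p) ⊆ T_pM`: the vectors at which `d exp_p` is not an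
isomorphism. -/
def conjVectors (D : Set (TangentBundle (𝓡 n) M)) (exp : TangentBundle (𝓡 n) M → M) (p : M) :
    Set (Eu n) :=
  {v | v ≠ 0 ∧ (⟨p, v⟩ : TangentBundle (𝓡 n) M) ∈ D ∧ ¬ Function.Bijective (dexp exp p v)}

/-- Regular conjugate vectors: near `v` every radial ray contains at most one conjugate vector. -/
def IsRegularConj (D : Set (TangentBundle (𝓡 n) M)) (exp : TangentBundle (𝓡 n) M → M) (p : M)
    (v : Eu n) : Prop :=
  v ∈ conjVectors D exp p ∧
    ∃ O ∈ 𝓝 v, ∀ u ∈ O ∩ conjVectors D exp p, ∀ t : ℝ, 0 < t →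
      t • u ∈ O ∩ conjVectors D exp p → t = 1

/-- Fold conjugate vectors: regular conjugate vectors `v` for which `N_p(v)` is one-dimensional and
transversal to `S(p)`, i.e. no nonzero element of `N_p(v)` is tangent to `S(p)` at `v`. -/
def IsFold (D : Set (TangentBundle (𝓡 n) M)) (exp : TangentBundle (𝓡 n) M → M) (p : M)
    (v : Eu n) : Prop :=
  IsRegularConj D exp p v ∧ order exp p v = 1 ∧
    ∀ α : Eu n, dexp exp p v α = 0 → α ≠ 0 → α ∉ tangentConeAt ℝ (conjVectors D exp p) v

/-- The part `Σ(p)` of the conjugate locus of `p` that comes from conjugate vectors in `O ⊆ TM`. -/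
def conjLocus (D : Set (TangentBundle (𝓡 n) M)) (exp : TangentBundle (𝓡 n) M → M)
    (O : Set (TangentBundle (𝓡 n) M)) (p : M) : Set M :=
  expAt exp p '' {v | (⟨p, v⟩ : TangentBundle (𝓡 n) M) ∈ O ∧ v ∈ conjVectors D exp p}

/-- The range of `exp_p` on the vectors `v` with `(p, v) ∈ O`. -/
def expRange (exp : TangentBundle (𝓡 n) M → M) (O : Set (TangentBundle (𝓡 n) M)) (p : M) : Set M :=
  expAt exp p '' {v | (⟨p, v⟩ : TangentBundle (𝓡 n) M) ∈ O}

end Exp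

/-! ### Riemannian notions -/

section Riemannian

variable {n : ℕ} {M : Type*} [TopologicalSpace M] [ChartedSpace (Eu n) M] [IsManifold (𝓡 n) ∞ M]

/-- The inner product `g(p)` on `T_pM`. -/
def ip (g : RiemMetric n M) (p : M) (v w : Eu n) : ℝ := g.inner p v w

/-- The norm `|v|` of `v ∈ T_pM`. -/
def gnorm (g : RiemMetric n M) (p : M) (v : Eu n) : ℝ := Real.sqrt (ip g p v v)

/-- The determinant of the Gram matrix of a family of vectors of `T_pM`. -/
def gramDet (g : RiemMetric n M) (p : M) {m : ℕ} (b : Fin m → Eu n) : ℝ :=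
  (Matrix.of fun i j => ip g p (b i) (b j)).det

/-- `det g(p)`, in the coordinates `ℝⁿ` of `T_pM`. -/
def fibreDet (g : RiemMetric n M) (p : M) : ℝ :=
  gramDet g p (fun i => EuclideanSpace.single i (1 : ℝ))

/-- `det g` as a function of the coordinates `x` of the preferred chart at `c`: the Gram determinant
of the coordinate vector fields. -/
def coordDet (g : RiemMetric n M) (c : M) (x : Eu n) : ℝ :=
  gramDet g ((extChartAt (𝓡 n) c).symm x) (fun i =>
    mfderiv 𝓘(ℝ, Eu n) (𝓡 n) (extChartAt (𝓡 n) c).symm x (EuclideanSpace.single i (1 : ℝ)))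

/-- The Riemannian volume `√(det g) dx` of `M` on the domain of the preferred chart at `c`
(as a measure on `M` that vanishes outside that domain). -/
def chartVolume [MeasurableSpace M] (g : RiemMetric n M) (c : M) : Measure M :=
  Measure.map (extChartAt (𝓡 n) c).symm
    ((volume.restrict (extChartAt (𝓡 n) c).target).withDensity
      fun x => ENNReal.ofReal (Real.sqrt (coordDet g c x)))

/-- The volume `dVol_p` of the Euclidean space `(T_pM, g(p))`. -/
def fibreVolume (g : RiemMetric n M) (p : M) : Measure (Eu n) :=
  ENNReal.ofReal (Real.sqrt (fibreDet g p)) • volume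

/-- The surface measure `dσ_p` of the unit sphere `S_pM`, as a measure on `T_pM`: the measure of a
part of the sphere is `n` times the volume of the cone over it inside the unit ball. -/
def sphereMeasure (g : RiemMetric n M) (p : M) : Measure (Eu n) :=
  (n : ℝ≥0∞) • Measure.map (fun v => (gnorm g p v)⁻¹ • v)
    ((fibreVolume g p).restrict {v | gnorm g p v < 1})

open scoped Bundle in
/-- The Riemannian distance of `g`. -/
def gdist (g : RiemMetric n M) (x y : M) : ℝ≥0∞ :=
  letI : Bundle.RiemannianBundle (fun x : M => TangentSpace (𝓡 n) x) := ⟨g.toRiemannianMetric⟩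
  Manifold.riemannianEDist (𝓡 n) x y

/-- The Riemannian distance from a point to a set. -/
def distTo (g : RiemMetric n M) (q : M) (s : Set M) : ℝ := (⨅ y ∈ s, gdist g q y).toReal

open Classical in
/-- The signed distance `z'(p, q)` from `q` to `Σ(p)`, positive on the side of `Σ(p)` that lies in
the range of `exp_p`. The set `O` is the neighbourhood of `(p₀, v₀)` to which `exp` is localized. -/
def signedDist (g : RiemMetric n M) (D : Set (TangentBundle (𝓡 n) M))
    (exp : TangentBundle (𝓡 n) M → M) (O : Set (TangentBundle (𝓡 n) M)) (x : M × M) : ℝ :=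
  if x.2 ∈ expRange exp O x.1 then distTo g x.2 (conjLocus D exp O x.1)
  else -distTo g x.2 (conjLocus D exp O x.1)

/-- The Jacobian determinant `det d exp_p` near `v`, with respect to the Riemannian volumes of
`T_pM` and of `M`; as a function of `u` near `v`
(`√(det g(exp_p u) / det g(p)) · det (∂ exp_p (u) / ∂u)`), the sign being fixed by the coordinates. -/
def detExp (g : RiemMetric n M) (exp : TangentBundle (𝓡 n) M → M) (p : M) (v : Eu n) : Eu n → ℝ :=
  fun u => Real.sqrt (coordDet g (expAt exp p v) (expChart exp p v u) / fibreDet g p) *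
    (fderiv ℝ (expChart exp p v) u).det

/-- `A(p, v) = |d det d exp_p (v)|`, the norm of the differential with respect to `g(p)`. -/
def invA (g : RiemMetric n M) (exp : TangentBundle (𝓡 n) M → M) (p : M) (v : Eu n) : ℝ :=
  sSup {a : ℝ | ∃ α : Eu n, gnorm g p α ≤ 1 ∧ a = |fderiv ℝ (detExp g exp p v) v α|}

/-- The tangent space `T_v S(p)` at a conjugate vector `v` at which the defining function
`det d exp_p` of `S(p)` has a nonzero differential. -/
def tangentS (g : RiemMetric n M) (exp : TangentBundle (𝓡 n) M → M) (p : M) (v : Eu n) :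
    Submodule ℝ (Eu n) :=
  LinearMap.ker (fderiv ℝ (detExp g exp p v) v : Eu n →ₗ[ℝ] ℝ)

/-- `D(p, v) = det (d exp_p |_{T_v S(p)})`, the (positive) Jacobian of `exp_p : S(p) → Σ(p)` with
respect to the metrics induced by `g(p)` on `S(p)` and by `g` on `Σ(p)`. -/
def invD (g : RiemMetric n M) (exp : TangentBundle (𝓡 n) M → M) (p : M) (v : Eu n) : ℝ :=
  Real.sqrt
    (gramDet g (expAt exp p v)
        (fun i => dexp exp p v (Module.finBasis ℝ (tangentS g exp p v) i : Eu n)) /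
      gramDet g p (fun i => (Module.finBasis ℝ (tangentS g exp p v) i : Eu n)))

/-! ### The weighted X-ray transform and the operator `N` -/

/-- The maximal time interval on which `t ↦ exp_p (t θ)` is defined. -/
def maxTimes (D : Set (TangentBundle (𝓡 n) M)) (p : M) (θ : Eu n) : Set ℝ :=
  {t | (⟨p, t • θ⟩ : TangentBundle (𝓡 n) M) ∈ D}

/-- The times `t > 0` at which `(p, t θ)` lies in `O`. -/
def timesIn (O : Set (TangentBundle (𝓡 n) M)) (p : M) (θ : Eu n) : Set ℝ :=
  {t | 0 < t ∧ (⟨p, t • θ⟩ : TangentBundle (𝓡 n) M) ∈ O}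

/-- The weighted X-ray transform
`X f (p, θ) = ∫ κ(γ_{p,θ}(t), γ̇_{p,θ}(t)) f(γ_{p,θ}(t)) dt`, the integral being over the times
`t ∈ T p θ`. -/
def xray (exp : TangentBundle (𝓡 n) M → M) (κ : TangentBundle (𝓡 n) M → ℂ)
    (T : M → Eu n → Set ℝ) (f : M → ℂ) (p : M) (θ : Eu n) : ℂ :=
  ∫ t in T p θ, κ (velocity exp p θ t) * f (expAt exp p (t • θ))

/-- The operator `N f (p) = ∫_{S_pM} κ♯(p, θ) X f (p, θ) dσ_p(θ)`. -/
def normalOp (g : RiemMetric n M) (exp : TangentBundle (𝓡 n) M → M)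
    (κs κ : TangentBundle (𝓡 n) M → ℂ) (T : M → Eu n → Set ℝ) (f : M → ℂ) (p : M) : ℂ :=
  ∫ θ, κs ⟨p, θ⟩ * xray exp κ T f p θ ∂(sphereMeasure g p)

/-- The weights localize `N` near `(p₀, v₀)`, with `O` as the neighbourhood of `(p₀, v₀)` and
`q₀ = exp_{p₀} v₀`: the only "geodesics" from a point `p` near `p₀` to a point `q` near `q₀` along
which the weight does not vanish are those with `q = exp_p (t θ)`, `t > 0` and `(p, t θ) ∈ O`. -/
def WeightsLocalized (g : RiemMetric n M) (D : Set (TangentBundle (𝓡 n) M))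
    (exp : TangentBundle (𝓡 n) M → M) (κs κ : TangentBundle (𝓡 n) M → ℂ)
    (O : Set (TangentBundle (𝓡 n) M)) (p₀ q₀ : M) : Prop :=
  ∀ᶠ x : M × M in 𝓝 (p₀, q₀), ∀ (θ : Eu n) (t : ℝ), gnorm g x.1 θ = 1 →
    t ∈ maxTimes D x.1 θ → expAt exp x.1 (t • θ) = x.2 →
    κs ⟨x.1, θ⟩ * κ (velocity exp x.1 θ t) ≠ 0 → t ∈ timesIn O x.1 θ

/-- `W_Σ = |v|^{1-n} κ♯(p, v/|v|) κ(q, -w/|v|)`, where `q = exp_p v` and `-w = γ̇_{p,v}(1)`. -/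
def weightSigma (g : RiemMetric n M) (exp : TangentBundle (𝓡 n) M → M)
    (κs κ : TangentBundle (𝓡 n) M → ℂ) (x : TangentBundle (𝓡 n) M) : ℂ :=
  ((gnorm g x.1 x.2 ^ (1 - (n : ℤ)) : ℝ) : ℂ) *
    κs ⟨x.1, (gnorm g x.1 x.2)⁻¹ • x.2⟩ *
    κ ⟨expAt exp x.1 x.2, (gnorm g x.1 x.2)⁻¹ • (velocity exp x.1 x.2 1).2⟩

/-- `K` is, near `(p₀, q₀)`, the Schwartz kernel of `T` with respect to the Riemannian volume:
`T f (p) = ∫ K(p, q) f(q) dVol(q)` for all `p` near `p₀` and all test functions `f` supported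
near `q₀`, the integral being absolutely convergent. -/
def HasKernelNear [MeasurableSpace M] (g : RiemMetric n M) (T : (M → ℂ) → M → ℂ) (K : M × M → ℂ)
    (p₀ q₀ : M) : Prop :=
  ∃ U ∈ 𝓝 p₀, ∃ V ∈ 𝓝 q₀, V ⊆ (extChartAt (𝓡 n) q₀).source ∧
    ∀ f : M → ℂ, ContMDiff (𝓡 n) 𝓘(ℝ, ℂ) ∞ f → HasCompactSupport f → tsupport f ⊆ V →
      ∀ p ∈ U, Integrable (fun q => K (p, q) * f q) (chartVolume g q₀) ∧
        T f p = ∫ q, K (p, q) * f q ∂(chartVolume g q₀)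

open Classical in
/-- The one-sided kernel `√2 / √(A D z') · a(√z', z'')` for `z' > 0`, and `0` for `z' ≤ 0`. Here
`A`, `D` are functions of `z''` through the parametrization `σ` of `S` by `z''`. -/
def foldKernel (g : RiemMetric n M) (exp : TangentBundle (𝓡 n) M → M) (z' : M × M → ℝ)
    (z'' : M × M → Eu (2 * n - 1)) (σ : Eu (2 * n - 1) → TangentBundle (𝓡 n) M)
    (a : ℝ → Eu (2 * n - 1) → ℂ) (x : M × M) : ℂ :=
  if 0 < z' x then
    ((Real.sqrt 2 / Real.sqrt (invA g exp (σ (z'' x)).1 (σ (z'' x)).2 *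
        invD g exp (σ (z'' x)).1 (σ (z'' x)).2 * z' x) : ℝ) : ℂ) * a (Real.sqrt (z' x)) (z'' x)
  else 0

end Riemannian

end FoldCaustic

end

/-!
# The kernel of the normal operator near a fold caustic

In charts, `(p, v) ↦ exp_p v` becomes a family of maps `E(x, ·)` between open sets of `ℝⁿ`,
depending smoothly on a parameter `x`. The condition on the Hessian makes the Jacobian determinant
of `E(x₀, ·)` a defining function of the set of conjugate vectors near `v₀`, and transversality of
the kernel then says that the second derivative of `E` in the kernel direction does not lie in the
range of the first: `E(x₀, ·)` has a fold at `v₀` (`exists_isFoldModel_of_isFold`).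

*The distance to the caustic.* A Lyapunov–Schmidt reduction and the completion of a square give
smooth functions with `ρ(x, E(x, w)) = X(x, w)²` (`exists_fold_normal_form`), so that the caustic is
`{ρ = 0}` and the range of `E(x, ·)` is `{ρ ≥ 0}`. Solving the eikonal equation by characteristics
(`exists_eikonal`) replaces `ρ` by a multiple `ζ` whose differential has norm `1`. Since the
characteristics are unit speed curves and `ζ` grows at most at unit rate along any path, `ζ` is the
signed distance `z'` (`eventually_distTo_eq`, `eventually_signedDist_eq`), and it still satisfies
`ζ(x, E) = X²` after rescaling `X` (`exists_isFoldModel`).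

*The fold in coordinates.* If `(ζ, z'')` are coordinates on the target, then `(X, z''(x, E))` are
coordinates on the source, in which the map `(x, w) ↦ (x, E)` is `(s, u) ↦ (s², u)`
(`exists_isFoldParam`). With the inverse `Υ` of these coordinates, `Υ(0, ·)` parametrizes the
conjugate vectors, and the preimages of a point with `z' > 0` are `Υ(±√z', z'')`.

*The kernel.* In polar coordinates of `T_pM`, the value `N f(p)` is the integral of
`W_Σ(v) f(exp_p v)` over `T_pM` (`integral_polar`, `normalOp_timesIn_eq`); for localized weights the
values of `t` outside the neighbourhood do not contribute (`normalOp_maxTimes_eq`). A change of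
variables on each of the two sheets `X > 0` and `X < 0` (`integral_fold`) gives the kernel as the
sum of `W_Σ / |det d exp_p|` over the two preimages. The determinant, taken with respect to the
Riemannian volumes, is `X k` with a smooth nonvanishing `k`, so the kernel is `1 / √z'` times the
sum of `W_Σ / |k|` over `Υ(±√z', z'')`. This sum is smooth in `(√z', z'')` and equal to
`2 W_Σ / |k|` at `z' = 0`, where `A D = k² / 2` (`invA_mul_invD`): the gradient of the determinant
is `k dX`, while a Gram determinant computation shows that the determinant of `d exp_p` on the
tangent spaces of `S(p)` is `|k| / (2 |dX|)`. The remainder is produced by Hadamard's lemma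
(`SmoothNear.exists_remainder`, `SmoothNear.exists_relative_remainder`).

Smooth dependence of the characteristics on all data comes from the implicit function theorem for
the integral equation in `C([0, 1], V)`, where composition with a smooth map is a smooth operator
(`contDiff_infty_comp_continuousMap`, `exists_smooth_flow`); the same operators give Hadamard's
lemma (`exists_smooth_slope`).
-/

noncomputable section

set_option maxSynthPendingDepth 3

namespace FoldCaustic

/-! ### Composition operators on spaces of continuous functions -/

section Superposition

variable {K : Type} [TopologicalSpace K] [CompactSpace K]
  {V F : Type} [NormedAddCommGroup V] [NormedSpace ℝ V] [NormedAddCommGroup F] [NormedSpace ℝ F]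

/-- The pointwise action of operator-valued continuous functions on vector-valued ones, as a
bounded bilinear map. -/
def pointwiseApply : C(K, V →L[ℝ] F) →L[ℝ] C(K, V) →L[ℝ] C(K, F) :=
  LinearMap.mkContinuous₂
    (LinearMap.mk₂ ℝ (fun (Λ : C(K, V →L[ℝ] F)) (h : C(K, V)) =>
        (⟨fun t => Λ t (h t), by fun_prop⟩ : C(K, F)))
      (fun _ _ _ => by ext; simp) (fun _ _ _ => by ext; simp)
      (fun _ _ _ => by ext; simp) (fun _ _ _ => by ext; simp)) 1
    (fun Λ h => by
      rw [one_mul]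
      refine (ContinuousMap.norm_le _ (by positivity)).2 fun t => ?_
      exact (ContinuousLinearMap.le_opNorm _ _).trans
        (mul_le_mul (Λ.norm_coe_le_norm t) (h.norm_coe_le_norm t) (by positivity) (by positivity)))

/-- Composition with a `C¹` map is differentiable, since the derivative of that map is uniformly
continuous near the compact range of a continuous function. -/
lemma hasFDerivAt_comp_continuousMap {f : V → F} (hf : ContDiff ℝ 1 f) (c : C(K, V)) :
    HasFDerivAt (fun c : C(K, V) => (⟨f, hf.continuous⟩ : C(V, F)).comp c)
      (pointwiseApply
        ((⟨fderiv ℝ f, hf.continuous_fderiv one_ne_zero⟩ : C(V, V →L[ℝ] F)).comp c)) c := by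
  rw [hasFDerivAt_iff_isLittleO_nhds_zero, Asymptotics.isLittleO_iff]
  intro ε hε
  have hc : IsCompact (range c) := isCompact_range c.continuous
  have hU := hc.uniformContinuousAt_of_continuousAt (fderiv ℝ f)
    (fun x _ => (hf.continuous_fderiv one_ne_zero).continuousAt) (Metric.dist_mem_uniformity hε)
  obtain ⟨δ, hδ, hδ'⟩ := Metric.mem_uniformity_dist.1 hU
  filter_upwards [Metric.ball_mem_nhds (0 : C(K, V)) hδ] with h hh
  refine (ContinuousMap.norm_le _ (by positivity)).2 fun t => ?_
  have hht : ‖h t‖ ≤ ‖h‖ := h.norm_coe_le_norm t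
  have hhδ : ‖h‖ < δ := by simpa using hh
  have key := (convex_ball (c t) δ).norm_image_sub_le_of_norm_hasFDerivWithin_le' (f := f)
    (f' := fderiv ℝ f) (φ := fderiv ℝ f (c t)) (C := ε) (x := c t) (y := c t + h t)
    (fun x _ => ((hf.differentiable one_ne_zero) x).hasFDerivAt.hasFDerivWithinAt)
    (fun x hx => by
      have := hδ' (a := c t) (b := x) (by rw [dist_comm]; exact hx) (mem_range_self t)
      have h2 : dist (fderiv ℝ f (c t)) (fderiv ℝ f x) < ε := this
      rw [dist_comm, dist_eq_norm] at h2
      exact h2.le)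
    (Metric.mem_ball_self hδ) (by simpa using hht.trans_lt hhδ)
  simp only [add_sub_cancel_left] at key
  exact key.trans (by gcongr)

/-- Composition with a `C^m` function is a `C^m` operation on continuous functions on a compact
space. -/
theorem contDiff_comp_continuousMap (m : ℕ) {F : Type} [NormedAddCommGroup F] [NormedSpace ℝ F]
    (f : C(V, F)) (hf : ContDiff ℝ m f) :
    ContDiff ℝ m (fun c : C(K, V) => f.comp c) := by
  induction m generalizing F with
  | zero =>
    rw [Nat.cast_zero, contDiff_zero]
    exact f.continuous_postcomp
  | succ m ih =>
    have h1 : ContDiff ℝ 1 f := hf.of_le (by norm_cast; omega)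
    rw [Nat.cast_succ]
    refine contDiff_succ_iff_hasFDerivAt.2 ⟨_, ?_, fun c => hasFDerivAt_comp_continuousMap h1 c⟩
    refine (pointwiseApply (K := K) (V := V) (F := F)).contDiff.comp (ih _ ?_)
    rw [Nat.cast_succ] at hf
    exact (contDiff_succ_iff_fderiv.1 hf).2.2

theorem contDiff_infty_comp_continuousMap (f : C(V, F)) (hf : ContDiff ℝ ∞ f) :
    ContDiff ℝ ∞ (fun c : C(K, V) => f.comp c) :=
  contDiff_infty.2 fun m => contDiff_comp_continuousMap m f (hf.of_le (by exact_mod_cast le_top))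

end Superposition

/-! ### Primitives, and division by the increment -/

section Hadamard

variable {V F : Type} [NormedAddCommGroup V] [NormedSpace ℝ V] [NormedAddCommGroup F]
  [NormedSpace ℝ F]

lemma continuous_primitive_iccExtend (u : C(unitInterval, F)) :
    Continuous fun τ : ℝ => ∫ s in (0 : ℝ)..τ, IccExtend zero_le_one u s :=
  intervalIntegral.continuous_primitive
    (fun a b => (u.continuous.Icc_extend' (h := zero_le_one)).intervalIntegrable a b) 0

/-- The operator `u ↦ (τ ↦ ∫ s in 0..τ, u s)` on `C([0,1], F)`. -/
def primitiveOp : C(unitInterval, F) →L[ℝ] C(unitInterval, F) :=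
  LinearMap.mkContinuous
    { toFun := fun u => ⟨fun τ => ∫ s in (0 : ℝ)..τ, IccExtend zero_le_one u s,
        (continuous_primitive_iccExtend u).comp continuous_subtype_val⟩
      map_add' := fun u v => by
        ext τ
        simp only [ContinuousMap.coe_mk, ContinuousMap.add_apply]
        rw [← intervalIntegral.integral_add]
        · rfl
        · exact (u.continuous.Icc_extend' (h := zero_le_one)).intervalIntegrable _ _
        · exact (v.continuous.Icc_extend' (h := zero_le_one)).intervalIntegrable _ _
      map_smul' := fun a u => by
        ext τ
        simp only [ContinuousMap.coe_mk, ContinuousMap.smul_apply, RingHom.id_apply]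
        rw [← intervalIntegral.integral_smul]
        rfl } 1
    (fun u => by
      rw [one_mul]
      refine (ContinuousMap.norm_le _ (norm_nonneg _)).2 fun τ => ?_
      have h := intervalIntegral.norm_integral_le_of_norm_le_const (a := (0 : ℝ)) (b := (τ : ℝ))
        (f := IccExtend zero_le_one u) (C := ‖u‖) (fun x _ => u.norm_coe_le_norm _)
      refine h.trans ?_
      have h1 : |(τ : ℝ) - 0| ≤ 1 := by
        rw [sub_zero, abs_of_nonneg τ.2.1]; exact τ.2.2
      nlinarith [norm_nonneg u])

lemma primitiveOp_apply (u : C(unitInterval, F)) (τ : unitInterval) :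
    primitiveOp u τ = ∫ s in (0 : ℝ)..τ, IccExtend zero_le_one u s := rfl

/-- The segments `θ ↦ v + θ h`, as a bounded linear map `V × V → C([0,1], V)`. -/
def segmentMap : V × V →L[ℝ] C(unitInterval, V) :=
  LinearMap.mkContinuous
    { toFun := fun x => ⟨fun θ => x.1 + (θ : ℝ) • x.2, by fun_prop⟩
      map_add' := fun x y => by
        ext θ; simp only [ContinuousMap.coe_mk, ContinuousMap.add_apply, Prod.fst_add,
          Prod.snd_add, smul_add]; abel
      map_smul' := fun a x => by
        ext θ; simp [smul_add, smul_comm a] } 2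
    (fun x => by
      refine (ContinuousMap.norm_le _ (by positivity)).2 fun θ => ?_
      have h1 : ‖x.1‖ ≤ ‖x‖ := norm_fst_le x
      have h2 : ‖x.2‖ ≤ ‖x‖ := norm_snd_le x
      have h3 : ‖(θ : ℝ)‖ ≤ 1 := by rw [Real.norm_of_nonneg θ.2.1]; exact θ.2.2
      calc ‖x.1 + (θ : ℝ) • x.2‖ ≤ ‖x.1‖ + ‖(θ : ℝ)‖ * ‖x.2‖ := by
            rw [← norm_smul]; exact norm_add_le _ _
        _ ≤ 2 * ‖x‖ := by nlinarith [norm_nonneg x.2, norm_nonneg (θ : ℝ)])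

variable [CompleteSpace F]

/-- Hadamard's lemma: the difference quotient of a smooth function is smooth. -/
theorem exists_smooth_slope {f : V → F} (hf : ContDiff ℝ ∞ f) :
    ∃ q : V × V → (V →L[ℝ] F), ContDiff ℝ ∞ q ∧ (∀ v, q (v, 0) = fderiv ℝ f v) ∧
      ∀ v h, f (v + h) = f v + q (v, h) h := by
  have hf' : ContDiff ℝ ∞ (fderiv ℝ f) := (contDiff_infty_iff_fderiv.1 hf).2
  let N : C(V, V →L[ℝ] F) := ⟨fderiv ℝ f, hf'.continuous⟩
  let q : V × V → (V →L[ℝ] F) := fun x =>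
    ContinuousMap.evalCLM ℝ (1 : unitInterval) (primitiveOp (N.comp (segmentMap x)))
  have hq : ∀ x, q x = ∫ s in (0 : ℝ)..1, fderiv ℝ f (x.1 + s • x.2) := by
    intro x
    change ∫ s in (0 : ℝ)..((1 : unitInterval) : ℝ), _ = _
    rw [show ((1 : unitInterval) : ℝ) = 1 from rfl]
    refine intervalIntegral.integral_congr fun s hs => ?_
    rw [uIcc_of_le zero_le_one] at hs
    change IccExtend zero_le_one (N.comp (segmentMap x)) s = _
    rw [IccExtend_of_mem _ _ hs]
    rfl
  refine ⟨q, ?_, fun v => ?_, fun v h => ?_⟩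
  · have h1 := contDiff_infty_comp_continuousMap (K := unitInterval) N hf'
    exact (ContinuousMap.evalCLM ℝ (1 : unitInterval)).contDiff.comp
      (primitiveOp.contDiff.comp (h1.comp segmentMap.contDiff))
  · rw [hq]; simp
  · have hcont : Continuous fun s : ℝ => fderiv ℝ f (v + s • h) :=
      hf'.continuous.comp (by fun_prop)
    have hd : ∀ s ∈ uIcc (0 : ℝ) 1,
        HasDerivAt (fun s : ℝ => f (v + s • h)) (fderiv ℝ f (v + s • h) h) s := by
      intro s _
      have h1 : HasFDerivAt f (fderiv ℝ f (v + s • h)) (v + s • h) :=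
        (hf.differentiable (by simp) _).hasFDerivAt
      have h2 : HasDerivAt (fun s : ℝ => v + s • h) h s := by
        simpa using ((hasDerivAt_id s).smul_const h).const_add v
      exact h1.comp_hasDerivAt s h2
    have hint := intervalIntegral.integral_eq_sub_of_hasDerivAt hd
      ((hcont.clm_apply continuous_const).intervalIntegrable _ _)
    rw [hq, ContinuousLinearMap.intervalIntegral_apply (hcont.intervalIntegrable _ _), hint]
    simp

end Hadamard

/-! ### Maps that are smooth near a point -/

section SmoothNear

variable {V W F : Type} [NormedAddCommGroup V] [NormedSpace ℝ V] [NormedAddCommGroup W]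
  [NormedSpace ℝ W] [NormedAddCommGroup F] [NormedSpace ℝ F]

/-- `f` is `C^∞` on some neighbourhood of `z`. (This is stronger than `ContDiffAt ℝ ∞ f z`, where
the neighbourhood may depend on the order of differentiability.) -/
def SmoothNear (f : V → W) (z : V) : Prop := ∀ᶠ y in 𝓝 z, ContDiffAt ℝ ∞ f y

namespace SmoothNear

variable {f : V → W} {z : V}

lemma contDiffAt (hf : SmoothNear f z) : ContDiffAt ℝ ∞ f z := hf.self_of_nhds

lemma continuousAt (hf : SmoothNear f z) : ContinuousAt f z := hf.contDiffAt.continuousAt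

lemma differentiableAt (hf : SmoothNear f z) : DifferentiableAt ℝ f z :=
  hf.contDiffAt.differentiableAt (by simp)

lemma hasFDerivAt (hf : SmoothNear f z) : HasFDerivAt f (fderiv ℝ f z) z :=
  hf.differentiableAt.hasFDerivAt

lemma eventually (hf : SmoothNear f z) : ∀ᶠ y in 𝓝 z, SmoothNear f y :=
  eventually_eventually_nhds.2 hf

lemma eventually_continuousAt (hf : SmoothNear f z) :
    ∀ᶠ y in 𝓝 z, ContinuousAt f y := hf.eventually.mono fun _ h => h.continuousAt

lemma of_contDiff (hf : ContDiff ℝ ∞ f) : SmoothNear f z :=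
  Eventually.of_forall fun _ => hf.contDiffAt

lemma of_contDiffOn {s : Set V} (hs : s ∈ 𝓝 z) (hf : ContDiffOn ℝ ∞ f s) : SmoothNear f z := by
  filter_upwards [eventually_mem_nhds_iff.2 hs] with y hy using hf.contDiffAt hy

lemma congr {g : V → W} (hf : SmoothNear f z) (h : f =ᶠ[𝓝 z] g) : SmoothNear g z := by
  filter_upwards [hf, h.eventuallyEq_nhds] with y hy hy' using hy.congr_of_eventuallyEq hy'.symm

lemma comp {g : W → F} (hg : SmoothNear g (f z)) (hf : SmoothNear f z) :
    SmoothNear (fun y => g (f y)) z := by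
  filter_upwards [hf, hf.continuousAt.eventually hg] with y hy hy' using hy'.comp y hy

lemma comp_of_eq {g : W → F} {y : W} (hg : SmoothNear g y) (hf : SmoothNear f z) (h : f z = y) :
    SmoothNear (fun y => g (f y)) z := by subst h; exact hg.comp hf

lemma const (c : W) : SmoothNear (fun _ : V => c) z := of_contDiff contDiff_const
lemma fst {z : V × W} : SmoothNear (fun x : V × W => x.1) z := of_contDiff contDiff_fst
lemma snd {z : V × W} : SmoothNear (fun x : V × W => x.2) z := of_contDiff contDiff_snd
lemma id {z : V} : SmoothNear (fun x : V => x) z := of_contDiff contDiff_id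

lemma clm (L : W →L[ℝ] F) (hf : SmoothNear f z) : SmoothNear (fun y => L (f y)) z :=
  (of_contDiff L.contDiff).comp hf

lemma prodMk {g : V → F} (hf : SmoothNear f z) (hg : SmoothNear g z) :
    SmoothNear (fun y => (f y, g y)) z := by
  filter_upwards [hf, hg] with y h1 h2 using h1.prodMk h2

lemma add {g : V → W} (hf : SmoothNear f z) (hg : SmoothNear g z) :
    SmoothNear (fun y => f y + g y) z := by
  filter_upwards [hf, hg] with y h1 h2 using h1.add h2

lemma sub {g : V → W} (hf : SmoothNear f z) (hg : SmoothNear g z) :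
    SmoothNear (fun y => f y - g y) z := by
  filter_upwards [hf, hg] with y h1 h2 using h1.sub h2

lemma neg (hf : SmoothNear f z) : SmoothNear (fun y => - f y) z := by
  filter_upwards [hf] with y h1 using h1.neg

lemma smul {a : V → ℝ} (ha : SmoothNear a z) (hf : SmoothNear f z) :
    SmoothNear (fun y => a y • f y) z := by
  filter_upwards [hf, ha] with y h1 h2 using h2.smul h1

lemma mul {A : Type} [NormedRing A] [NormedAlgebra ℝ A] {a b : V → A} (ha : SmoothNear a z)
    (hb : SmoothNear b z) : SmoothNear (fun y => a y * b y) z := by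
  filter_upwards [ha, hb] with y h1 h2 using h1.mul h2

lemma inv {A : Type} [NormedField A] [NormedAlgebra ℝ A] {a : V → A} (ha : SmoothNear a z)
    (h : a z ≠ 0) : SmoothNear (fun y => (a y)⁻¹) z := by
  filter_upwards [ha, ha.continuousAt.eventually_ne h] with y h1 h2 using h1.inv h2

lemma div {A : Type} [NormedField A] [NormedAlgebra ℝ A] {a b : V → A} (ha : SmoothNear a z)
    (hb : SmoothNear b z) (h : b z ≠ 0) : SmoothNear (fun y => a y / b y) z := by
  simp only [div_eq_mul_inv]
  exact ha.mul (hb.inv h)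

lemma sqrt {a : V → ℝ} (ha : SmoothNear a z) (h : a z ≠ 0) :
    SmoothNear (fun y => Real.sqrt (a y)) z := by
  filter_upwards [ha, ha.continuousAt.eventually_ne h] with y h1 h2 using h1.sqrt h2

lemma abs {a : V → ℝ} (ha : SmoothNear a z) (h : a z ≠ 0) :
    SmoothNear (fun y => |a y|) z := by
  have : (fun y => |a y|) = fun y => Real.sqrt (a y * a y) := by
    ext y; rw [Real.sqrt_mul_self_eq_abs]
  rw [this]
  exact (ha.mul ha).sqrt (mul_ne_zero h h)

lemma ofReal {a : V → ℝ} (ha : SmoothNear a z) : SmoothNear (fun y => (a y : ℂ)) z :=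
  ha.clm Complex.ofRealCLM

lemma clm_apply {L : V → W →L[ℝ] F} {g : V → W} (hL : SmoothNear L z) (hg : SmoothNear g z) :
    SmoothNear (fun y => L y (g y)) z := by
  filter_upwards [hL, hg] with y h1 h2 using h1.clm_apply h2

lemma clm_comp {G : Type} [NormedAddCommGroup G] [NormedSpace ℝ G] {L : V → W →L[ℝ] F}
    {N : V → G →L[ℝ] W} (hL : SmoothNear L z) (hN : SmoothNear N z) :
    SmoothNear (fun y => (L y).comp (N y)) z := by
  filter_upwards [hL, hN] with y h1 h2 using h1.clm_comp h2

lemma fderiv (hf : SmoothNear f z) : SmoothNear (fderiv ℝ f) z := by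
  filter_upwards [hf] with y h using h.fderiv_right (by simp)

/-- The inverse of a smooth family of isomorphisms is smooth. -/
lemma inverse [CompleteSpace W] {L : V → W →L[ℝ] F} (hL : SmoothNear L z)
    (h : (L z).IsInvertible) : SmoothNear (fun y => (L y).inverse) z := by
  obtain ⟨e, he⟩ := h
  have h1 : ∀ᶠ y in 𝓝 z, L y ∈ range ((↑) : (W ≃L[ℝ] F) → W →L[ℝ] F) :=
    hL.continuousAt.eventually (he ▸ ContinuousLinearEquiv.nhds e)
  filter_upwards [hL, h1] with y hy ⟨e', he'⟩
  have := contDiffAt_map_inverse (n := ∞) (𝕜 := ℝ) e'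
  rw [he'] at this
  exact this.comp y hy

lemma continuousLinearMap_det [FiniteDimensional ℝ W] {L : V → W →L[ℝ] W}
    (hL : SmoothNear L z) : SmoothNear (fun y => (L y).det) z := by
  let b := Module.finBasis ℝ W
  have : (fun y => (L y).det) = fun y => (LinearMap.toMatrix b b (L y : W →ₗ[ℝ] W)).det := by
    ext y
    rw [LinearMap.det_toMatrix]
  rw [this]
  simp only [Matrix.det_apply]
  filter_upwards [hL] with y hy
  refine ContDiffAt.sum fun σ _ => ContDiffAt.const_smul _ (contDiffAt_prod fun i _ => ?_)
  simp only [LinearMap.toMatrix_apply]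
  have h1 : ContDiffAt ℝ ∞ (fun y => L y (b i)) y := hy.clm_apply contDiffAt_const
  exact ((LinearMap.toContinuousLinearMap (b.coord (σ i))).contDiff.contDiffAt).comp y h1

end SmoothNear

/-- The partial derivative in the second variable. -/
lemma fderiv_comp_prodMk {f : V × W → F} {x : V} {w : W} (hf : DifferentiableAt ℝ f (x, w)) :
    fderiv ℝ (fun w => f (x, w)) w = (fderiv ℝ f (x, w)).comp (ContinuousLinearMap.inr ℝ V W) :=
  (hf.hasFDerivAt.comp w (hasFDerivAt_prodMk_right x w)).fderiv

lemma SmoothNear.fderiv_snd {f : V × W → F} {z : V × W} (hf : SmoothNear f z) :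
    SmoothNear (fun y : V × W => _root_.fderiv ℝ (fun w => f (y.1, w)) y.2) z := by
  have h1 : SmoothNear (fun y : V × W =>
      (_root_.fderiv ℝ f y).comp (ContinuousLinearMap.inr ℝ V W)) z :=
    hf.fderiv.clm_comp (SmoothNear.const _)
  refine h1.congr ?_
  filter_upwards [hf.eventually] with y hy
  exact (fderiv_comp_prodMk (x := y.1) (w := y.2) hy.differentiableAt).symm

lemma SmoothNear.slice {f : V × W → F} {x : V} {w : W} (hf : SmoothNear f (x, w)) :
    SmoothNear (fun w => f (x, w)) w :=
  hf.comp_of_eq ((SmoothNear.const x).prodMk SmoothNear.id) rfl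

/-- A map that is smooth near a point coincides near this point with a smooth map. -/
lemma SmoothNear.exists_contDiff [FiniteDimensional ℝ V] {f : V → W} {z : V}
    (hf : SmoothNear f z) : ∃ g : V → W, ContDiff ℝ ∞ g ∧ g =ᶠ[𝓝 z] f := by
  obtain ⟨r, hr, hball⟩ := Metric.eventually_nhds_iff_ball.1 hf
  let χ : ContDiffBump z := ⟨r / 4, r / 2, by positivity, by linarith⟩
  refine ⟨fun y => χ y • f y, ?_, ?_⟩
  · rw [contDiff_iff_contDiffAt]
    intro y
    by_cases hy : y ∈ Metric.ball z r
    · exact χ.contDiffAt.smul (hball y hy)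
    · have h1 : ∀ᶠ y' in 𝓝 y, χ y' = 0 := by
        have hy2 : r / 2 < dist y z := by
          rw [Metric.mem_ball, not_lt] at hy; linarith
        filter_upwards [(continuous_id.dist continuous_const).continuousAt.eventually_const_lt hy2]
          with y' hy'
        exact χ.zero_of_le_dist (le_of_lt hy')
      exact (contDiffAt_const (c := (0 : W))).congr_of_eventuallyEq
        (h1.mono fun y' hy' => by simp [hy'])
  · filter_upwards [χ.eventuallyEq_one] with y hy
    rw [hy]; simp

/-- Inverse function theorem. -/
theorem SmoothNear.exists_local_inverse [CompleteSpace V] {f : V → W} {a : V}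
    (hf : SmoothNear f a) (e : V ≃L[ℝ] W) (he : HasFDerivAt f (e : V →L[ℝ] W) a) :
    ∃ g : W → V, SmoothNear g (f a) ∧ g (f a) = a ∧ (∀ᶠ x in 𝓝 a, g (f x) = x) ∧
      ∀ᶠ y in 𝓝 (f a), f (g y) = y := by
  let φ := hf.contDiffAt.toOpenPartialHomeomorph f he (by simp)
  have hφ : (φ : V → W) = f := rfl
  have ha : a ∈ φ.source := hf.contDiffAt.mem_toOpenPartialHomeomorph_source he (by simp)
  have hfa : f a ∈ φ.target := φ.map_source ha
  have hga : φ.symm (f a) = a := φ.left_inv ha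
  have hcont : ContinuousAt φ.symm (f a) := φ.continuousAt_symm hfa
  have hinv : ∀ᶠ x in 𝓝 a, _root_.fderiv ℝ f x ∈ range ((↑) : (V ≃L[ℝ] W) → V →L[ℝ] W) := by
    refine hf.fderiv.continuousAt.eventually ?_
    rw [he.fderiv]
    exact ContinuousLinearEquiv.nhds e
  rw [ContinuousAt, hga] at hcont
  refine ⟨φ.symm, ?_, hga, ?_, ?_⟩
  · filter_upwards [φ.open_target.mem_nhds hfa, hcont.eventually hinv, hcont.eventually hf]
      with y hy ⟨e', he'⟩ hy2
    refine φ.contDiffAt_symm hy (f₀' := e') ?_ hy2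
    rw [he']
    exact (hy2.differentiableAt (by simp)).hasFDerivAt
  · filter_upwards [φ.open_source.mem_nhds ha] with x hx using φ.left_inv hx
  · filter_upwards [φ.open_target.mem_nhds hfa] with y hy using φ.right_inv hy

theorem SmoothNear.exists_local_inverse_of_injective [FiniteDimensional ℝ V]
    [FiniteDimensional ℝ W] {f : V → W} {a : V} (hf : SmoothNear f a)
    (hd : Module.finrank ℝ V = Module.finrank ℝ W)
    (hi : ∀ v, _root_.fderiv ℝ f a v = 0 → v = 0) :
    ∃ g : W → V, SmoothNear g (f a) ∧ g (f a) = a ∧ (∀ᶠ x in 𝓝 a, g (f x) = x) ∧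
      ∀ᶠ y in 𝓝 (f a), f (g y) = y := by
  have hinj : Function.Injective (_root_.fderiv ℝ f a : V →ₗ[ℝ] W) :=
    (injective_iff_map_eq_zero _).2 hi
  let e := (LinearEquiv.ofInjectiveOfFinrankEq (_root_.fderiv ℝ f a : V →ₗ[ℝ] W) hinj hd)
  have : CompleteSpace V := FiniteDimensional.complete ℝ V
  refine hf.exists_local_inverse e.toContinuousLinearEquiv ?_
  convert hf.hasFDerivAt using 1
  ext v
  rfl

end SmoothNear

/-! ### Smooth dependence of integral curves on time and initial value -/

section Flow

variable {V : Type} [NormedAddCommGroup V] [NormedSpace ℝ V] [CompleteSpace V]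

/-- The local flow of a smooth vector field is smooth. The integral curves, with time rescaled to
`[0,1]`, are the zeros of a smooth map on the Banach space `C([0,1], V)`, whose partial derivative
is the identity at time zero. -/
theorem exists_smooth_flow {X : V → V} (hX : ContDiff ℝ ∞ X) (z₀ : V) :
    ∃ Φ : ℝ × V → V, SmoothNear Φ (0, z₀) ∧ (∀ᶠ z in 𝓝 z₀, Φ (0, z) = z) ∧
      ∀ᶠ p : ℝ × V in 𝓝 ((0 : ℝ), z₀), HasDerivAt (fun t => Φ (t, p.2)) (X (Φ p)) p.1 := by
  let N : C(V, V) := ⟨X, hX.continuous⟩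
  let Q : C(unitInterval, V) → C(unitInterval, V) := fun c => primitiveOp (N.comp c)
  have hQ : ContDiff ℝ ∞ Q :=
    primitiveOp.contDiff.comp (contDiff_infty_comp_continuousMap N hX)
  let cst : V →L[ℝ] C(unitInterval, V) := segmentMap.comp (ContinuousLinearMap.inl ℝ V V)
  have hcst : ∀ z τ, cst z τ = z := fun z τ => by
    change z + (τ : ℝ) • (0 : V) = z; simp
  let Ψ : C(unitInterval, V) × (ℝ × V) → C(unitInterval, V) × (ℝ × V) :=
    fun x => (x.1 - cst x.2.2 - x.2.1 • Q x.1, x.2)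
  have hΨ : ContDiff ℝ ∞ Ψ := by
    refine ContDiff.prodMk ?_ contDiff_snd
    refine (contDiff_fst.sub (cst.contDiff.comp (contDiff_snd.comp contDiff_snd))).sub ?_
    exact (contDiff_fst.comp contDiff_snd).smul (hQ.comp contDiff_fst)
  let c₀ := cst z₀
  let a : C(unitInterval, V) × (ℝ × V) := (c₀, (0, z₀))
  let L : (ℝ × V) →L[ℝ] C(unitInterval, V) :=
    cst.comp (ContinuousLinearMap.snd ℝ ℝ V) +
      (ContinuousLinearMap.fst ℝ ℝ V).smulRight (Q c₀)
  let fs := ContinuousLinearMap.fst ℝ C(unitInterval, V) (ℝ × V)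
  let sn := ContinuousLinearMap.snd ℝ C(unitInterval, V) (ℝ × V)
  let e : (C(unitInterval, V) × (ℝ × V)) ≃L[ℝ] (C(unitInterval, V) × (ℝ × V)) :=
    ContinuousLinearEquiv.equivOfInverse ((fs - L.comp sn).prod sn) ((fs + L.comp sn).prod sn)
      (fun x => by simp [fs, sn]) (fun x => by simp [fs, sn])
  have he : HasFDerivAt Ψ (e : _ →L[ℝ] _) a := by
    have h1 : HasFDerivAt (fun x : C(unitInterval, V) × (ℝ × V) => x.2.1 • Q x.1)
        ((0 : ℝ) • ((fderiv ℝ Q c₀).comp fs) +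
          ((ContinuousLinearMap.fst ℝ ℝ V).comp sn).smulRight (Q c₀)) a := by
      have hq : HasFDerivAt (fun x : C(unitInterval, V) × (ℝ × V) => Q x.1)
          ((fderiv ℝ Q c₀).comp fs) a :=
        HasFDerivAt.comp (f := fun x : C(unitInterval, V) × (ℝ × V) => x.1) (g := Q) a
          (hQ.differentiable (by simp) c₀).hasFDerivAt hasFDerivAt_fst
      exact (((ContinuousLinearMap.fst ℝ ℝ V).comp sn).hasFDerivAt (x := a)).smul hq
    have h2 : HasFDerivAt (fun x : C(unitInterval, V) × (ℝ × V) => cst x.2.2)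
        (cst.comp ((ContinuousLinearMap.snd ℝ ℝ V).comp sn)) a :=
      (cst.comp ((ContinuousLinearMap.snd ℝ ℝ V).comp sn)).hasFDerivAt
    have h3 := ((fs.hasFDerivAt (x := a)).sub h2).sub h1
    refine (h3.prodMk (sn.hasFDerivAt (x := a))).congr_fderiv (ContinuousLinearMap.ext fun x => ?_)
    simp only [e, L, ContinuousLinearEquiv.coe_coe, ContinuousLinearEquiv.equivOfInverse_apply]
    refine Prod.ext ?_ rfl
    simp [fs, sn]
    abel
  have hΨa : Ψ a = (0, (0, z₀)) := by
    simp [Ψ, a, c₀]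
  obtain ⟨g, hg, hga, hgl, hgr⟩ := (SmoothNear.of_contDiff hΨ (z := a)).exists_local_inverse e he
  rw [hΨa] at hg hga hgr
  let ι : ℝ × V → C(unitInterval, V) × (ℝ × V) := fun p => (0, p)
  have hι : ContDiff ℝ ∞ ι := contDiff_const.prodMk contDiff_id
  let γ : ℝ × V → C(unitInterval, V) := fun p => (g (ι p)).1
  have hγs : SmoothNear γ (0, z₀) :=
    SmoothNear.fst.comp (hg.comp_of_eq (SmoothNear.of_contDiff hι) rfl)
  have hγ0 : γ (0, z₀) = c₀ := by simp only [γ, ι, hga]; rfl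
  have hι0 : Tendsto ι (𝓝 (0, z₀)) (𝓝 (0, (0, z₀))) := hι.continuous.tendsto _
  have hγeq : ∀ᶠ p in 𝓝 ((0 : ℝ), z₀), γ p = cst p.2 + p.1 • Q (γ p) := by
    filter_upwards [hι0.eventually hgr] with p hp
    have h2 : (g (ι p)).2 = p := congrArg Prod.snd hp
    have h1 : (g (ι p)).1 - cst (g (ι p)).2.2 - (g (ι p)).2.1 • Q (g (ι p)).1 = 0 :=
      congrArg Prod.fst hp
    rw [h2, sub_sub, sub_eq_zero] at h1
    exact h1
  -- uniqueness of solutions that stay near the constant solution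
  have huniq : ∀ᶠ x in 𝓝 a, x.1 = cst x.2.2 + x.2.1 • Q x.1 → γ x.2 = x.1 := by
    filter_upwards [hgl] with x hx hx2
    have : Ψ x = ι x.2 := by
      refine Prod.ext ?_ rfl
      change x.1 - cst x.2.2 - x.2.1 • Q x.1 = 0
      rw [sub_sub, sub_eq_zero]; exact hx2
    change (g (ι x.2)).1 = x.1
    rw [← this, hx]
  obtain ⟨δ, hδ, hδu⟩ := Metric.eventually_nhds_iff_ball.1 huniq
  have hγc : Tendsto γ (𝓝 (0, z₀)) (𝓝 c₀) := by
    have := hγs.continuousAt; rwa [ContinuousAt, hγ0] at this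
  obtain ⟨r, hr, hball⟩ := Metric.eventually_nhds_iff_ball.1
    ((hγeq.and (hγc.eventually (Metric.ball_mem_nhds c₀ hδ))).and
      (hγs.eventually_continuousAt))
  let r' := min r δ
  have hr' : 0 < r' := lt_min hr hδ
  have hmem : ∀ (t : ℝ) (z : V), |t| < r' → dist z z₀ < r' →
      (t, z) ∈ Metric.ball ((0 : ℝ), z₀) r := by
    intro t z ht hz
    rw [Metric.mem_ball, Prod.dist_eq, max_lt_iff]
    exact ⟨by simpa using ht.trans_le (min_le_left _ _), hz.trans_le (min_le_left _ _)⟩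
  have hpt : ∀ (t : ℝ) (z : V) (τ : unitInterval), |t| < r' → dist z z₀ < r' →
      γ (t, z) τ = z + t • ∫ s in (0 : ℝ)..τ, X (IccExtend zero_le_one (γ (t, z)) s) := by
    intro t z τ ht hz
    have h1 := (hball _ (hmem t z ht hz)).1.1
    have h2 : γ (t, z) τ = (cst z + t • Q (γ (t, z))) τ := congrArg (fun c => c τ) h1
    rw [ContinuousMap.add_apply, hcst] at h2
    exact h2
  let Φ : ℝ × V → V := fun p => γ p 1
  have hscale : ∀ (t : ℝ) (z : V) (σ : unitInterval), |t| < r' → dist z z₀ < r' →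
      Φ ((σ : ℝ) * t, z) = γ (t, z) σ := by
    intro t z σ ht hz
    let cσ : C(unitInterval, V) := ⟨fun τ => γ (t, z) (σ * τ), by fun_prop⟩
    have hb : dist (γ (t, z)) c₀ < δ := (hball _ (hmem t z ht hz)).1.2
    have hcσ : dist cσ c₀ < δ := by
      refine (ContinuousMap.dist_lt_iff hδ).2 fun τ => ?_
      have := (ContinuousMap.dist_lt_iff hδ).1 hb (σ * τ)
      change dist (γ (t, z) (σ * τ)) (cst z₀ τ) < δ
      rw [hcst]
      change dist (γ (t, z) (σ * τ)) (cst z₀ (σ * τ)) < δ at this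
      rwa [hcst] at this
    have hσt : |(σ : ℝ) * t| < r' := by
      rw [abs_mul, abs_of_nonneg σ.2.1]
      nlinarith [abs_nonneg t, σ.2.2, σ.2.1]
    have hsol : cσ = cst z + ((σ : ℝ) * t) • Q cσ := by
      ext τ
      have h1 := hpt t z (σ * τ) ht hz
      have h2 := intervalIntegral.smul_integral_comp_mul_left (a := (0 : ℝ)) (b := (τ : ℝ))
        (fun s => X (IccExtend zero_le_one (γ (t, z)) s)) (σ : ℝ)
      rw [mul_zero] at h2
      change γ (t, z) (σ * τ) = cst z τ + ((σ : ℝ) * t) • primitiveOp (N.comp cσ) τ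
      rw [hcst, h1, mul_comm (σ : ℝ) t, mul_smul, primitiveOp_apply,
        show ((σ * τ : unitInterval) : ℝ) = σ * τ from rfl, ← h2]
      congr 3
      refine intervalIntegral.integral_congr fun s hs => ?_
      rw [uIcc_of_le τ.2.1] at hs
      have hs1 : s ∈ Icc (0 : ℝ) 1 := ⟨hs.1, hs.2.trans τ.2.2⟩
      have hs2 : (σ : ℝ) * s ∈ Icc (0 : ℝ) 1 :=
        ⟨mul_nonneg σ.2.1 hs1.1, mul_le_one₀ σ.2.2 hs1.1 hs1.2⟩
      simp only [IccExtend_of_mem _ _ hs1, IccExtend_of_mem _ _ hs2]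
      rfl
    have hmema : (cσ, ((σ : ℝ) * t, z)) ∈ Metric.ball a δ := by
      rw [Metric.mem_ball, Prod.dist_eq, Prod.dist_eq, max_lt_iff, max_lt_iff]
      exact ⟨hcσ, by simpa [a] using hσt.trans_le (min_le_right _ _),
        hz.trans_le (min_le_right _ _)⟩
    have h3 := hδu _ hmema hsol
    change γ ((σ : ℝ) * t, z) 1 = _
    rw [show γ ((σ : ℝ) * t, z) = cσ from h3]
    change γ (t, z) (σ * 1) = _
    rw [mul_one]
  have hΦint : ∀ (t : ℝ) (z : V), |t| < r' → dist z z₀ < r' →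
      Φ (t, z) = z + ∫ s in (0 : ℝ)..t, X (Φ (s, z)) := by
    intro t z ht hz
    have h1 := hpt t z 1 ht hz
    have h2 := intervalIntegral.smul_integral_comp_mul_left (a := (0 : ℝ)) (b := (1 : ℝ))
        (fun s => X (Φ (s, z))) t
    rw [mul_zero, mul_one] at h2
    rw [← h2]
    refine h1.trans ?_
    congr 2
    refine intervalIntegral.integral_congr fun s hs => ?_
    rw [show ((1 : unitInterval) : ℝ) = 1 from rfl, uIcc_of_le zero_le_one] at hs
    simp only [IccExtend_of_mem _ _ hs]
    rw [mul_comm t s, hscale t z ⟨s, hs⟩ ht hz]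
  have hΦs : SmoothNear Φ (0, z₀) := hγs.clm (ContinuousMap.evalCLM ℝ (1 : unitInterval))
  have hΦc : ∀ (t : ℝ) (z : V), |t| < r' → dist z z₀ < r' → ContinuousAt Φ (t, z) := by
    intro t z ht hz
    exact ((ContinuousMap.evalCLM ℝ (1 : unitInterval)).continuous.continuousAt).comp
      (hball _ (hmem t z ht hz)).2
  have hz₀ : ∀ᶠ z in 𝓝 z₀, dist z z₀ < r' := Metric.ball_mem_nhds z₀ hr'
  refine ⟨Φ, hΦs, ?_, ?_⟩
  · filter_upwards [hz₀] with z hz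
    rw [hΦint 0 z (by simpa using hr') hz]; simp
  · have ht0 : ∀ᶠ t : ℝ in 𝓝 0, |t| < r' := by
      filter_upwards [Metric.ball_mem_nhds (0 : ℝ) hr'] with t ht using by simpa using ht
    rw [nhds_prod_eq]
    filter_upwards [ht0.prod_mk hz₀] with p hp
    obtain ⟨ht, hz⟩ := hp
    have hcontOn : ContinuousOn (fun s => X (Φ (s, p.2))) (Ioo (-r') r') := by
      intro s hs
      have h1 := hΦc s p.2 (abs_lt.2 hs) hz
      have h2 : ContinuousAt (fun s => Φ (s, p.2)) s :=
        ContinuousAt.comp (f := fun s : ℝ => (s, p.2)) h1 (by fun_prop)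
      exact (hX.continuous.continuousAt.comp h2).continuousWithinAt
    have hpt' := abs_lt.1 ht
    have hsub : uIcc 0 p.1 ⊆ Ioo (-r') r' := by
      intro s hs
      rcases le_total 0 p.1 with h | h
      · rw [uIcc_of_le h] at hs; exact ⟨by linarith [hs.1], by linarith [hs.2, hpt'.2]⟩
      · rw [uIcc_of_ge h] at hs; exact ⟨by linarith [hs.1, hpt'.1], by linarith [hs.2]⟩
    have hmem2 : Ioo (-r') r' ∈ 𝓝 p.1 := isOpen_Ioo.mem_nhds hpt'
    have hD := intervalIntegral.integral_hasDerivAt_right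
      ((hcontOn.mono hsub).intervalIntegrable)
      (hcontOn.stronglyMeasurableAtFilter isOpen_Ioo p.1 hpt')
      (hcontOn.continuousAt hmem2)
    refine (hD.const_add p.2).congr_of_eventuallyEq ?_
    filter_upwards [hmem2] with t ht'
    exact hΦint t p.2 (abs_lt.2 ht') hz

end Flow

/-! ### The eikonal equation -/

section Eikonal

variable {P V F Z : Type} [NormedAddCommGroup P] [NormedSpace ℝ P] [NormedAddCommGroup V]
  [NormedSpace ℝ V] [NormedAddCommGroup F] [NormedSpace ℝ F] [NormedAddCommGroup Z]

/-- A first integral: a function whose time derivative vanishes near `(0, z₀)` agrees there with its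
value at time `0`. -/
lemma eventually_eq_of_hasDerivAt_zero {f : ℝ × Z → F} {z₀ : Z}
    (h : ∀ᶠ p : ℝ × Z in 𝓝 ((0 : ℝ), z₀), HasDerivAt (fun s => f (s, p.2)) 0 p.1) :
    ∀ᶠ p : ℝ × Z in 𝓝 ((0 : ℝ), z₀), f p = f (0, p.2) := by
  obtain ⟨r, hr, hball⟩ := Metric.eventually_nhds_iff_ball.1 h
  filter_upwards [Metric.ball_mem_nhds ((0 : ℝ), z₀) hr] with p hp
  rw [Metric.mem_ball, Prod.dist_eq, max_lt_iff, Real.dist_eq, sub_zero] at hp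
  have hd : ∀ s ∈ Ioo (-r) r, HasDerivAt (fun s => f (s, p.2)) 0 s := fun s hs =>
    hball (s, p.2) (by
      rw [Metric.mem_ball, Prod.dist_eq, max_lt_iff, Real.dist_eq, sub_zero]
      exact ⟨abs_lt.2 hs, hp.2⟩)
  exact isOpen_Ioo.is_const_of_deriv_eq_zero isPreconnected_Ioo
    (fun s hs => (hd s hs).differentiableAt.differentiableWithinAt)
    (fun s hs => (hd s hs).deriv) (abs_lt.1 hp.1) ⟨by linarith, hr⟩

variable [NormedSpace ℝ Z]

/-- Mixed partial derivatives: if `∂_s Y = R`, then `∂_s (dY · u) = dR · u`. -/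
lemma hasDerivAt_fderiv_of_hasDerivAt {Y R : ℝ × Z → F} {p : ℝ × Z} (hY : SmoothNear Y p)
    (hR : ∀ᶠ p in 𝓝 p, HasDerivAt (fun s => Y (s, p.2)) (R p) p.1) :
    HasDerivAt (fun s => fderiv ℝ Y (s, p.2)) (fderiv ℝ R p) p.1 := by
  have h1 : (fun p' => fderiv ℝ Y p' (1, 0)) =ᶠ[𝓝 p] R := by
    filter_upwards [hR, hY.eventually] with p' h h'
    have h2 : HasDerivAt (fun s : ℝ => (s, p'.2)) ((1 : ℝ), (0 : Z)) p'.1 :=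
      (hasDerivAt_id _).prodMk (hasDerivAt_const _ _)
    exact (h'.hasFDerivAt.comp_hasDerivAt (f := fun s : ℝ => (s, p'.2)) p'.1 h2).unique h
  have h2 : HasDerivAt (fun s : ℝ => (s, p.2)) ((1 : ℝ), (0 : Z)) p.1 :=
    (hasDerivAt_id _).prodMk (hasDerivAt_const _ _)
  have h3 := hY.fderiv.hasFDerivAt.comp_hasDerivAt (f := fun s : ℝ => (s, p.2)) p.1 h2
  have hsym : IsSymmSndFDerivAt ℝ Y p := hY.contDiffAt.isSymmSndFDerivAt (by
    simp only [minSmoothness_of_isRCLikeNormedField]; exact WithTop.coe_le_coe.2 le_top)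
  refine HasDerivAt.congr_deriv h3 ?_
  ext u
  · rw [← h1.fderiv_eq]
    have h4 : HasFDerivAt (fun p' => fderiv ℝ Y p' (1, 0))
        ((ContinuousLinearMap.apply ℝ F ((1 : ℝ), (0 : Z))).comp (fderiv ℝ (fderiv ℝ Y) p)) p :=
      (ContinuousLinearMap.apply ℝ F ((1 : ℝ), (0 : Z))).hasFDerivAt.comp p hY.fderiv.hasFDerivAt
    rw [h4.fderiv]
    simp
  · rw [← h1.fderiv_eq]
    have h4 : HasFDerivAt (fun p' => fderiv ℝ Y p' (1, 0))
        ((ContinuousLinearMap.apply ℝ F ((1 : ℝ), (0 : Z))).comp (fderiv ℝ (fderiv ℝ Y) p)) p :=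
      (ContinuousLinearMap.apply ℝ F ((1 : ℝ), (0 : Z))).hasFDerivAt.comp p hY.fderiv.hasFDerivAt
    rw [h4.fderiv]
    simpa using hsym.eq (1, 0) (0, u)

/-- The covector `η ↦ ξ ((B' η) ξ)`, the differential in `y` of `ξ (B(y) ξ)`. -/
def quadDeriv (B' : V →L[ℝ] (V →L[ℝ] ℝ) →L[ℝ] V) (ξ : V →L[ℝ] ℝ) : V →L[ℝ] ℝ :=
  ξ.comp ((ContinuousLinearMap.apply ℝ V ξ).comp B')

lemma quadDeriv_apply (B' : V →L[ℝ] (V →L[ℝ] ℝ) →L[ℝ] V) (ξ : V →L[ℝ] ℝ) (η : V) :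
    quadDeriv B' ξ η = ξ (B' η ξ) := rfl

/-- The Hamiltonian vector field of `H(y, ξ) = ½ ξ (B(y) ξ)` on the cotangent space. -/
def hamiltonianField (B : V → (V →L[ℝ] ℝ) →L[ℝ] V) (z : V × (V →L[ℝ] ℝ)) : V × (V →L[ℝ] ℝ) :=
  (B z.1 z.2, -((1 / 2 : ℝ) • quadDeriv (fderiv ℝ B z.1) z.2))

lemma contDiff_hamiltonianField {B : V → (V →L[ℝ] ℝ) →L[ℝ] V} (hB : ContDiff ℝ ∞ B) :
    ContDiff ℝ ∞ (hamiltonianField B) := by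
  have hB' : ContDiff ℝ ∞ (fderiv ℝ B) := (contDiff_infty_iff_fderiv.1 hB).2
  have h : ContDiff ℝ ∞ fun z : V × (V →L[ℝ] ℝ) => quadDeriv (fderiv ℝ B z.1) z.2 :=
    contDiff_snd.clm_comp
      (((ContinuousLinearMap.apply (E := V →L[ℝ] ℝ) ℝ V).contDiff.comp contDiff_snd).clm_comp
        (hB'.comp contDiff_fst))
  exact ((hB.comp contDiff_fst).clm_apply contDiff_snd).prodMk (h.const_smul (1 / 2 : ℝ)).neg

/-- Solution of the eikonal equation `|d_y ζ| = 1` by characteristics, for a family of hypersurfaces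
`ρ(x, ·) = 0` depending on a parameter `x`. The dual metric is `A`. The vector `e` is transversal to
the hypersurfaces, and `ρ` is normalized along `e`. The curves `s ↦ Γ(s, z)` are the
characteristics: they have unit speed, start on the hypersurface, and reach the second component of
`z` at time `ζ(z)`. -/
theorem exists_eikonal [FiniteDimensional ℝ P] [FiniteDimensional ℝ V]
    {A : V → (V →L[ℝ] ℝ) →L[ℝ] V} {y₀ : V} (hA : SmoothNear A y₀)
    (hsymm : ∀ᶠ y in 𝓝 y₀, ∀ ξ η : V →L[ℝ] ℝ, ξ (A y η) = η (A y ξ))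
    (hpos : ∀ ξ : V →L[ℝ] ℝ, ξ ≠ 0 → 0 < ξ (A y₀ ξ))
    {ρ : P × V → ℝ} {x₀ : P} (hρ : SmoothNear ρ (x₀, y₀)) (hρ0 : ρ (x₀, y₀) = 0) {e : V}
    (he : ∀ x y t, ρ (x, y + t • e) = ρ (x, y) + t) :
    ∃ (ζ : P × V → ℝ) (Γ : ℝ × (P × V) → V) (c : P × V → ℝ),
      SmoothNear ζ (x₀, y₀) ∧ SmoothNear Γ (0, (x₀, y₀)) ∧ Γ (0, (x₀, y₀)) = y₀ ∧
      SmoothNear c (x₀, y₀) ∧ 0 < c (x₀, y₀) ∧ (∀ᶠ z in 𝓝 (x₀, y₀), ζ z = ρ z * c z) ∧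
      (∀ᶠ z : P × V in 𝓝 (x₀, y₀), fderiv ℝ (fun y => ζ (z.1, y)) z.2
        (A z.2 (fderiv ℝ (fun y => ζ (z.1, y)) z.2)) = 1) ∧
      (∀ᶠ z : P × V in 𝓝 (x₀, y₀), ρ (z.1, Γ (0, z)) = 0 ∧ Γ (ζ z, z) = z.2) ∧
      ∀ᶠ p : ℝ × (P × V) in 𝓝 ((0 : ℝ), (x₀, y₀)), ∃ ξ : V →L[ℝ] ℝ,
        HasDerivAt (fun s => Γ (s, p.2)) (A (Γ p) ξ) p.1 ∧ ξ (A (Γ p) ξ) = 1 := by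
  obtain ⟨B, hB, hBA⟩ := hA.exists_contDiff
  have hBsymm : ∀ᶠ y in 𝓝 y₀, ∀ ξ η : V →L[ℝ] ℝ, ξ (B y η) = η (B y ξ) := by
    filter_upwards [hBA, hsymm] with y h1 h2; rw [h1]; exact h2
  have hBd : ∀ y, HasFDerivAt B (fderiv ℝ B y) y := fun y =>
    (hB.differentiable (by simp) y).hasFDerivAt
  set z₀ : P × V := (x₀, y₀) with hz₀
  set p₀ : ℝ × (P × V) := (0, z₀) with hp₀
  -- the unit conormal and the projection along `e`
  let N : P × V → (V →L[ℝ] ℝ) := fun z => fderiv ℝ (fun y => ρ (z.1, y)) z.2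
  have hN : SmoothNear N z₀ := hρ.fderiv_snd
  have hNe : ∀ᶠ z in 𝓝 z₀, N z e = 1 := by
    filter_upwards [hρ.eventually] with z hz
    have h1 : HasFDerivAt (fun y => ρ (z.1, y)) (N z) z.2 :=
      (hz.slice (x := z.1) (w := z.2)).hasFDerivAt
    have h2 : HasDerivAt (fun t : ℝ => z.2 + t • e) e 0 := by
      simpa using ((hasDerivAt_id (0 : ℝ)).smul_const e).const_add z.2
    have h3 : HasDerivAt (fun t : ℝ => ρ (z.1, z.2 + t • e)) (N z e) 0 :=
      HasFDerivAt.comp_hasDerivAt (l := fun y => ρ (z.1, y)) (f := fun t : ℝ => z.2 + t • e) 0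
        (by simpa using h1) h2
    have h4 : HasDerivAt (fun t : ℝ => ρ (z.1, z.2 + t • e)) 1 0 := by
      simp only [he]; simpa using (hasDerivAt_id (0 : ℝ)).const_add (ρ z)
    exact h3.unique h4
  have hN0 : N z₀ ≠ 0 := by
    intro h; have := hNe.self_of_nhds; rw [h] at this; simp at this
  let nn : P × V → ℝ := fun z => N z (B z.2 (N z))
  have hBs : SmoothNear (fun z : P × V => B z.2) z₀ :=
    (SmoothNear.of_contDiff hB).comp SmoothNear.snd
  have hnn : SmoothNear nn z₀ := hN.clm_apply (hBs.clm_apply hN)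
  have hB0 : B y₀ = A y₀ := hBA.self_of_nhds
  have hnn0 : 0 < nn z₀ := by
    change 0 < N z₀ (B y₀ (N z₀)); rw [hB0]; exact hpos _ hN0
  let ξ0 : P × V → (V →L[ℝ] ℝ) := fun z => (Real.sqrt (nn z))⁻¹ • N z
  have hξ0 : SmoothNear ξ0 z₀ :=
    ((hnn.sqrt hnn0.ne').inv (Real.sqrt_ne_zero'.2 hnn0)).smul hN
  have hξ0n : ∀ᶠ z in 𝓝 z₀, ξ0 z (B z.2 (ξ0 z)) = 1 := by
    filter_upwards [hnn.continuousAt.eventually_const_lt hnn0] with z hz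
    have h1 : ξ0 z (B z.2 (ξ0 z)) = (Real.sqrt (nn z))⁻¹ * ((Real.sqrt (nn z))⁻¹ * nn z) := by
      simp [ξ0, nn]
    rw [h1]
    have h2 := Real.mul_self_sqrt hz.le
    have h3 : Real.sqrt (nn z) ≠ 0 := Real.sqrt_ne_zero'.2 hz
    field_simp
    nlinarith
  let pr : P × V → P × V := fun z => (z.1, z.2 - ρ z • e)
  have hpr : SmoothNear pr z₀ :=
    SmoothNear.fst.prodMk (SmoothNear.snd.sub (hρ.smul (SmoothNear.const e)))
  have hpr0 : pr z₀ = z₀ := by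
    refine Prod.ext rfl ?_
    change y₀ - ρ (x₀, y₀) • e = y₀
    rw [hρ0]; simp
  have hρpr : ∀ z, ρ (pr z) = 0 := by
    intro z
    have := he z.1 z.2 (-ρ z)
    rw [neg_smul, ← sub_eq_add_neg] at this
    change ρ (z.1, z.2 - ρ z • e) = 0
    rw [this]; exact add_neg_cancel _
  have hprt : Tendsto pr (𝓝 z₀) (𝓝 z₀) := by
    have := hpr.continuousAt; rwa [ContinuousAt, hpr0] at this
  -- the Hamiltonian flow from the conormals of the hypersurfaces
  obtain ⟨Φ, hΦ, hΦ0, hΦd⟩ := exists_smooth_flow (contDiff_hamiltonianField hB) (y₀, ξ0 z₀)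
  let ini : P × V → V × (V →L[ℝ] ℝ) := fun z => ((pr z).2, ξ0 (pr z))
  have hξpr : SmoothNear (fun z => ξ0 (pr z)) z₀ := SmoothNear.comp_of_eq hξ0 hpr hpr0
  have hini : SmoothNear ini z₀ := (SmoothNear.snd.comp hpr).prodMk hξpr
  have hini0 : ini z₀ = (y₀, ξ0 z₀) := by
    change ((pr z₀).2, ξ0 (pr z₀)) = _; rw [hpr0]
  let Q : ℝ × (P × V) → V × (V →L[ℝ] ℝ) := fun p => Φ (p.1, ini p.2)
  let ι : ℝ × (P × V) → ℝ × (V × (V →L[ℝ] ℝ)) := fun p => (p.1, ini p.2)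
  have hι : SmoothNear ι p₀ :=
    SmoothNear.fst.prodMk (SmoothNear.comp_of_eq hini SmoothNear.snd rfl)
  have hι0 : ι p₀ = (0, (y₀, ξ0 z₀)) := by simp only [ι, hp₀, hini0]
  have hιt : Tendsto ι (𝓝 p₀) (𝓝 (0, (y₀, ξ0 z₀))) := by
    have := hι.continuousAt; rwa [ContinuousAt, hι0] at this
  have hQ : SmoothNear Q p₀ := SmoothNear.comp_of_eq hΦ hι hι0
  have hini_t : Tendsto ini (𝓝 z₀) (𝓝 (y₀, ξ0 z₀)) := by
    have := hini.continuousAt; rwa [ContinuousAt, hini0] at this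
  have hQ0 : ∀ᶠ z in 𝓝 z₀, Q (0, z) = ini z := hini_t.eventually hΦ0
  have hQd : ∀ᶠ p : ℝ × (P × V) in 𝓝 p₀,
      HasDerivAt (fun s => Q (s, p.2)) (hamiltonianField B (Q p)) p.1 := hιt.eventually hΦd
  let Y : ℝ × (P × V) → V := fun p => (Q p).1
  let Ξ : ℝ × (P × V) → (V →L[ℝ] ℝ) := fun p => (Q p).2
  have hY : SmoothNear Y p₀ := SmoothNear.fst.comp hQ
  have hΞ : SmoothNear Ξ p₀ := SmoothNear.snd.comp hQ
  have hQp₀ : Q p₀ = (y₀, ξ0 z₀) := hQ0.self_of_nhds.trans hini0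
  have hY0 : Y p₀ = y₀ := congrArg Prod.fst hQp₀
  have hΞ0 : Ξ p₀ = ξ0 z₀ := congrArg Prod.snd hQp₀
  have hYd : ∀ᶠ p : ℝ × (P × V) in 𝓝 p₀, HasDerivAt (fun s => Y (s, p.2)) (B (Y p) (Ξ p)) p.1 := by
    filter_upwards [hQd] with p hp
    exact (ContinuousLinearMap.fst ℝ V (V →L[ℝ] ℝ)).hasFDerivAt.comp_hasDerivAt p.1 hp
  have hΞd : ∀ᶠ p : ℝ × (P × V) in 𝓝 p₀, HasDerivAt (fun s => Ξ (s, p.2))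
      (-((1 / 2 : ℝ) • quadDeriv (fderiv ℝ B (Y p)) (Ξ p))) p.1 := by
    filter_upwards [hQd] with p hp
    exact (ContinuousLinearMap.snd ℝ V (V →L[ℝ] ℝ)).hasFDerivAt.comp_hasDerivAt p.1 hp
  have hYt : Tendsto Y (𝓝 p₀) (𝓝 y₀) := by
    have := hY.continuousAt; rwa [ContinuousAt, hY0] at this
  have hsndt : Tendsto (fun p : ℝ × (P × V) => p.2) (𝓝 p₀) (𝓝 z₀) := continuous_snd.tendsto _
  -- conservation of the Hamiltonian
  have hH : ∀ᶠ p in 𝓝 p₀, Ξ p (B (Y p) (Ξ p)) = 1 := by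
    have h1 := eventually_eq_of_hasDerivAt_zero (z₀ := z₀) (f := fun p => Ξ p (B (Y p) (Ξ p))) (by
      filter_upwards [hYd, hΞd, hYt.eventually hBsymm] with p h1 h2 h3
      have h4 : HasDerivAt (fun s => B (Y (s, p.2))) (fderiv ℝ B (Y p) (B (Y p) (Ξ p))) p.1 :=
        HasFDerivAt.comp_hasDerivAt (l := B) (f := fun s => Y (s, p.2)) p.1 (hBd (Y p)) h1
      have h5 := h2.clm_apply (h4.clm_apply h2)
      convert h5 using 1
      have h6 := h3 (Ξ p) (quadDeriv (fderiv ℝ B (Y p)) (Ξ p))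
      simp only [Prod.mk.eta, map_add, map_neg, map_smul, neg_apply,
        smul_apply, smul_eq_mul, quadDeriv_apply] at h6 ⊢
      rw [h6]; ring)
    filter_upwards [h1, hsndt.eventually hQ0, hsndt.eventually (hprt.eventually hξ0n)]
      with p h1 h2 h3
    rw [h1]
    change (Q (0, p.2)).2 (B (Q (0, p.2)).1 (Q (0, p.2)).2) = 1
    rw [h2]
    exact h3
  -- Gauss lemma: the covector stays conormal to the wave fronts
  let inr2 : V →L[ℝ] ℝ × (P × V) :=
    (ContinuousLinearMap.inr ℝ ℝ (P × V)).comp (ContinuousLinearMap.inr ℝ P V)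
  have hG : ∀ᶠ p in 𝓝 p₀, (Ξ p).comp ((fderiv ℝ Y p).comp inr2) = 0 := by
    have h1 := eventually_eq_of_hasDerivAt_zero (z₀ := z₀)
      (f := fun p => (Ξ p).comp ((fderiv ℝ Y p).comp inr2)) (by
      filter_upwards [hYd.eventually_nhds, hΞd, hYt.eventually hBsymm, hY.eventually,
        hΞ.eventually, hH.eventually_nhds] with p h1 h2 h3 h4 h5 h6
      have h7 := hasDerivAt_fderiv_of_hasDerivAt h4 h1
      have h8 := h2.clm_comp (h7.clm_comp (hasDerivAt_const p.1 inr2))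
      refine h8.congr_deriv (ContinuousLinearMap.ext fun η => ?_)
      have hBY : HasFDerivAt (fun p => B (Y p)) ((fderiv ℝ B (Y p)).comp (fderiv ℝ Y p)) p :=
        HasFDerivAt.comp (g := B) p (hBd (Y p)) h4.hasFDerivAt
      have h9 := hBY.clm_apply h5.hasFDerivAt
      have h10 := h5.hasFDerivAt.clm_apply h9
      have h11 : HasFDerivAt (fun p => Ξ p (B (Y p) (Ξ p)))
          (0 : ℝ × (P × V) →L[ℝ] ℝ) p :=
        (hasFDerivAt_const (1 : ℝ) p).congr_of_eventuallyEq h6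
      have h12 := congrArg (fun L : ℝ × (P × V) →L[ℝ] ℝ => L (inr2 η)) (h10.unique h11)
      have h13 := h3 (Ξ p) (fderiv ℝ Ξ p (inr2 η))
      rw [h9.fderiv]
      simp only [Prod.mk.eta, add_apply, ContinuousLinearMap.comp_apply,
        ContinuousLinearMap.flip_apply, zero_apply, map_add,
        neg_apply, smul_apply, smul_eq_mul,
        quadDeriv_apply, ContinuousLinearMap.comp_zero, map_zero] at h12 ⊢
      linarith)
    have h0t : Tendsto (fun z : P × V => ((0 : ℝ), z)) (𝓝 z₀) (𝓝 p₀) :=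
      (continuous_const.prodMk continuous_id).tendsto _
    have h3 : ∀ᶠ z in 𝓝 z₀, (Ξ (0, z)).comp ((fderiv ℝ Y (0, z)).comp inr2) = 0 := by
      filter_upwards [h0t.eventually hY.eventually, hQ0.eventually_nhds, hρ.eventually,
        hprt.eventually hρ.eventually, hpr.eventually] with z hz1 hz2 hz3 hz4 hz5
      ext η
      have e1 : fderiv ℝ (fun y => Y (0, (z.1, y))) z.2 η = fderiv ℝ Y (0, z) (inr2 η) := by
        have hf : HasFDerivAt (fun y : V => ((0 : ℝ), (z.1, y))) inr2 z.2 := by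
          have := (hasFDerivAt_prodMk_right (𝕜 := ℝ) (0 : ℝ) (z.1, z.2)).comp z.2
            (hasFDerivAt_prodMk_right z.1 z.2)
          exact this
        exact congrArg (fun L => L η)
          (HasFDerivAt.comp (f := fun y : V => ((0 : ℝ), (z.1, y))) z.2 hz1.hasFDerivAt hf).fderiv
      have e2 : (fun y => Y (0, (z.1, y))) =ᶠ[𝓝 z.2] fun y => (pr (z.1, y)).2 := by
        have ht : Tendsto (fun y : V => (z.1, y)) (𝓝 z.2) (𝓝 z) :=
          (continuous_const.prodMk continuous_id).tendsto' _ _ rfl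
        filter_upwards [ht.eventually hz2] with y hy
        exact congrArg Prod.fst hy
      have e3 : HasFDerivAt (fun y => (pr (z.1, y)).2)
          (fderiv ℝ (fun y => (pr (z.1, y)).2) z.2) z.2 :=
        ((SmoothNear.snd.comp hz5).slice (x := z.1) (w := z.2)).hasFDerivAt
      have e4 : HasFDerivAt (fun y => ρ (z.1, (pr (z.1, y)).2))
          ((N (pr z)).comp (fderiv ℝ (fun y => (pr (z.1, y)).2) z.2)) z.2 :=
        HasFDerivAt.comp (g := fun y => ρ (z.1, y)) (f := fun y => (pr (z.1, y)).2) z.2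
          (hz4.slice (x := z.1) (w := (pr z).2)).hasFDerivAt e3
      have e5 : HasFDerivAt (fun y => ρ (z.1, (pr (z.1, y)).2)) (0 : V →L[ℝ] ℝ) z.2 :=
        (hasFDerivAt_const (0 : ℝ) z.2).congr_of_eventuallyEq
          (Eventually.of_forall fun y => hρpr (z.1, y))
      have e6 := congrArg (fun L => L η) (e4.unique e5)
      have e7 : Ξ (0, z) = ξ0 (pr z) := congrArg Prod.snd hz2.self_of_nhds
      rw [ContinuousLinearMap.comp_apply, ContinuousLinearMap.comp_apply, ← e1, e2.fderiv_eq, e7]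
      simp only [ContinuousLinearMap.comp_apply, zero_apply] at e6
      simp [ξ0, e6]
    filter_upwards [h1, hsndt.eventually h3] with p h1 h3
    rw [h1, h3]
  -- the local diffeomorphism given by the characteristics
  let j : P × V → ℝ × (P × V) := fun z => (ρ z, z)
  have hj : SmoothNear j z₀ := hρ.prodMk SmoothNear.id
  have hj0 : j z₀ = p₀ := by change (ρ z₀, z₀) = _; rw [hρ0]
  have hjt : Tendsto j (𝓝 z₀) (𝓝 p₀) := by
    have := hj.continuousAt; rwa [ContinuousAt, hj0] at this
  let T : P × V → V := fun z => Y (j z)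
  have hT : SmoothNear T z₀ := SmoothNear.comp_of_eq hY hj hj0
  have hT0 : T z₀ = y₀ := by simp only [T, hj0, hY0]
  have hTd : ∀ᶠ z in 𝓝 z₀, ∀ b : V, fderiv ℝ T z (0, b) =
      N z b • B (Y (j z)) (Ξ (j z)) + fderiv ℝ Y (j z) (inr2 b) := by
    filter_upwards [hjt.eventually hY.eventually, hρ.eventually, hjt.eventually hYd]
      with z h1 h2 h3 b
    have h4 : HasFDerivAt j ((fderiv ℝ ρ z).prod (ContinuousLinearMap.id ℝ (P × V))) z :=
      h2.hasFDerivAt.prodMk (hasFDerivAt_id z)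
    have h5 : HasFDerivAt T _ z := h1.hasFDerivAt.comp z h4
    have h6 : HasDerivAt (fun s : ℝ => (s, z)) ((1 : ℝ), (0 : P × V)) (j z).1 :=
      (hasDerivAt_id _).prodMk (hasDerivAt_const _ _)
    have h7 : fderiv ℝ Y (j z) (1, 0) = B (Y (j z)) (Ξ (j z)) :=
      (HasFDerivAt.comp_hasDerivAt (f := fun s : ℝ => (s, z)) (j z).1 h1.hasFDerivAt h6).unique h3
    have h8 : N z b = fderiv ℝ ρ z (0, b) := by
      have := congrArg (fun L => L b)
        (fderiv_comp_prodMk (f := ρ) (x := z.1) (w := z.2) h2.differentiableAt)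
      exact this
    rw [h5.fderiv, ← h7, h8, ← map_smul, ← map_add]
    simp only [ContinuousLinearMap.comp_apply]
    congr 1
    simp [inr2]
  let Fm : P × V → P × V := fun z => (z.1, T z)
  have hFm : SmoothNear Fm z₀ := SmoothNear.fst.prodMk hT
  have hFm0 : Fm z₀ = z₀ := by change (z₀.1, T z₀) = _; rw [hT0]
  obtain ⟨G, hG1, hG2, hG3, hG4⟩ := hFm.exists_local_inverse_of_injective rfl (by
    rintro ⟨a, b⟩ hab
    have h1 : fderiv ℝ Fm z₀ = (ContinuousLinearMap.fst ℝ P V).prod (fderiv ℝ T z₀) :=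
      (hasFDerivAt_fst.prodMk hT.hasFDerivAt).fderiv
    rw [h1, ContinuousLinearMap.prod_apply, Prod.mk_eq_zero] at hab
    obtain ⟨ha, hb⟩ := hab
    have ha' : a = 0 := ha
    subst ha'
    have h2 := hTd.self_of_nhds b
    rw [hb, hj0] at h2
    have h3 : fderiv ℝ Y p₀ (inr2 b) = b - N z₀ b • e := by
      have hf : HasFDerivAt (fun y : V => ((0 : ℝ), (x₀, y))) inr2 y₀ :=
        (hasFDerivAt_prodMk_right (𝕜 := ℝ) (0 : ℝ) (x₀, y₀)).comp y₀
          (hasFDerivAt_prodMk_right x₀ y₀)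
      have e1 : HasFDerivAt (fun y => Y (0, (x₀, y))) ((fderiv ℝ Y p₀).comp inr2) y₀ :=
        HasFDerivAt.comp (f := fun y : V => ((0 : ℝ), (x₀, y))) y₀ hY.hasFDerivAt hf
      have e2 : (fun y => Y (0, (x₀, y))) =ᶠ[𝓝 y₀] fun y => y - ρ (x₀, y) • e := by
        have ht : Tendsto (fun y : V => (x₀, y)) (𝓝 y₀) (𝓝 z₀) :=
          (continuous_const.prodMk continuous_id).tendsto' _ _ rfl
        filter_upwards [ht.eventually hQ0] with y hy
        exact congrArg Prod.fst hy
      have e3 : HasFDerivAt (fun y => y - ρ (x₀, y) • e)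
          (ContinuousLinearMap.id ℝ V - (N z₀).smulRight e) y₀ :=
        (hasFDerivAt_id y₀).sub ((hρ.slice (x := x₀) (w := y₀)).hasFDerivAt.smul_const e)
      have e4 := congrArg (fun L => L b) (e1.unique (e3.congr_of_eventuallyEq e2))
      simpa using e4
    rw [h3, hY0, hΞ0] at h2
    have h4 := congrArg (N z₀) h2
    simp only [map_zero, map_add, map_sub, map_smul, smul_eq_mul, hNe.self_of_nhds] at h4
    have h5 : 0 < N z₀ (B y₀ (ξ0 z₀)) := by
      have : N z₀ (B y₀ (ξ0 z₀)) = (Real.sqrt (nn z₀))⁻¹ * nn z₀ := by simp [ξ0, nn, hz₀]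
      rw [this]
      exact mul_pos (inv_pos.2 (Real.sqrt_pos.2 hnn0)) hnn0
    have h6 : N z₀ b = 0 := by
      have : N z₀ b * N z₀ (B y₀ (ξ0 z₀)) = 0 := by linarith
      exact (mul_eq_zero.1 this).resolve_right h5.ne'
    rw [h6] at h2
    simp only [zero_smul, zero_add, sub_zero] at h2
    rw [← h2]; rfl)
  rw [hFm0] at hG1 hG2 hG4
  have hGt : Tendsto G (𝓝 z₀) (𝓝 z₀) := by
    have := hG1.continuousAt; rwa [ContinuousAt, hG2] at this
  have hGfst : ∀ᶠ z in 𝓝 z₀, (G z).1 = z.1 := by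
    filter_upwards [hG4] with z hz
    have h : (Fm (G z)).1 = z.1 := congrArg Prod.fst hz
    exact h
  have hTG : ∀ᶠ z in 𝓝 z₀, T (G z) = z.2 := by
    filter_upwards [hG4] with z hz using congrArg Prod.snd hz
  let ζ : P × V → ℝ := fun z => ρ (G z)
  have hζ : SmoothNear ζ z₀ := SmoothNear.comp_of_eq hρ hG1 hG2
  have hζd : ∀ᶠ z : P × V in 𝓝 z₀, fderiv ℝ (fun y => ζ (z.1, y)) z.2 = Ξ (j (G z)) := by
    filter_upwards [hζ.eventually, hG1.eventually, hGt.eventually hρ.eventually,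
      hGt.eventually hT.eventually, hTG.eventually_nhds, hGfst.eventually_nhds,
      hGt.eventually hTd, hGt.eventually (hjt.eventually hH), hGt.eventually (hjt.eventually hG)]
      with z h1 h2 h3 h4 h5 h6 h7 h8 h9
    rw [fderiv_comp_prodMk (x := z.1) (w := z.2) h1.differentiableAt]
    ext b
    have e1 : fderiv ℝ ζ z = (fderiv ℝ ρ (G z)).comp (fderiv ℝ G z) :=
      (h3.hasFDerivAt.comp z h2.hasFDerivAt).fderiv
    have e2 : (fderiv ℝ T (G z)).comp (fderiv ℝ G z) = ContinuousLinearMap.snd ℝ P V :=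
      (h4.hasFDerivAt.comp z h2.hasFDerivAt).unique
        (hasFDerivAt_snd.congr_of_eventuallyEq h5)
    have e3 : (ContinuousLinearMap.fst ℝ P V).comp (fderiv ℝ G z) =
        ContinuousLinearMap.fst ℝ P V :=
      (hasFDerivAt_fst.comp z h2.hasFDerivAt).unique
        (hasFDerivAt_fst.congr_of_eventuallyEq h6)
    have e4 : fderiv ℝ G z (0, b) = (0, (fderiv ℝ G z (0, b)).2) :=
      Prod.ext (congrArg (fun L => L (0, b)) e3) rfl
    set b' := (fderiv ℝ G z (0, b)).2
    have e5 : fderiv ℝ T (G z) (0, b') = b := by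
      rw [← e4]; exact congrArg (fun L => L (0, b)) e2
    have e6 : N (G z) b' = fderiv ℝ ρ (G z) (0, b') :=
      congrArg (fun L => L b')
        (fderiv_comp_prodMk (f := ρ) (x := (G z).1) (w := (G z).2) h3.differentiableAt)
    have e7 := congrArg (fun L => L b') h9
    simp only [ContinuousLinearMap.comp_apply, zero_apply] at e7
    change fderiv ℝ ζ z (0, b) = _
    rw [e1, ContinuousLinearMap.comp_apply, e4, ← e6]
    conv_rhs => rw [← e5, h7 b', map_add, map_smul, smul_eq_mul, h8, e7]
    ring
  have hfix : ∀ᶠ z in 𝓝 z₀, ρ z = 0 → ζ z = 0 := by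
    filter_upwards [hG3, hQ0] with z h1 h2 h3
    have h4 : Fm z = z := by
      refine Prod.ext rfl ?_
      change Y (ρ z, z) = z.2
      rw [h3]
      change (Q (0, z)).1 = z.2
      rw [h2]
      change z.2 - ρ z • e = z.2
      rw [h3]; simp
    rw [h4] at h1
    change ρ (G z) = 0
    rw [h1, h3]
  obtain ⟨ζ', hζ', hζζ'⟩ := hζ.exists_contDiff
  obtain ⟨q, hq, hq0, hqs⟩ := exists_smooth_slope hζ'
  let c : P × V → ℝ := fun z => q (pr z, (0, ρ z • e)) (0, e)
  let Γ : ℝ × (P × V) → V := fun p => Y (p.1, G p.2)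
  let k : ℝ × (P × V) → ℝ × (P × V) := fun p => (p.1, G p.2)
  have hk : SmoothNear k p₀ :=
    SmoothNear.fst.prodMk (SmoothNear.comp_of_eq hG1 SmoothNear.snd rfl)
  have hk0 : k p₀ = p₀ := by simp only [k, hp₀, hG2]
  have hkt : Tendsto k (𝓝 p₀) (𝓝 p₀) := by
    have := hk.continuousAt; rwa [ContinuousAt, hk0] at this
  refine ⟨ζ, Γ, c, hζ, SmoothNear.comp_of_eq hY hk hk0, ?_, ?_, ?_, ?_, ?_, ?_, ?_⟩
  · change Y (k p₀) = y₀; rw [hk0, hY0]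
  · refine SmoothNear.clm_apply ?_ (SmoothNear.const _)
    refine (SmoothNear.of_contDiff hq).comp (hpr.prodMk ?_)
    exact (SmoothNear.const _).prodMk (hρ.smul (SmoothNear.const e))
  · have h1 : c z₀ = fderiv ℝ ζ z₀ (0, e) := by
      change q (pr z₀, (0, ρ z₀ • e)) (0, e) = _
      rw [hpr0, hρ0, zero_smul, show ((0 : P), (0 : V)) = 0 from rfl, hq0, hζζ'.fderiv_eq]
    have h2 := congrArg (fun L => L e)
      (fderiv_comp_prodMk (f := ζ) (x := x₀) (w := y₀) hζ.differentiableAt)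
    have h3 := hζd.self_of_nhds
    rw [hG2, hj0, hΞ0] at h3
    have h4 : fderiv ℝ ζ z₀ (0, e) = ξ0 z₀ e := by
      rw [← h3]; exact h2.symm
    rw [h1, h4]
    have : ξ0 z₀ e = (Real.sqrt (nn z₀))⁻¹ * N z₀ e := rfl
    rw [this, hNe.self_of_nhds, mul_one]
    exact inv_pos.2 (Real.sqrt_pos.2 hnn0)
  · filter_upwards [hζζ', hprt.eventually hζζ', hprt.eventually hfix] with z h1 h2 h3
    have h4 := hqs (pr z) (0, ρ z • e)
    have h5 : pr z + (0, ρ z • e) = z := by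
      refine Prod.ext ?_ ?_
      · simp [pr]
      · simp [pr]
    rw [h5, h1, h2, h3 (hρpr z), zero_add] at h4
    rw [h4, show ((0 : P), ρ z • e) = ρ z • ((0 : P), e) by simp, map_smul, smul_eq_mul]
    simp [c]
  · filter_upwards [hζd, hGt.eventually (hjt.eventually hH), hTG, hBA.eventually_nhds |>
      (continuous_snd.tendsto z₀).eventually] with z h1 h2 h3 h4
    rw [h1]
    have h5 : Y (j (G z)) = z.2 := h3
    rw [h5, h4.self_of_nhds] at h2
    exact h2
  · filter_upwards [hGt.eventually hQ0, hTG, hGfst] with z h1 h2 h3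
    refine ⟨?_, h2⟩
    have h4 : Γ (0, z) = (pr (G z)).2 := congrArg Prod.fst h1
    rw [h4, ← h3]
    exact hρpr (G z)
  · filter_upwards [hkt.eventually hYd, hkt.eventually hH, hkt.eventually (hYt.eventually hBA)]
      with p h1 h2 h3
    refine ⟨Ξ (k p), ?_, ?_⟩
    · change HasDerivAt _ (A (Y (k p)) (Ξ (k p))) _
      rw [← h3]; exact h1
    · change Ξ (k p) (A (Y (k p)) (Ξ (k p))) = 1
      rw [← h3]; exact h2

end Eikonal

/-! ### The normal form of a fold -/

section FoldNormalForm

variable {P V Z : Type} [NormedAddCommGroup P] [NormedSpace ℝ P] [NormedAddCommGroup V]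
  [NormedSpace ℝ V] [NormedAddCommGroup Z] [NormedSpace ℝ Z]

/-- Taylor's formula of second order along the direction `e`, with smooth remainder. -/
lemma exists_smooth_second_slope {f : Z → ℝ} (hf : ContDiff ℝ ∞ f) (e : Z) :
    ∃ q : Z × ℝ → ℝ, ContDiff ℝ ∞ q ∧
      (∀ z t, f (z + t • e) = f z + t * fderiv ℝ f z e + t ^ 2 * q (z, t)) ∧
      ∀ z, q (z, 0) = 1 / 2 * fderiv ℝ (fun z => fderiv ℝ f z e) z e := by
  obtain ⟨q₁, hq₁, hq₁0, hq₁s⟩ := exists_smooth_slope hf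
  let r : Z × ℝ → ℝ := fun x => q₁ (x.1, x.2 • e) e
  have hr : ContDiff ℝ ∞ r := by
    refine ContDiff.clm_apply (hq₁.comp ?_) contDiff_const
    exact contDiff_fst.prodMk (contDiff_snd.smul contDiff_const)
  obtain ⟨q₂, hq₂, hq₂0, hq₂s⟩ := exists_smooth_slope hr
  have hr0 : ∀ z, r (z, 0) = fderiv ℝ f z e := fun z => by simp [r, hq₁0]
  have hfr : ∀ z (t : ℝ), f (z + t • e) = f z + t * r (z, t) := fun z t => by
    rw [hq₁s, map_smul, smul_eq_mul]
  refine ⟨fun x => q₂ ((x.1, 0), (0, x.2)) (0, 1), ?_, fun z t => ?_, fun z => ?_⟩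
  · refine ContDiff.clm_apply (hq₂.comp ?_) contDiff_const
    exact (contDiff_fst.prodMk contDiff_const).prodMk (contDiff_const.prodMk contDiff_snd)
  · have h1 := hq₂s (z, 0) (0, t)
    rw [Prod.mk_add_mk, add_zero, zero_add, hr0,
      show ((0 : Z), t) = t • ((0 : Z), (1 : ℝ)) by simp, map_smul, smul_eq_mul] at h1
    rw [hfr, h1]
    simp only [Prod.smul_mk, smul_zero, smul_eq_mul, mul_one]
    ring
  · -- compare the derivatives at `t = 0` of `∂ₑ f (z + t e) = r + t ∂ₜ r`
    have hline : ∀ t : ℝ, HasDerivAt (fun t : ℝ => z + t • e) e t := fun t => by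
      simpa using ((hasDerivAt_id t).smul_const e).const_add z
    have hrt : ∀ t : ℝ, HasDerivAt (fun t : ℝ => r (z, t)) (fderiv ℝ r (z, t) (0, 1)) t := fun t =>
      HasFDerivAt.comp_hasDerivAt (f := fun t : ℝ => (z, t)) t
        (hr.differentiable (by simp) (z, t)).hasFDerivAt
        ((hasDerivAt_const t z).prodMk (hasDerivAt_id t))
    have h1 : ∀ t : ℝ, fderiv ℝ f (z + t • e) e = r (z, t) + t * fderiv ℝ r (z, t) (0, 1) := by
      intro t
      have e1 : HasDerivAt (fun t : ℝ => f (z + t • e)) (fderiv ℝ f (z + t • e) e) t :=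
        (hf.differentiable (by simp) _).hasFDerivAt.comp_hasDerivAt t (hline t)
      have e2 : HasDerivAt (fun t : ℝ => f (z + t • e))
          (1 * r (z, t) + t * fderiv ℝ r (z, t) (0, 1)) t := by
        have := ((hasDerivAt_id t).mul (hrt t)).const_add (f z)
        refine this.congr_of_eventuallyEq (Eventually.of_forall fun t => ?_)
        simp [hfr]
      rw [e1.unique e2, one_mul]
    have hd : ContDiff ℝ ∞ (fun z => fderiv ℝ f z e) :=
      ((contDiff_infty_iff_fderiv.1 hf).2).clm_apply contDiff_const
    have e3 : HasDerivAt (fun t : ℝ => fderiv ℝ f (z + t • e) e)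
        (fderiv ℝ (fun z => fderiv ℝ f z e) (z + (0 : ℝ) • e) e) 0 :=
      HasFDerivAt.comp_hasDerivAt (l := fun z => fderiv ℝ f z e) (f := fun t : ℝ => z + t • e) 0
        (hd.differentiable (by simp) _).hasFDerivAt (hline 0)
    have hr' : ContDiff ℝ ∞ (fun t : ℝ => fderiv ℝ r (z, t) ((0 : Z), (1 : ℝ))) :=
      (((contDiff_infty_iff_fderiv.1 hr).2).comp (contDiff_const.prodMk contDiff_id)).clm_apply
        contDiff_const
    have e4 := (hrt 0).add ((hasDerivAt_id (0 : ℝ)).mul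
      (hr'.differentiable (by simp) 0).hasDerivAt)
    have e5 := e3.unique (e4.congr_of_eventuallyEq (Eventually.of_forall fun t => by
      simp [h1]))
    simp only [zero_smul, add_zero, id_eq, one_mul, zero_mul] at e5
    change q₂ ((z, 0), (0, 0)) (0, 1) = _
    rw [show ((0 : Z), (0 : ℝ)) = 0 from rfl, hq₂0, e5]
    ring

/-- A family of maps `E(x, ·)` with a fold at `w₀` takes, in terms of suitable functions `ρ` on the
target and `X` on the source, the form `ρ = X²`. The construction is a Lyapunov–Schmidt reduction to
the scalar function `f = ℓ ∘ E` along the line `ℝ e`, followed by the completion of the square at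
the critical point of `f` on each such line. -/
lemma exists_fold_normal_form_of_pos [FiniteDimensional ℝ P] [FiniteDimensional ℝ V]
    {E : P × V → V} {x₀ : P} {w₀ y₀ : V} (hE : SmoothNear E (x₀, w₀)) (hy₀ : E (x₀, w₀) = y₀)
    {α : V} (hα : α ≠ 0)
    (hker : ∀ v, fderiv ℝ (fun w => E (x₀, w)) w₀ v = 0 ↔ ∃ c : ℝ, v = c • α)
    {l : V →L[ℝ] ℝ} (hl : ∀ v, l (fderiv ℝ (fun w => E (x₀, w)) w₀ v) = 0)
    {e : V} (hle : l e = 1)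
    (hpos : 0 < l (fderiv ℝ (fderiv ℝ (fun w => E (x₀, w))) w₀ α α)) :
    ∃ ρ X : P × V → ℝ, SmoothNear ρ (x₀, y₀) ∧ SmoothNear X (x₀, w₀) ∧ ρ (x₀, y₀) = 0 ∧
      X (x₀, w₀) = 0 ∧ (∀ x y t, ρ (x, y + t • e) = ρ (x, y) + t) ∧
      (∀ᶠ z : P × V in 𝓝 (x₀, w₀), ρ (z.1, E z) = X z ^ 2) ∧
      fderiv ℝ X (x₀, w₀) (0, α) ≠ 0 := by
  set L := fderiv ℝ (fun w => E (x₀, w)) w₀ with hL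
  have hLE : ∀ v, fderiv ℝ E (x₀, w₀) (0, v) = L v := fun v =>
    (congrArg (fun L => L v) (fderiv_comp_prodMk (x := x₀) (w := w₀) hE.differentiableAt)).symm
  have hLα : L α = 0 := (hker α).2 ⟨1, (one_smul ℝ α).symm⟩
  obtain ⟨lam, hlam⟩ := SeparatingDual.exists_eq_one (R := ℝ) hα
  -- the `e`-component of `E` is replaced by the coordinate `lam` along the kernel
  let Gam : P × V → P × V := fun z => (z.1, E z + (lam z.2 - l (E z)) • e)
  have hGam : SmoothNear Gam (x₀, w₀) := by
    refine SmoothNear.fst.prodMk (hE.add (SmoothNear.smul ?_ (SmoothNear.const e)))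
    exact (SmoothNear.snd.clm lam).sub (hE.clm l)
  let u₀ : V := y₀ + (lam w₀ - l y₀) • e
  have hGam0 : Gam (x₀, w₀) = (x₀, u₀) := by simp only [Gam, hy₀, u₀]
  have hGamd : ∀ᶠ z in 𝓝 (x₀, w₀), ∀ a : P × V, fderiv ℝ Gam z a =
      (a.1, fderiv ℝ E z a + (lam a.2 - l (fderiv ℝ E z a)) • e) := by
    filter_upwards [hE.eventually] with z hz a
    have h1 : HasFDerivAt Gam ((ContinuousLinearMap.fst ℝ P V).prod (fderiv ℝ E z +
        (lam.comp (ContinuousLinearMap.snd ℝ P V) - l.comp (fderiv ℝ E z)).smulRight e)) z := by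
      refine hasFDerivAt_fst.prodMk (hz.hasFDerivAt.add (HasFDerivAt.smul_const ?_ e))
      exact (lam.hasFDerivAt.comp z hasFDerivAt_snd).sub (l.hasFDerivAt.comp z hz.hasFDerivAt)
    rw [h1.fderiv]; simp
  obtain ⟨Gi, hGi, hGi0, hGil, hGir⟩ := hGam.exists_local_inverse_of_injective rfl (by
    rintro ⟨a, b⟩ hab
    rw [hGamd.self_of_nhds, Prod.mk_eq_zero] at hab
    obtain ⟨ha, hb⟩ := hab
    have ha' : a = 0 := ha
    subst ha'
    rw [hLE, hl, sub_zero] at hb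
    have h1 := congrArg l hb
    rw [map_add, hl, map_smul, hle, map_zero] at h1
    have h2 : lam b = 0 := by simpa using h1
    have h3 : L b = 0 := by
      have h4 : L b + lam b • e = 0 := hb
      rwa [h2, zero_smul, add_zero] at h4
    obtain ⟨c, rfl⟩ := (hker b).1 h3
    rw [map_smul, hlam, smul_eq_mul, mul_one] at h2
    simp [h2])
  rw [hGam0] at hGi hGi0 hGir
  have hf₀ : SmoothNear (fun z => l (E (Gi z))) (x₀, u₀) :=
    (SmoothNear.comp_of_eq hE hGi hGi0).clm l
  obtain ⟨f, hf, hff₀⟩ := hf₀.exists_contDiff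
  have hGamt : Tendsto Gam (𝓝 (x₀, w₀)) (𝓝 (x₀, u₀)) := by
    have := hGam.continuousAt; rwa [ContinuousAt, hGam0] at this
  have hGit : Tendsto Gi (𝓝 (x₀, u₀)) (𝓝 (x₀, w₀)) := by
    have := hGi.continuousAt; rwa [ContinuousAt, hGi0] at this
  have hfE : ∀ᶠ z in 𝓝 (x₀, w₀), f (Gam z) = l (E z) := by
    filter_upwards [hGamt.eventually hff₀, hGil] with z h1 h2
    rw [h1, h2]
  let ee : P × V := (0, e)
  let d : P × V → ℝ := fun z => fderiv ℝ f z ee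
  have hd : ContDiff ℝ ∞ d := ((contDiff_infty_iff_fderiv.1 hf).2).clm_apply contDiff_const
  -- first and second derivative of `f` along `e` at the base point
  have hder : d (x₀, u₀) = 0 ∧ fderiv ℝ d (x₀, u₀) ee =
      l (fderiv ℝ (fderiv ℝ (fun w => E (x₀, w))) w₀ α α) := by
    let cu : ℝ → P × V := fun t => (x₀, u₀) + t • ee
    have hcu : ∀ t, HasDerivAt cu ee t := fun t => by
      have h := ((hasDerivAt_id t).smul_const ee).const_add (x₀, u₀)
      rw [one_smul] at h
      exact h
    have hcu0 : cu 0 = (x₀, u₀) := by simp [cu]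
    have hcut : Tendsto cu (𝓝 0) (𝓝 (x₀, u₀)) := by
      have := (hcu 0).continuousAt; rwa [ContinuousAt, hcu0] at this
    let b : P × V → V := fun z => (fderiv ℝ Gi z ee).2
    have hb : SmoothNear b (x₀, u₀) :=
      SmoothNear.snd.comp (hGi.fderiv.clm_apply (SmoothNear.const ee))
    have hbeq : ∀ᶠ z in 𝓝 (x₀, u₀), (Gi z).1 = z.1 ∧ fderiv ℝ Gi z ee = (0, b z) ∧
        lam (b z) = 1 := by
      filter_upwards [hGir.eventually_nhds, hGi.eventually, hGit.eventually hGam.eventually,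
        hGit.eventually hGamd] with z h1 h2 h3 h4
      have h5 : (fderiv ℝ Gam (Gi z)).comp (fderiv ℝ Gi z) = ContinuousLinearMap.id ℝ (P × V) :=
        (HasFDerivAt.comp z h3.hasFDerivAt h2.hasFDerivAt).unique
          ((hasFDerivAt_id z).congr_of_eventuallyEq h1)
      have h6 : fderiv ℝ Gam (Gi z) (fderiv ℝ Gi z ee) = ee := congrArg (fun L => L ee) h5
      rw [h4] at h6
      have h7 : (fderiv ℝ Gi z ee).1 = 0 := congrArg Prod.fst h6
      have h8 := congrArg (fun a => l a.2) h6
      simp only [map_add, map_smul, hle, ee, smul_eq_mul, mul_one] at h8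
      have h9 : (Gam (Gi z)).1 = z.1 := congrArg Prod.fst h1.self_of_nhds
      refine ⟨h9, Prod.ext h7 rfl, ?_⟩
      linarith
    -- the curve `w(t)` in the source over the line `ℝ e`
    have hw : ∀ᶠ t in 𝓝 (0 : ℝ), HasDerivAt (fun t => (Gi (cu t)).2) (b (cu t)) t := by
      filter_upwards [hcut.eventually hGi.eventually] with t h1
      exact (ContinuousLinearMap.snd ℝ P V).hasFDerivAt.comp_hasDerivAt t
        (h1.hasFDerivAt.comp_hasDerivAt t (hcu t))
    have hEs : SmoothNear (fun w => E (x₀, w)) w₀ := hE.slice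
    have hw0 : (Gi (cu 0)).2 = w₀ := by rw [hcu0, hGi0]
    have hwt : Tendsto (fun t => (Gi (cu t)).2) (𝓝 0) (𝓝 w₀) := by
      have := hw.self_of_nhds.continuousAt; rwa [ContinuousAt, hw0] at this
    have hdcu : ∀ᶠ t in 𝓝 (0 : ℝ), d (cu t) =
        l (fderiv ℝ (fun w => E (x₀, w)) (Gi (cu t)).2 (b (cu t))) := by
      filter_upwards [hw, hwt.eventually hEs.eventually, hcut.eventually hff₀.eventuallyEq_nhds,
        (hcut.eventually hbeq).eventually_nhds] with t h1 h2 h3 h4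
      have e1 : HasDerivAt (fun t => f (cu t)) (d (cu t)) t :=
        (hf.differentiable (by simp) _).hasFDerivAt.comp_hasDerivAt t (hcu t)
      have e2 : HasDerivAt (fun t => l (E (x₀, (Gi (cu t)).2)))
          (l (fderiv ℝ (fun w => E (x₀, w)) (Gi (cu t)).2 (b (cu t)))) t :=
        l.hasFDerivAt.comp_hasDerivAt t
          (HasFDerivAt.comp_hasDerivAt (l := fun w => E (x₀, w)) t h2.hasFDerivAt h1)
      refine e1.unique (e2.congr_of_eventuallyEq ?_)
      filter_upwards [(hcu t).continuousAt.eventually h3, h4] with s h5 h6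
      rw [h5]
      have h7 : (Gi (cu s)).1 = x₀ := by rw [h6.1]; simp [cu, ee]
      have h8 : Gi (cu s) = (x₀, (Gi (cu s)).2) := Prod.ext h7 rfl
      rw [← h8]
    have hd0 : d (x₀, u₀) = 0 := by
      have := hdcu.self_of_nhds
      rwa [hcu0, hGi0, hl] at this
    have hb0 : b (x₀, u₀) = α := by
      obtain ⟨-, h1, h2⟩ := hbeq.self_of_nhds
      have h3 : fderiv ℝ Gam (x₀, w₀) (0, b (x₀, u₀)) = ee := by
        rw [← h1]
        have h5 : (fderiv ℝ Gam (Gi (x₀, u₀))).comp (fderiv ℝ Gi (x₀, u₀)) =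
            ContinuousLinearMap.id ℝ (P × V) :=
          (HasFDerivAt.comp (g := Gam) (f := Gi) (x₀, u₀) (by rw [hGi0]; exact hGam.hasFDerivAt)
            hGi.hasFDerivAt).unique ((hasFDerivAt_id _).congr_of_eventuallyEq hGir)
        rw [hGi0] at h5
        exact congrArg (fun L => L ee) h5
      rw [hGamd.self_of_nhds, hLE, hl, h2] at h3
      have h4 : L (b (x₀, u₀)) = 0 := by
        have := congrArg Prod.snd h3
        simpa [ee] using this
      obtain ⟨c, hc⟩ := (hker _).1 h4
      rw [hc, map_smul, hlam, smul_eq_mul, mul_one] at h2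
      rw [hc, h2, one_smul]
    refine ⟨hd0, ?_⟩
    have e1 : HasDerivAt (fun t => d (cu t)) (fderiv ℝ d (x₀, u₀) ee) 0 := by
      have h1 : HasFDerivAt d (fderiv ℝ d (x₀, u₀)) (cu 0) := by
        rw [hcu0]; exact (hd.differentiable (by simp) _).hasFDerivAt
      exact h1.comp_hasDerivAt 0 (hcu 0)
    have e2 : HasDerivAt (fun t => fderiv ℝ (fun w => E (x₀, w)) (Gi (cu t)).2)
        (fderiv ℝ (fderiv ℝ (fun w => E (x₀, w))) w₀ α) 0 := by
      have h1 : HasFDerivAt (fderiv ℝ (fun w => E (x₀, w)))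
          (fderiv ℝ (fderiv ℝ (fun w => E (x₀, w))) w₀) ((Gi (cu 0)).2) := by
        rw [hw0]; exact hEs.fderiv.hasFDerivAt
      have h2 := hw.self_of_nhds
      rw [hcu0, hb0] at h2
      exact HasFDerivAt.comp_hasDerivAt (f := fun t => (Gi (cu t)).2) 0 h1 h2
    have e3 : HasDerivAt (fun t => b (cu t)) (fderiv ℝ b (x₀, u₀) ee) 0 := by
      have h1 : HasFDerivAt b (fderiv ℝ b (x₀, u₀)) (cu 0) := by rw [hcu0]; exact hb.hasFDerivAt
      exact h1.comp_hasDerivAt 0 (hcu 0)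
    have e4 := l.hasFDerivAt.comp_hasDerivAt 0 (e2.clm_apply e3)
    have e5 := e1.unique (e4.congr_of_eventuallyEq hdcu)
    rw [e5, hcu0, hGi0, hb0, map_add, hl, add_zero]
  obtain ⟨hd0, hd1⟩ := hder
  -- the critical points of `f` along the lines parallel to `e`
  let Lam : P × V → P × V := fun z => (z.1, z.2 + (d z - l z.2) • e)
  have hLam : SmoothNear Lam (x₀, u₀) := by
    refine SmoothNear.fst.prodMk (SmoothNear.snd.add (SmoothNear.smul ?_ (SmoothNear.const e)))
    exact (SmoothNear.of_contDiff hd).sub (SmoothNear.snd.clm l)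
  let kap : P × V → P × V := fun z => (z.1, z.2 - l z.2 • e)
  have hkap : ∀ x y (t : ℝ), kap (x, y + t • e) = kap (x, y) := by
    intro x y t
    simp only [kap, map_add, map_smul, hle, smul_eq_mul, mul_one, add_smul, Prod.mk.injEq, true_and]
    abel
  have hkaps : ∀ z, SmoothNear kap z := fun z =>
    SmoothNear.fst.prodMk (SmoothNear.snd.sub ((SmoothNear.snd.clm l).smul (SmoothNear.const e)))
  have hLam0 : Lam (x₀, u₀) = kap (x₀, y₀) := by
    have h1 : kap (x₀, u₀) = kap (x₀, y₀) := hkap _ _ _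
    rw [← h1]
    simp only [Lam, kap, hd0, neg_smul, sub_eq_add_neg, zero_add]
  obtain ⟨Li, hLi, hLi0, hLil, hLir⟩ := hLam.exists_local_inverse_of_injective rfl (by
    rintro ⟨a, b⟩ hab
    have h1 : HasFDerivAt Lam ((ContinuousLinearMap.fst ℝ P V).prod (ContinuousLinearMap.snd ℝ P V +
        (fderiv ℝ d (x₀, u₀) - l.comp (ContinuousLinearMap.snd ℝ P V)).smulRight e)) (x₀, u₀) := by
      refine hasFDerivAt_fst.prodMk (hasFDerivAt_snd.add (HasFDerivAt.smul_const ?_ e))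
      exact (hd.differentiable (by simp) _).hasFDerivAt.sub
        (l.hasFDerivAt.comp _ hasFDerivAt_snd)
    rw [h1.fderiv] at hab
    simp only [ContinuousLinearMap.prod_apply, ContinuousLinearMap.coe_fst', Prod.mk_eq_zero] at hab
    obtain ⟨ha, hb⟩ := hab
    subst ha
    simp only [add_apply, ContinuousLinearMap.coe_snd', ContinuousLinearMap.smulRight_apply,
      sub_apply, ContinuousLinearMap.comp_apply] at hb
    have h2 := congrArg l hb
    simp only [map_add, map_smul, hle, smul_eq_mul, mul_one, map_zero] at h2
    have h3 : fderiv ℝ d (x₀, u₀) (0, b) = 0 := by linarith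
    rw [h3, zero_sub, neg_smul, ← sub_eq_add_neg, sub_eq_zero] at hb
    rw [hb, show ((0 : P), l b • e) = l b • ee by simp [ee], map_smul, smul_eq_mul, hd1] at h3
    have h4 : l b = 0 := (mul_eq_zero.1 h3).resolve_right hpos.ne'
    rw [hb, h4, zero_smul]; rfl)
  rw [hLam0] at hLi hLi0 hLir
  let C : P × V → V := fun z => (Li (kap z)).2
  have hC : SmoothNear C (x₀, y₀) := SmoothNear.snd.comp (hLi.comp (hkaps _))
  have hCe : ∀ x y (t : ℝ), C (x, y + t • e) = C (x, y) := fun x y t => by simp only [C, hkap]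
  have hC0 : C (x₀, y₀) = u₀ := by simp only [C, hLi0]
  have hCeq : ∀ᶠ z : P × V in 𝓝 (x₀, y₀), d (z.1, C z) = 0 ∧ z.2 = C z + (l z.2 - l (C z)) • e := by
    filter_upwards [(hkaps (x₀, y₀)).continuousAt.eventually hLir] with z hz
    have h1 : (Lam (Li (kap z))).1 = (kap z).1 := congrArg Prod.fst hz
    have h2 : Li (kap z) = (z.1, C z) := Prod.ext h1 rfl
    rw [h2] at hz
    have h3 : C z + (d (z.1, C z) - l (C z)) • e = z.2 - l z.2 • e := congrArg Prod.snd hz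
    have h4 := congrArg l h3
    simp only [map_add, map_sub, map_smul, hle, smul_eq_mul, mul_one] at h4
    have h5 : d (z.1, C z) = 0 := by linarith
    refine ⟨h5, ?_⟩
    rw [h5, zero_sub, neg_smul] at h3
    rw [sub_smul, add_sub, add_sub_right_comm, sub_eq_add_neg (C z), h3]
    abel
  obtain ⟨q, hq, hqs, hq0⟩ := exists_smooth_second_slope hf ee
  -- the time from the critical point, along `e`
  let tt : P × V → ℝ := fun z => lam z.2 - l (C (z.1, E z))
  have hpE : SmoothNear (fun z : P × V => (z.1, E z)) (x₀, w₀) := SmoothNear.fst.prodMk hE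
  have hpEt : Tendsto (fun z : P × V => (z.1, E z)) (𝓝 (x₀, w₀)) (𝓝 (x₀, y₀)) := by
    have := hpE.continuousAt; rwa [ContinuousAt, hy₀] at this
  have hCE : SmoothNear (fun z : P × V => C (z.1, E z)) (x₀, w₀) :=
    SmoothNear.comp_of_eq hC hpE (by rw [hy₀])
  have htt : SmoothNear tt (x₀, w₀) := (SmoothNear.snd.clm lam).sub (hCE.clm l)
  have htt0 : tt (x₀, w₀) = 0 := by
    simp only [tt, hy₀, hC0, u₀, map_add, map_smul, hle, smul_eq_mul]; ring
  let qq : P × V → ℝ := fun z => q ((z.1, C (z.1, E z)), tt z)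
  have hqq : SmoothNear qq (x₀, w₀) :=
    (SmoothNear.of_contDiff hq).comp ((SmoothNear.fst.prodMk hCE).prodMk htt)
  have hqq0 : 0 < qq (x₀, w₀) := by
    have : qq (x₀, w₀) = q ((x₀, u₀), 0) := by simp only [qq, htt0, hy₀, hC0]
    rw [this, hq0]
    have : fderiv ℝ (fun z => fderiv ℝ f z ee) (x₀, u₀) ee = fderiv ℝ d (x₀, u₀) ee := rfl
    rw [this, hd1]; positivity
  refine ⟨fun z => l z.2 - f (z.1, C z), fun z => tt z * Real.sqrt (qq z),
    ?_, ?_, ?_, ?_, ?_, ?_, ?_⟩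
  · exact (SmoothNear.snd.clm l).sub ((SmoothNear.of_contDiff hf).comp (SmoothNear.fst.prodMk hC))
  · exact htt.mul (hqq.sqrt hqq0.ne')
  · have h1 : f (x₀, u₀) = l y₀ := by
      have := hfE.self_of_nhds; rwa [hGam0, hy₀] at this
    simp [hC0, h1]
  · simp [htt0]
  · intro x y t
    simp only [hCe, map_add, map_smul, hle, smul_eq_mul]; ring
  · filter_upwards [hfE, hpEt.eventually hCeq, hqq.continuousAt.eventually_const_lt hqq0]
      with z h1 h2 h3
    obtain ⟨h4, h5⟩ := h2
    have h6 : Gam z = (z.1, C (z.1, E z)) + tt z • ee := by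
      refine Prod.ext (by simp [Gam, ee]) ?_
      simp only [Gam, ee, Prod.snd_add, Prod.smul_snd, tt]
      have h7 : E z = C (z.1, E z) + (l (E z) - l (C (z.1, E z))) • e := h5
      refine (congrArg (fun v => v + (lam z.2 - l (E z)) • e) h7).trans ?_
      simp only [add_assoc, ← add_smul]
      congr 2; ring
    rw [h6, hqs] at h1
    have h4' : fderiv ℝ f (z.1, C (z.1, E z)) ee = 0 := h4
    rw [h4', mul_zero, add_zero] at h1
    rw [mul_pow, Real.sq_sqrt h3.le, ← h1]
    simp only [qq]; ring
  · have h1 : HasFDerivAt (fun z => tt z * Real.sqrt (qq z))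
        (tt (x₀, w₀) • fderiv ℝ (fun z => Real.sqrt (qq z)) (x₀, w₀) +
          Real.sqrt (qq (x₀, w₀)) • fderiv ℝ tt (x₀, w₀)) (x₀, w₀) :=
      htt.hasFDerivAt.mul (hqq.sqrt hqq0.ne').hasFDerivAt
    have h2 : HasFDerivAt tt (lam.comp (ContinuousLinearMap.snd ℝ P V) -
        l.comp ((fderiv ℝ C (x₀, y₀)).comp
          ((ContinuousLinearMap.fst ℝ P V).prod (fderiv ℝ E (x₀, w₀))))) (x₀, w₀) := by
      refine (lam.hasFDerivAt.comp _ hasFDerivAt_snd).sub (l.hasFDerivAt.comp _ ?_)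
      refine HasFDerivAt.comp (g := C) (f := fun z : P × V => (z.1, E z)) _ ?_
        (hasFDerivAt_fst.prodMk hE.hasFDerivAt)
      rw [hy₀]; exact hC.hasFDerivAt
    rw [h1.fderiv, htt0, h2.fderiv]
    simp only [zero_smul, zero_add, smul_apply, sub_apply, ContinuousLinearMap.comp_apply,
      ContinuousLinearMap.coe_snd', ContinuousLinearMap.prod_apply, ContinuousLinearMap.coe_fst',
      hLE, hLα, hlam, smul_eq_mul]
    rw [show ((0 : P), (0 : V)) = 0 from rfl, map_zero, map_zero, sub_zero, mul_one]
    exact Real.sqrt_ne_zero'.2 hqq0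

/-- The normal form of a fold, without a sign condition on the second derivative. -/
theorem exists_fold_normal_form [FiniteDimensional ℝ P] [FiniteDimensional ℝ V]
    {E : P × V → V} {x₀ : P} {w₀ y₀ : V} (hE : SmoothNear E (x₀, w₀)) (hy₀ : E (x₀, w₀) = y₀)
    {α : V} (hα : α ≠ 0)
    (hker : ∀ v, fderiv ℝ (fun w => E (x₀, w)) w₀ v = 0 ↔ ∃ c : ℝ, v = c • α)
    {l : V →L[ℝ] ℝ} (hl : ∀ v, l (fderiv ℝ (fun w => E (x₀, w)) w₀ v) = 0) (hl0 : l ≠ 0)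
    (hne : l (fderiv ℝ (fderiv ℝ (fun w => E (x₀, w))) w₀ α α) ≠ 0) :
    ∃ (ρ X : P × V → ℝ) (e : V), SmoothNear ρ (x₀, y₀) ∧ SmoothNear X (x₀, w₀) ∧
      ρ (x₀, y₀) = 0 ∧ X (x₀, w₀) = 0 ∧ (∀ x y t, ρ (x, y + t • e) = ρ (x, y) + t) ∧
      (∀ᶠ z : P × V in 𝓝 (x₀, w₀), ρ (z.1, E z) = X z ^ 2) ∧
      fderiv ℝ X (x₀, w₀) (0, α) ≠ 0 := by
  obtain ⟨e, he⟩ : ∃ e, l e = 1 := by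
    obtain ⟨v, hv⟩ : ∃ v, l v ≠ 0 := by
      by_contra! h; exact hl0 (ContinuousLinearMap.ext h)
    exact ⟨(l v)⁻¹ • v, by rw [map_smul, smul_eq_mul, inv_mul_cancel₀ hv]⟩
  rcases hne.lt_or_gt with h | h
  · obtain ⟨ρ, X, h1⟩ := exists_fold_normal_form_of_pos hE hy₀ hα hker (l := -l) (e := -e)
      (fun v => by rw [neg_apply, hl, neg_zero])
      (by simp [he]) (by rw [neg_apply]; linarith)
    exact ⟨ρ, X, -e, h1⟩
  · obtain ⟨ρ, X, h1⟩ := exists_fold_normal_form_of_pos hE hy₀ hα hker hl he h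
    exact ⟨ρ, X, e, h1⟩

end FoldNormalForm

/-! ### Gram determinants -/

section Gram

variable {V : Type} [NormedAddCommGroup V] [NormedSpace ℝ V]
  {ι κ : Type} [Fintype ι] [DecidableEq ι] [Fintype κ] [DecidableEq κ]

/-- The Gram determinant of a family of vectors with respect to a bilinear form. -/
def gram (g : V →L[ℝ] V →L[ℝ] ℝ) (u : ι → V) : ℝ := (Matrix.of fun i j => g (u i) (u j)).det

lemma gram_reindex (g : V →L[ℝ] V →L[ℝ] ℝ) (u : ι → V) (e : κ ≃ ι) :
    gram g (u ∘ e) = gram g u :=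
  Matrix.det_submatrix_equiv_self e (Matrix.of fun i j => g (u i) (u j))

lemma gram_eq_of_basis (g : V →L[ℝ] V →L[ℝ] ℝ) (e : Module.Basis ι ℝ V) (u : ι → V) :
    gram g u = (e.toMatrix u).det ^ 2 * gram g e := by
  have h : (Matrix.of fun i j => g (u i) (u j)) =
      (e.toMatrix u).transpose * (Matrix.of fun i j => g (e i) (e j)) * e.toMatrix u := by
    ext i j
    have hu : ∀ i, u i = ∑ k, e.toMatrix u k i • e k := fun i => (e.sum_toMatrix_smul_self u i).symm
    rw [Matrix.of_apply, hu i, hu j]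
    simp only [map_sum, map_smul, sum_apply, smul_apply, smul_eq_mul, Matrix.mul_apply,
      Matrix.transpose_apply, Matrix.of_apply, Finset.sum_mul, Finset.mul_sum]
    exact Finset.sum_congr rfl fun k _ => Finset.sum_congr rfl fun l _ => by ring
  rw [gram, h, Matrix.det_mul, Matrix.det_mul, Matrix.det_transpose]
  rw [gram]; ring

/-- How Gram determinants of full families change under a linear map. -/
lemma gram_comp_mul (g₁ g₂ : V →L[ℝ] V →L[ℝ] ℝ) (e : Module.Basis ι ℝ V) (T : V →L[ℝ] V)
    (u : ι → V) : gram g₂ (fun i => T (u i)) * gram g₁ e = gram g₁ u * gram g₂ e * T.det ^ 2 := by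
  have h : (e.toMatrix fun i => T (u i)).det = T.det * (e.toMatrix u).det := by
    have h1 : e.toMatrix (fun i => T (u i)) =
        LinearMap.toMatrix e e (T : V →ₗ[ℝ] V) * e.toMatrix u := by
      ext i j
      rw [Matrix.mul_apply, Module.Basis.toMatrix_apply]
      exact (congrFun (LinearMap.toMatrix_mulVec_repr e e (T : V →ₗ[ℝ] V) (u j)) i).symm
    rw [h1, Matrix.det_mul, LinearMap.det_toMatrix]
  rw [gram_eq_of_basis g₂ e, gram_eq_of_basis g₁ e u, h]
  ring

lemma gram_pos {g : V →L[ℝ] V →L[ℝ] ℝ} (hs : ∀ v w, g v w = g w v) (hp : ∀ v, v ≠ 0 → 0 < g v v)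
    {u : ι → V} (hu : LinearIndependent ℝ u) : 0 < gram g u := by
  refine Matrix.PosDef.det_pos (Matrix.PosDef.of_dotProduct_mulVec_pos ?_ fun x hx => ?_)
  · ext i j
    simp [hs (u j) (u i)]
  · have h1 : star x ⬝ᵥ (Matrix.of fun i j => g (u i) (u j)).mulVec x =
        g (∑ i, x i • u i) (∑ i, x i • u i) := by
      simp only [map_sum, map_smul, sum_apply, smul_apply, smul_eq_mul, dotProduct,
        Matrix.mulVec, Matrix.of_apply, Pi.star_apply, star_trivial, Finset.mul_sum]
      rw [Finset.sum_comm]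
      exact Finset.sum_congr rfl fun k _ => Finset.sum_congr rfl fun l _ => by rw [hs]; ring
    rw [h1]
    refine hp _ fun h => hx ?_
    funext i
    exact Fintype.linearIndependent_iff.1 hu x h i

/-- The Gram determinant of a family and a vector orthogonal to it. -/
lemma gram_sum_unit (g : V →L[ℝ] V →L[ℝ] ℝ) (u : ι → V) (a : V) (h : ∀ i, g a (u i) = 0) :
    gram g (Sum.elim u fun _ : Unit => a) = gram g u * g a a := by
  have : (Matrix.of fun i j => g (Sum.elim u (fun _ : Unit => a) i) (Sum.elim u (fun _ => a) j)) =
      Matrix.fromBlocks (Matrix.of fun i j => g (u i) (u j)) (Matrix.of fun i _ => g (u i) a) 0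
        (Matrix.of fun _ _ : Unit => g a a) := by
    ext i j
    rcases i with i | i <;> rcases j with j | j <;> simp [h]
  rw [gram, this, Matrix.det_fromBlocks_zero₂₁]
  simp [gram]

lemma det_add_smulRight [FiniteDimensional ℝ V] (φ : V →L[ℝ] ℝ) (c : V) :
    (ContinuousLinearMap.id ℝ V + φ.smulRight c).det = 1 + φ c := by
  have := LinearMap.transvection.det (φ : Module.Dual ℝ V) c
  rw [ContinuousLinearMap.det]
  convert this using 2
  · ext v
    simp [LinearMap.transvection]
  · rfl

/-- The Jacobian of a corank-one map `L` on the hyperplane `ker φ`, complementary to the kernel of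
`L`, in terms of the determinant of the isomorphism `L + φ N`, where `N` is the unit normal of the
range. Here `a` is the vector dual to `φ`, and `e` a reference basis. -/
theorem gram_mul_det_bordered [FiniteDimensional ℝ V] (g₁ g₂ : V →L[ℝ] V →L[ℝ] ℝ)
    (h₁ : ∀ v, v ≠ 0 → 0 < g₁ v v) (e : Module.Basis ι ℝ V) {m : ℕ}
    (hm : m + 1 = Fintype.card ι) (L : V →L[ℝ] V) (φ : V →L[ℝ] ℝ) {N a β : V}
    (hNL : ∀ v, g₂ N (L v) = 0) (hN : g₂ N N = 1) (ha : ∀ v, g₁ a v = φ v)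
    (hLβ : L β = 0) (hβ : φ β = 1) (b : Fin m → V) (hb : ∀ i, φ (b i) = 0) :
    gram g₂ (fun i => L (b i)) * φ a * gram g₁ e =
      gram g₁ b * gram g₂ e * (L + φ.smulRight N).det ^ 2 := by
  have ha0 : a ≠ 0 := by
    rintro rfl; have := ha β; rw [hβ, map_zero] at this; simp at this
  have hφa : 0 < φ a := by rw [← ha]; exact h₁ a ha0
  -- `R` fixes `ker φ` and maps `a` into the kernel of `L`
  let R : V →L[ℝ] V := ContinuousLinearMap.id ℝ V + φ.smulRight (β - (φ a)⁻¹ • a)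
  have hR : R.det = 1 := by
    rw [det_add_smulRight, map_sub, map_smul, hβ, smul_eq_mul, inv_mul_cancel₀ hφa.ne']; norm_num
  let T : V →L[ℝ] V := (L + φ.smulRight N).comp R
  have hT : T.det = (L + φ.smulRight N).det := by
    have : T.det = (L + φ.smulRight N).det * R.det := LinearMap.det_comp _ _
    rw [this, hR, mul_one]
  have hTb : ∀ i, T (b i) = L (b i) := fun i => by simp [T, R, hb]
  have hTa : T a = φ a • N := by
    have hRa : R a = φ a • β := by
      simp only [R, add_apply, ContinuousLinearMap.id_apply, ContinuousLinearMap.smulRight_apply,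
        smul_sub, smul_smul, mul_inv_cancel₀ hφa.ne', one_smul]
      abel
    change (L + φ.smulRight N) (R a) = _
    rw [hRa]; simp [hLβ, hβ]
  have hcard : Fintype.card (Fin m ⊕ Unit) = Fintype.card ι := by simp [hm]
  let s : (Fin m ⊕ Unit) ≃ ι := Fintype.equivOfCardEq hcard
  let e' : Module.Basis (Fin m ⊕ Unit) ℝ V := e.reindex s.symm
  have he' : ∀ g : V →L[ℝ] V →L[ℝ] ℝ, gram g e' = gram g e := fun g => by
    rw [← gram_reindex g e s]; congr 1; ext i; simp [e']
  have key := gram_comp_mul g₁ g₂ e' T (Sum.elim b fun _ : Unit => a)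
  have h3 : (fun i => T (Sum.elim b (fun _ : Unit => a) i)) =
      Sum.elim (fun i => L (b i)) fun _ : Unit => φ a • N := by
    ext i; rcases i with i | i
    · simp [hTb]
    · simp [hTa]
  rw [h3, gram_sum_unit, gram_sum_unit, he', he', hT, ha] at key
  · simp only [map_smul, smul_apply, hN, smul_eq_mul, mul_one] at key
    have : φ a * (gram g₂ (fun i => L (b i)) * φ a * gram g₁ e) =
        φ a * (gram g₁ b * gram g₂ e * (L + φ.smulRight N).det ^ 2) := by linarith
    exact mul_left_cancel₀ hφa.ne' this
  · intro i; rw [ha, hb]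
  · intro i; simp [hNL]

/-- The vector dual to a functional with respect to a positive definite form. -/
lemma exists_dual_vec [FiniteDimensional ℝ V] {g : V →L[ℝ] V →L[ℝ] ℝ}
    (hp : ∀ v, v ≠ 0 → 0 < g v v) (φ : V →L[ℝ] ℝ) : ∃ a, ∀ v, g a v = φ v := by
  let T : V →ₗ[ℝ] Module.Dual ℝ V :=
    (LinearMap.toContinuousLinearMap (𝕜 := ℝ) (E := V) (F' := ℝ)).symm.toLinearMap ∘ₗ
      (g : V →ₗ[ℝ] V →L[ℝ] ℝ)
  have hT : ∀ v w, T v w = g v w := fun _ _ => rfl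
  have hinj : Function.Injective T := by
    refine (injective_iff_map_eq_zero T).2 fun v hv => ?_
    by_contra h
    have := hp v h
    rw [← hT, hv] at this
    simp at this
  have hsurj : Function.Surjective T :=
    (LinearMap.injective_iff_surjective_of_finrank_eq_finrank
      (Subspace.dual_finrank_eq (K := ℝ) (V := V)).symm).1 hinj
  obtain ⟨a, ha⟩ := hsurj (φ : V →ₗ[ℝ] ℝ)
  exact ⟨a, fun v => by rw [← hT, ha]; rfl⟩

/-- The operator norm of a functional with respect to a positive definite form. -/
lemma sSup_abs_dual {g : V →L[ℝ] V →L[ℝ] ℝ} (hs : ∀ v w, g v w = g w v)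
    (hp : ∀ v, v ≠ 0 → 0 < g v v) {φ : V →L[ℝ] ℝ} {a : V} (ha : ∀ v, g a v = φ v) :
    sSup {r : ℝ | ∃ α, Real.sqrt (g α α) ≤ 1 ∧ r = |φ α|} = Real.sqrt (φ a) := by
  have hnn : ∀ v, 0 ≤ g v v := fun v => by
    by_cases h : v = 0
    · simp [h]
    · exact (hp v h).le
  have hφa : 0 ≤ φ a := by rw [← ha]; exact hnn a
  have hle : ∀ α, Real.sqrt (g α α) ≤ 1 → |φ α| ≤ Real.sqrt (φ a) := by
    intro α hα
    rw [Real.sqrt_le_iff, one_pow] at hα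
    replace hα := hα.2
    refine Real.abs_le_sqrt ?_
    by_cases h : a = 0
    · subst h
      rw [← ha]; simp
    · have h1 : 0 < φ a := by rw [← ha]; exact hp a h
      have h2 := hnn (φ a • α - φ α • a)
      have h3 : g (φ a • α - φ α • a) (φ a • α - φ α • a) =
          φ a * (φ a * g α α - φ α ^ 2) := by
        simp only [map_sub, map_smul, sub_apply, smul_apply, smul_eq_mul, ha, hs α a]
        ring
      rw [h3] at h2
      have h4 := (mul_nonneg_iff_of_pos_left h1).1 h2
      nlinarith
  refine le_antisymm (csSup_le ⟨0, 0, by simp, by simp⟩ ?_) ?_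
  · rintro r ⟨α, hα, rfl⟩; exact hle α hα
  · refine le_csSup ⟨Real.sqrt (φ a), ?_⟩ ?_
    · rintro r ⟨α, hα, rfl⟩; exact hle α hα
    · by_cases h : φ a = 0
      · exact ⟨0, by simp, by simp [h]⟩
      · have h1 : 0 < φ a := hφa.lt_of_ne' h
        have h2 : 0 < Real.sqrt (φ a) := Real.sqrt_pos.2 h1
        have h3 := Real.mul_self_sqrt hφa
        refine ⟨(Real.sqrt (φ a))⁻¹ • a, ?_, ?_⟩
        · simp only [map_smul, smul_apply, smul_eq_mul, ha]
          rw [Real.sqrt_le_iff, one_pow]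
          refine ⟨zero_le_one, ?_⟩
          have : (Real.sqrt (φ a))⁻¹ * ((Real.sqrt (φ a))⁻¹ * φ a) = 1 := by
            field_simp; nlinarith
          exact this.le
        · rw [map_smul, smul_eq_mul, abs_of_pos (by positivity)]
          field_simp; nlinarith

end Gram

/-! ### The Jacobian of a fold -/

section Jacobian

variable {P V : Type} [NormedAddCommGroup P] [NormedSpace ℝ P] [NormedAddCommGroup V]
  [NormedSpace ℝ V] [FiniteDimensional ℝ V]

/-- If `ζ(x, E(x, w)) = X(x, w)²`, then the Jacobian of `E(x, ·)` is divisible by `X`. The quotient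
is given by the determinant of `∂_w E + ∂_w X N`, where `N` is a vector field with
`∂_y ζ (N) = 1`. -/
theorem det_fold {E : P × V → V} {ζ X : P × V → ℝ} {N : P × V → V} {x₀ : P} {w₀ y₀ : V}
    (hE : SmoothNear E (x₀, w₀)) (hy₀ : E (x₀, w₀) = y₀) (hζ : SmoothNear ζ (x₀, y₀))
    (hX : SmoothNear X (x₀, w₀)) (hX0 : X (x₀, w₀) = 0) (hN : SmoothNear N (x₀, y₀))
    (hζX : ∀ᶠ z : P × V in 𝓝 (x₀, w₀), ζ (z.1, E z) = X z ^ 2)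
    (hνN : ∀ᶠ z : P × V in 𝓝 (x₀, y₀), fderiv ℝ (fun y => ζ (z.1, y)) z.2 (N z) = 1)
    (hker : ∀ v, fderiv ℝ (fun w => E (x₀, w)) w₀ v = 0 →
      fderiv ℝ (fun w => X (x₀, w)) w₀ v = 0 → v = 0) :
    ∃ Lt : P × V → V →L[ℝ] V, SmoothNear Lt (x₀, w₀) ∧
      (∀ z, Lt z = fderiv ℝ (fun w => E (z.1, w)) z.2 +
        (fderiv ℝ (fun w => X (z.1, w)) z.2).smulRight (N (z.1, E z))) ∧
      (∀ᶠ z in 𝓝 (x₀, w₀), (Lt z).det ≠ 0 ∧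
        (fderiv ℝ (fun w => E (z.1, w)) z.2).det * (1 + 2 * X z) = 2 * X z * (Lt z).det) ∧
      ∀ᶠ z : P × V in 𝓝 (x₀, w₀), ∀ v, fderiv ℝ (fun y => ζ (z.1, y)) (E z)
        (fderiv ℝ (fun w => E (z.1, w)) z.2 v) =
          2 * X z * fderiv ℝ (fun w => X (z.1, w)) z.2 v := by
  have hpE : SmoothNear (fun z : P × V => (z.1, E z)) (x₀, w₀) := SmoothNear.fst.prodMk hE
  have hpEt : Tendsto (fun z : P × V => (z.1, E z)) (𝓝 (x₀, w₀)) (𝓝 (x₀, y₀)) := by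
    have := hpE.continuousAt; rwa [ContinuousAt, hy₀] at this
  have hNE : SmoothNear (fun z : P × V => N (z.1, E z)) (x₀, w₀) :=
    SmoothNear.comp_of_eq hN hpE (by rw [hy₀])
  let Lt : P × V → V →L[ℝ] V := fun z => fderiv ℝ (fun w => E (z.1, w)) z.2 +
        (fderiv ℝ (fun w => X (z.1, w)) z.2).smulRight (N (z.1, E z))
  have hLt : SmoothNear Lt (x₀, w₀) := by
    refine hE.fderiv_snd.add ?_
    filter_upwards [hX.fderiv_snd, hNE] with z h1 h2
    exact h1.smulRight h2
  have hchain : ∀ᶠ z : P × V in 𝓝 (x₀, w₀), ∀ v, fderiv ℝ (fun y => ζ (z.1, y)) (E z)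
      (fderiv ℝ (fun w => E (z.1, w)) z.2 v) =
        2 * X z * fderiv ℝ (fun w => X (z.1, w)) z.2 v := by
    filter_upwards [hE.eventually, hX.eventually, hpEt.eventually hζ.eventually,
      hζX.eventually_nhds] with z h1 h2 h3 h4 v
    have e1 : HasFDerivAt (fun w => E (z.1, w)) (fderiv ℝ (fun w => E (z.1, w)) z.2) z.2 :=
      (h1.slice (x := z.1) (w := z.2)).hasFDerivAt
    have e2 : HasFDerivAt (fun w => X (z.1, w)) (fderiv ℝ (fun w => X (z.1, w)) z.2) z.2 :=
      (h2.slice (x := z.1) (w := z.2)).hasFDerivAt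
    have e3 : HasFDerivAt (fun y => ζ (z.1, y)) (fderiv ℝ (fun y => ζ (z.1, y)) (E z)) (E z) :=
      (h3.slice (x := z.1) (w := E z)).hasFDerivAt
    have e4 : HasFDerivAt (fun w => ζ (z.1, E (z.1, w))) _ z.2 :=
      HasFDerivAt.comp (g := fun y => ζ (z.1, y)) (f := fun w => E (z.1, w)) z.2 e3 e1
    have e5 := e2.mul e2
    have ht : Tendsto (fun w : V => (z.1, w)) (𝓝 z.2) (𝓝 z) :=
      (continuous_const.prodMk continuous_id).tendsto' _ _ rfl
    have e6 : (fun w => ζ (z.1, E (z.1, w))) =ᶠ[𝓝 z.2] fun w => X (z.1, w) * X (z.1, w) := by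
      filter_upwards [ht.eventually h4] with w hw
      rw [hw, sq]
    have e7 := congrArg (fun L => L v) (e4.unique (e5.congr_of_eventuallyEq e6))
    simp only [ContinuousLinearMap.comp_apply, add_apply, smul_apply, smul_eq_mul] at e7
    rw [e7]; ring
  have hdet0 : (Lt (x₀, w₀)).det ≠ 0 := by
    have hinj : LinearMap.ker (Lt (x₀, w₀) : V →ₗ[ℝ] V) = ⊥ := by
      refine LinearMap.ker_eq_bot'.2 fun v hv => ?_
      have h1 : fderiv ℝ (fun w => E (x₀, w)) w₀ v +
          fderiv ℝ (fun w => X (x₀, w)) w₀ v • N (x₀, y₀) = 0 := by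
        have h0 : Lt (x₀, w₀) v = 0 := hv
        simpa [Lt, hy₀] using h0
      have h2 := hchain.self_of_nhds v
      simp only [hX0, mul_zero, zero_mul, hy₀] at h2
      have h3 := congrArg (fderiv ℝ (fun y => ζ (x₀, y)) y₀) h1
      have h4 : fderiv ℝ (fun y => ζ (x₀, y)) y₀ (N (x₀, y₀)) = 1 := hνN.self_of_nhds
      rw [map_add, map_smul, h2, h4, map_zero, zero_add, smul_eq_mul, mul_one] at h3
      rw [h3, zero_smul, add_zero] at h1
      exact hker v h1 h3
    intro h
    have := LinearMap.bot_lt_ker_of_det_eq_zero (f := (Lt (x₀, w₀) : V →ₗ[ℝ] V)) h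
    rw [hinj] at this
    exact lt_irrefl _ this
  refine ⟨Lt, hLt, fun z => rfl, ?_, hchain⟩
  have hX1 : ∀ᶠ z in 𝓝 (x₀, w₀), 1 + 2 * X z ≠ 0 := by
    refine (continuousAt_const.add (continuousAt_const.mul hX.continuousAt)).eventually_ne ?_
    simp [hX0]
  filter_upwards [hLt.continuousLinearMap_det.continuousAt.eventually_ne hdet0, hchain,
    hpEt.eventually hνN, hX1] with z h1 h2 h3 h4
  refine ⟨h1, ?_⟩
  set L := fderiv ℝ (fun w => E (z.1, w)) z.2 with hL
  set φ := fderiv ℝ (fun w => X (z.1, w)) z.2 with hφ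
  set n := N (z.1, E z) with hn
  have hLtz : Lt z = L + φ.smulRight n := rfl
  obtain ⟨β, hβ⟩ : ∃ β, Lt z β = n := by
    have hu : IsUnit (LinearMap.det (Lt z : V →ₗ[ℝ] V)) := isUnit_iff_ne_zero.2 h1
    exact ((LinearMap.equivOfDetNeZero (Lt z : V →ₗ[ℝ] V) h1).surjective n)
  have hφβ : (1 + 2 * X z) * φ β = 1 := by
    have h5 := congrArg (fderiv ℝ (fun y => ζ (z.1, y)) (E z)) hβ
    rw [hLtz, add_apply, ContinuousLinearMap.smulRight_apply, map_add, map_smul, h2, h3,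
      smul_eq_mul] at h5
    linarith
  have hLdet : L = (Lt z).comp (ContinuousLinearMap.id ℝ V + φ.smulRight (-β)) := by
    ext v
    simp only [ContinuousLinearMap.comp_apply, add_apply, ContinuousLinearMap.id_apply,
      ContinuousLinearMap.smulRight_apply, smul_neg, map_add, map_neg, map_smul, hβ]
    simp [hLtz]
  have hdet : L.det = (Lt z).det * (1 + φ (-β)) := by
    rw [← det_add_smulRight]
    conv_lhs => rw [hLdet]
    exact LinearMap.det_comp _ _
  rw [hdet, map_neg]
  linear_combination (-(Lt z).det) * hφβ

end Jacobian

/-! ### Corank one singularities -/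

section Corank

variable {V : Type} [NormedAddCommGroup V] [NormedSpace ℝ V]

/-- At a corank one singularity `w₀` of `f` with kernel `ℝα`, the differential of the Jacobian
determinant is `h ↦ c l(f''(h, α))`, where `c ≠ 0` and `l` is a functional whose kernel is the
range of `df`. -/
theorem exists_fderiv_det_eq [FiniteDimensional ℝ V] {f : V → V} {w₀ α : V}
    (hf : SmoothNear f w₀) (hα : α ≠ 0)
    (hker : ∀ v, fderiv ℝ f w₀ v = 0 ↔ ∃ c : ℝ, v = c • α) :
    ∃ (l : V →L[ℝ] ℝ) (c : ℝ), c ≠ 0 ∧ l ≠ 0 ∧ (∀ v, l (fderiv ℝ f w₀ v) = 0) ∧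
      (∀ u, l u = 0 → ∃ v, fderiv ℝ f w₀ v = u) ∧
      ∀ h, fderiv ℝ (fun w => (fderiv ℝ f w).det) w₀ h = c * l (fderiv ℝ (fderiv ℝ f) w₀ h α) := by
  set L := fderiv ℝ f w₀ with hL
  have hkerα : LinearMap.ker (L : V →ₗ[ℝ] V) = ℝ ∙ α := by
    ext v
    rw [LinearMap.mem_ker, Submodule.mem_span_singleton]
    exact (hker v).trans ⟨fun ⟨c, h⟩ => ⟨c, h.symm⟩, fun ⟨c, h⟩ => ⟨c, h.symm⟩⟩
  have hrank : Module.finrank ℝ (LinearMap.range (L : V →ₗ[ℝ] V)) + 1 = Module.finrank ℝ V := by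
    rw [← LinearMap.finrank_range_add_finrank_ker (L : V →ₗ[ℝ] V), hkerα,
      finrank_span_singleton hα]
  have hlt : LinearMap.range (L : V →ₗ[ℝ] V) < ⊤ := by
    refine lt_top_iff_ne_top.2 fun h => ?_
    rw [h, finrank_top] at hrank
    omega
  obtain ⟨l', hl'0, hl'⟩ := Submodule.exists_le_ker_of_lt_top _ hlt
  let l : V →L[ℝ] ℝ := LinearMap.toContinuousLinearMap l'
  have hl0 : l ≠ 0 := fun h => hl'0 (by ext v; exact congrArg (fun m : V →L[ℝ] ℝ => m v) h)
  have hll : ∀ v, l (L v) = 0 := fun v => hl' ⟨v, rfl⟩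
  have hlr : ∀ u, l u = 0 → ∃ v, L v = u := by
    have h1 : Module.finrank ℝ (LinearMap.ker l') + 1 = Module.finrank ℝ V :=
      Module.Dual.finrank_ker_add_one_of_ne_zero hl'0
    have h2 : LinearMap.range (L : V →ₗ[ℝ] V) = LinearMap.ker l' :=
      Submodule.eq_of_le_of_finrank_eq hl' (by omega)
    intro u hu
    have : u ∈ LinearMap.range (L : V →ₗ[ℝ] V) := by rw [h2]; exact hu
    exact this
  obtain ⟨N, hN⟩ : ∃ N, l N = 1 := by
    obtain ⟨v, hv⟩ : ∃ v, l v ≠ 0 := by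
      by_contra! h; exact hl0 (ContinuousLinearMap.ext h)
    exact ⟨(l v)⁻¹ • v, by rw [map_smul, smul_eq_mul, inv_mul_cancel₀ hv]⟩
  obtain ⟨φ, hφ⟩ := SeparatingDual.exists_eq_one (R := ℝ) hα
  let Mt : V → V →L[ℝ] V := fun w => fderiv ℝ f w + φ.smulRight N
  have hMt : SmoothNear Mt w₀ := hf.fderiv.add (SmoothNear.const _)
  have hLα : L α = 0 := (hker α).2 ⟨1, (one_smul _ _).symm⟩
  have hM0 : Mt w₀ α = N := by
    change L α + φ α • N = N
    rw [hLα, hφ, zero_add, one_smul]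
  have hdet0 : (Mt w₀).det ≠ 0 := by
    intro h
    have h1 := LinearMap.bot_lt_ker_of_det_eq_zero (f := (Mt w₀ : V →ₗ[ℝ] V)) h
    refine absurd (LinearMap.ker_eq_bot'.2 fun v hv => ?_) h1.ne'
    have h2 : L v + φ v • N = 0 := hv
    have h3 : φ v = 0 := by
      have := congrArg l h2
      rwa [map_add, hll, map_smul, hN, zero_add, smul_eq_mul, mul_one, map_zero] at this
    rw [h3, zero_smul, add_zero] at h2
    obtain ⟨c, rfl⟩ := (hker v).1 h2
    rw [map_smul, hφ, smul_eq_mul, mul_one] at h3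
    rw [h3, zero_smul]
  have hinv : ∀ w, (Mt w).det ≠ 0 → (Mt w).IsInvertible := fun w hw =>
    ⟨(LinearMap.equivOfDetNeZero (Mt w : V →ₗ[ℝ] V) hw).toContinuousLinearEquiv, by ext v; rfl⟩
  let β : V → V := fun w => (Mt w).inverse N
  have hβ : SmoothNear β w₀ := (hMt.inverse (hinv _ hdet0)).clm_apply (SmoothNear.const N)
  have hdetne := hMt.continuousLinearMap_det.continuousAt.eventually_ne hdet0
  have hMβ : ∀ᶠ w in 𝓝 w₀, Mt w (β w) = N := by
    filter_upwards [hdetne] with w hw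
    exact (hinv w hw).self_apply_inverse N
  have hβ0 : β w₀ = α := by
    have h1 := (hinv _ hdet0).inverse_apply_self α
    rwa [hM0] at h1
  have hJ : ∀ᶠ w in 𝓝 w₀, (fderiv ℝ f w).det = (Mt w).det * (1 - φ (β w)) := by
    filter_upwards [hMβ] with w hw
    have h1 : fderiv ℝ f w = (Mt w).comp (ContinuousLinearMap.id ℝ V + φ.smulRight (-β w)) := by
      ext v
      simp only [ContinuousLinearMap.comp_apply, add_apply, ContinuousLinearMap.id_apply,
        ContinuousLinearMap.smulRight_apply, smul_neg, map_add, map_neg, map_smul, hw]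
      simp [Mt]
    have h2 : ((Mt w).comp (ContinuousLinearMap.id ℝ V + φ.smulRight (-β w))).det =
      (Mt w).det * (ContinuousLinearMap.id ℝ V + φ.smulRight (-β w)).det := LinearMap.det_comp _ _
    rw [h1, h2, det_add_smulRight, map_neg, sub_eq_add_neg]
  have hdβ : ∀ h, φ (fderiv ℝ β w₀ h) = - l (fderiv ℝ (fderiv ℝ f) w₀ h α) := by
    intro h
    have h1 := hMt.hasFDerivAt.clm_apply hβ.hasFDerivAt
    have h2 := (h1.congr_of_eventuallyEq (f₁ := fun _ => N)
      (hMβ.mono fun w hw => hw.symm)).unique (hasFDerivAt_const N w₀)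
    have h3 : fderiv ℝ Mt w₀ = fderiv ℝ (fderiv ℝ f) w₀ := fderiv_add_const _
    have h4 := congrArg (fun T : V →L[ℝ] V => l (T h)) h2
    simp only [add_apply, ContinuousLinearMap.comp_apply, ContinuousLinearMap.flip_apply,
      zero_apply, map_zero, h3, hβ0, map_add] at h4
    have h5 : l (Mt w₀ (fderiv ℝ β w₀ h)) = φ (fderiv ℝ β w₀ h) := by
      change l (L _ + φ _ • N) = _
      rw [map_add, hll, map_smul, hN, zero_add, smul_eq_mul, mul_one]
    rw [h5] at h4
    linarith
  refine ⟨l, (Mt w₀).det, hdet0, hl0, hll, hlr, fun h => ?_⟩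
  have h1 : HasFDerivAt (fun w => 1 - φ (β w)) (-(φ.comp (fderiv ℝ β w₀))) w₀ :=
    (φ.hasFDerivAt.comp w₀ hβ.hasFDerivAt).const_sub 1
  have h2 := (hMt.continuousLinearMap_det.hasFDerivAt.mul h1).congr_of_eventuallyEq hJ
  rw [h2.fderiv]
  simp only [add_apply, smul_apply, neg_apply, ContinuousLinearMap.comp_apply, hdβ, hβ0, hφ]
  simp

/-- A hypersurface `F = 0` contains all directions in the kernel of `dF ≠ 0` in its tangent cone. -/
theorem mem_tangentConeAt_of_fderiv_eq_zero {F : V → ℝ} {v₀ u α : V} {s : Set V}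
    (hF : SmoothNear F v₀) (hF0 : F v₀ = 0) (hu : fderiv ℝ F v₀ u ≠ 0) (hα : fderiv ℝ F v₀ α = 0)
    (hs : ∀ᶠ v in 𝓝 v₀, F v = 0 → v ∈ s) : α ∈ tangentConeAt ℝ s v₀ := by
  let c : ℝ × ℝ → V := fun p => v₀ + p.1 • α + p.2 • u
  have hc : SmoothNear c (0, 0) :=
    ((SmoothNear.const v₀).add (SmoothNear.fst.smul (SmoothNear.const α))).add
      (SmoothNear.snd.smul (SmoothNear.const u))
  have hc0 : c (0, 0) = v₀ := by simp [c]
  have hcd : HasFDerivAt c ((ContinuousLinearMap.fst ℝ ℝ ℝ).smulRight α +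
      (ContinuousLinearMap.snd ℝ ℝ ℝ).smulRight u) (0, 0) :=
    ((hasFDerivAt_fst.smul_const α).const_add v₀).add (hasFDerivAt_snd.smul_const u)
  let H : ℝ × ℝ → ℝ × ℝ := fun p => (p.1, F (c p))
  have hH : SmoothNear H (0, 0) := SmoothNear.fst.prodMk (hF.comp_of_eq hc hc0)
  have hHd : HasFDerivAt H ((ContinuousLinearMap.fst ℝ ℝ ℝ).prod ((fderiv ℝ F v₀).comp
      ((ContinuousLinearMap.fst ℝ ℝ ℝ).smulRight α +
      (ContinuousLinearMap.snd ℝ ℝ ℝ).smulRight u))) (0, 0) := by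
    refine hasFDerivAt_fst.prodMk (HasFDerivAt.comp (g := F) (f := c) _ ?_ hcd)
    rw [hc0]; exact hF.hasFDerivAt
  have hH0 : H (0, 0) = (0, 0) := by simp [H, hc0, hF0]
  obtain ⟨g, hg, hg0, -, hg2⟩ := hH.exists_local_inverse_of_injective rfl (by
    rintro ⟨a, b⟩ hab
    rw [hHd.fderiv] at hab
    simp only [ContinuousLinearMap.prod_apply, ContinuousLinearMap.comp_apply, add_apply,
      ContinuousLinearMap.smulRight_apply, ContinuousLinearMap.coe_fst',
      ContinuousLinearMap.coe_snd', map_add, map_smul, hα, smul_eq_mul, mul_zero, zero_add,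
      Prod.mk_eq_zero, mul_eq_zero, hu, or_false] at hab
    exact Prod.ext hab.1 hab.2)
  rw [hH0] at hg hg0 hg2
  let γ : ℝ → V := fun t => c (g (t, 0))
  have ht : Tendsto (fun t : ℝ => ((t, 0) : ℝ × ℝ)) (𝓝 0) (𝓝 (0, 0)) :=
    (continuous_id.prodMk continuous_const).tendsto' _ _ rfl
  have hgd : HasFDerivAt (fun t : ℝ => g (t, 0))
      ((fderiv ℝ g (0, 0)).comp (ContinuousLinearMap.inl ℝ ℝ ℝ)) 0 :=
    HasFDerivAt.comp (g := g) (f := fun t : ℝ => (t, (0 : ℝ))) 0 hg.hasFDerivAt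
      (hasFDerivAt_prodMk_left 0 0)
  set ab := (fderiv ℝ g (0, 0)) (1, 0) with hab
  have hHg : HasFDerivAt (fun t : ℝ => H (g (t, 0))) _ 0 :=
    HasFDerivAt.comp (g := H) (f := fun t : ℝ => g (t, 0)) 0 (by rw [hg0]; exact hHd) hgd
  have hHg2 : (fun t : ℝ => H (g (t, 0))) =ᶠ[𝓝 0] fun t : ℝ => (t, 0) := ht.eventually hg2
  have h1 := congrArg (fun L : ℝ →L[ℝ] ℝ × ℝ => L 1)
    ((hHg.congr_of_eventuallyEq hHg2.symm).unique (hasFDerivAt_prodMk_left 0 0))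
  simp only [ContinuousLinearMap.comp_apply, ContinuousLinearMap.inl_apply, ← hab,
    ContinuousLinearMap.prod_apply, add_apply, ContinuousLinearMap.smulRight_apply,
    ContinuousLinearMap.coe_fst', ContinuousLinearMap.coe_snd', map_add, map_smul, hα, smul_eq_mul,
    mul_zero, zero_add, Prod.mk.injEq, mul_eq_zero, hu, or_false] at h1
  have hγ : HasFDerivAt γ _ 0 :=
    HasFDerivAt.comp (g := c) (f := fun t : ℝ => g (t, 0)) 0 (by rw [hg0]; exact hcd) hgd
  have h1t : (1 : ℝ) ∈ tangentConeAt ℝ (γ ⁻¹' s) 0 := by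
    have : γ ⁻¹' s ∈ 𝓝 (0 : ℝ) := by
      have hγc : Tendsto γ (𝓝 0) (𝓝 v₀) := by
        have := hγ.continuousAt.tendsto
        rwa [show γ 0 = v₀ by simp only [γ, hg0, hc0]] at this
      filter_upwards [hHg2, hγc.eventually hs] with t h2 h3
      exact h3 (congrArg Prod.snd h2)
    rw [tangentConeAt_of_mem_nhds this]; trivial
  have hγ1 := (hγ.hasFDerivWithinAt (s := γ ⁻¹' s)).mapsTo_tangent_cone h1t
  have h2 := tangentConeAt_mono (𝕜 := ℝ) (x := γ 0) (image_preimage_subset γ s) hγ1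
  rw [show γ 0 = v₀ by simp only [γ, hg0, hc0]] at h2
  convert h2 using 1
  simp only [ContinuousLinearMap.comp_apply, ContinuousLinearMap.inl_apply, ← hab,
    add_apply, ContinuousLinearMap.smulRight_apply,
    ContinuousLinearMap.coe_fst', ContinuousLinearMap.coe_snd', h1.1, h1.2]
  simp

end Corank

/-! ### Coordinates adapted to a fold -/

/-- If `ζ` vanishes at `p₀`, then `(s, z'' p)` tends to `(0, z'' p₀)` as `p → p₀` and `s² = ζ p`. -/
lemma eventually_forall_sq_eq {T F : Type} [TopologicalSpace T] [NormedAddCommGroup F]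
    {ζ : T → ℝ} {z'' : T → F} {p₀ : T}
    (hζ : ContinuousAt ζ p₀) (hζ0 : ζ p₀ = 0) (hz : ContinuousAt z'' p₀) {q : ℝ × F → Prop}
    (hq : ∀ᶠ u in 𝓝 (0, z'' p₀), q u) : ∀ᶠ p in 𝓝 p₀, ∀ s : ℝ, s ^ 2 = ζ p → q (s, z'' p) := by
  rw [nhds_prod_eq] at hq
  obtain ⟨pa, ha, pb, hb, hab⟩ := eventually_prod_iff.1 hq
  obtain ⟨ε, hε, hball⟩ := Metric.eventually_nhds_iff.1 ha
  have h1 : ∀ᶠ p in 𝓝 p₀, ζ p < ε ^ 2 := hζ.eventually_lt_const (by rw [hζ0]; positivity)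
  filter_upwards [h1, hz.eventually hb] with p hp1 hp2 s hs
  refine hab (hball ?_) hp2
  rw [dist_zero_right, Real.norm_eq_abs]
  exact abs_lt_of_sq_lt_sq (by rw [hs]; exact hp1) hε.le

section Coordinates

variable {P V F : Type} [NormedAddCommGroup P] [NormedSpace ℝ P] [NormedAddCommGroup V]
  [NormedSpace ℝ V] [NormedAddCommGroup F] [NormedSpace ℝ F]

/-- `Υ` is the inverse of the coordinate system `(X, z''(x, E))` near `(x₀, w₀)`, in which the
fold map `(x, w) ↦ (x, E(x, w))` becomes `(s, u) ↦ (s², u)` if the coordinates `(ζ, z'')` are used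
near `(x₀, y₀)`. -/
structure IsFoldParam (E : P × V → V) (ζ X : P × V → ℝ) (z'' : P × V → F) (Υ : ℝ × F → P × V)
    (x₀ : P) (w₀ y₀ : V) : Prop where
  smooth : SmoothNear Υ (0, z'' (x₀, y₀))
  base : Υ (0, z'' (x₀, y₀)) = (x₀, w₀)
  left_inv : ∀ᶠ z in 𝓝 (x₀, w₀), Υ (X z, z'' (z.1, E z)) = z
  right_inv : ∀ᶠ u in 𝓝 (0, z'' (x₀, y₀)), X (Υ u) = u.1 ∧ z'' ((Υ u).1, E (Υ u)) = u.2
  preimage : ∀ᶠ p in 𝓝 (x₀, y₀), ∀ s : ℝ, s ^ 2 = ζ p →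
    (Υ (s, z'' p)).1 = p.1 ∧ E (Υ (s, z'' p)) = p.2 ∧ X (Υ (s, z'' p)) = s

variable [FiniteDimensional ℝ P] [FiniteDimensional ℝ V] [FiniteDimensional ℝ F]

/-- In coordinates that complete `ζ`, a fold is the map `(s, u) ↦ (s², u)`. The functions
`X` and `z''(x, E)` are coordinates on the source: a vector annihilated by both differentials is
mapped by `d(x, E)` to a vector annihilated by `dζ` and `dz''`, hence to zero, and no such vector
other than zero is annihilated by `dX`. -/
theorem exists_isFoldParam {E : P × V → V} {ζ X : P × V → ℝ} {x₀ : P} {w₀ y₀ : V}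
    (hE : SmoothNear E (x₀, w₀)) (hy₀ : E (x₀, w₀) = y₀) (hζ : SmoothNear ζ (x₀, y₀))
    (hX : SmoothNear X (x₀, w₀)) (hX0 : X (x₀, w₀) = 0)
    (hζX : ∀ᶠ z : P × V in 𝓝 (x₀, w₀), ζ (z.1, E z) = X z ^ 2)
    (hker : ∀ v, fderiv ℝ (fun w => E (x₀, w)) w₀ v = 0 →
      fderiv ℝ (fun w => X (x₀, w)) w₀ v = 0 → v = 0)
    (hF : Module.finrank ℝ F + 1 = Module.finrank ℝ P + Module.finrank ℝ V)
    {z'' : P × V → F} (hz : SmoothNear z'' (x₀, y₀))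
    (hinj : ∀ u, fderiv ℝ ζ (x₀, y₀) u = 0 → fderiv ℝ z'' (x₀, y₀) u = 0 → u = 0) :
    ∃ Υ, IsFoldParam E ζ X z'' Υ x₀ w₀ y₀ := by
  have hdim : Module.finrank ℝ (P × V) = Module.finrank ℝ (ℝ × F) := by
    rw [Module.finrank_prod, Module.finrank_prod, Module.finrank_self]; omega
  have hpE : SmoothNear (fun z : P × V => (z.1, E z)) (x₀, w₀) := SmoothNear.fst.prodMk hE
  have hpE0 : ((x₀, w₀).1, E (x₀, w₀)) = (x₀, y₀) := by rw [hy₀]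
  have hpEt : Tendsto (fun z : P × V => (z.1, E z)) (𝓝 (x₀, w₀)) (𝓝 (x₀, y₀)) := by
    have := hpE.continuousAt; rwa [ContinuousAt, hy₀] at this
  have hζ0 : ζ (x₀, y₀) = 0 := by
    have := hζX.self_of_nhds
    simpa [hy₀, hX0] using this
  have hzE : SmoothNear (fun z : P × V => z'' (z.1, E z)) (x₀, w₀) := hz.comp_of_eq hpE hpE0
  let Ψ : P × V → ℝ × F := fun z => (X z, z'' (z.1, E z))
  have hΨ : SmoothNear Ψ (x₀, w₀) := hX.prodMk hzE
  have hpEd : HasFDerivAt (fun z : P × V => (z.1, E z))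
      ((ContinuousLinearMap.fst ℝ P V).prod (fderiv ℝ E (x₀, w₀))) (x₀, w₀) :=
    hasFDerivAt_fst.prodMk hE.hasFDerivAt
  have hzEd : HasFDerivAt (fun z : P × V => z'' (z.1, E z)) _ (x₀, w₀) :=
    HasFDerivAt.comp (g := z'') (f := fun z : P × V => (z.1, E z)) (x₀, w₀)
      (by rw [hpE0]; exact hz.hasFDerivAt) hpEd
  have hζEd : HasFDerivAt (fun z : P × V => ζ (z.1, E z)) _ (x₀, w₀) :=
    HasFDerivAt.comp (g := ζ) (f := fun z : P × V => (z.1, E z)) (x₀, w₀)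
      (by rw [hpE0]; exact hζ.hasFDerivAt) hpEd
  have hdζ : ∀ v : P × V, fderiv ℝ ζ (x₀, y₀) (v.1, fderiv ℝ E (x₀, w₀) v) = 0 := by
    intro v
    have h1 := (hX.hasFDerivAt.pow 2).congr_of_eventuallyEq hζX
    have h2 := congrArg (fun L => L v) (hζEd.unique h1)
    simpa [hX0] using h2
  obtain ⟨Υ, hΥ, hΥ0, hl, hr⟩ := hΨ.exists_local_inverse_of_injective hdim (by
    intro v hv
    rw [(hX.hasFDerivAt.prodMk hzEd).fderiv] at hv
    obtain ⟨h1, h2⟩ := Prod.mk.inj hv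
    have h3 := hinj _ (hdζ v) h2
    obtain ⟨h4, h5⟩ := Prod.mk.inj h3
    have hv' : v = (0, v.2) := Prod.ext h4 rfl
    have h6 := hker v.2 (by
      rw [fderiv_comp_prodMk hE.differentiableAt, ContinuousLinearMap.comp_apply,
        ContinuousLinearMap.inr_apply, ← hv', h5]) (by
      rw [fderiv_comp_prodMk hX.differentiableAt, ContinuousLinearMap.comp_apply,
        ContinuousLinearMap.inr_apply, ← hv']; exact h1)
    rw [hv', h6]; rfl)
  have hΨ0 : Ψ (x₀, w₀) = (0, z'' (x₀, y₀)) := by simp only [Ψ, hX0, hy₀]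
  rw [hΨ0] at hΥ hΥ0 hr
  refine ⟨Υ, hΥ, hΥ0, hl, hr.mono fun u hu => ⟨congrArg Prod.fst hu, congrArg Prod.snd hu⟩, ?_⟩
  obtain ⟨Θ, -, -, hΘ, -⟩ := (hζ.prodMk hz).exists_local_inverse_of_injective hdim (by
    intro v hv
    rw [(hζ.hasFDerivAt.prodMk hz.hasFDerivAt).fderiv] at hv
    obtain ⟨h1, h2⟩ := Prod.mk.inj hv
    exact hinj v h1 h2)
  have hΥt : Tendsto Υ (𝓝 (0, z'' (x₀, y₀))) (𝓝 (x₀, w₀)) := by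
    have := hΥ.continuousAt; rwa [ContinuousAt, hΥ0] at this
  filter_upwards [hΘ, eventually_forall_sq_eq hζ.continuousAt hζ0 hz.continuousAt
    ((hr.and (hΥt.eventually hζX)).and (hΥt.eventually (hpEt.eventually hΘ)))] with p h1 h2 s hs
  obtain ⟨⟨h3, h4⟩, h5⟩ := h2 s hs
  have h6 : X (Υ (s, z'' p)) = s := congrArg Prod.fst h3
  have h7 : z'' ((Υ (s, z'' p)).1, E (Υ (s, z'' p))) = z'' p := congrArg Prod.snd h3
  rw [h6, hs] at h4
  rw [h4, h7, h1] at h5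
  exact ⟨(congrArg Prod.fst h5).symm, (congrArg Prod.snd h5).symm, h6⟩

/-- A function with nonzero differential can be completed to coordinates. -/
lemma exists_complement {V : Type} [NormedAddCommGroup V] [NormedSpace ℝ V]
    [FiniteDimensional ℝ V] {l : V →L[ℝ] ℝ} (hl : l ≠ 0) :
    ∃ π : V →L[ℝ] LinearMap.ker (l : V →ₗ[ℝ] ℝ), (∀ u, l u = 0 → π u = 0 → u = 0) ∧
      Module.finrank ℝ (LinearMap.ker (l : V →ₗ[ℝ] ℝ)) + 1 = Module.finrank ℝ V := by
  obtain ⟨π, hπ⟩ := LinearMap.exists_leftInverse_of_injective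
    (LinearMap.ker (l : V →ₗ[ℝ] ℝ)).subtype (Submodule.ker_subtype _)
  refine ⟨LinearMap.toContinuousLinearMap π, fun u hu h => ?_,
    Module.Dual.finrank_ker_add_one_of_ne_zero fun h =>
      hl (ContinuousLinearMap.ext fun v => congrArg (fun m : V →ₗ[ℝ] ℝ => m v) h)⟩
  have h1 := congrArg (fun m => m (⟨u, hu⟩ : LinearMap.ker (l : V →ₗ[ℝ] ℝ))) hπ
  have h2 : π u = ⟨u, hu⟩ := h1
  have h3 : π u = 0 := h
  rw [h3] at h2
  exact (congrArg Subtype.val h2).symm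

end Coordinates

/-! ### Integration over the fibres of a fold -/

section FoldIntegral

variable {P V F : Type} [NormedAddCommGroup P] [NormedSpace ℝ P] [NormedAddCommGroup V]
  [NormedSpace ℝ V] [NormedAddCommGroup F] [NormedSpace ℝ F] [FiniteDimensional ℝ V]
  [MeasurableSpace V] [BorelSpace V]

/-- In a ball on which `∂X/∂α ≠ 0` the zero set of `X` has measure zero. -/
lemma addHaar_zero_set_eq_zero (μ : Measure V) [μ.IsAddHaarMeasure] {X : V → ℝ} {w₀ α : V} {r : ℝ}
    (hX : ∀ w ∈ Metric.ball w₀ r, DifferentiableAt ℝ X w)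
    (hα : ∀ w ∈ Metric.ball w₀ r, fderiv ℝ X w α ≠ 0) :
    μ {w ∈ Metric.ball w₀ r | X w = 0} = 0 := by
  have hms : MeasurableSet {w ∈ Metric.ball w₀ r | X w = 0} := by
    have h1 : ContinuousOn X (Metric.ball w₀ r) := fun w hw =>
      (hX w hw).continuousAt.continuousWithinAt
    have h2 : {w ∈ Metric.ball w₀ r | X w = 0} =
        Metric.ball w₀ r \ (Metric.ball w₀ r ∩ X ⁻¹' {0}ᶜ) := by
      ext w
      refine ⟨fun h => ⟨h.1, fun h' => h'.2 h.2⟩, fun h => ⟨h.1, ?_⟩⟩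
      by_contra h'
      exact h.2 ⟨h.1, h'⟩
    rw [h2]
    exact Metric.isOpen_ball.measurableSet.diff
      (h1.isOpen_inter_preimage Metric.isOpen_ball isOpen_compl_singleton).measurableSet
  -- by Rolle's theorem, two distinct zeros do not differ by a multiple of `α`
  have key : ∀ w ∈ Metric.ball w₀ r, ∀ t : ℝ, w + t • α ∈ Metric.ball w₀ r → X w = 0 →
      X (w + t • α) = 0 → ¬ 0 < t := by
    intro w hw t hwt h0 h1 ht
    have hseg : ∀ s ∈ Icc 0 t, w + s • α ∈ Metric.ball w₀ r := fun s hs => by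
      have h2 := (convex_ball w₀ r) hw hwt (a := 1 - s / t) (b := s / t)
        (by rw [sub_nonneg, div_le_one ht]; exact hs.2) (div_nonneg hs.1 ht.le) (by ring)
      convert h2 using 1
      rw [smul_add, smul_smul, div_mul_cancel₀ _ ht.ne', ← add_assoc, ← add_smul]
      simp
    have hd : ∀ s ∈ Icc 0 t, HasDerivAt (fun s : ℝ => X (w + s • α))
        (fderiv ℝ X (w + s • α) α) s := fun s hs =>
      (hX _ (hseg s hs)).hasFDerivAt.comp_hasDerivAt s
        (by simpa using ((hasDerivAt_id s).smul_const α).const_add w)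
    obtain ⟨s, hs, hs0⟩ := exists_hasDerivAt_eq_zero ht
      (fun s hs => (hd s hs).continuousAt.continuousWithinAt)
      (by simp [h0, h1]) (fun s hs => hd s (Ioo_subset_Icc_self hs))
    exact hα _ (hseg s (Ioo_subset_Icc_self hs)) hs0
  refine Measure.addHaar_eq_zero_of_disjoint_translates μ (fun k : ℕ => (1 / ((k : ℝ) + 1)) • α)
    ?_ ?_ hms
  · refine (Metric.isBounded_closedBall (x := (0 : V)) (r := ‖α‖)).subset ?_
    rintro _ ⟨k, rfl⟩
    rw [mem_closedBall_zero_iff, norm_smul, Real.norm_of_nonneg (by positivity)]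
    refine mul_le_of_le_one_left (norm_nonneg _) ?_
    rw [div_le_one (by positivity)]
    linarith [Nat.cast_nonneg (α := ℝ) k]
  · intro i j hij
    have hne : (1 : ℝ) / ((i : ℝ) + 1) ≠ 1 / ((j : ℝ) + 1) := fun h => by
      rw [div_eq_div_iff (by positivity) (by positivity)] at h
      exact hij (by exact_mod_cast (by linarith : (i : ℝ) = j))
    refine Set.disjoint_left.2 ?_
    rintro _ ⟨_, rfl, w, ⟨hw, hw0⟩, rfl⟩ ⟨_, rfl, w', ⟨hw', hw0'⟩, h⟩
    simp only at h
    set a := (1 : ℝ) / ((i : ℝ) + 1)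
    set b := (1 : ℝ) / ((j : ℝ) + 1)
    have h1 : w' = w + (a - b) • α := by
      rw [sub_smul, add_sub, eq_sub_iff_add_eq, add_comm, h, add_comm]
    have h2 : w = w' + (b - a) • α := by
      rw [h1, add_assoc, ← add_smul]; simp
    rcases hne.lt_or_gt with h3 | h3
    · exact key w' hw' _ (h2 ▸ hw) hw0' (h2 ▸ hw0) (sub_pos.2 h3)
    · exact key w hw _ (h1 ▸ hw') hw0 (h1 ▸ hw0') (sub_pos.2 h3)

/-- The contribution of one sheet of a fold to the fibre integral. The sheet is given by the sign
`ε` of `X`; on it, `w` is recovered from `y = E w` as `Υ y`. -/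
lemma integral_fold_sheet (μ : Measure V) [μ.IsAddHaarMeasure] {B : Set V} (hB : IsOpen B)
    {E : V → V} {X k : V → ℝ} {ζ : V → ℝ} {Υ : V → V} {ε : ℝ}
    {W : V → ℂ} {f : V → ℂ}
    (hE : ∀ w ∈ B, DifferentiableAt ℝ E w) (hX : ContinuousOn X B)
    (hdet : ∀ w ∈ B, (fderiv ℝ E w).det = X w * k w) (hk : ∀ w ∈ B, k w ≠ 0)
    (hζ : ∀ w ∈ B, ζ (E w) = X w ^ 2)
    (hΥ : ∀ w ∈ B, 0 < ε * X w → Υ (E w) = w)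
    (hf : ∀ y, f y ≠ 0 → 0 < ζ y → Υ y ∈ B ∧ E (Υ y) = y ∧ 0 < ε * X (Υ y))
    (hint : IntegrableOn (fun w => W w * f (E w)) B μ) :
    Integrable (fun y => if 0 < ζ y then W (Υ y) / (|k (Υ y)| * Real.sqrt (ζ y) : ℝ) * f y
      else 0) μ ∧
    ∫ w in {w ∈ B | 0 < ε * X w}, W w * f (E w) ∂μ =
      ∫ y, (if 0 < ζ y then W (Υ y) / (|k (Υ y)| * Real.sqrt (ζ y) : ℝ) * f y else 0) ∂μ := by
  set A := {w ∈ B | 0 < ε * X w} with hA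
  set G : V → ℂ := fun y => if 0 < ζ y then
    W (Υ y) / (|k (Υ y)| * Real.sqrt (ζ y) : ℝ) * f y else 0 with hG
  have hAm : MeasurableSet A := by
    have h2 : A = B ∩ X ⁻¹' {t | 0 < ε * t} := rfl
    rw [h2]
    exact (hX.isOpen_inter_preimage hB
      (isOpen_lt continuous_const (continuous_const.mul continuous_id))).measurableSet
  have hd : ∀ w ∈ A, HasFDerivWithinAt E (fderiv ℝ E w) A w := fun w hw =>
    (hE w hw.1).hasFDerivAt.hasFDerivWithinAt
  have hinj : InjOn E A := fun w hw w' hw' h => by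
    rw [← hΥ w hw.1 hw.2, ← hΥ w' hw'.1 hw'.2, h]
  have habs : ∀ w ∈ A, 0 < |X w| := fun w hw => abs_pos.2 fun h => by
    have := hw.2; rw [h, mul_zero] at this; exact lt_irrefl _ this
  have hGE : ∀ w ∈ A, |(fderiv ℝ E w).det| • G (E w) = W w * f (E w) := by
    intro w hw
    have h1 := habs w hw
    have h2 : 0 < ζ (E w) := by rw [hζ w hw.1, ← sq_abs]; positivity
    have h3 : Real.sqrt (ζ (E w)) = |X w| := by rw [hζ w hw.1, Real.sqrt_sq_eq_abs]
    have h4 : 0 < |k w| := abs_pos.2 (hk w hw.1)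
    simp only [hG, if_pos h2, hΥ w hw.1 hw.2, h3, hdet w hw.1, abs_mul]
    rw [Complex.real_smul]
    have h5 : ((|k w| * |X w| : ℝ) : ℂ) ≠ 0 := by
      exact_mod_cast (mul_pos h4 h1).ne'
    rw [mul_comm |X w|]
    field_simp
  have hGsupp : ∀ y, y ∉ E '' A → G y = 0 := by
    intro y hy
    simp only [hG]
    split_ifs with h
    · by_cases hfy : f y = 0
      · rw [hfy, mul_zero]
      · obtain ⟨h1, h2, h3⟩ := hf y hfy h
        exact absurd ⟨_, ⟨h1, h3⟩, h2⟩ hy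
    · rfl
  have h1 : IntegrableOn (fun w => |(fderiv ℝ E w).det| • G (E w)) A μ :=
    (hint.mono_set fun w hw => hw.1).congr_fun (fun w hw => (hGE w hw).symm) hAm
  have h2 : IntegrableOn G (E '' A) μ :=
    (integrableOn_image_iff_integrableOn_abs_det_fderiv_smul μ hAm hd hinj G).2 h1
  refine ⟨(integrableOn_iff_integrable_of_support_subset fun y hy => ?_).1 h2, ?_⟩
  · by_contra h; exact hy (hGsupp y h)
  · rw [← setIntegral_eq_integral_of_forall_compl_eq_zero (s := E '' A) hGsupp,
      integral_image_eq_integral_abs_det_fderiv_smul μ hAm hd hinj G]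
    exact setIntegral_congr_fun hAm fun w hw => (hGE w hw).symm

open Classical in
/-- The two sheets of a fold together. `O` is a neighbourhood of the fold point to which the fibre
integral is localized; only its part near the fold point contributes. -/
theorem integral_fold (μ : Measure V) [μ.IsAddHaarMeasure] {E : P × V → V} {ζ X : P × V → ℝ}
    {z'' : P × V → F} {Υ : ℝ × F → P × V} {x₀ : P} {w₀ y₀ α : V}
    (hpar : IsFoldParam E ζ X z'' Υ x₀ w₀ y₀)
    (hE : SmoothNear E (x₀, w₀)) (hy₀ : E (x₀, w₀) = y₀) (hζ : SmoothNear ζ (x₀, y₀))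
    (hX : SmoothNear X (x₀, w₀)) (hX0 : X (x₀, w₀) = 0) (hz : SmoothNear z'' (x₀, y₀))
    (hζX : ∀ᶠ z : P × V in 𝓝 (x₀, w₀), ζ (z.1, E z) = X z ^ 2)
    (hXα : fderiv ℝ X (x₀, w₀) (0, α) ≠ 0)
    {k : P × V → ℝ} (hk : ContinuousAt k (x₀, w₀)) (hk0 : k (x₀, w₀) ≠ 0)
    (hdet : ∀ᶠ z : P × V in 𝓝 (x₀, w₀), (fderiv ℝ (fun w => E (z.1, w)) z.2).det = X z * k z)
    {W : P × V → ℂ} (hW : SmoothNear W (x₀, w₀))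
    {O : Set (P × V)} (hO : IsOpen O) (hO0 : (x₀, w₀) ∈ O)
    (hnear : ∀ N ∈ 𝓝 (x₀, w₀), ∀ᶠ p in 𝓝 (x₀, y₀), ∀ w, (p.1, w) ∈ O → E (p.1, w) = p.2 →
      (p.1, w) ∈ N) :
    ∃ U ∈ 𝓝 x₀, ∃ V' ∈ 𝓝 y₀, ∀ x ∈ U, ∀ f : V → ℂ, Measurable f → (∃ C, ∀ y, ‖f y‖ ≤ C) →
      (∀ y, f y ≠ 0 → y ∈ V') →
      IntegrableOn (fun w => W (x, w) * f (E (x, w))) {w | (x, w) ∈ O} μ ∧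
      Integrable (fun y => (if 0 < ζ (x, y) then
        (W (Υ (Real.sqrt (ζ (x, y)), z'' (x, y))) /
            (|k (Υ (Real.sqrt (ζ (x, y)), z'' (x, y)))| : ℝ) +
          W (Υ (-Real.sqrt (ζ (x, y)), z'' (x, y))) /
            (|k (Υ (-Real.sqrt (ζ (x, y)), z'' (x, y)))| : ℝ)) / (Real.sqrt (ζ (x, y)) : ℝ)
        else 0) * f y) μ ∧
      ∫ w in {w | (x, w) ∈ O}, W (x, w) * f (E (x, w)) ∂μ =
        ∫ y, (if 0 < ζ (x, y) then
        (W (Υ (Real.sqrt (ζ (x, y)), z'' (x, y))) /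
            (|k (Υ (Real.sqrt (ζ (x, y)), z'' (x, y)))| : ℝ) +
          W (Υ (-Real.sqrt (ζ (x, y)), z'' (x, y))) /
            (|k (Υ (-Real.sqrt (ζ (x, y)), z'' (x, y)))| : ℝ)) / (Real.sqrt (ζ (x, y)) : ℝ)
        else 0) * f y ∂μ := by
  have hζ0 : ζ (x₀, y₀) = 0 := by
    have := hζX.self_of_nhds
    simpa [hy₀, hX0] using this
  -- a small closed ball on which all local identities hold
  have hXα' : ∀ᶠ z : P × V in 𝓝 (x₀, w₀), fderiv ℝ (fun w => X (z.1, w)) z.2 α ≠ 0 := by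
    have h1 : ContinuousAt (fun z : P × V => fderiv ℝ (fun w => X (z.1, w)) z.2 α) (x₀, w₀) :=
      (hX.fderiv_snd.clm_apply (SmoothNear.const α)).continuousAt
    refine h1.eventually_ne ?_
    simp only
    rwa [fderiv_comp_prodMk hX.differentiableAt, ContinuousLinearMap.comp_apply]
  obtain ⟨r, hr, hball⟩ := Metric.nhds_basis_closedBall.eventually_iff.1
    (((((hE.eventually.and hX.eventually).and (hXα'.and hζX)).and
      ((hk.eventually_ne hk0).and hdet)).and ((hW.eventually.and hpar.left_inv).and
        (hO.mem_nhds hO0))))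
  have hcb : ∀ x ∈ Metric.closedBall x₀ r, ∀ w ∈ Metric.closedBall w₀ r,
      (x, w) ∈ Metric.closedBall (x₀, w₀) r := fun x hx w hw => by
    rw [← closedBall_prod_same]; exact ⟨hx, hw⟩
  -- all preimages in `O` of a point near `(x₀, y₀)` lie in the ball, as do both points of `Υ`
  have hΥt : Tendsto Υ (𝓝 (0, z'' (x₀, y₀))) (𝓝 (x₀, w₀)) := by
    have := hpar.smooth.continuousAt; rwa [ContinuousAt, hpar.base] at this
  have hnb : ∀ᶠ p in 𝓝 (x₀, y₀), (∀ w, (p.1, w) ∈ O → E (p.1, w) = p.2 →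
      (p.1, w) ∈ Metric.ball (x₀, w₀) r) ∧ ∀ s : ℝ, s ^ 2 = ζ p →
      ((Υ (s, z'' p)).1 = p.1 ∧ E (Υ (s, z'' p)) = p.2 ∧ X (Υ (s, z'' p)) = s) ∧
        Υ (s, z'' p) ∈ Metric.ball (x₀, w₀) r := by
    filter_upwards [hnear _ (Metric.ball_mem_nhds _ hr), hpar.preimage,
      eventually_forall_sq_eq hζ.continuousAt hζ0 hz.continuousAt
        (hΥt.eventually (Metric.ball_mem_nhds _ hr))] with p h1 h2 h3
    exact ⟨h1, fun s hs => ⟨h2 s hs, h3 s hs⟩⟩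
  rw [nhds_prod_eq] at hnb
  obtain ⟨U, hU, V', hV', hUV⟩ := mem_prod_iff.1 hnb
  refine ⟨U ∩ Metric.ball x₀ r, inter_mem hU (Metric.ball_mem_nhds _ hr), V', hV',
    fun x hx f hfm ⟨C, hC⟩ hfV => ?_⟩
  have hxr : x ∈ Metric.closedBall x₀ r := Metric.ball_subset_closedBall hx.2
  have hz2 : ∀ w ∈ Metric.closedBall w₀ r, _ := fun w hw => hball (hcb x hxr w hw)
  have hbc : ∀ w ∈ Metric.ball w₀ r, w ∈ Metric.closedBall w₀ r := fun w hw =>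
    Metric.ball_subset_closedBall hw
  set B := Metric.ball w₀ r with hBdef
  set H : V → ℂ := fun w => W (x, w) * f (E (x, w)) with hH
  have hEc : ContinuousOn (fun w => E (x, w)) (Metric.closedBall w₀ r) := fun w hw =>
    (hz2 w hw).1.1.1.1.slice.continuousAt.continuousWithinAt
  have hWc : ContinuousOn (fun w => W (x, w)) (Metric.closedBall w₀ r) := fun w hw =>
    (hz2 w hw).2.1.1.slice.continuousAt.continuousWithinAt
  have hHint : IntegrableOn H B μ := by
    have hcb : MeasurableSet (Metric.closedBall w₀ r) := Metric.isClosed_closedBall.measurableSet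
    have h1 : IntegrableOn H (Metric.closedBall w₀ r) μ := by
      obtain ⟨C', hC'⟩ := (isCompact_closedBall w₀ r).exists_bound_of_continuousOn hWc
      have hm : AEStronglyMeasurable H (μ.restrict (Metric.closedBall w₀ r)) :=
        (hWc.aestronglyMeasurable hcb).mul
          ((hfm.comp_aemeasurable (hEc.aemeasurable hcb)).aestronglyMeasurable)
      refine ⟨hm, HasFiniteIntegral.restrict_of_bounded (C := C' * C)
        (isCompact_closedBall w₀ r).measure_lt_top ?_⟩
      refine (ae_restrict_iff' hcb).2 (Eventually.of_forall fun w hw => ?_)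
      rw [hH, norm_mul]
      exact mul_le_mul (hC' w hw) (hC _) (norm_nonneg _) ((norm_nonneg _).trans (hC' w hw))
    exact h1.mono_set Metric.ball_subset_closedBall
  have hOm : MeasurableSet {w | (x, w) ∈ O} :=
    (hO.preimage (continuous_const.prodMk continuous_id)).measurableSet
  have hBO : B ⊆ {w | (x, w) ∈ O} := fun w hw => (hz2 w (hbc w hw)).2.2
  have hHO : ∀ w ∈ {w | (x, w) ∈ O} \ B, H w = 0 := by
    rintro w ⟨hw, hwB⟩
    simp only [hH]
    by_cases h : f (E (x, w)) = 0
    · rw [h, mul_zero]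
    · have h1 := (hUV (show (x, E (x, w)) ∈ U ×ˢ V' from ⟨hx.1, hfV _ h⟩)).1 w hw rfl
      rw [← ball_prod_same] at h1
      exact absurd h1.2 hwB
  have hHOint : IntegrableOn H {w | (x, w) ∈ O} μ :=
    hHint.of_forall_sdiff_eq_zero hOm hHO
  have hsheet : ∀ ε : ℝ, (ε = 1 ∨ ε = -1) → _ := fun ε hε =>
    integral_fold_sheet μ (B := B) Metric.isOpen_ball (E := fun w => E (x, w))
      (X := fun w => X (x, w)) (k := fun w => k (x, w)) (ζ := fun y => ζ (x, y))
      (Υ := fun y => (Υ (ε * Real.sqrt (ζ (x, y)), z'' (x, y))).2) (W := fun w => W (x, w))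
      (f := f) (ε := ε)
      (fun w hw => (hz2 w (hbc w hw)).1.1.1.1.slice.differentiableAt)
      (fun w hw => (hz2 w (hbc w hw)).1.1.1.2.slice.continuousAt.continuousWithinAt)
      (fun w hw => (hz2 w (hbc w hw)).1.2.2) (fun w hw => (hz2 w (hbc w hw)).1.2.1)
      (fun w hw => (hz2 w (hbc w hw)).1.1.2.2)
      (by
        intro w hw hpos
        have h1 : ζ (x, E (x, w)) = X (x, w) ^ 2 := (hz2 w (hbc w hw)).1.1.2.2
        have h2 : Υ (X (x, w), z'' (x, E (x, w))) = (x, w) := (hz2 w (hbc w hw)).2.1.2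
        have h3 : ε * Real.sqrt (ζ (x, E (x, w))) = X (x, w) := by
          rw [h1, Real.sqrt_sq_eq_abs]
          rcases hε with rfl | rfl
          · rw [one_mul] at hpos ⊢; exact abs_of_pos hpos
          · rw [abs_of_neg (by linarith)]; ring
        simp only [h3, h2])
      (by
        intro y hy hpos
        have h1 : (ε * Real.sqrt (ζ (x, y))) ^ 2 = ζ (x, y) := by
          rw [mul_pow, Real.sq_sqrt hpos.le]; rcases hε with rfl | rfl <;> norm_num
        obtain ⟨⟨h2, h3, h4⟩, h5⟩ :=
          (hUV (show (x, y) ∈ U ×ˢ V' from ⟨hx.1, hfV _ hy⟩)).2 _ h1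
        have h6 : (x, (Υ (ε * Real.sqrt (ζ (x, y)), z'' (x, y))).2) =
          Υ (ε * Real.sqrt (ζ (x, y)), z'' (x, y)) := Prod.ext h2.symm rfl
        rw [← ball_prod_same] at h5
        refine ⟨h5.2, by simp only [h6, h3], ?_⟩
        simp only [h6, h4]
        rw [← mul_assoc]
        have : ε * ε = 1 := by rcases hε with rfl | rfl <;> norm_num
        rw [this, one_mul]
        exact Real.sqrt_pos.2 hpos)
      hHint
  obtain ⟨hi1, he1⟩ := hsheet 1 (Or.inl rfl)
  obtain ⟨hi2, he2⟩ := hsheet (-1) (Or.inr rfl)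
  have hsum : (fun y => (if 0 < ζ (x, y) then
        (W (Υ (Real.sqrt (ζ (x, y)), z'' (x, y))) /
            (|k (Υ (Real.sqrt (ζ (x, y)), z'' (x, y)))| : ℝ) +
          W (Υ (-Real.sqrt (ζ (x, y)), z'' (x, y))) /
            (|k (Υ (-Real.sqrt (ζ (x, y)), z'' (x, y)))| : ℝ)) / (Real.sqrt (ζ (x, y)) : ℝ)
        else 0) * f y) = fun y =>
      (if 0 < ζ (x, y) then W (x, (Υ (1 * Real.sqrt (ζ (x, y)), z'' (x, y))).2) /
        (|k (x, (Υ (1 * Real.sqrt (ζ (x, y)), z'' (x, y))).2)| * Real.sqrt (ζ (x, y)) : ℝ) * f y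
        else 0) +
      (if 0 < ζ (x, y) then W (x, (Υ (-1 * Real.sqrt (ζ (x, y)), z'' (x, y))).2) /
        (|k (x, (Υ (-1 * Real.sqrt (ζ (x, y)), z'' (x, y))).2)| * Real.sqrt (ζ (x, y)) : ℝ) * f y
        else 0) := by
    ext y
    by_cases hpos : 0 < ζ (x, y)
    · simp only [if_pos hpos, one_mul, neg_mul]
      by_cases hfy : f y = 0
      · simp [hfy]
      · have h6 : ∀ s : ℝ, s ^ 2 = ζ (x, y) → (x, (Υ (s, z'' (x, y))).2) =
            Υ (s, z'' (x, y)) := fun s hs => Prod.ext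
          ((hUV (show (x, y) ∈ U ×ˢ V' from ⟨hx.1, hfV _ hfy⟩)).2 _ hs).1.1.symm rfl
        rw [h6 _ (Real.sq_sqrt hpos.le), h6 (-Real.sqrt (ζ (x, y)))
          (by rw [neg_sq, Real.sq_sqrt hpos.le])]
        push_cast
        rw [div_mul_eq_div_div, div_mul_eq_div_div]
        ring
    · simp only [if_neg hpos, zero_mul, add_zero]
  refine ⟨hHOint, ?_, ?_⟩
  · rw [hsum]; exact hi1.add hi2
  · rw [hsum, integral_add hi1 hi2, ← he1, ← he2,
      setIntegral_eq_of_subset_of_forall_sdiff_eq_zero hOm hBO hHO]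
    have hBm : MeasurableSet B := Metric.isOpen_ball.measurableSet
    have hXB : ContinuousOn (fun w => X (x, w)) B := fun w hw =>
      (hz2 w (hbc w hw)).1.1.1.2.slice.continuousAt.continuousWithinAt
    have hpm : ∀ ε : ℝ, MeasurableSet {w ∈ B | 0 < ε * X (x, w)} := fun ε =>
      (hXB.isOpen_inter_preimage Metric.isOpen_ball (t := {t | 0 < ε * t})
        (isOpen_lt continuous_const (continuous_const.mul continuous_id))).measurableSet
    have hdisj : Disjoint {w ∈ B | 0 < 1 * X (x, w)} {w ∈ B | 0 < -1 * X (x, w)} :=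
      Set.disjoint_left.2 fun w h1 h2 => by
        have h3 := h1.2; have h4 := h2.2; linarith
    rw [← setIntegral_union hdisj (hpm _) (hHint.mono_set fun w hw => hw.1)
      (hHint.mono_set fun w hw => hw.1)]
    refine (setIntegral_congr_set ?_).symm
    have hnull := addHaar_zero_set_eq_zero μ (X := fun w => X (x, w)) (w₀ := w₀) (α := α) (r := r)
      (fun w hw => (hz2 w (hbc w hw)).1.1.1.2.slice.differentiableAt)
      (fun w hw => (hz2 w (hbc w hw)).1.1.2.1)
    refine (ae_eq_set.2 ⟨?_, ?_⟩)
    · rw [Set.sdiff_eq_empty.2, measure_empty]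
      exact union_subset (fun w hw => hw.1) fun w hw => hw.1
    · refine measure_mono_null ?_ hnull
      rintro w ⟨hw, hw'⟩
      refine ⟨hw, ?_⟩
      by_contra h
      rcases lt_or_gt_of_ne h with h | h
      · exact hw' (Or.inr ⟨hw, by linarith⟩)
      · exact hw' (Or.inl ⟨hw, by linarith⟩)

end FoldIntegral

/-! ### The tangent bundle and the metric in a chart -/

section Charts

variable {n : ℕ} {M : Type*} [TopologicalSpace M] [ChartedSpace (Eu n) M] [IsManifold (𝓡 n) ∞ M]

/-- The coordinate vector fields of the preferred chart at `c`: the isomorphism of `ℝⁿ` with the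
tangent space at the point with coordinates `x`. -/
def chartVec (c : M) (x : Eu n) : Eu n →L[ℝ] Eu n :=
  mfderiv 𝓘(ℝ, Eu n) (𝓡 n) (extChartAt (𝓡 n) c).symm x

/-- The chart of the tangent bundle induced by the preferred chart at `c`, as a map from coordinates
`(x, w)` to tangent vectors. -/
def bundleChart (c : M) (z : Eu n × Eu n) : TangentBundle (𝓡 n) M :=
  ⟨(extChartAt (𝓡 n) c).symm z.1, chartVec c z.1 z.2⟩

/-- The inner product of `T_pM` as a bilinear form on the model space. -/
def innerAt (g : RiemMetric n M) (p : M) : Eu n →L[ℝ] Eu n →L[ℝ] ℝ := g.inner p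

/-- The metric in the preferred chart at `c`. -/
def metricChart (g : RiemMetric n M) (c : M) (x : Eu n) : Eu n →L[ℝ] Eu n →L[ℝ] ℝ :=
  (innerAt g ((extChartAt (𝓡 n) c).symm x)).bilinearComp (chartVec c x) (chartVec c x)

/-- The standard basis of the model space. -/
def stdBasis (n : ℕ) : Module.Basis (Fin n) ℝ (Eu n) := (EuclideanSpace.basisFun (Fin n) ℝ).toBasis

lemma stdBasis_apply (i : Fin n) : stdBasis n i = EuclideanSpace.single i (1 : ℝ) := by
  simp [stdBasis]

lemma coe_stdBasis : (stdBasis n : Fin n → Eu n) = fun i => EuclideanSpace.single i (1 : ℝ) :=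
  funext stdBasis_apply

lemma metricChart_apply (g : RiemMetric n M) (c : M) (x a b : Eu n) :
    metricChart g c x a b =
      innerAt g ((extChartAt (𝓡 n) c).symm x) (chartVec c x a) (chartVec c x b) := rfl

lemma coordDet_eq (g : RiemMetric n M) (c : M) (x : Eu n) :
    coordDet g c x = gram (metricChart g c x) (stdBasis n) := by
  rw [coe_stdBasis]; rfl

lemma fibreDet_eq (g : RiemMetric n M) (p : M) :
    fibreDet g p = gram (innerAt g p) (stdBasis n) := by
  rw [coe_stdBasis]; rfl

lemma innerAt_symm (g : RiemMetric n M) (p : M) (v w : Eu n) :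
    innerAt g p v w = innerAt g p w v := g.symm p v w

lemma innerAt_pos (g : RiemMetric n M) (p : M) (v : Eu n) (hv : v ≠ 0) : 0 < innerAt g p v v :=
  g.pos p v hv

lemma isInvertible_chartVec (c : M) {x : Eu n} (hx : x ∈ (extChartAt (𝓡 n) c).target) :
    (chartVec c x).IsInvertible := by
  have := isInvertible_mfderivWithin_extChartAt_symm (I := 𝓡 n) hx
  rwa [ModelWithCorners.range_eq_univ, mfderivWithin_univ] at this

lemma chartVec_injective (c : M) {x : Eu n} (hx : x ∈ (extChartAt (𝓡 n) c).target) :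
    Function.Injective (chartVec c x) := by
  obtain ⟨e, he⟩ := isInvertible_chartVec c hx
  rw [← he]; exact e.injective

lemma chartVec_self (c : M) : chartVec c (extChartAt (𝓡 n) c c) = ContinuousLinearMap.id ℝ _ := by
  have := mfderivWithin_range_extChartAt_symm (I := 𝓡 n) (x := c)
  rwa [ModelWithCorners.range_eq_univ, mfderivWithin_univ] at this

lemma metricChart_symm (g : RiemMetric n M) (c : M) (x a b : Eu n) :
    metricChart g c x a b = metricChart g c x b a := innerAt_symm _ _ _ _

lemma metricChart_pos (g : RiemMetric n M) (c : M) {x : Eu n}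
    (hx : x ∈ (extChartAt (𝓡 n) c).target) (v : Eu n) (hv : v ≠ 0) :
    0 < metricChart g c x v v :=
  innerAt_pos g _ _ fun h => hv (chartVec_injective c hx (h.trans (map_zero _).symm))

lemma bundleChart_eq (c : M) (v : Eu n) {z : Eu n × Eu n}
    (hz : z.1 ∈ (extChartAt (𝓡 n) c).target) :
    bundleChart c z = (extChartAt (𝓡 n).tangent (⟨c, v⟩ : TangentBundle (𝓡 n) M)).symm z := by
  have h1 : z.1 ∈ (chartAt (Eu n) c).target := by simpa [extChartAt_target] using hz
  have h := tangentMap_chart_symm (I := 𝓡 n) (p := (⟨c, v⟩ : TangentBundle (𝓡 n) M))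
    (q := (⟨z.1, z.2⟩ : TangentBundle (𝓡 n) (Eu n))) h1
  exact h

lemma mem_extChartAt_tangent_target (c : M) (v : Eu n) {z : Eu n × Eu n}
    (hz : z.1 ∈ (extChartAt (𝓡 n) c).target) :
    z ∈ (extChartAt (𝓡 n).tangent (⟨c, v⟩ : TangentBundle (𝓡 n) M)).target := by
  rw [FiberBundle.extChartAt_target]
  refine ⟨⟨hz, ?_⟩, trivial⟩
  rw [mem_preimage, TangentBundle.trivializationAt_baseSet]
  simpa using (extChartAt (𝓡 n) c).map_target hz

lemma contMDiffOn_bundleChart (c : M) :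
    ContMDiffOn 𝓘(ℝ, Eu n × Eu n) (𝓡 n).tangent ∞ (bundleChart c)
      ((extChartAt (𝓡 n) c).target ×ˢ univ) := by
  refine ContMDiffOn.congr (f := (extChartAt (𝓡 n).tangent
    (⟨c, 0⟩ : TangentBundle (𝓡 n) M)).symm) ?_ fun z hz => bundleChart_eq c 0 hz.1
  exact (contMDiffOn_extChartAt_symm (I := (𝓡 n).tangent) (n := ∞)
    (⟨c, 0⟩ : TangentBundle (𝓡 n) M)).mono fun z hz => mem_extChartAt_tangent_target c 0 hz.1

lemma bundleChart_base (c : M) (v : Eu n) :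
    bundleChart c (extChartAt (𝓡 n) c c, v) = ⟨c, v⟩ := by
  simp only [bundleChart, chartVec_self]
  rw [extChartAt_to_inv]; rfl

/-- `bundleChart c` maps neighbourhoods to neighbourhoods. -/
lemma image_bundleChart_mem_nhds (c : M) {z : Eu n × Eu n}
    (hz : z.1 ∈ (extChartAt (𝓡 n) c).target) {s : Set (Eu n × Eu n)} (hs : s ∈ 𝓝 z) :
    bundleChart c '' s ∈ 𝓝 (bundleChart c z) := by
  set q : TangentBundle (𝓡 n) M := ⟨c, 0⟩
  have hzt := mem_extChartAt_tangent_target c 0 hz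
  have hsrc : bundleChart c z ∈ (extChartAt (𝓡 n).tangent q).source := by
    rw [bundleChart_eq c 0 hz]; exact (extChartAt (𝓡 n).tangent q).map_target hzt
  have hq : extChartAt (𝓡 n).tangent q (bundleChart c z) = z := by
    rw [bundleChart_eq c 0 hz]; exact (extChartAt (𝓡 n).tangent q).right_inv hzt
  have h3 : Tendsto (extChartAt (𝓡 n).tangent q) (𝓝 (bundleChart c z)) (𝓝 z) := by
    have := continuousAt_extChartAt' (I := (𝓡 n).tangent) hsrc
    rwa [ContinuousAt, hq] at this
  have ht : ∀ᶠ z : Eu n × Eu n in 𝓝 z, z.1 ∈ (extChartAt (𝓡 n) c).target :=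
    continuousAt_fst.eventually ((isOpen_extChartAt_target c).mem_nhds hz)
  filter_upwards [h3.eventually hs, extChartAt_source_mem_nhds' (I := (𝓡 n).tangent) hsrc,
    h3.eventually ht] with x h4 h5 h6
  refine ⟨_, h4, ?_⟩
  rw [bundleChart_eq c 0 h6]
  exact (extChartAt (𝓡 n).tangent q).left_inv h5

lemma contMDiffAt_bundleChart (c : M) {z : Eu n × Eu n}
    (hz : z.1 ∈ (extChartAt (𝓡 n) c).target) :
    ContMDiffAt 𝓘(ℝ, Eu n × Eu n) (𝓡 n).tangent ∞ (bundleChart c) z :=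
  (contMDiffOn_bundleChart c).contMDiffAt
    (prod_mem_nhds ((isOpen_extChartAt_target c).mem_nhds hz) univ_mem)

lemma contDiffOn_metricChart (g : RiemMetric n M) (c : M) :
    ContDiffOn ℝ ∞ (metricChart g c) (extChartAt (𝓡 n) c).target := by
  refine contDiffOn_clm_apply.2 fun a => contDiffOn_clm_apply.2 fun b => ?_
  have hs : ∀ a : Eu n, ContMDiffOn 𝓘(ℝ, Eu n) (𝓡 n).tangent ∞ (fun x => bundleChart c (x, a))
      (extChartAt (𝓡 n) c).target := fun a =>
    (contMDiffOn_bundleChart c).comp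
      (contMDiff_id.prodMk_space contMDiff_const).contMDiffOn fun x hx => ⟨hx, trivial⟩
  have h : ContMDiffOn 𝓘(ℝ, Eu n) 𝓘(ℝ, ℝ) ∞ (fun x => metricChart g c x a b)
      (extChartAt (𝓡 n) c).target := fun x hx => by
    have h1 : ContMDiffWithinAt 𝓘(ℝ, Eu n) ((𝓡 n).prod 𝓘(ℝ, ℝ)) ∞
        (fun x => Bundle.TotalSpace.mk' ℝ (E := Bundle.Trivial M ℝ) ((extChartAt (𝓡 n) c).symm x)
          (metricChart g c x a b)) (extChartAt (𝓡 n) c).target x := by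
      apply ContMDiffWithinAt.clm_bundle_apply₂ (F₁ := Eu n) (F₂ := Eu n)
        (E₁ := fun x : M => TangentSpace (𝓡 n) x) (E₂ := fun x : M => TangentSpace (𝓡 n) x)
        (v := fun x => chartVec c x a) (w := fun x => chartVec c x b)
      · exact ContMDiffAt.comp_contMDiffWithinAt x g.contMDiff.contMDiffAt
          (contMDiffOn_extChartAt_symm c x hx)
      · exact hs a x hx
      · exact hs b x hx
    simp only [Bundle.contMDiffWithinAt_totalSpace] at h1
    exact h1.2
  exact contMDiffOn_iff_contDiffOn.1 h

end Charts

/-! ### The exponential map in charts -/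

section ExpCoord

variable {n : ℕ} {M : Type*} [TopologicalSpace M] [ChartedSpace (Eu n) M]

/-- The map `exp`, read in the chart of `TM` induced by the preferred chart at `p₀` and the
preferred chart at `q₀`. -/
def expCoord (exp : TangentBundle (𝓡 n) M → M) (p₀ q₀ : M) (z : Eu n × Eu n) : Eu n :=
  extChartAt (𝓡 n) q₀ (exp (bundleChart p₀ z))

/-- The partial differential `∂_w` of `expCoord`. -/
def dexpCoord (exp : TangentBundle (𝓡 n) M → M) (p₀ q₀ : M) (z : Eu n × Eu n) : Eu n →L[ℝ] Eu n :=
  fderiv ℝ (fun w => expCoord exp p₀ q₀ (z.1, w)) z.2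

/-- The coordinates `(x, w)` of tangent vectors at which `exp` is smooth and can be read in the
given charts. -/
def expDomain (D : Set (TangentBundle (𝓡 n) M)) (exp : TangentBundle (𝓡 n) M → M) (p₀ q₀ : M) :
    Set (Eu n × Eu n) :=
  {z | z.1 ∈ (extChartAt (𝓡 n) p₀).target ∧ bundleChart p₀ z ∈ D ∧ z.2 ≠ 0 ∧
    exp (bundleChart p₀ z) ∈ (extChartAt (𝓡 n) q₀).source}

variable {D : Set (TangentBundle (𝓡 n) M)} {exp : TangentBundle (𝓡 n) M → M} {p₀ q₀ : M}
  {z : Eu n × Eu n}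

lemma expCoord_mem_target (hz : z ∈ expDomain D exp p₀ q₀) :
    expCoord exp p₀ q₀ z ∈ (extChartAt (𝓡 n) q₀).target :=
  (extChartAt (𝓡 n) q₀).map_source hz.2.2.2

lemma symm_expCoord (hz : z ∈ expDomain D exp p₀ q₀) :
    (extChartAt (𝓡 n) q₀).symm (expCoord exp p₀ q₀ z) = exp (bundleChart p₀ z) :=
  (extChartAt (𝓡 n) q₀).left_inv hz.2.2.2

lemma mem_expDomain_self (hz : z ∈ expDomain D exp p₀ q₀) :
    z ∈ expDomain D exp p₀ (exp (bundleChart p₀ z)) :=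
  ⟨hz.1, hz.2.1, hz.2.2.1, mem_extChartAt_source _⟩

variable [IsManifold (𝓡 n) ∞ M]

lemma bundleChart_snd_ne_zero (hz : z.1 ∈ (extChartAt (𝓡 n) p₀).target) :
    (bundleChart p₀ z).2 ≠ 0 ↔ z.2 ≠ 0 := by
  have h1 : (bundleChart p₀ z).2 = chartVec p₀ z.1 z.2 := rfl
  rw [h1, not_iff_not]
  exact ⟨fun h => chartVec_injective p₀ hz (h.trans (map_zero _).symm),
    fun h => by rw [h]; exact map_zero _⟩

lemma contMDiffAt_exp (hexp : IsRegularExp D exp) (hz : z.1 ∈ (extChartAt (𝓡 n) p₀).target)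
    (hD : bundleChart p₀ z ∈ D) (hz0 : z.2 ≠ 0) :
    ContMDiffAt (𝓡 n).tangent (𝓡 n) ∞ exp (bundleChart p₀ z) := by
  refine hexp.smooth.contMDiffAt ?_
  have h1 : ∀ᶠ z' in 𝓝 z, z'.1 ∈ (extChartAt (𝓡 n) p₀).target ∧ z'.2 ≠ 0 :=
    (continuousAt_fst.eventually ((isOpen_extChartAt_target p₀).mem_nhds hz)).and
      (continuousAt_snd.eventually_ne hz0)
  filter_upwards [image_bundleChart_mem_nhds p₀ hz h1, hexp.isOpen_domain.mem_nhds hD]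
  rintro _ ⟨z', ⟨h2, h3⟩, rfl⟩ h4
  exact ⟨h4, (bundleChart_snd_ne_zero h2).2 h3⟩

lemma contMDiffAt_exp_bundleChart (hexp : IsRegularExp D exp) (hz : z ∈ expDomain D exp p₀ q₀) :
    ContMDiffAt 𝓘(ℝ, Eu n × Eu n) (𝓡 n) ∞ (fun z => exp (bundleChart p₀ z)) z :=
  (contMDiffAt_exp hexp hz.1 hz.2.1 hz.2.2.1).comp z (contMDiffAt_bundleChart p₀ hz.1)

lemma isOpen_expDomain (hexp : IsRegularExp D exp) : IsOpen (expDomain D exp p₀ q₀) := by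
  refine isOpen_iff_mem_nhds.2 fun z hz => ?_
  have h1 := (contMDiffAt_bundleChart p₀ hz.1).continuousAt
  filter_upwards [continuousAt_fst.eventually ((isOpen_extChartAt_target p₀).mem_nhds hz.1),
    continuousAt_snd.eventually_ne hz.2.2.1, h1.eventually (hexp.isOpen_domain.mem_nhds hz.2.1),
    (contMDiffAt_exp_bundleChart hexp hz).continuousAt.eventually
      (extChartAt_source_mem_nhds' (I := 𝓡 n) hz.2.2.2)] with z' a b c d
  exact ⟨a, c, b, d⟩

lemma smoothNear_expCoord (hexp : IsRegularExp D exp) (hz : z ∈ expDomain D exp p₀ q₀) :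
    SmoothNear (expCoord exp p₀ q₀) z := by
  filter_upwards [(isOpen_expDomain hexp).mem_nhds hz] with z hz
  have h1 : ContMDiffAt 𝓘(ℝ, Eu n × Eu n) 𝓘(ℝ, Eu n) ∞ (expCoord exp p₀ q₀) z :=
    (contMDiffAt_extChartAt' (by rw [← extChartAt_source (𝓡 n)]; exact hz.2.2.2)).comp z
      (contMDiffAt_exp_bundleChart hexp hz)
  exact contMDiffAt_iff_contDiffAt.1 h1

lemma hasFDerivAt_expCoord (hexp : IsRegularExp D exp) (hz : z ∈ expDomain D exp p₀ q₀) :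
    HasFDerivAt (fun w => expCoord exp p₀ q₀ (z.1, w)) (dexpCoord exp p₀ q₀ z) z.2 :=
  (SmoothNear.slice (x := z.1) (w := z.2) (smoothNear_expCoord hexp hz)).hasFDerivAt

lemma hasMFDerivAt_chart_symm (c : M) {x : Eu n} (hx : x ∈ (extChartAt (𝓡 n) c).target) :
    HasMFDerivAt 𝓘(ℝ, Eu n) (𝓡 n) (extChartAt (𝓡 n) c).symm x (chartVec c x) := by
  refine MDifferentiableAt.hasMFDerivAt ?_
  have := mdifferentiableWithinAt_extChartAt_symm (I := 𝓡 n) hx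
  rwa [ModelWithCorners.range_eq_univ, mdifferentiableWithinAt_univ] at this

/-- Near a vector with coordinates `z`, the map `exp_p` is the composition of `expCoord` with
charts. -/
lemma expAt_eventuallyEq (hexp : IsRegularExp D exp) (hz : z ∈ expDomain D exp p₀ q₀) :
    expAt exp ((extChartAt (𝓡 n) p₀).symm z.1) =ᶠ[𝓝 (chartVec p₀ z.1 z.2)] fun u =>
      (extChartAt (𝓡 n) q₀).symm (expCoord exp p₀ q₀ (z.1, (chartVec p₀ z.1).inverse u)) := by
  have hi := isInvertible_chartVec p₀ hz.1
  have h1 : Tendsto (fun u => (z.1, (chartVec p₀ z.1).inverse u)) (𝓝 (chartVec p₀ z.1 z.2))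
      (𝓝 z) := by
    refine Continuous.tendsto' (by fun_prop) _ _ (Prod.ext rfl ?_)
    exact hi.inverse_apply_self z.2
  filter_upwards [h1.eventually ((isOpen_expDomain hexp).mem_nhds hz)] with u hu
  rw [symm_expCoord hu]
  have : chartVec p₀ z.1 ((chartVec p₀ z.1).inverse u) = u := hi.self_apply_inverse u
  simp only [expAt, bundleChart, this]

lemma hasMFDerivAt_expAt (hexp : IsRegularExp D exp) (hz : z ∈ expDomain D exp p₀ q₀) :
    HasMFDerivAt 𝓘(ℝ, Eu n) (𝓡 n) (expAt exp ((extChartAt (𝓡 n) p₀).symm z.1)) (chartVec p₀ z.1 z.2)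
      ((chartVec q₀ (expCoord exp p₀ q₀ z)).comp
        ((dexpCoord exp p₀ q₀ z).comp (chartVec p₀ z.1).inverse)) := by
  have hi := isInvertible_chartVec p₀ hz.1
  have h0 : (chartVec p₀ z.1).inverse (chartVec p₀ z.1 z.2) = z.2 := hi.inverse_apply_self z.2
  have h1 : HasFDerivAt (fun u => expCoord exp p₀ q₀ (z.1, (chartVec p₀ z.1).inverse u))
      ((dexpCoord exp p₀ q₀ z).comp (chartVec p₀ z.1).inverse) (chartVec p₀ z.1 z.2) :=
    HasFDerivAt.comp (g := fun w => expCoord exp p₀ q₀ (z.1, w)) (f := (chartVec p₀ z.1).inverse)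
      (chartVec p₀ z.1 z.2) (by rw [h0]; exact hasFDerivAt_expCoord hexp hz)
      (ContinuousLinearMap.hasFDerivAt _)
  have h2 : expCoord exp p₀ q₀ (z.1, (chartVec p₀ z.1).inverse (chartVec p₀ z.1 z.2)) =
      expCoord exp p₀ q₀ z := by rw [h0]
  have h3 := hasMFDerivAt_chart_symm q₀ (expCoord_mem_target hz)
  rw [← h2] at h3
  have h4 := HasMFDerivAt.comp (chartVec p₀ z.1 z.2) h3 h1.hasMFDerivAt
  rw [h2] at h4
  exact h4.congr_of_eventuallyEq (expAt_eventuallyEq hexp hz)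

lemma dexp_eq (hexp : IsRegularExp D exp) (hz : z ∈ expDomain D exp p₀ q₀) :
    dexp exp ((extChartAt (𝓡 n) p₀).symm z.1) (chartVec p₀ z.1 z.2) =
      (chartVec q₀ (expCoord exp p₀ q₀ z)).comp
        ((dexpCoord exp p₀ q₀ z).comp (chartVec p₀ z.1).inverse) :=
  (hasMFDerivAt_expAt hexp hz).mfderiv

lemma velocity_eq (hexp : IsRegularExp D exp) (hz : z ∈ expDomain D exp p₀ q₀) :
    velocity exp ((extChartAt (𝓡 n) p₀).symm z.1) (chartVec p₀ z.1 z.2) 1 =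
      bundleChart q₀ (expCoord exp p₀ q₀ z, dexpCoord exp p₀ q₀ z z.2) := by
  set p := (extChartAt (𝓡 n) p₀).symm z.1 with hp
  set v : Eu n := chartVec p₀ z.1 z.2 with hv
  have hi := isInvertible_chartVec p₀ hz.1
  have h0 : (chartVec p₀ z.1).inverse v = z.2 := hi.inverse_apply_self z.2
  have h1 : HasMFDerivAt 𝓘(ℝ, Eu n) (𝓡 n) (expAt exp p) ((1 : ℝ) • v)
      ((chartVec q₀ (expCoord exp p₀ q₀ z)).comp
        ((dexpCoord exp p₀ q₀ z).comp (chartVec p₀ z.1).inverse)) := by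
    rw [one_smul]; exact hasMFDerivAt_expAt hexp hz
  have h2 : HasMFDerivAt 𝓘(ℝ, ℝ) 𝓘(ℝ, Eu n) (fun s : ℝ => s • v) 1
      ((1 : ℝ →L[ℝ] ℝ).smulRight v) :=
    ((hasFDerivAt_id (𝕜 := ℝ) (1 : ℝ)).smul_const v).hasMFDerivAt
  have h3 := (HasMFDerivAt.comp (1 : ℝ) h1 h2).mfderiv
  have h4 : mfderiv 𝓘(ℝ, ℝ) (𝓡 n) (fun s : ℝ => expAt exp p (s • v)) 1 (1 : ℝ) =
      chartVec q₀ (expCoord exp p₀ q₀ z) (dexpCoord exp p₀ q₀ z z.2) := by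
    have h5 := congrArg (fun L : ℝ →L[ℝ] Eu n => L 1) h3
    refine h5.trans ?_
    change chartVec q₀ _ (dexpCoord exp p₀ q₀ z ((chartVec p₀ z.1).inverse ((1 : ℝ) • v))) = _
    rw [one_smul, h0]
  have h6 : expAt exp p ((1 : ℝ) • v) = (extChartAt (𝓡 n) q₀).symm (expCoord exp p₀ q₀ z) := by
    rw [one_smul, symm_expCoord hz]; rfl
  simp only [velocity, bundleChart]
  rw [← h4]
  have aux : ∀ (q q' : M) (w : Eu n), q = q' →
      (⟨q, w⟩ : TangentBundle (𝓡 n) M) = ⟨q', w⟩ := by rintro q _ w rfl; rfl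
  exact aux _ _ _ h6

lemma bijective_dexp_iff (hexp : IsRegularExp D exp) (hz : z ∈ expDomain D exp p₀ q₀) :
    Function.Bijective (dexp exp ((extChartAt (𝓡 n) p₀).symm z.1) (chartVec p₀ z.1 z.2)) ↔
      (dexpCoord exp p₀ q₀ z).det ≠ 0 := by
  obtain ⟨e₁, he₁⟩ := isInvertible_chartVec p₀ hz.1
  obtain ⟨e₂, he₂⟩ := isInvertible_chartVec q₀ (expCoord_mem_target hz)
  rw [dexp_eq hexp hz, ← he₁, ← he₂, ContinuousLinearMap.inverse_equiv]
  have h1 : Function.Bijective (((e₂ : Eu n →L[ℝ] Eu n).comp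
      ((dexpCoord exp p₀ q₀ z).comp (e₁.symm : Eu n →L[ℝ] Eu n)))) ↔
      Function.Bijective (dexpCoord exp p₀ q₀ z) := by
    change Function.Bijective (e₂ ∘ (dexpCoord exp p₀ q₀ z) ∘ e₁.symm) ↔ _
    rw [Function.Bijective.of_comp_iff' e₂.bijective,
      Function.Bijective.of_comp_iff _ e₁.symm.bijective]
  refine h1.trans ⟨fun h => ?_, fun h =>
    (LinearMap.equivOfDetNeZero (dexpCoord exp p₀ q₀ z : Eu n →ₗ[ℝ] Eu n) h).bijective⟩
  have := LinearEquiv.isUnit_det' (LinearEquiv.ofBijective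
    (dexpCoord exp p₀ q₀ z : Eu n →ₗ[ℝ] Eu n) h)
  exact this.ne_zero

/-- In charts, the conjugate vectors are the zeros of the Jacobian determinant. -/
lemma mem_conjVectors_iff (hexp : IsRegularExp D exp) (hz : z ∈ expDomain D exp p₀ q₀) :
    (chartVec p₀ z.1 z.2) ∈ conjVectors D exp ((extChartAt (𝓡 n) p₀).symm z.1) ↔
      (dexpCoord exp p₀ q₀ z).det = 0 := by
  have h1 : bundleChart p₀ z ∈ D := hz.2.1
  have h2 : chartVec p₀ z.1 z.2 ≠ 0 := (bundleChart_snd_ne_zero hz.1).2 hz.2.2.1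
  refine ⟨fun h => ?_, fun h => ⟨h2, h1, ?_⟩⟩
  · by_contra h3; exact h.2.2 ((bijective_dexp_iff hexp hz).2 h3)
  · intro h3; exact (bijective_dexp_iff hexp hz).1 h3 h

end ExpCoord

/-! ### The fold in terms of the distance to the caustic -/

section FoldModel

variable {P V : Type} [NormedAddCommGroup P] [NormedSpace ℝ P] [NormedAddCommGroup V]
  [NormedSpace ℝ V]

/-- A fold `E(x, ·)` from `V` to `V` with parameter `x`, the target carrying the metric `G`, near
the fold point `w₀`. The function `ζ` is the signed distance to the caustic, `N` its gradient,
`Γ(s, x, y)` the point at distance `s` from the caustic on the geodesic through `y` normal to it;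
`X` is the square root of `ζ(x, E)`, and `Lt = ∂_w E + ∂_w X N`. -/
structure IsFoldModel (E : P × V → V) (G : V → V →L[ℝ] V →L[ℝ] ℝ) (x₀ : P) (w₀ y₀ α : V)
    (ζ X : P × V → ℝ) (N : P × V → V) (Γ : ℝ × P × V → V) (Lt : P × V → V →L[ℝ] V) : Prop where
  smooth_E : SmoothNear E (x₀, w₀)
  E_base : E (x₀, w₀) = y₀
  smooth_ζ : SmoothNear ζ (x₀, y₀)
  smooth_X : SmoothNear X (x₀, w₀)
  X_base : X (x₀, w₀) = 0
  smooth_Γ : SmoothNear Γ (0, x₀, y₀)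
  Γ_base : Γ (0, x₀, y₀) = y₀
  ζ_E : ∀ᶠ z : P × V in 𝓝 (x₀, w₀), ζ (z.1, E z) = X z ^ 2
  ker : ∀ v, fderiv ℝ (fun w => E (x₀, w)) w₀ v = 0 → fderiv ℝ (fun w => X (x₀, w)) w₀ v = 0 → v = 0
  dX : fderiv ℝ X (x₀, w₀) (0, α) ≠ 0
  gradient : ∀ᶠ p : P × V in 𝓝 (x₀, y₀), G p.2 (N p) = fderiv ℝ (fun y => ζ (p.1, y)) p.2 ∧
    G p.2 (N p) (N p) = 1
  char_zero : ∀ᶠ p : P × V in 𝓝 (x₀, y₀), ζ (p.1, Γ (0, p)) = 0 ∧ Γ (ζ p, p) = p.2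
  char_deriv : ∀ᶠ p : ℝ × P × V in 𝓝 (0, x₀, y₀),
    ∃ u, HasDerivAt (fun s => Γ (s, p.2)) u p.1 ∧ G (Γ p) u u = 1
  smooth_Lt : SmoothNear Lt (x₀, w₀)
  Lt_eq : ∀ z, Lt z = fderiv ℝ (fun w => E (z.1, w)) z.2 +
    (fderiv ℝ (fun w => X (z.1, w)) z.2).smulRight (N (z.1, E z))
  det_eq : ∀ᶠ z in 𝓝 (x₀, w₀), (Lt z).det ≠ 0 ∧
    (fderiv ℝ (fun w => E (z.1, w)) z.2).det * (1 + 2 * X z) = 2 * X z * (Lt z).det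
  normal : ∀ᶠ z : P × V in 𝓝 (x₀, w₀), ∀ v, fderiv ℝ (fun y => ζ (z.1, y)) (E z)
    (fderiv ℝ (fun w => E (z.1, w)) z.2 v) = 2 * X z * fderiv ℝ (fun w => X (z.1, w)) z.2 v

/-- A positive definite form is an isomorphism onto the dual space. -/
lemma isInvertible_of_pos [FiniteDimensional ℝ V] {g : V →L[ℝ] V →L[ℝ] ℝ}
    (hp : ∀ v, v ≠ 0 → 0 < g v v) : g.IsInvertible := by
  have hinj : Function.Injective g := (injective_iff_map_eq_zero g).2 fun v hv => by
    by_contra h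
    have := hp v h
    rw [hv] at this
    exact lt_irrefl _ this
  have hsurj : Function.Surjective g := fun φ => by
    obtain ⟨a, ha⟩ := exists_dual_vec hp φ
    exact ⟨a, ContinuousLinearMap.ext ha⟩
  exact ⟨(LinearEquiv.ofBijective (g : V →ₗ[ℝ] V →L[ℝ] ℝ) ⟨hinj, hsurj⟩).toContinuousLinearEquiv,
    by ext; rfl⟩

/-- The normal form `ρ(x, E) = X₁²` of a fold, and the solution `ζ = c ρ` of the eikonal equation
with the same zero set, give `ζ(x, E) = X²` with `X = √c X₁`. -/
theorem exists_isFoldModel [FiniteDimensional ℝ P] [FiniteDimensional ℝ V] {E : P × V → V}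
    {x₀ : P} {w₀ y₀ : V}
    (hE : SmoothNear E (x₀, w₀)) (hy₀ : E (x₀, w₀) = y₀) {G : V → V →L[ℝ] V →L[ℝ] ℝ}
    (hG : SmoothNear G y₀) (hGs : ∀ y a b, G y a b = G y b a)
    (hGp : ∀ᶠ y in 𝓝 y₀, ∀ v, v ≠ 0 → 0 < G y v v) {α : V} (hα : α ≠ 0)
    (hker : ∀ v, fderiv ℝ (fun w => E (x₀, w)) w₀ v = 0 ↔ ∃ c : ℝ, v = c • α)
    {l : V →L[ℝ] ℝ} (hl : ∀ v, l (fderiv ℝ (fun w => E (x₀, w)) w₀ v) = 0) (hl0 : l ≠ 0)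
    (hne : l (fderiv ℝ (fderiv ℝ (fun w => E (x₀, w))) w₀ α α) ≠ 0) :
    ∃ ζ X N Γ Lt, IsFoldModel E G x₀ w₀ y₀ α ζ X N Γ Lt := by
  obtain ⟨ρ, X₁, e, hρ, hX₁, hρ0, hX₁0, hρe, hρX, hdX₁⟩ :=
    exists_fold_normal_form hE hy₀ hα hker hl hl0 hne
  let A : V → (V →L[ℝ] ℝ) →L[ℝ] V := fun y => (G y).inverse
  have hA : SmoothNear A y₀ := hG.inverse (isInvertible_of_pos hGp.self_of_nhds)
  have hGA : ∀ y, (∀ v, v ≠ 0 → 0 < G y v v) → ∀ ξ, G y (A y ξ) = ξ := fun y hy ξ =>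
    (isInvertible_of_pos hy).self_apply_inverse ξ
  have hAs : ∀ᶠ y in 𝓝 y₀, ∀ ξ η : V →L[ℝ] ℝ, ξ (A y η) = η (A y ξ) := by
    filter_upwards [hGp] with y hy ξ η
    conv_lhs => rw [← hGA y hy ξ]
    conv_rhs => rw [← hGA y hy η]
    exact hGs _ _ _
  have hAp : ∀ ξ : V →L[ℝ] ℝ, ξ ≠ 0 → 0 < ξ (A y₀ ξ) := by
    intro ξ hξ
    have h1 := hGA y₀ hGp.self_of_nhds ξ
    have h2 : A y₀ ξ ≠ 0 := fun h => hξ (by rw [← h1, h, map_zero])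
    have := hGp.self_of_nhds _ h2
    rwa [h1] at this
  obtain ⟨ζ, Γ, c, hζ, hΓ, hΓ0, hc, hc0, hζc, heik, hchar, hchar'⟩ :=
    exists_eikonal hA hAs hAp hρ hρ0 hρe
  have hpE : SmoothNear (fun z : P × V => (z.1, E z)) (x₀, w₀) := SmoothNear.fst.prodMk hE
  have hpEt : Tendsto (fun z : P × V => (z.1, E z)) (𝓝 (x₀, w₀)) (𝓝 (x₀, y₀)) := by
    have := hpE.continuousAt; rwa [ContinuousAt, hy₀] at this
  have hcE : SmoothNear (fun z : P × V => c (z.1, E z)) (x₀, w₀) :=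
    hc.comp_of_eq hpE (by rw [hy₀])
  have hcE0 : 0 < c (x₀, E (x₀, w₀)) := by rw [hy₀]; exact hc0
  have hsc : SmoothNear (fun z : P × V => Real.sqrt (c (z.1, E z))) (x₀, w₀) := hcE.sqrt hcE0.ne'
  let X : P × V → ℝ := fun z => X₁ z * Real.sqrt (c (z.1, E z))
  have hX : SmoothNear X (x₀, w₀) := hX₁.mul hsc
  have hX0 : X (x₀, w₀) = 0 := by simp [X, hX₁0]
  have hdX : fderiv ℝ X (x₀, w₀) (0, α) ≠ 0 := by
    have h1 := (hX₁.hasFDerivAt.mul hsc.hasFDerivAt).fderiv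
    have h2 : fderiv ℝ X (x₀, w₀) (0, α) =
        Real.sqrt (c (x₀, E (x₀, w₀))) * fderiv ℝ X₁ (x₀, w₀) (0, α) := by
      have := congrArg (fun L => L ((0, α) : P × V)) h1
      refine this.trans ?_
      simp [hX₁0]
    rw [h2]
    exact mul_ne_zero (Real.sqrt_pos.2 hcE0).ne' hdX₁
  have hζX : ∀ᶠ z : P × V in 𝓝 (x₀, w₀), ζ (z.1, E z) = X z ^ 2 := by
    filter_upwards [hpEt.eventually hζc, hρX, hcE.continuousAt.eventually_const_lt hcE0]
      with z h1 h2 h3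
    rw [h1, h2, mul_pow, Real.sq_sqrt h3.le]
  have hkerX : ∀ v, fderiv ℝ (fun w => E (x₀, w)) w₀ v = 0 →
      fderiv ℝ (fun w => X (x₀, w)) w₀ v = 0 → v = 0 := by
    intro v h1 h2
    obtain ⟨t, rfl⟩ := (hker v).1 h1
    rw [fderiv_comp_prodMk hX.differentiableAt, ContinuousLinearMap.comp_apply, map_smul, map_smul,
      ContinuousLinearMap.inr_apply, smul_eq_mul] at h2
    rcases mul_eq_zero.1 h2 with h | h
    · rw [h, zero_smul]
    · exact absurd h hdX
  let N : P × V → V := fun p => A p.2 (fderiv ℝ (fun y => ζ (p.1, y)) p.2)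
  have hN : SmoothNear N (x₀, y₀) :=
    (SmoothNear.comp_of_eq (g := A) (f := Prod.snd) hA SmoothNear.snd rfl).clm_apply hζ.fderiv_snd
  have hsnd : Tendsto (Prod.snd : P × V → V) (𝓝 (x₀, y₀)) (𝓝 y₀) := continuous_snd.tendsto' _ _ rfl
  obtain ⟨Lt, hLt, hLte, hdet, hnorm⟩ := det_fold hE hy₀ hζ hX hX0 hN hζX heik hkerX
  refine ⟨ζ, X, N, Γ, Lt, hE, hy₀, hζ, hX, hX0, hΓ, hΓ0, hζX, hkerX, hdX, ?_, ?_, ?_, hLt, hLte,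
    hdet, hnorm⟩
  · filter_upwards [heik, hsnd.eventually hGp] with p h1 h2
    have h3 := hGA p.2 h2 (fderiv ℝ (fun y => ζ (p.1, y)) p.2)
    exact ⟨h3, (congrArg (fun L => L (N p)) h3).trans h1⟩
  · have ht : Tendsto (fun p : P × V => (p.1, Γ (0, p))) (𝓝 (x₀, y₀)) (𝓝 (x₀, y₀)) := by
      have h1 : ContinuousAt (fun p : P × V => (p.1, Γ (0, p))) (x₀, y₀) :=
        continuousAt_fst.prodMk (ContinuousAt.comp (g := Γ) (f := fun p : P × V => ((0 : ℝ), p))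
          hΓ.continuousAt (continuousAt_const.prodMk continuousAt_id))
      rwa [ContinuousAt, hΓ0] at h1
    filter_upwards [hchar, ht.eventually hζc] with p h1 h2
    exact ⟨by rw [h2, h1.1, zero_mul], h1.2⟩
  · have ht : Tendsto Γ (𝓝 (0, x₀, y₀)) (𝓝 y₀) := by
      have := hΓ.continuousAt; rwa [ContinuousAt, hΓ0] at this
    filter_upwards [hchar', ht.eventually hGp] with p ⟨ξ, h1, h2⟩ h3
    exact ⟨_, h1, by rw [hGA _ h3]; exact h2⟩

/-- The quotient of the Jacobian of a fold by `X`. -/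
def jacQuot (X : P × V → ℝ) (Lt : P × V → V →L[ℝ] V) (z : P × V) : ℝ :=
  2 * (Lt z).det / (1 + 2 * X z)

namespace IsFoldModel

variable {E : P × V → V} {G : V → V →L[ℝ] V →L[ℝ] ℝ} {x₀ : P} {w₀ y₀ α : V} {ζ X : P × V → ℝ}
  {N : P × V → V} {Γ : ℝ × P × V → V} {Lt : P × V → V →L[ℝ] V}
  (h : IsFoldModel E G x₀ w₀ y₀ α ζ X N Γ Lt)
include h

lemma ζ_base : ζ (x₀, y₀) = 0 := by
  have := h.ζ_E.self_of_nhds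
  simpa [h.E_base, h.X_base] using this

lemma smooth_prodE : SmoothNear (fun z : P × V => (z.1, E z)) (x₀, w₀) :=
  SmoothNear.fst.prodMk h.smooth_E

lemma tendsto_prodE : Tendsto (fun z : P × V => (z.1, E z)) (𝓝 (x₀, w₀)) (𝓝 (x₀, y₀)) := by
  have := h.smooth_prodE.continuousAt; rwa [ContinuousAt, h.E_base] at this

lemma eventually_X_ne : ∀ᶠ z in 𝓝 (x₀, w₀), 1 + 2 * X z ≠ 0 := by
  refine (continuousAt_const.add
    (continuousAt_const.mul h.smooth_X.continuousAt)).eventually_ne ?_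
  simp [h.X_base]

lemma smooth_jacQuot [FiniteDimensional ℝ V] : SmoothNear (jacQuot X Lt) (x₀, w₀) :=
  ((SmoothNear.const 2).mul h.smooth_Lt.continuousLinearMap_det).div
    ((SmoothNear.const 1).add ((SmoothNear.const 2).mul h.smooth_X)) h.eventually_X_ne.self_of_nhds

lemma jacQuot_ne : jacQuot X Lt (x₀, w₀) ≠ 0 :=
  div_ne_zero (mul_ne_zero two_ne_zero h.det_eq.self_of_nhds.1) h.eventually_X_ne.self_of_nhds

lemma det_eq_mul_jacQuot : ∀ᶠ z in 𝓝 (x₀, w₀),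
    (fderiv ℝ (fun w => E (z.1, w)) z.2).det = X z * jacQuot X Lt z := by
  filter_upwards [h.det_eq, h.eventually_X_ne] with z h1 h2
  rw [jacQuot, mul_div_assoc', eq_div_iff h2, h1.2]
  ring

lemma dζ_ne : fderiv ℝ (fun y => ζ (x₀, y)) y₀ ≠ 0 := fun h0 => by
  have h1 := h.gradient.self_of_nhds
  have h2 : fderiv ℝ (fun y => ζ (x₀, y)) y₀ (N (x₀, y₀)) = 1 := by
    rw [← h1.1]; exact h1.2
  rw [h0] at h2
  simp at h2

lemma fderiv_ζ_ne : fderiv ℝ ζ (x₀, y₀) ≠ 0 := fun h0 => h.dζ_ne (by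
  rw [fderiv_comp_prodMk h.smooth_ζ.differentiableAt, h0, ContinuousLinearMap.zero_comp])

/-- The Jacobian of the fold on the hypersurface of singularities, where `X = 0`. -/
lemma gram_singular {ι : Type} [Fintype ι] [DecidableEq ι] [FiniteDimensional ℝ V]
    (e : Module.Basis ι ℝ V) {m : ℕ} (hm : m + 1 = Fintype.card ι) :
    ∀ᶠ z : P × V in 𝓝 (x₀, w₀), X z = 0 → fderiv ℝ (fun w => X (z.1, w)) z.2 ≠ 0 ∧
      ∀ (g₁ : V →L[ℝ] V →L[ℝ] ℝ), (∀ v, v ≠ 0 → 0 < g₁ v v) → ∀ a : V,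
      (∀ v, g₁ a v = fderiv ℝ (fun w => X (z.1, w)) z.2 v) → ∀ b : Fin m → V,
      (∀ i, fderiv ℝ (fun w => X (z.1, w)) z.2 (b i) = 0) →
      gram (G (E z)) (fun i => fderiv ℝ (fun w => E (z.1, w)) z.2 (b i)) *
        fderiv ℝ (fun w => X (z.1, w)) z.2 a * gram g₁ e =
      gram g₁ b * gram (G (E z)) e * (Lt z).det ^ 2 := by
  filter_upwards [h.normal, h.det_eq, h.tendsto_prodE.eventually h.gradient] with z h1 h2 h3 hX
  simp only [hX, mul_zero, zero_mul] at h1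
  obtain ⟨β, hβ⟩ := (LinearMap.equivOfDetNeZero (Lt z : V →ₗ[ℝ] V) h2.1).surjective (N (z.1, E z))
  have hβ' : Lt z β = N (z.1, E z) := hβ
  rw [h.Lt_eq, add_apply, ContinuousLinearMap.smulRight_apply] at hβ'
  have hφβ : fderiv ℝ (fun w => X (z.1, w)) z.2 β = 1 := by
    have h4 := congrArg (G (E z) (N (z.1, E z))) hβ'
    rw [map_add, map_smul, h3.2, h3.1, h1, zero_add, smul_eq_mul, mul_one] at h4
    exact h4
  have hLβ : fderiv ℝ (fun w => E (z.1, w)) z.2 β = 0 := by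
    rw [hφβ, one_smul] at hβ'
    exact add_eq_right.1 hβ'
  refine ⟨fun h0 => by rw [h0] at hφβ; simp at hφβ, fun g₁ hg₁ a ha b hb => ?_⟩
  rw [h.Lt_eq]
  exact gram_mul_det_bordered g₁ (G (E z)) hg₁ e hm _ _
    (fun v => by rw [h3.1, h1]) h3.2 ha hLβ hφβ b hb

/-- The fold in coordinates that complete the distance to the caustic. -/
lemma exists_isFoldParam [FiniteDimensional ℝ P] [FiniteDimensional ℝ V] {F : Type}
    [NormedAddCommGroup F] [NormedSpace ℝ F] [FiniteDimensional ℝ F]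
    (hF : Module.finrank ℝ F + 1 = Module.finrank ℝ P + Module.finrank ℝ V)
    {z'' : P × V → F} (hz : SmoothNear z'' (x₀, y₀))
    (hinj : ∀ u, fderiv ℝ ζ (x₀, y₀) u = 0 → fderiv ℝ z'' (x₀, y₀) u = 0 → u = 0) :
    ∃ Υ, IsFoldParam E ζ X z'' Υ x₀ w₀ y₀ :=
  FoldCaustic.exists_isFoldParam h.smooth_E h.E_base h.smooth_ζ h.smooth_X h.X_base h.ζ_E h.ker hF
    hz hinj

end IsFoldModel

end FoldModel

/-! ### The invariants `A` and `D` of a fold -/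

section Invariants

/-- Two differentiable functions with the same absolute value have differentials with the same
absolute value at a common zero. -/
lemma abs_fderiv_eq_of_abs_eq {V : Type} [NormedAddCommGroup V] [NormedSpace ℝ V] {f h : V → ℝ}
    {v : V} (hf : DifferentiableAt ℝ f v) (hh : DifferentiableAt ℝ h v) (h0 : f v = 0)
    (hfh : ∀ᶠ u in 𝓝 v, |f u| = |h u|) (α : V) : |fderiv ℝ f v α| = |fderiv ℝ h v α| := by
  have hh0 : h v = 0 := by
    have := hfh.self_of_nhds
    rw [h0, abs_zero] at this
    exact abs_eq_zero.1 this.symm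
  have key : ∀ {k : V → ℝ}, DifferentiableAt ℝ k v → k v = 0 →
      Tendsto (fun t : ℝ => |t|⁻¹ * |k (v + t • α)|) (𝓝[≠] 0) (𝓝 |fderiv ℝ k v α|) := by
    intro k hk hk0
    have h1 : HasDerivAt (fun t : ℝ => k (v + t • α)) (fderiv ℝ k v α) 0 :=
      HasFDerivAt.comp_hasDerivAt (l := k) (f := fun t : ℝ => v + t • α) 0
        (by simpa using hk.hasFDerivAt)
        (by simpa using ((hasDerivAt_id (0 : ℝ)).smul_const α).const_add v)
    have h2 := h1.tendsto_slope_zero.abs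
    refine h2.congr fun t => ?_
    simp [hk0, abs_mul]
  refine tendsto_nhds_unique (key hf h0) ((key hh hh0).congr' ?_)
  have ht : Tendsto (fun t : ℝ => v + t • α) (𝓝[≠] 0) (𝓝 v) :=
    (Continuous.tendsto' (by fun_prop) _ _ (by simp)).mono_left nhdsWithin_le_nhds
  filter_upwards [ht.eventually hfh] with t h1
  rw [h1]

lemma gram_comp {V ι : Type} [NormedAddCommGroup V] [NormedSpace ℝ V] [Fintype ι] [DecidableEq ι]
    (g : V →L[ℝ] V →L[ℝ] ℝ) (e : Module.Basis ι ℝ V) (T : V →L[ℝ] V) :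
    gram g (fun i => T (e i)) = T.det ^ 2 * gram g e := by
  have h1 : e.toMatrix (fun i => T (e i)) = LinearMap.toMatrix e e (T : V →ₗ[ℝ] V) := by
    ext i j; rw [Module.Basis.toMatrix_apply, LinearMap.toMatrix_apply]; rfl
  rw [gram_eq_of_basis g e, h1, LinearMap.det_toMatrix]

variable {n : ℕ} {M : Type*} [TopologicalSpace M] [ChartedSpace (Eu n) M] [IsManifold (𝓡 n) ∞ M]

/-- The Jacobian determinant of `exp_p` with respect to the Riemannian volumes, in charts. -/
def jacCoord (g : RiemMetric n M) (exp : TangentBundle (𝓡 n) M → M) (p₀ q₀ : M)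
    (z : Eu n × Eu n) : ℝ :=
  Real.sqrt (coordDet g q₀ (expCoord exp p₀ q₀ z) / coordDet g p₀ z.1) *
    (dexpCoord exp p₀ q₀ z).det

variable {g : RiemMetric n M} {D : Set (TangentBundle (𝓡 n) M)} {exp : TangentBundle (𝓡 n) M → M}
  {p₀ q₀ q₁ : M} {z : Eu n × Eu n}

lemma coordDet_pos (g : RiemMetric n M) (c : M) {x : Eu n}
    (hx : x ∈ (extChartAt (𝓡 n) c).target) : 0 < coordDet g c x := by
  rw [coordDet_eq]
  exact gram_pos (metricChart_symm g c x) (metricChart_pos g c hx) (stdBasis n).linearIndependent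

lemma fibreDet_pos (g : RiemMetric n M) (p : M) : 0 < fibreDet g p := by
  rw [fibreDet_eq]
  exact gram_pos (innerAt_symm g p) (innerAt_pos g p) (stdBasis n).linearIndependent

lemma gram_chartVec (g : RiemMetric n M) (c : M) (x : Eu n) {ι : Type} [Fintype ι] [DecidableEq ι]
    (b : ι → Eu n) : gram (innerAt g ((extChartAt (𝓡 n) c).symm x)) (fun i => chartVec c x (b i)) =
      gram (metricChart g c x) b := rfl

lemma coordDet_eq_fibreDet (g : RiemMetric n M) (c : M) (x : Eu n) :
    coordDet g c x = (chartVec c x).det ^ 2 * fibreDet g ((extChartAt (𝓡 n) c).symm x) := by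
  rw [coordDet_eq, ← gram_chartVec, gram_comp, fibreDet_eq]

lemma sq_jacCoord (hexp : IsRegularExp D exp) (hz : z ∈ expDomain D exp p₀ q₀) :
    jacCoord g exp p₀ q₀ z ^ 2 * coordDet g p₀ z.1 = gram (innerAt g (exp (bundleChart p₀ z)))
      (fun i => dexp exp ((extChartAt (𝓡 n) p₀).symm z.1) (chartVec p₀ z.1 z.2)
        (chartVec p₀ z.1 (stdBasis n i))) := by
  have h1 := coordDet_pos g p₀ hz.1
  have h2 := coordDet_pos g q₀ (expCoord_mem_target hz)
  have h3 : ∀ i, dexp exp ((extChartAt (𝓡 n) p₀).symm z.1) (chartVec p₀ z.1 z.2)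
        (chartVec p₀ z.1 (stdBasis n i)) = chartVec q₀ (expCoord exp p₀ q₀ z)
          (dexpCoord exp p₀ q₀ z (stdBasis n i)) := fun i => by
    rw [dexp_eq hexp hz]
    simp only [ContinuousLinearMap.comp_apply, (isInvertible_chartVec p₀ hz.1).inverse_apply_self]
  simp only [h3]
  rw [← symm_expCoord hz, gram_chartVec, gram_comp, ← coordDet_eq, jacCoord, mul_pow,
    Real.sq_sqrt (div_nonneg h2.le h1.le)]
  field_simp

/-- The Jacobian determinant does not depend on the chart in the target. -/
lemma abs_jacCoord_eq (hexp : IsRegularExp D exp) (hz : z ∈ expDomain D exp p₀ q₀)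
    (hz' : z ∈ expDomain D exp p₀ q₁) :
    |jacCoord g exp p₀ q₀ z| = |jacCoord g exp p₀ q₁ z| := by
  rw [← sq_eq_sq_iff_abs_eq_abs]
  refine mul_right_cancel₀ (coordDet_pos g p₀ hz.1).ne' ?_
  rw [sq_jacCoord hexp hz, sq_jacCoord hexp hz']

lemma smoothNear_coordDet (g : RiemMetric n M) (c : M) {x : Eu n}
    (hx : x ∈ (extChartAt (𝓡 n) c).target) : SmoothNear (coordDet g c) x := by
  have h1 : SmoothNear (metricChart g c) x :=
    SmoothNear.of_contDiffOn ((isOpen_extChartAt_target c).mem_nhds hx) (contDiffOn_metricChart g c)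
  have h2 : coordDet g c = fun x => (Matrix.of fun i j =>
      metricChart g c x (stdBasis n i) (stdBasis n j)).det := funext fun x => coordDet_eq g c x
  rw [h2]
  simp only [Matrix.det_apply, Matrix.of_apply]
  filter_upwards [h1] with y hy
  refine ContDiffAt.sum fun σ _ => ContDiffAt.const_smul _ (contDiffAt_prod fun i _ => ?_)
  exact (hy.clm_apply contDiffAt_const).clm_apply contDiffAt_const

lemma smoothNear_dexpCoord (hexp : IsRegularExp D exp) (hz : z ∈ expDomain D exp p₀ q₀) :
    SmoothNear (dexpCoord exp p₀ q₀) z := (smoothNear_expCoord hexp hz).fderiv_snd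

lemma smoothNear_volumeRatio (hexp : IsRegularExp D exp) (hz : z ∈ expDomain D exp p₀ q₀) :
    SmoothNear (fun z : Eu n × Eu n =>
      Real.sqrt (coordDet g q₀ (expCoord exp p₀ q₀ z) / coordDet g p₀ z.1)) z := by
  have h1 := coordDet_pos g p₀ hz.1
  have h2 := coordDet_pos g q₀ (expCoord_mem_target hz)
  exact (((smoothNear_coordDet g q₀ (expCoord_mem_target hz)).comp
    (smoothNear_expCoord hexp hz)).div ((smoothNear_coordDet g p₀ hz.1).comp SmoothNear.fst)
      h1.ne').sqrt (div_pos h2 h1).ne'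

lemma smoothNear_jacCoord (hexp : IsRegularExp D exp) (hz : z ∈ expDomain D exp p₀ q₀) :
    SmoothNear (jacCoord g exp p₀ q₀) z :=
  (smoothNear_volumeRatio hexp hz).mul (smoothNear_dexpCoord hexp hz).continuousLinearMap_det

lemma det_inverse_chartVec {c : M} {x : Eu n} (hx : x ∈ (extChartAt (𝓡 n) c).target) :
    (chartVec c x).inverse.det * (chartVec c x).det = 1 := by
  have h1 : (chartVec c x).inverse.comp (chartVec c x) = ContinuousLinearMap.id ℝ _ := by
    ext1 v; exact (isInvertible_chartVec c hx).inverse_apply_self v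
  have h2 : ((chartVec c x).inverse.comp (chartVec c x)).det =
    (chartVec c x).inverse.det * (chartVec c x).det := LinearMap.det_comp _ _
  rw [← h2, h1]
  exact LinearMap.det_id

/-- `detExp` in charts. -/
lemma abs_detExp (hexp : IsRegularExp D exp) (hz : z ∈ expDomain D exp p₀ q₀) :
    DifferentiableAt ℝ (detExp g exp ((extChartAt (𝓡 n) p₀).symm z.1) (chartVec p₀ z.1 z.2))
      (chartVec p₀ z.1 z.2) ∧
    ∀ᶠ u in 𝓝 (chartVec p₀ z.1 z.2),
      |detExp g exp ((extChartAt (𝓡 n) p₀).symm z.1) (chartVec p₀ z.1 z.2) u| =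
        |jacCoord g exp p₀ q₀ (z.1, (chartVec p₀ z.1).inverse u)| := by
  set p := (extChartAt (𝓡 n) p₀).symm z.1 with hp
  set v : Eu n := chartVec p₀ z.1 z.2 with hv
  set q := exp (bundleChart p₀ z) with hq
  set B := (chartVec p₀ z.1).inverse with hB
  have hi := isInvertible_chartVec p₀ hz.1
  have hz1 := mem_expDomain_self hz
  rw [← hq] at hz1
  have hBv : B v = z.2 := hi.inverse_apply_self z.2
  have hcd := coordDet_eq_fibreDet g p₀ z.1
  have hfd := fibreDet_pos g p
  have hdet := det_inverse_chartVec hz.1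
  rw [← hB] at hdet
  -- `exp_p` in the chart at `exp_p v`
  have hchart : expChart exp p v = fun u => expCoord exp p₀ q (z.1, B u) := by
    funext u
    have h1 : bundleChart p₀ (z.1, B u) = ⟨p, u⟩ := by
      have h2 : chartVec p₀ z.1 (B u) = u := hi.self_apply_inverse u
      simp only [bundleChart, h2]
      rfl
    simp only [expCoord, h1]
    rfl
  have ht : Tendsto (fun u => (z.1, B u)) (𝓝 v) (𝓝 z) :=
    Continuous.tendsto' (by fun_prop) _ _ (Prod.ext rfl hBv)
  have hform : ∀ᶠ u in 𝓝 v, detExp g exp p v u =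
      Real.sqrt (coordDet g p₀ z.1 / fibreDet g p) * B.det * jacCoord g exp p₀ q (z.1, B u) := by
    filter_upwards [ht.eventually ((isOpen_expDomain hexp).mem_nhds hz1)] with u hu'
    have hu : (z.1, B u) ∈ expDomain D exp p₀ q := hu'
    have h1 : HasFDerivAt (fun u => expCoord exp p₀ q (z.1, B u))
        ((dexpCoord exp p₀ q (z.1, B u)).comp B) u :=
      HasFDerivAt.comp (g := fun w => expCoord exp p₀ q (z.1, w)) (f := B) u
        (hasFDerivAt_expCoord (z := (z.1, B u)) hexp hu) B.hasFDerivAt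
    have h2 : expAt exp p v = q := rfl
    have h3 : ((dexpCoord exp p₀ q (z.1, B u)).comp B).det =
      (dexpCoord exp p₀ q (z.1, B u)).det * B.det := LinearMap.det_comp _ _
    have h4 := coordDet_pos g p₀ hz.1
    have h5 := coordDet_pos g q (expCoord_mem_target hu)
    rw [detExp, hchart, h1.fderiv, h2, h3, jacCoord]
    simp only
    have h6 : Real.sqrt (coordDet g q (expCoord exp p₀ q (z.1, B u)) / fibreDet g p) =
        Real.sqrt (coordDet g p₀ z.1 / fibreDet g p) *
          Real.sqrt (coordDet g q (expCoord exp p₀ q (z.1, B u)) / coordDet g p₀ z.1) := by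
      rw [← Real.sqrt_mul (div_nonneg h4.le hfd.le)]
      congr 1
      field_simp
    rw [h6]; ring
  have hB1 : |Real.sqrt (coordDet g p₀ z.1 / fibreDet g p) * B.det| = 1 := by
    rw [hcd, mul_div_assoc, div_self hfd.ne', mul_one, Real.sqrt_sq_eq_abs, abs_mul, abs_abs,
      ← abs_mul, mul_comm, hdet, abs_one]
  refine ⟨?_, ?_⟩
  · have h1 : SmoothNear (fun u => jacCoord g exp p₀ q (z.1, B u)) v :=
      (smoothNear_jacCoord hexp hz1).comp_of_eq
        ((SmoothNear.const z.1).prodMk (SmoothNear.of_contDiff B.contDiff)) (Prod.ext rfl hBv)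
    exact (h1.differentiableAt.const_mul _).congr_of_eventuallyEq hform
  · filter_upwards [hform, ht.eventually ((isOpen_expDomain hexp).mem_nhds hz1),
      ht.eventually ((isOpen_expDomain hexp).mem_nhds hz)] with u h1 h2 h3
    rw [h1, abs_mul, hB1, one_mul]
    exact abs_jacCoord_eq hexp h2 h3

/-- The invariants `A` and `D` at the singular vectors of a fold. -/
theorem invA_mul_invD (hexp : IsRegularExp D exp) {x₀ w₀ y₀ α : Eu n} {ζ X : Eu n × Eu n → ℝ}
    {N : Eu n × Eu n → Eu n} {Γ : ℝ × Eu n × Eu n → Eu n} {Lt : Eu n × Eu n → Eu n →L[ℝ] Eu n}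
    (h : IsFoldModel (expCoord exp p₀ q₀) (metricChart g q₀) x₀ w₀ y₀ α ζ X N Γ Lt)
    (hz₀ : (x₀, w₀) ∈ expDomain D exp p₀ q₀) :
    ∀ᶠ z : Eu n × Eu n in 𝓝 (x₀, w₀), X z = 0 →
      0 < invA g exp ((extChartAt (𝓡 n) p₀).symm z.1) (chartVec p₀ z.1 z.2) ∧
      0 < invD g exp ((extChartAt (𝓡 n) p₀).symm z.1) (chartVec p₀ z.1 z.2) ∧
      invA g exp ((extChartAt (𝓡 n) p₀).symm z.1) (chartVec p₀ z.1 z.2) *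
        invD g exp ((extChartAt (𝓡 n) p₀).symm z.1) (chartVec p₀ z.1 z.2) =
      (Real.sqrt (coordDet g q₀ (expCoord exp p₀ q₀ z) / coordDet g p₀ z.1) * jacQuot X Lt z) ^ 2
        / 2 := by
  obtain ⟨m, hm⟩ : ∃ m, m + 1 = Fintype.card (Fin n) := by
    refine ⟨Fintype.card (Fin n) - 1, Nat.sub_add_cancel (Nat.one_le_iff_ne_zero.2 fun h1 => ?_)⟩
    have : Subsingleton (Eu n) := by
      rw [Fintype.card_fin] at h1; subst h1; infer_instance
    exact hz₀.2.2.1 (Subsingleton.elim _ _)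
  filter_upwards [h.det_eq_mul_jacQuot.eventually_nhds, h.det_eq, h.smooth_X.eventually,
    h.smooth_jacQuot.eventually, (isOpen_expDomain hexp).mem_nhds hz₀,
    h.gram_singular (stdBasis n) hm] with z hdet hdet1 hXs hks hz hgram hX
  set p := (extChartAt (𝓡 n) p₀).symm z.1 with hp
  set v : Eu n := chartVec p₀ z.1 z.2 with hv
  set B := (chartVec p₀ z.1).inverse with hB
  set c := Real.sqrt (coordDet g q₀ (expCoord exp p₀ q₀ z) / coordDet g p₀ z.1) with hc
  set φ := fderiv ℝ (fun w => X (z.1, w)) z.2 with hφ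
  set k := jacQuot X Lt z with hk
  have hi := isInvertible_chartVec p₀ hz.1
  have hBv : B v = z.2 := hi.inverse_apply_self z.2
  have hvB : ∀ u, chartVec p₀ z.1 (B u) = u := fun u => hi.self_apply_inverse u
  have hc1 := coordDet_pos g p₀ hz.1
  have hc2 := coordDet_pos g q₀ (expCoord_mem_target hz)
  have hc0 : 0 < c := Real.sqrt_pos.2 (div_pos hc2 hc1)
  have hkLt : k = 2 * (Lt z).det := by rw [hk, jacQuot, hX]; simp
  have hk0 : k ≠ 0 := by rw [hkLt]; exact mul_ne_zero two_ne_zero hdet1.1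
  -- the differential of the Jacobian determinant is `± c k φ`
  have hJ : HasFDerivAt (fun w => jacCoord g exp p₀ q₀ (z.1, w)) ((c * k) • φ) z.2 := by
    have ht : Tendsto (fun w : Eu n => (z.1, w)) (𝓝 z.2) (𝓝 z) :=
      (continuous_const.prodMk continuous_id).tendsto' _ _ rfl
    have h1 : (fun w => jacCoord g exp p₀ q₀ (z.1, w)) =ᶠ[𝓝 z.2] fun w => X (z.1, w) *
        (Real.sqrt (coordDet g q₀ (expCoord exp p₀ q₀ (z.1, w)) / coordDet g p₀ z.1) *
          jacQuot X Lt (z.1, w)) := by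
      filter_upwards [ht.eventually hdet] with w hw
      have h2 : (dexpCoord exp p₀ q₀ (z.1, w)).det = X (z.1, w) * jacQuot X Lt (z.1, w) := hw
      rw [jacCoord, h2]; ring
    have h2 : HasFDerivAt (fun w => X (z.1, w)) φ z.2 :=
      (SmoothNear.slice (x := z.1) (w := z.2) hXs).hasFDerivAt
    have h3 : DifferentiableAt ℝ (fun w =>
        Real.sqrt (coordDet g q₀ (expCoord exp p₀ q₀ (z.1, w)) / coordDet g p₀ z.1) *
          jacQuot X Lt (z.1, w)) z.2 :=
      (SmoothNear.slice (x := z.1) (w := z.2)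
        ((smoothNear_volumeRatio (g := g) hexp hz).mul hks)).differentiableAt
    refine ((h2.mul h3.hasFDerivAt).congr_of_eventuallyEq h1).congr_fderiv ?_
    have hX' : X (z.1, z.2) = 0 := hX
    rw [hX', zero_smul, zero_add]
  obtain ⟨hdiff, habs⟩ := abs_detExp (g := g) hexp hz
  have hdF : ∀ α, |fderiv ℝ (detExp g exp p v) v α| = |((c * k) • φ.comp B) α| := by
    intro α
    have h1 : HasFDerivAt (fun u => jacCoord g exp p₀ q₀ (z.1, B u)) (((c * k) • φ).comp B) v :=
      HasFDerivAt.comp (g := fun w => jacCoord g exp p₀ q₀ (z.1, w)) (f := B) v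
        (by rw [hBv]; exact hJ) B.hasFDerivAt
    have h2 := abs_fderiv_eq_of_abs_eq h1.differentiableAt hdiff (by
      have h3 : (dexpCoord exp p₀ q₀ z).det = X z * k := hdet.self_of_nhds
      rw [hBv, jacCoord, h3, hX]; simp) (habs.mono fun u hu => hu.symm) α
    rw [← h2, h1.fderiv]; rfl
  -- the dual vector
  obtain ⟨a, ha⟩ := exists_dual_vec (metricChart_pos g p₀ hz.1) φ
  have hφ0 : φ ≠ 0 := (hgram hX).1
  have ha0 : a ≠ 0 := by
    rintro rfl
    exact hφ0 (ContinuousLinearMap.ext fun v => by rw [← ha]; simp)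
  have hφa : 0 < φ a := by rw [← ha]; exact metricChart_pos g p₀ hz.1 a ha0
  have hA : invA g exp p v = Real.sqrt ((c * k) ^ 2 * φ a) := by
    have h1 : ∀ u, innerAt g p ((c * k) • chartVec p₀ z.1 a) u = ((c * k) • φ.comp B) u := by
      intro u
      rw [map_smul, smul_apply, smul_apply, ContinuousLinearMap.comp_apply, ← ha,
        metricChart_apply, hvB]
    have h2 := sSup_abs_dual (innerAt_symm g p) (innerAt_pos g p) h1
    have h3 : ((c * k) • φ.comp B) ((c * k) • chartVec p₀ z.1 a) = (c * k) ^ 2 * φ a := by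
      have : B (chartVec p₀ z.1 a) = a := hi.inverse_apply_self a
      rw [map_smul, smul_apply, ContinuousLinearMap.comp_apply, this]
      simp only [smul_eq_mul]; ring
    rw [h3] at h2
    rw [← h2, invA]
    congr 1
    ext r
    refine exists_congr fun α => and_congr Iff.rfl ?_
    rw [hdF]
  have hDker : ∀ u, u ∈ tangentS g exp p v ↔ φ (B u) = 0 := by
    intro u
    have h1 : u ∈ tangentS g exp p v ↔ fderiv ℝ (detExp g exp p v) v u = 0 := Iff.rfl
    rw [h1, ← abs_eq_zero, hdF, abs_eq_zero, smul_apply, ContinuousLinearMap.comp_apply,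
      smul_eq_mul, mul_eq_zero]
    simp [hc0.ne', hk0]
  have hD : invD g exp p v = Real.sqrt ((c * k) ^ 2 / (4 * φ a)) := by
    have hFne : (fderiv ℝ (detExp g exp p v) v : Eu n →ₗ[ℝ] ℝ) ≠ 0 := by
      intro h0
      have h1 := (hDker (chartVec p₀ z.1 a)).1 (by rw [tangentS, h0, LinearMap.ker_zero]; trivial)
      have : B (chartVec p₀ z.1 a) = a := hi.inverse_apply_self a
      rw [this] at h1
      exact hφa.ne' h1
    obtain rfl : m = Module.finrank ℝ (tangentS g exp p v) := by
      have h1 := Module.Dual.finrank_ker_add_one_of_ne_zero hFne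
      rw [finrank_euclideanSpace, ← hm] at h1
      exact (Nat.succ.inj h1).symm
    set b := Module.finBasis ℝ (tangentS g exp p v) with hb
    have h2 := (hgram hX).2 (metricChart g p₀ z.1) (metricChart_pos g p₀ hz.1) a ha
      (fun i => B (b i)) (fun i => (hDker _).1 (b i).2)
    have h3 : gramDet g (expAt exp p v) (fun i => dexp exp p v (b i : Eu n)) =
        gram (metricChart g q₀ (expCoord exp p₀ q₀ z))
          (fun i => dexpCoord exp p₀ q₀ z (B (b i))) := by
      rw [← gram_chartVec, symm_expCoord hz, dexp_eq hexp hz]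
      rfl
    have h4 : gramDet g p (fun i => (b i : Eu n)) =
        gram (metricChart g p₀ z.1) (fun i => B (b i)) := by
      rw [← gram_chartVec]
      simp only [hvB]
      rfl
    have h5 : 0 < gram (metricChart g p₀ z.1) (fun i => B (b i)) := by
      rw [← h4]
      refine gram_pos (g := innerAt g p) (innerAt_symm g p) (innerAt_pos g p) ?_
      exact b.linearIndependent.map' (tangentS g exp p v).subtype (Submodule.ker_subtype _)
    have h6 : gram (metricChart g p₀ z.1) (stdBasis n) = coordDet g p₀ z.1 :=
      (coordDet_eq _ _ _).symm
    have h7 : gram (metricChart g q₀ (expCoord exp p₀ q₀ z)) (stdBasis n) =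
      coordDet g q₀ (expCoord exp p₀ q₀ z) := (coordDet_eq _ _ _).symm
    rw [h6, h7] at h2
    rw [invD, ← hb, h3, h4]
    congr 1
    have h8 : c ^ 2 = coordDet g q₀ (expCoord exp p₀ q₀ z) / coordDet g p₀ z.1 :=
      Real.sq_sqrt (div_pos hc2 hc1).le
    rw [mul_pow, h8, hkLt, div_eq_div_iff h5.ne' (by positivity)]
    rw [div_mul_eq_mul_div, div_mul_eq_mul_div, eq_div_iff hc1.ne']
    have h9 : gram (metricChart g q₀ (expCoord exp p₀ q₀ z))
      (fun i => dexpCoord exp p₀ q₀ z (B (b i))) * φ a * coordDet g p₀ z.1 =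
      gram (metricChart g p₀ z.1) (fun i => B (b i)) * coordDet g q₀ (expCoord exp p₀ q₀ z) *
        (Lt z).det ^ 2 := h2
    linear_combination 4 * h9
  have hck : 0 < (c * k) ^ 2 := by have := mul_ne_zero hc0.ne' hk0; positivity
  refine ⟨by rw [hA]; exact Real.sqrt_pos.2 (by positivity),
    by rw [hD]; exact Real.sqrt_pos.2 (by positivity), ?_⟩
  rw [hA, hD, ← Real.sqrt_mul (by positivity)]
  have : (c * k) ^ 2 * φ a * ((c * k) ^ 2 / (4 * φ a)) = ((c * k) ^ 2 / 2) ^ 2 := by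
    field_simp; norm_num
  rw [this, Real.sqrt_sq (by positivity)]

end Invariants

/-! ### Fold conjugate vectors -/

section FoldVectors

variable {n : ℕ} {M : Type*} [TopologicalSpace M] [ChartedSpace (Eu n) M] [IsManifold (𝓡 n) ∞ M]
  {D : Set (TangentBundle (𝓡 n) M)} {exp : TangentBundle (𝓡 n) M → M} {p₀ : M} {v₀ : Eu n}

lemma base_mem_expDomain (hv : v₀ ∈ conjVectors D exp p₀) :
    (extChartAt (𝓡 n) p₀ p₀, v₀) ∈ expDomain D exp p₀ (expAt exp p₀ v₀) := by
  refine ⟨mem_extChartAt_target p₀, ?_, hv.1, ?_⟩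
  · rw [bundleChart_base]; exact hv.2.1
  · rw [bundleChart_base]; exact mem_extChartAt_source _

lemma expCoord_base :
    expCoord exp p₀ (expAt exp p₀ v₀) (extChartAt (𝓡 n) p₀ p₀, v₀) =
      extChartAt (𝓡 n) (expAt exp p₀ v₀) (expAt exp p₀ v₀) := by
  rw [expCoord, bundleChart_base]; rfl

/-- A fold conjugate vector is a fold in the sense of the normal form: the condition on the Hessian
makes the set of conjugate vectors a smooth hypersurface, and transversality of the kernel to it
is the nonvanishing of the second derivative in the kernel direction, modulo the range. -/
theorem exists_isFoldModel_of_isFold (g : RiemMetric n M) (hexp : IsRegularExp D exp)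
    (hfold : IsFold D exp p₀ v₀) :
    ∃ α ζ X N Γ Lt, IsFoldModel (expCoord exp p₀ (expAt exp p₀ v₀))
      (metricChart g (expAt exp p₀ v₀)) (extChartAt (𝓡 n) p₀ p₀) v₀
      (extChartAt (𝓡 n) (expAt exp p₀ v₀) (expAt exp p₀ v₀)) α ζ X N Γ Lt := by
  obtain ⟨⟨hconj, -⟩, hord, htr⟩ := hfold
  set q₀ := expAt exp p₀ v₀ with hq₀
  set x₀ := extChartAt (𝓡 n) p₀ p₀ with hx₀
  have hdom : (x₀, v₀) ∈ expDomain D exp p₀ q₀ := base_mem_expDomain hconj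
  set f : Eu n → Eu n := fun w => expCoord exp p₀ q₀ (x₀, w) with hf
  have hfs : SmoothNear f v₀ := (smoothNear_expCoord hexp hdom).slice
  have hsymm : (extChartAt (𝓡 n) p₀).symm x₀ = p₀ := extChartAt_to_inv p₀
  have hid : chartVec p₀ x₀ = ContinuousLinearMap.id ℝ _ := chartVec_self p₀
  have hchart : expChart exp p₀ v₀ = f := by
    funext u
    have h1 : bundleChart p₀ (x₀, u) = ⟨p₀, u⟩ := bundleChart_base p₀ u
    simp only [hf, expCoord, h1]
    rfl
  have hdexp : dexp exp p₀ v₀ = fderiv ℝ f v₀ := by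
    have h1 := dexp_eq hexp hdom
    simp only [hsymm, hid] at h1
    have h2 : expCoord exp p₀ q₀ (x₀, v₀) = extChartAt (𝓡 n) q₀ q₀ := expCoord_base
    rw [h2, chartVec_self, ContinuousLinearMap.inverse_id] at h1
    exact h1
  -- the kernel
  obtain ⟨⟨α, hαk⟩, hα0, hαspan⟩ := finrank_eq_one_iff'.1 hord
  have hα : α ≠ 0 := fun h => hα0 (Subtype.ext h)
  have hLα : fderiv ℝ f v₀ α = 0 := by rw [← hdexp]; exact hαk
  have hker : ∀ v, fderiv ℝ f v₀ v = 0 ↔ ∃ c : ℝ, v = c • α := by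
    refine fun v => ⟨fun h => ?_, ?_⟩
    · obtain ⟨c, hc⟩ := hαspan ⟨v, by rw [LinearMap.mem_ker, hdexp]; exact h⟩
      exact ⟨c, (congrArg Subtype.val hc).symm⟩
    · rintro ⟨c, rfl⟩
      rw [map_smul, hLα, smul_zero]
  obtain ⟨l, c, hc, hl0, hl, hlr, hdet⟩ := exists_fderiv_det_eq hfs hα hker
  -- the radial derivative of the Jacobian does not vanish
  have hrad : l (fderiv ℝ (fderiv ℝ f) v₀ v₀ α) ≠ 0 := by
    intro h
    obtain ⟨v, hv⟩ := hlr _ h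
    have hinj := (hexp.hessian p₀ v₀ hconj.1 hconj.2.1).1
    refine hα0 (hinj ?_)
    simp only [hchart]
    rw [(Submodule.Quotient.mk_eq_zero _).2, (Submodule.Quotient.mk_eq_zero _).2]
    · simp
    · rw [hdexp]; exact ⟨v, hv⟩
  have hFs : SmoothNear (fun w => (fderiv ℝ f w).det) v₀ := hfs.fderiv.continuousLinearMap_det
  have ht : Tendsto (fun w : Eu n => (x₀, w)) (𝓝 v₀) (𝓝 (x₀, v₀)) :=
    (continuous_const.prodMk continuous_id).tendsto' _ _ rfl
  have hconjF : ∀ᶠ w in 𝓝 v₀, w ∈ conjVectors D exp p₀ ↔ (fderiv ℝ f w).det = 0 := by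
    filter_upwards [ht.eventually ((isOpen_expDomain hexp).mem_nhds hdom)] with w hw'
    have hw : (x₀, w) ∈ expDomain D exp p₀ q₀ := hw'
    have h1 := mem_conjVectors_iff hexp hw
    simp only [hsymm, hid] at h1
    exact h1
  have hF0 : (fderiv ℝ f v₀).det = 0 := hconjF.self_of_nhds.1 hconj
  have hne : l (fderiv ℝ (fderiv ℝ f) v₀ α α) ≠ 0 := by
    intro h
    refine htr α (by rw [hdexp]; exact hLα) hα ?_
    refine mem_tangentConeAt_of_fderiv_eq_zero hFs hF0 (u := v₀) ?_ ?_
      (hconjF.mono fun w hw => hw.2)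
    · rw [hdet]; exact mul_ne_zero hc hrad
    · rw [hdet, h, mul_zero]
  have htgt : ∀ᶠ y in 𝓝 (extChartAt (𝓡 n) q₀ q₀), y ∈ (extChartAt (𝓡 n) q₀).target :=
    (isOpen_extChartAt_target q₀).mem_nhds (mem_extChartAt_target q₀)
  obtain ⟨ζ, X, N, Γ, Lt, h⟩ := exists_isFoldModel (smoothNear_expCoord hexp hdom) expCoord_base
    (G := metricChart g q₀)
    (SmoothNear.of_contDiffOn htgt (contDiffOn_metricChart g q₀)) (metricChart_symm g q₀)
    (htgt.mono fun y hy => metricChart_pos g q₀ hy) hα hker hl hl0 hne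
  exact ⟨α, ζ, X, N, Γ, Lt, h⟩

end FoldVectors

/-! ### The Riemannian distance -/

section Distance

variable {n : ℕ} {M : Type*} [TopologicalSpace M] [ChartedSpace (Eu n) M] [IsManifold (𝓡 n) ∞ M]
  {g : RiemMetric n M}

open scoped Bundle in
/-- A path of unit speed bounds the distance of its endpoints by the length of its interval. -/
lemma gdist_le_of_unit_speed {γ : ℝ → M} {a b : ℝ} (hab : a ≤ b)
    (hγ : ContMDiffOn 𝓘(ℝ, ℝ) (𝓡 n) 1 γ (Icc a b)) {u : ℝ → Eu n}
    (hd : ∀ t ∈ Icc a b, HasMFDerivAt 𝓘(ℝ, ℝ) (𝓡 n) γ t ((1 : ℝ →L[ℝ] ℝ).smulRight (u t)))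
    (hu : ∀ t ∈ Icc a b, innerAt g (γ t) (u t) (u t) = 1) :
    gdist g (γ a) (γ b) ≤ ENNReal.ofReal (b - a) := by
  let _ : Bundle.RiemannianBundle (fun x : M => TangentSpace (𝓡 n) x) := ⟨g.toRiemannianMetric⟩
  refine (Manifold.riemannianEDist_le_pathELength hγ rfl rfl hab).trans ?_
  rw [Manifold.pathELength_eq_lintegral_mfderiv_Icc]
  have h1 : ∀ t ∈ Icc a b, ‖mfderiv 𝓘(ℝ, ℝ) (𝓡 n) γ t 1‖ₑ = 1 := by
    intro t ht
    have h2 : (mfderiv 𝓘(ℝ, ℝ) (𝓡 n) γ t (1 : ℝ) : Eu n) = u t := by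
      rw [(hd t ht).mfderiv]
      exact one_smul ℝ (u t)
    have h3 : innerAt g (γ t) (mfderiv 𝓘(ℝ, ℝ) (𝓡 n) γ t (1 : ℝ))
        (mfderiv 𝓘(ℝ, ℝ) (𝓡 n) γ t (1 : ℝ)) = 1 := by
      have h4 := hu t ht
      rw [← h2] at h4
      exact h4
    have h5 : inner ℝ (mfderiv 𝓘(ℝ, ℝ) (𝓡 n) γ t 1) (mfderiv 𝓘(ℝ, ℝ) (𝓡 n) γ t 1) = 1 := h3
    rw [← ofReal_norm, norm_eq_sqrt_real_inner, h5]
    simp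
  rw [setLIntegral_congr_fun measurableSet_Icc h1]
  simp

open scoped Bundle in
/-- Points at distance less than `r` are joined by a path of length less than `r`, which stays in
the ball of radius `r`. -/
lemma exists_path_of_gdist_lt {x y : M} {r : ℝ≥0∞} (hr : gdist g x y < r) :
    ∃ γ : ℝ → M, γ 0 = x ∧ γ 1 = y ∧ ContMDiff 𝓘(ℝ, ℝ) (𝓡 n) 1 γ ∧
      (∫⁻ t in Icc (0 : ℝ) 1, ENNReal.ofReal (gnorm g (γ t)
        (mfderiv 𝓘(ℝ, ℝ) (𝓡 n) γ t (1 : ℝ))) < r) ∧ ∀ t ∈ Icc (0 : ℝ) 1, gdist g x (γ t) < r := by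
  let _ : Bundle.RiemannianBundle (fun x : M => TangentSpace (𝓡 n) x) := ⟨g.toRiemannianMetric⟩
  obtain ⟨γ, h0, h1, hγ, hl, -⟩ :=
    Manifold.exists_lt_locally_constant_of_riemannianEDist_lt (I := 𝓡 n) hr zero_lt_one
  refine ⟨γ, h0, h1, hγ, ?_, fun t ht => ?_⟩
  · rw [Manifold.pathELength_eq_lintegral_mfderiv_Icc] at hl
    refine lt_of_eq_of_lt (lintegral_congr fun t => ?_) hl
    rw [← ofReal_norm, norm_eq_sqrt_real_inner]
    rfl
  · refine lt_of_le_of_lt ?_ hl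
    refine (Manifold.riemannianEDist_le_pathELength (hγ.contMDiffOn (s := Icc 0 t)) h0 rfl
      ht.1).trans ?_
    exact Manifold.pathELength_mono le_rfl ht.2

open scoped Bundle in
lemma gdist_comm (x y : M) : gdist g x y = gdist g y x := by
  let _ : Bundle.RiemannianBundle (fun x : M => TangentSpace (𝓡 n) x) := ⟨g.toRiemannianMetric⟩
  exact Manifold.riemannianEDist_comm

open scoped Bundle in
lemma gdist_triangle (x y z : M) : gdist g x z ≤ gdist g x y + gdist g y z := by
  let _ : Bundle.RiemannianBundle (fun x : M => TangentSpace (𝓡 n) x) := ⟨g.toRiemannianMetric⟩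
  exact Manifold.riemannianEDist_triangle

open scoped Bundle in
lemma eventually_gdist_lt (x : M) {c : ℝ≥0∞} (hc : 0 < c) : ∀ᶠ y in 𝓝 x, gdist g x y < c := by
  let _ : Bundle.RiemannianBundle (fun x : M => TangentSpace (𝓡 n) x) := ⟨g.toRiemannianMetric⟩
  have _ : IsContinuousRiemannianBundle (Eu n) (fun x : M => TangentSpace (𝓡 n) x) :=
    ⟨g.inner, g.contMDiff.continuous, fun _ _ _ => rfl⟩
  exact eventually_riemannianEDist_lt (𝓡 n) x hc

open scoped Bundle in
/-- The Riemannian distance induces a topology at least as fine as that of `M`. -/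
lemma exists_gdist_lt_subset [T2Space M] {x : M} {s : Set M} (hs : s ∈ 𝓝 x) :
    ∃ c > 0, ∀ y, gdist g x y < c → y ∈ s := by
  let _ : Bundle.RiemannianBundle (fun x : M => TangentSpace (𝓡 n) x) := ⟨g.toRiemannianMetric⟩
  have _ : IsContinuousRiemannianBundle (Eu n) (fun x : M => TangentSpace (𝓡 n) x) :=
    ⟨g.inner, g.contMDiff.continuous, fun _ _ _ => rfl⟩
  have _ : LocallyCompactSpace M := ChartedSpace.locallyCompactSpace (Eu n) M
  obtain ⟨c, hc, h⟩ := setOfPred_riemannianEDist_lt_subset_nhds' (𝓡 n) hs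
  exact ⟨c, hc, fun y hy => h hy⟩

end Distance

/-! ### The distance to the caustic -/

section DistanceToCaustic

variable {n : ℕ} {M : Type*} [TopologicalSpace M] [ChartedSpace (Eu n) M] [IsManifold (𝓡 n) ∞ M]
  {g : RiemMetric n M}

/-- A function whose differential has norm at most `1` increases along a path by at most the length
of the path. -/
lemma ofReal_abs_sub_le_length {c : M} {F : Eu n → ℝ} {W : Set (Eu n)}
    (hF : ∀ y ∈ W, ContDiffAt ℝ 1 F y)
    (hFg : ∀ y ∈ W, ∀ v, |fderiv ℝ F y v| ≤ Real.sqrt (metricChart g c y v v)) {γ : ℝ → M}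
    (hγ : ContMDiff 𝓘(ℝ, ℝ) (𝓡 n) 1 γ)
    (hs : ∀ t ∈ Icc (0 : ℝ) 1, γ t ∈ (extChartAt (𝓡 n) c).source ∧ extChartAt (𝓡 n) c (γ t) ∈ W) :
    ENNReal.ofReal |F (extChartAt (𝓡 n) c (γ 1)) - F (extChartAt (𝓡 n) c (γ 0))| ≤
      ∫⁻ t in Icc (0 : ℝ) 1, ENNReal.ofReal (gnorm g (γ t)
        (mfderiv 𝓘(ℝ, ℝ) (𝓡 n) γ t (1 : ℝ))) := by
  set η : ℝ → Eu n := fun t => extChartAt (𝓡 n) c (γ t) with hη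
  have hηs : ∀ t ∈ Icc (0 : ℝ) 1, ContDiffAt ℝ 1 η t := fun t ht => by
    have h1 : ContMDiffAt 𝓘(ℝ, ℝ) 𝓘(ℝ, Eu n) 1 η t :=
      (contMDiffAt_extChartAt' (by rw [← extChartAt_source (𝓡 n)]; exact (hs t ht).1)).comp t
        hγ.contMDiffAt
    exact contMDiffAt_iff_contDiffAt.1 h1
  have hf : ContDiffOn ℝ 1 (fun t => F (η t)) (Icc 0 1) := fun t ht =>
    ((hF _ (hs t ht).2).comp t (hηs t ht)).contDiffWithinAt
  have h1 := enorm_sub_le_lintegral_deriv_of_contDiffOn_Icc hf zero_le_one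
  rw [← ofReal_norm, Real.norm_eq_abs] at h1
  refine h1.trans (setLIntegral_mono' measurableSet_Icc fun t ht => ?_)
  rw [← ofReal_norm, Real.norm_eq_abs]
  refine ENNReal.ofReal_le_ofReal ?_
  have hηd : HasDerivAt η (deriv η t) t :=
    ((hηs t ht).differentiableAt one_ne_zero).hasDerivAt
  have hFd : HasFDerivAt F (fderiv ℝ F (η t)) (η t) :=
    ((hF _ (hs t ht).2).differentiableAt one_ne_zero).hasFDerivAt
  have hd : deriv (fun t => F (η t)) t = fderiv ℝ F (η t) (deriv η t) :=
    (HasFDerivAt.comp_hasDerivAt (l := F) (f := η) t hFd hηd).deriv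
  rw [show |deriv (fun t => F (η t)) t| = |fderiv ℝ F (η t) (deriv η t)| from congrArg abs hd]
  refine (hFg _ (hs t ht).2 _).trans (le_of_eq ?_)
  have hback : (extChartAt (𝓡 n) c).symm (η t) = γ t := (extChartAt (𝓡 n) c).left_inv (hs t ht).1
  have hev : γ =ᶠ[𝓝 t] fun s => (extChartAt (𝓡 n) c).symm (η s) := by
    filter_upwards [hγ.continuous.continuousAt.eventually
      (extChartAt_source_mem_nhds' (I := 𝓡 n) (hs t ht).1)] with s hs
    exact ((extChartAt (𝓡 n) c).left_inv hs).symm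
  have hmd := (HasMFDerivAt.comp t
    (hasMFDerivAt_chart_symm c ((extChartAt (𝓡 n) c).map_source (hs t ht).1))
    hηd.hasFDerivAt.hasMFDerivAt).congr_of_eventuallyEq hev
  have hvel : (mfderiv 𝓘(ℝ, ℝ) (𝓡 n) γ t (1 : ℝ) : Eu n) = chartVec c (η t) (deriv η t) := by
    rw [hmd.mfderiv]
    change chartVec c (η t) ((1 : ℝ) • deriv η t) = _
    rw [one_smul]
  rw [metricChart_apply, hback, ← hvel]
  rfl

/-- The distance to the caustic is `|ζ|`: the characteristic through a point joins it to the caustic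
by a path of length `|ζ|`, and no path is shorter, since the differential of `ζ` has norm `1`. -/
theorem eventually_distTo_eq [T2Space M] {q₀ : M} {E : Eu n × Eu n → Eu n} {x₀ w₀ y₀ α : Eu n}
    {ζ X : Eu n × Eu n → ℝ} {N : Eu n × Eu n → Eu n} {Γ : ℝ × Eu n × Eu n → Eu n}
    {Lt : Eu n × Eu n → Eu n →L[ℝ] Eu n}
    (h : IsFoldModel E (metricChart g q₀) x₀ w₀ y₀ α ζ X N Γ Lt)
    (hy₀ : y₀ = extChartAt (𝓡 n) q₀ q₀) :
    ∀ᶠ p : Eu n × Eu n in 𝓝 (x₀, y₀), ∀ C : Set M,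
      (∀ q ∈ C, q ∈ (extChartAt (𝓡 n) q₀).source ∧ ζ (p.1, extChartAt (𝓡 n) q₀ q) = 0) →
      (extChartAt (𝓡 n) q₀).symm (Γ (0, p)) ∈ C →
      distTo g ((extChartAt (𝓡 n) q₀).symm p.2) C = |ζ p| := by
  set ψ := extChartAt (𝓡 n) q₀ with hψ
  have hy₀t : y₀ ∈ ψ.target := hy₀ ▸ mem_extChartAt_target q₀
  have htgt : ψ.target ∈ 𝓝 y₀ := (isOpen_extChartAt_target q₀).mem_nhds hy₀t
  have hζ0 := h.ζ_base
  -- the neighbourhood in which short paths stay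
  have hn1 := h.smooth_ζ.eventually.and h.gradient
  rw [nhds_prod_eq] at hn1
  obtain ⟨W₁, hW₁, W₂, hW₂, hW⟩ := mem_prod_iff.1 hn1
  have hs : ψ.source ∩ ψ ⁻¹' (W₂ ∩ ψ.target) ∈ 𝓝 q₀ := by
    refine inter_mem (extChartAt_source_mem_nhds q₀) ?_
    refine (continuousAt_extChartAt q₀).preimage_mem_nhds ?_
    rw [← hψ, ← hy₀]
    exact inter_mem hW₂ htgt
  obtain ⟨c, hc, hcs⟩ := exists_gdist_lt_subset (g := g) hs
  have hc2 : 0 < c / 2 := ENNReal.half_pos hc.ne'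
  have hn2 : ∀ᶠ p : Eu n × Eu n in 𝓝 (x₀, y₀), gdist g q₀ (ψ.symm p.2) < c / 2 := by
    have h1 : Tendsto (fun p : Eu n × Eu n => ψ.symm p.2) (𝓝 (x₀, y₀)) (𝓝 q₀) := by
      have h2 := (continuousAt_extChartAt_symm (I := 𝓡 n) q₀).tendsto
      rw [extChartAt_to_inv, ← hψ, ← hy₀] at h2
      exact h2.comp continuousAt_snd
    exact h1.eventually (eventually_gdist_lt q₀ hc2)
  have hn3 : ∀ᶠ p : Eu n × Eu n in 𝓝 (x₀, y₀), ENNReal.ofReal |ζ p| < c / 2 := by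
    have h1 : ContinuousAt (fun p => ENNReal.ofReal |ζ p|) (x₀, y₀) :=
      ENNReal.continuous_ofReal.continuousAt.comp h.smooth_ζ.continuousAt.abs
    refine h1.eventually_lt_const ?_
    simpa [hζ0] using hc2
  -- the characteristics
  have hΓt : ∀ᶠ p in 𝓝 ((0 : ℝ), x₀, y₀), Γ p ∈ ψ.target := by
    have h1 : Tendsto Γ (𝓝 ((0 : ℝ), x₀, y₀)) (𝓝 y₀) := by
      have := h.smooth_Γ.continuousAt; rwa [ContinuousAt, h.Γ_base] at this
    exact h1.eventually htgt
  have hn4 := (h.char_deriv.and h.smooth_Γ).and hΓt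
  rw [nhds_prod_eq] at hn4
  obtain ⟨pa, ha, pb, hb, hab⟩ := eventually_prod_iff.1 hn4
  obtain ⟨δ, hδ, hball⟩ := Metric.eventually_nhds_iff.1 ha
  have hn5 : ∀ᶠ p in 𝓝 (x₀, y₀), |ζ p| < δ :=
    h.smooth_ζ.continuousAt.abs.eventually_lt_const (by simpa [hζ0] using hδ)
  have hx : ∀ᶠ p : Eu n × Eu n in 𝓝 (x₀, y₀), p.1 ∈ W₁ := continuousAt_fst.eventually hW₁
  have hyt : ∀ᶠ p : Eu n × Eu n in 𝓝 (x₀, y₀), p.2 ∈ ψ.target := continuousAt_snd.eventually htgt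
  filter_upwards [hn2, hn3, hb, hn5, hx, h.char_zero, hyt] with p h2 h3 hpb h5 hpx hch hpt C hC hΓC
  set q := ψ.symm p.2 with hq
  have hψq : ψ q = p.2 := ψ.right_inv hpt
  -- upper bound
  have hup : gdist g q (ψ.symm (Γ (0, p))) ≤ ENNReal.ofReal |ζ p| := by
    have hseg : ∀ s : ℝ, |s| ≤ |ζ p| → (∃ u, HasDerivAt (fun s => Γ (s, p)) u s ∧
        metricChart g q₀ (Γ (s, p)) u u = 1) ∧ ContDiffAt ℝ ∞ Γ (s, p) ∧ Γ (s, p) ∈ ψ.target := by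
      intro s hs
      have h6 := hab (hball (by
        rw [dist_zero_right, Real.norm_eq_abs]; exact hs.trans_lt h5)) hpb
      exact ⟨h6.1.1, h6.1.2, h6.2⟩
    have hpath : ∀ a b : ℝ, a ≤ b → (∀ s ∈ Icc a b, |s| ≤ |ζ p|) →
        gdist g (ψ.symm (Γ (a, p))) (ψ.symm (Γ (b, p))) ≤ ENNReal.ofReal (b - a) := by
      intro a b hab' hsab
      refine gdist_le_of_unit_speed (γ := fun s => ψ.symm (Γ (s, p))) hab'
        (u := fun s => chartVec q₀ (Γ (s, p)) (deriv (fun s => Γ (s, p)) s)) ?_ ?_ ?_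
      · intro s hs
        obtain ⟨-, h7, h8⟩ := hseg s (hsab s hs)
        have h9 : ContDiffAt ℝ 1 (fun s : ℝ => Γ (s, p)) s :=
          (h7.of_le (by simp)).comp s (contDiffAt_id.prodMk contDiffAt_const)
        have h10 : ContMDiffAt 𝓘(ℝ, Eu n) (𝓡 n) 1 ψ.symm (Γ (s, p)) :=
          (contMDiffOn_extChartAt_symm q₀).contMDiffAt ((isOpen_extChartAt_target q₀).mem_nhds h8)
        exact (h10.comp s h9.contMDiffAt).contMDiffWithinAt
      · intro s hs
        obtain ⟨⟨u, h7, -⟩, -, h8⟩ := hseg s (hsab s hs)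
        have h9 := HasMFDerivAt.comp s (hasMFDerivAt_chart_symm q₀ h8)
          h7.hasFDerivAt.hasMFDerivAt
        rw [h7.deriv]
        refine h9.congr_mfderiv ?_
        ext1
        change chartVec q₀ (Γ (s, p)) ((1 : ℝ) • u) = (1 : ℝ) • chartVec q₀ (Γ (s, p)) u
        rw [one_smul, one_smul]
      · intro s hs
        obtain ⟨⟨u, h7, h8⟩, -, -⟩ := hseg s (hsab s hs)
        rw [h7.deriv]
        exact h8
    have hend : ψ.symm (Γ (ζ p, p)) = q := by rw [hch.2]
    rcases le_total 0 (ζ p) with h6 | h6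
    · have h7 := hpath 0 (ζ p) h6 fun s hs => by
        rw [abs_of_nonneg hs.1, abs_of_nonneg h6]; exact hs.2
      rw [hend, sub_zero, gdist_comm] at h7
      rwa [abs_of_nonneg h6]
    · have h7 := hpath (ζ p) 0 h6 fun s hs => by
        rw [abs_of_nonpos hs.2, abs_of_nonpos h6]; linarith [hs.1]
      rw [hend, zero_sub] at h7
      rwa [abs_of_nonpos h6]
  -- lower bound
  have hlow : ∀ q' ∈ C, ENNReal.ofReal |ζ p| ≤ gdist g q q' := by
    intro q' hq'
    by_contra! hlt
    obtain ⟨γ, hγ0, hγ1, hγ, hlen, hstay⟩ := exists_path_of_gdist_lt hlt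
    have hin : ∀ t ∈ Icc (0 : ℝ) 1, γ t ∈ ψ.source ∧ ψ (γ t) ∈ W₂ := by
      intro t ht
      have h6 : gdist g q₀ (γ t) < c := by
        refine (gdist_triangle q₀ q (γ t)).trans_lt ?_
        rw [← ENNReal.add_halves c]
        exact ENNReal.add_lt_add h2 ((hstay t ht).trans h3)
      have h7 := hcs _ h6
      exact ⟨h7.1, h7.2.1⟩
    have hloc : ∀ y ∈ W₂, SmoothNear ζ (p.1, y) ∧ _ := fun y hy =>
      hW (show (p.1, y) ∈ W₁ ×ˢ W₂ from ⟨hpx, hy⟩)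
    have h6 := ofReal_abs_sub_le_length (g := g) (c := q₀) (F := fun y => ζ (p.1, y)) (W := W₂)
      (fun y hy => (hloc y hy).1.slice.contDiffAt.of_le (by simp)) (fun y hy v => by
        obtain ⟨h7, h8⟩ := (hloc y hy).2
        rw [← h7]
        refine Real.abs_le_sqrt ?_
        -- the Cauchy-Schwarz inequality
        have hyv : ∀ u, 0 ≤ metricChart g q₀ y u u := fun u => by
          by_cases hu : chartVec q₀ y u = 0
          · rw [metricChart_apply, hu]; simp
          · exact (innerAt_pos g _ _ hu).le
        have h9 := hyv (v - metricChart g q₀ y (N (p.1, y)) v • N (p.1, y))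
        simp only [map_sub, map_smul, sub_apply, smul_apply, smul_eq_mul, h8,
          metricChart_symm g q₀ y v (N (p.1, y))] at h9
        nlinarith) hγ hin
    have h7 : ζ (p.1, ψ q) = ζ p := by rw [hψq]
    rw [hγ0, hγ1] at h6
    have h8 : ζ (p.1, ψ q') = 0 := (hC q' hq').2
    have h6 : ENNReal.ofReal |ζ (p.1, ψ q') - ζ (p.1, ψ q)| ≤ _ := h6
    rw [h8, h7, zero_sub, abs_neg] at h6
    exact absurd (h6.trans_lt hlen) (lt_irrefl _)
  have heq : (⨅ y ∈ C, gdist g q y) = ENNReal.ofReal |ζ p| :=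
    le_antisymm ((iInf₂_le _ hΓC).trans hup) (le_iInf₂ hlow)
  rw [distTo, heq, ENNReal.toReal_ofReal (abs_nonneg _)]

end DistanceToCaustic

/-! ### Polar coordinates -/

section PolarCoordinates

variable {V : Type} [NormedAddCommGroup V] [NormedSpace ℝ V] [FiniteDimensional ℝ V]
  [MeasurableSpace V] [BorelSpace V] [Nontrivial V]

/-- Polar coordinates for nonnegative functions and the unit sphere of a positively homogeneous
function `ν`, whose surface measure is defined by the volumes of cones. -/
lemma lintegral_polar (μ : Measure V) [μ.IsAddHaarMeasure] {ν : V → ℝ} (hν : Continuous ν)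
    (hpos : ∀ v, v ≠ 0 → 0 < ν v) (hsmul : ∀ (t : ℝ) v, 0 < t → ν (t • v) = t * ν v)
    {F : V → ℝ≥0∞} (hF : Measurable F) :
    ∫⁻ θ, (∫⁻ t in Ioi (0 : ℝ), ENNReal.ofReal (t ^ (Module.finrank ℝ V - 1)) * F (t • θ))
      ∂((Module.finrank ℝ V : ℝ≥0∞) •
        Measure.map (fun v => (ν v)⁻¹ • v) (μ.restrict {v | ν v < 1})) = ∫⁻ v, F v ∂μ := by
  set d := Module.finrank ℝ V with hd
  have hd0 : 0 < d := Module.finrank_pos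
  have hne : ∀ᵐ v ∂μ, v ≠ 0 := by
    refine (measure_eq_zero_iff_ae_notMem.1 (measure_singleton (μ := μ) (0 : V))).mono ?_
    intro v hv h; exact hv h
  have hνm : Measurable ν := hν.measurable
  have hm1 : Measurable fun v => (ν v)⁻¹ • v := hνm.inv.smul measurable_id
  have hset : MeasurableSet {v | ν v < 1} := measurableSet_lt hνm measurable_const
  have hmF : Measurable fun x : V × ℝ => ENNReal.ofReal (x.2 ^ (d - 1)) * F (x.2 • x.1) :=
    (measurable_snd.pow_const _).ennreal_ofReal.mul (hF.comp (measurable_snd.smul measurable_fst))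
  rw [lintegral_smul_measure, lintegral_map (Measurable.lintegral_prod_right' hmF) hm1]
  -- the substitution `t = ν v * r` in the radial integral
  have h2 : ∀ v, v ≠ 0 → ∫⁻ t in Ioi (0 : ℝ), ENNReal.ofReal (t ^ (d - 1)) * F (t • (ν v)⁻¹ • v) =
      ∫⁻ r in Ioi (0 : ℝ), ENNReal.ofReal (ν v ^ d * r ^ (d - 1)) * F (r • v) := by
    intro v hv
    have hc := hpos v hv
    have hmG : Measurable fun t : ℝ => (Ioi (0 : ℝ)).indicator
        (fun t => ENNReal.ofReal (t ^ (d - 1)) * F (t • (ν v)⁻¹ • v)) t :=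
      ((measurable_id.pow_const _).ennreal_ofReal.mul
        (hF.comp (measurable_id.smul_const _))).indicator measurableSet_Ioi
    have h3 := lintegral_map (μ := volume) hmG (measurable_const_mul (ν v))
    rw [Real.map_volume_mul_left hc.ne', lintegral_smul_measure] at h3
    rw [← lintegral_indicator measurableSet_Ioi, ← lintegral_indicator measurableSet_Ioi]
    have h4 : ENNReal.ofReal (ν v) * ENNReal.ofReal |(ν v)⁻¹| = 1 := by
      rw [← ENNReal.ofReal_mul hc.le, abs_of_pos (inv_pos.2 hc), mul_inv_cancel₀ hc.ne',
        ENNReal.ofReal_one]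
    rw [← one_mul (∫⁻ t, (Ioi (0 : ℝ)).indicator _ t), ← h4, mul_assoc]
    rw [smul_eq_mul] at h3
    rw [h3, ← lintegral_const_mul' _ _ ENNReal.ofReal_ne_top]
    refine lintegral_congr fun r => ?_
    by_cases hr : 0 < r
    · rw [indicator_of_mem (mem_Ioi.2 (mul_pos hc hr)), indicator_of_mem (mem_Ioi.2 hr),
        ← mul_assoc, ← ENNReal.ofReal_mul hc.le]
      congr 2
      · obtain ⟨k, hk⟩ : ∃ k, d = k + 1 := ⟨d - 1, by omega⟩
        rw [hk, Nat.add_sub_cancel]; ring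
      · rw [smul_smul]; congr 1; field_simp
    · have hr' : ¬ 0 < ν v * r := fun h => hr ((mul_pos_iff_of_pos_left hc).1 h)
      rw [indicator_of_notMem (s := Ioi (0 : ℝ)) (a := ν v * r) hr',
        indicator_of_notMem (s := Ioi (0 : ℝ)) (a := r) hr, mul_zero]
  have hmF2 : Measurable fun x : V × ℝ =>
      ENNReal.ofReal (ν x.1 ^ d * x.2 ^ (d - 1)) * F (x.2 • x.1) :=
    ((hνm.comp measurable_fst).pow_const _ |>.mul (measurable_snd.pow_const _)).ennreal_ofReal.mul
      (hF.comp (measurable_snd.smul measurable_fst))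
  rw [lintegral_congr_ae (ae_restrict_of_ae (hne.mono h2)),
    lintegral_lintegral_swap hmF2.aemeasurable]
  -- the substitution `u = r • v` in the integral over the cone
  have h5 : ∀ r ∈ Ioi (0 : ℝ), ∫⁻ v in {v | ν v < 1},
      ENNReal.ofReal (ν v ^ d * r ^ (d - 1)) * F (r • v) ∂μ =
      ∫⁻ u, {u : V | ν u < r}.indicator
        (fun u => ENNReal.ofReal (ν u ^ d * r ^ (-(d : ℝ) - 1)) * F u) u ∂μ := by
    intro r hr
    have hr : 0 < r := hr
    set G : V → ℝ≥0∞ := {u : V | ν u < r}.indicator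
        (fun u => ENNReal.ofReal ((ν u / r) ^ d * r ^ (d - 1)) * F u) with hG
    have hGm : Measurable G := ((((hνm.div_const _).pow_const _).mul_const _).ennreal_ofReal.mul
      hF).indicator (measurableSet_lt hνm measurable_const)
    have h6 := lintegral_map (μ := μ) hGm (measurable_const_smul r)
    rw [Measure.map_addHaar_smul μ hr.ne', lintegral_smul_measure, ← hd, smul_eq_mul,
      ← lintegral_const_mul' _ _ ENNReal.ofReal_ne_top] at h6
    rw [← lintegral_indicator hset]
    calc _ = ∫⁻ v, G (r • v) ∂μ := lintegral_congr fun v => by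
          have h7 : ν (r • v) < r ↔ ν v < 1 := by
            rw [hsmul r v hr]; constructor
            · intro h; nlinarith
            · intro h; nlinarith
          by_cases hv : ν v < 1
          · rw [hG, indicator_of_mem (by exact hv), indicator_of_mem (by exact h7.2 hv),
              hsmul r v hr, mul_div_cancel_left₀ _ hr.ne']
          · rw [hG, indicator_of_notMem (by exact hv), indicator_of_notMem]
            exact fun h => hv (h7.1 h)
      _ = _ := by
          rw [← h6]
          refine lintegral_congr fun u => ?_
          by_cases hu : ν u < r
          · rw [hG, indicator_of_mem (by exact hu), indicator_of_mem (by exact hu), ← mul_assoc,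
              ← ENNReal.ofReal_mul (abs_nonneg _)]
            congr 2
            rw [abs_of_pos (by positivity), div_pow, Real.rpow_sub hr, Real.rpow_neg hr.le,
              Real.rpow_natCast, Real.rpow_one]
            obtain ⟨k, hk⟩ : ∃ k, d = k + 1 := ⟨d - 1, by omega⟩
            rw [hk, Nat.add_sub_cancel]; field_simp; ring
          · rw [hG, indicator_of_notMem (by exact hu), indicator_of_notMem (by exact hu), mul_zero]
  rw [setLIntegral_congr_fun measurableSet_Ioi h5]
  have hmF3 : Measurable fun x : ℝ × V => {u : V | ν u < x.1}.indicator
      (fun u => ENNReal.ofReal (ν u ^ d * x.1 ^ (-(d : ℝ) - 1)) * F u) x.2 := by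
    have h7 : MeasurableSet {x : ℝ × V | ν x.2 < x.1} :=
      measurableSet_lt (hνm.comp measurable_snd) measurable_fst
    have h8 : Measurable fun x : ℝ × V =>
        ENNReal.ofReal (ν x.2 ^ d * x.1 ^ (-(d : ℝ) - 1)) * F x.2 :=
      (((hνm.comp measurable_snd).pow_const _).mul
        (measurable_fst.pow_const _)).ennreal_ofReal.mul (hF.comp measurable_snd)
    exact h8.indicator h7
  rw [lintegral_lintegral_swap hmF3.aemeasurable, smul_eq_mul,
    ← lintegral_const_mul' _ _ (ENNReal.natCast_ne_top d)]
  refine lintegral_congr_ae (hne.mono fun u hu => ?_)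
  have hc := hpos u hu
  have h9 : ∫⁻ r in Ioi (0 : ℝ), {u : V | ν u < r}.indicator
      (fun u => ENNReal.ofReal (ν u ^ d * r ^ (-(d : ℝ) - 1)) * F u) u =
      ∫⁻ r in Ioi (ν u), ENNReal.ofReal (ν u ^ d * r ^ (-(d : ℝ) - 1)) * F u := by
    rw [← lintegral_indicator measurableSet_Ioi, ← lintegral_indicator measurableSet_Ioi]
    refine lintegral_congr fun r => ?_
    by_cases hr : ν u < r
    · rw [indicator_of_mem (mem_Ioi.2 (hc.trans hr)), indicator_of_mem (mem_Ioi.2 hr),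
        indicator_of_mem (by exact hr)]
    · rw [indicator_of_notMem (s := Ioi (ν u)) (by simpa using hr)]
      by_cases h0 : 0 < r
      · rw [indicator_of_mem (mem_Ioi.2 h0), indicator_of_notMem (by exact hr)]
      · rw [indicator_of_notMem (by simpa using h0)]
  have hlt : -(d : ℝ) - 1 < -1 := by
    have : (0 : ℝ) < d := by exact_mod_cast hd0
    linarith
  have h10 : ∫⁻ r in Ioi (ν u), ENNReal.ofReal (ν u ^ d * r ^ (-(d : ℝ) - 1)) =
      ENNReal.ofReal (1 / d) := by
    rw [← ofReal_integral_eq_lintegral_ofReal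
      ((integrableOn_Ioi_rpow_of_lt hlt hc).const_mul _)]
    · rw [integral_const_mul, integral_Ioi_rpow_of_lt hlt hc]
      congr 1
      rw [sub_add_cancel, Real.rpow_neg hc.le, Real.rpow_natCast]
      have : (d : ℝ) ≠ 0 := by exact_mod_cast hd0.ne'
      field_simp
    · refine (ae_restrict_iff' measurableSet_Ioi).2 (ae_of_all _ fun r hr => ?_)
      have : 0 < r := hc.trans hr
      simp only [Pi.zero_apply]
      positivity
  simp only
  rw [h9, lintegral_mul_const _ (by fun_prop), h10, ← mul_assoc, ← ENNReal.ofReal_natCast,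
    ← ENNReal.ofReal_mul (Nat.cast_nonneg d), mul_one_div_cancel (by exact_mod_cast hd0.ne'),
    ENNReal.ofReal_one, one_mul]

/-- Polar coordinates for integrable functions. -/
lemma integral_polar (μ : Measure V) [μ.IsAddHaarMeasure] {ν : V → ℝ} (hν : Continuous ν)
    (hpos : ∀ v, v ≠ 0 → 0 < ν v) (hsmul : ∀ (t : ℝ) v, 0 < t → ν (t • v) = t * ν v)
    {H : V → ℂ} (hH : Integrable H μ) :
    ∫ θ, (∫ t in Ioi (0 : ℝ), ((t ^ (Module.finrank ℝ V - 1) : ℝ) : ℂ) * H (t • θ))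
      ∂((Module.finrank ℝ V : ℝ≥0∞) •
        Measure.map (fun v => (ν v)⁻¹ • v) (μ.restrict {v | ν v < 1})) = ∫ v, H v ∂μ := by
  set d := Module.finrank ℝ V with hd
  set σ : Measure V := (d : ℝ≥0∞) •
        Measure.map (fun v => (ν v)⁻¹ • v) (μ.restrict {v | ν v < 1}) with hσ
  set τ : Measure ℝ := (volume.restrict (Ioi (0 : ℝ))).withDensity
    fun t => ENNReal.ofReal (t ^ (d - 1)) with hτ
  have hτm : Measurable fun t : ℝ => ENNReal.ofReal (t ^ (d - 1)) :=
    (measurable_id.pow_const _).ennreal_ofReal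
  have hΦ : Measurable fun x : V × ℝ => x.2 • x.1 := measurable_snd.smul measurable_fst
  have hmap : Measure.map (fun x : V × ℝ => x.2 • x.1) (σ.prod τ) = μ := by
    refine Measure.ext_of_lintegral _ fun F hF => ?_
    rw [lintegral_map hF hΦ,
      lintegral_prod (fun x : V × ℝ => F (x.2 • x.1)) (hF.comp hΦ).aemeasurable,
      ← lintegral_polar μ hν hpos hsmul hF]
    refine lintegral_congr fun θ => ?_
    rw [hτ, lintegral_withDensity_eq_lintegral_mul _ hτm
      (g := fun t : ℝ => F (t • θ)) (hF.comp (measurable_id.smul_const θ))]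
    rfl
  have hHm : AEStronglyMeasurable H (Measure.map (fun x : V × ℝ => x.2 • x.1) (σ.prod τ)) := by
    rw [hmap]; exact hH.1
  have hint : Integrable (fun x : V × ℝ => H (x.2 • x.1)) (σ.prod τ) := by
    have := hH
    rw [← hmap] at this
    exact (integrable_map_measure hHm hΦ.aemeasurable).1 this
  have h1 : ∫ v, H v ∂μ = ∫ x : V × ℝ, H (x.2 • x.1) ∂(σ.prod τ) := by
    rw [← integral_map hΦ.aemeasurable hHm, hmap]
  rw [h1, integral_prod _ hint]
  refine integral_congr_ae (ae_of_all _ fun θ => ?_)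
  change (∫ t in Ioi (0 : ℝ), ((t ^ (d - 1) : ℝ) : ℂ) * H (t • θ)) = ∫ t, H (t • θ) ∂τ
  rw [hτ, integral_withDensity_eq_integral_toReal_smul hτm (ae_of_all _ fun t => by simp)]
  refine setIntegral_congr_fun measurableSet_Ioi fun t ht => ?_
  have ht : 0 < t := ht
  rw [ENNReal.toReal_ofReal (by positivity), Complex.real_smul]

end PolarCoordinates

/-! ### The operator as an integral over the tangent space -/

section FibreIntegral

variable {n : ℕ} {M : Type*} [TopologicalSpace M] [ChartedSpace (Eu n) M] [IsManifold (𝓡 n) ∞ M]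
  {g : RiemMetric n M} {D O : Set (TangentBundle (𝓡 n) M)} {exp : TangentBundle (𝓡 n) M → M}
  {κs κ : TangentBundle (𝓡 n) M → ℂ}

lemma gnorm_pos (g : RiemMetric n M) (p : M) {v : Eu n} (hv : v ≠ 0) : 0 < gnorm g p v :=
  Real.sqrt_pos.2 (innerAt_pos g p v hv)

lemma gnorm_smul (g : RiemMetric n M) (p : M) (t : ℝ) (v : Eu n) (ht : 0 < t) :
    gnorm g p (t • v) = t * gnorm g p v := by
  have h1 : ip g p (t • v) (t • v) = t ^ 2 * ip g p v v := by
    change innerAt g p (t • v) (t • v) = t ^ 2 * innerAt g p v v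
    simp only [map_smul, smul_apply, smul_eq_mul]; ring
  rw [gnorm, h1, Real.sqrt_mul (sq_nonneg t), Real.sqrt_sq ht.le, gnorm]

lemma continuous_gnorm (g : RiemMetric n M) (p : M) : Continuous (gnorm g p) := by
  have h1 : Continuous fun v : Eu n => innerAt g p v v :=
    (innerAt g p).continuous.clm_apply continuous_id
  exact Real.continuous_sqrt.comp h1

lemma isAddHaarMeasure_fibreVolume (g : RiemMetric n M) (p : M) :
    (fibreVolume g p).IsAddHaarMeasure :=
  Measure.IsAddHaarMeasure.smul _
    (by simpa using fibreDet_pos g p) ENNReal.ofReal_ne_top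

lemma continuous_fibre (p : M) : Continuous fun v : Eu n => (⟨p, v⟩ : TangentBundle (𝓡 n) M) :=
  FiberBundle.continuous_totalSpaceMk (Eu n) (TangentSpace (𝓡 n) : M → Type) p

lemma ae_gnorm_eq_one (g : RiemMetric n M) (hn : 0 < n) (p : M) :
    ∀ᵐ θ ∂(sphereMeasure g p), gnorm g p θ = 1 := by
  have _ := isAddHaarMeasure_fibreVolume g p
  have _ : Nonempty (Fin n) := ⟨⟨0, hn⟩⟩
  have hm : Measurable (gnorm g p) := (continuous_gnorm g p).measurable
  refine Measure.ae_smul_measure ?_ _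
  refine (ae_map_iff (hm.inv.smul measurable_id).aemeasurable
    (measurableSet_eq_fun hm measurable_const)).2 (ae_restrict_of_ae ?_)
  refine (measure_eq_zero_iff_ae_notMem.1
    (measure_singleton (μ := fibreVolume g p) (0 : Eu n))).mono fun v hv => ?_
  have h := gnorm_pos g p (v := v) (fun h => hv h)
  change gnorm g p ((gnorm g p v)⁻¹ • v) = 1
  rw [gnorm_smul g p _ _ (inv_pos.2 h), inv_mul_cancel₀ h.ne']

/-- The chain rule for the velocity of a reparametrized geodesic. Differentiability is not needed:
if one side is not differentiable, then neither is the other, and both velocities are zero. -/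
lemma velocity_smul_snd (exp : TangentBundle (𝓡 n) M → M) (p : M) (θ : Eu n) {t : ℝ} (ht : t ≠ 0) :
    ((velocity exp p (t • θ) 1).2 : Eu n) = t • ((velocity exp p θ t).2 : Eu n) := by
  set γ : ℝ → M := fun s => expAt exp p (s • θ) with hγ
  have hfun : (fun s : ℝ => expAt exp p (s • t • θ)) = γ ∘ fun s => s * t := by
    ext s; simp only [hγ, Function.comp, smul_smul]
  have hfun' : γ = (γ ∘ fun s => s * t) ∘ fun s => s * t⁻¹ := by
    ext s; simp only [Function.comp, mul_assoc, inv_mul_cancel₀ ht, mul_one]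
  have hlin : ∀ c s : ℝ, HasMFDerivAt 𝓘(ℝ, ℝ) 𝓘(ℝ, ℝ) (fun s : ℝ => s * c) s
      ((1 : ℝ →L[ℝ] ℝ).smulRight c) := fun c s =>
    ((hasFDerivAt_id (𝕜 := ℝ) s).smul_const c).hasMFDerivAt
  change (mfderiv 𝓘(ℝ, ℝ) (𝓡 n) (fun s : ℝ => expAt exp p (s • t • θ)) 1 (1 : ℝ) : Eu n) =
    t • (mfderiv 𝓘(ℝ, ℝ) (𝓡 n) γ t (1 : ℝ) : Eu n)
  rw [hfun]
  by_cases hd : MDifferentiableAt 𝓘(ℝ, ℝ) (𝓡 n) γ t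
  · have h1 : HasMFDerivAt 𝓘(ℝ, ℝ) (𝓡 n) γ ((1 : ℝ) * t) (mfderiv 𝓘(ℝ, ℝ) (𝓡 n) γ t) := by
      rw [one_mul]; exact hd.hasMFDerivAt
    rw [(HasMFDerivAt.comp (1 : ℝ) h1 (hlin t 1)).mfderiv]
    change (mfderiv 𝓘(ℝ, ℝ) (𝓡 n) γ t : ℝ →L[ℝ] Eu n) ((1 : ℝ) • t) = _
    rw [one_smul]
    have h2 : ∀ L : ℝ →L[ℝ] Eu n, L t = t • L 1 := fun L => by
      rw [← map_smul, smul_eq_mul, mul_one]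
    exact h2 _
  · -- neither curve is differentiable, and both derivatives are `0` by convention
    have hd' : ¬ MDifferentiableAt 𝓘(ℝ, ℝ) (𝓡 n) (γ ∘ fun s => s * t) 1 := fun h => by
      apply hd
      rw [hfun']
      refine MDifferentiableAt.comp t ?_ (hlin t⁻¹ t).mdifferentiableAt
      rwa [mul_inv_cancel₀ ht]
    rw [mfderiv_zero_of_not_mdifferentiableAt hd, mfderiv_zero_of_not_mdifferentiableAt hd']
    change (0 : Eu n) = t • (0 : Eu n)
    rw [smul_zero]

/-- Along the ray of a unit vector the weights of `N` and the Jacobian of polar coordinates combine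
to `W_Σ`. -/
lemma pow_mul_weightSigma {p : M} {θ : Eu n} (hθ : gnorm g p θ = 1) {t : ℝ} (ht : 0 < t)
    (hn : 0 < n) :
    ((t ^ (n - 1) : ℝ) : ℂ) * weightSigma g exp κs κ ⟨p, t • θ⟩ =
      κs ⟨p, θ⟩ * κ (velocity exp p θ t) := by
  have h1 : gnorm g p (t • θ) = t := by rw [gnorm_smul g p t θ ht, hθ, mul_one]
  have h2 : t⁻¹ • t • θ = θ := inv_smul_smul₀ ht.ne' θ
  have h3 : (⟨expAt exp p (t • θ), t⁻¹ • (velocity exp p (t • θ) 1).2⟩ : TangentBundle (𝓡 n) M) =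
      velocity exp p θ t := by
    have h4 : (t⁻¹ • ((velocity exp p (t • θ) 1).2 : Eu n) : Eu n) = (velocity exp p θ t).2 := by
      refine (congrArg (fun w : Eu n => t⁻¹ • w) (velocity_smul_snd exp p θ ht.ne')).trans ?_
      exact inv_smul_smul₀ (β := Eu n) ht.ne' _
    exact congrArg (fun w : Eu n => (⟨expAt exp p (t • θ), w⟩ : TangentBundle (𝓡 n) M)) h4
  have h5 : (t ^ (n - 1) : ℝ) * t ^ (1 - (n : ℤ)) = 1 := by
    rw [← zpow_natCast, ← zpow_add₀ ht.ne', Nat.cast_sub hn]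
    simp
  simp only [weightSigma]
  change ((t ^ (n - 1) : ℝ) : ℂ) * (((gnorm g p (t • θ) ^ (1 - (n : ℤ)) : ℝ) : ℂ) *
    κs ⟨p, (gnorm g p (t • θ))⁻¹ • t • θ⟩ *
    κ ⟨expAt exp p (t • θ), (gnorm g p (t • θ))⁻¹ • (velocity exp p (t • θ) 1).2⟩) = _
  rw [h1, h2, h3, ← mul_assoc, ← mul_assoc, ← Complex.ofReal_mul, h5, Complex.ofReal_one, one_mul]

/-- The part of `N` near `(p₀, v₀)` as an integral over the tangent space. -/
theorem normalOp_timesIn_eq (hn : 0 < n) (hO : IsOpen O) (f : M → ℂ) (p : M)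
    (hint : IntegrableOn (fun v : Eu n => weightSigma g exp κs κ ⟨p, v⟩ * f (expAt exp p v))
      {v : Eu n | (⟨p, v⟩ : TangentBundle (𝓡 n) M) ∈ O} (fibreVolume g p)) :
    normalOp g exp κs κ (timesIn O) f p =
      ∫ v in {v : Eu n | (⟨p, v⟩ : TangentBundle (𝓡 n) M) ∈ O},
        weightSigma g exp κs κ ⟨p, v⟩ * f (expAt exp p v) ∂(fibreVolume g p) := by
  have _ := isAddHaarMeasure_fibreVolume g p
  have _ : Nonempty (Fin n) := ⟨⟨0, hn⟩⟩
  have hOp : IsOpen {v : Eu n | (⟨p, v⟩ : TangentBundle (𝓡 n) M) ∈ O} :=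
    hO.preimage (continuous_fibre p)
  have h1 := integral_polar (fibreVolume g p) (continuous_gnorm g p) (fun v => gnorm_pos g p)
    (gnorm_smul g p) ((integrable_indicator_iff hOp.measurableSet).2 hint)
  rw [integral_indicator hOp.measurableSet, finrank_euclideanSpace_fin] at h1
  rw [← h1, normalOp]
  refine integral_congr_ae ((ae_gnorm_eq_one g hn p).mono fun θ hθ => ?_)
  have hT : MeasurableSet (timesIn O p θ) :=
    (isOpen_Ioi.inter (hOp.preimage (continuous_id.smul continuous_const))).measurableSet
  simp only [xray]
  rw [← integral_const_mul, ← integral_indicator hT, ← integral_indicator measurableSet_Ioi]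
  refine integral_congr_ae (ae_of_all _ fun t => ?_)
  by_cases ht : 0 < t
  · by_cases hO' : (⟨p, t • θ⟩ : TangentBundle (𝓡 n) M) ∈ O
    · rw [indicator_of_mem (show t ∈ timesIn O p θ from ⟨ht, hO'⟩), indicator_of_mem (mem_Ioi.2 ht),
        indicator_of_mem (show t • θ ∈ {v : Eu n | (⟨p, v⟩ : TangentBundle (𝓡 n) M) ∈ O} from hO'),
        ← mul_assoc, ← mul_assoc, pow_mul_weightSigma hθ ht hn]
    · rw [indicator_of_notMem (fun h : t ∈ timesIn O p θ => hO' h.2),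
        indicator_of_mem (mem_Ioi.2 ht), indicator_of_notMem (by exact hO'), mul_zero]
  · rw [indicator_of_notMem (fun h : t ∈ timesIn O p θ => ht h.1),
      indicator_of_notMem (s := Ioi (0 : ℝ)) ht]

/-- For localized weights, the operator over the maximal time intervals agrees with its part near
`(p₀, v₀)`. -/
theorem normalOp_maxTimes_eq (hn : 0 < n) (hD : IsOpen D) (hOD : O ⊆ D) {p₀ q₀ : M}
    (hloc : WeightsLocalized g D exp κs κ O p₀ q₀) :
    ∃ U ∈ 𝓝 p₀, ∃ V ∈ 𝓝 q₀, ∀ f : M → ℂ, (∀ q, f q ≠ 0 → q ∈ V) → ∀ p ∈ U,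
      normalOp g exp κs κ (maxTimes D) f p = normalOp g exp κs κ (timesIn O) f p := by
  have h0 := hloc
  rw [WeightsLocalized, nhds_prod_eq] at h0
  obtain ⟨U, hU, V, hV, hUV⟩ := mem_prod_iff.1 h0
  refine ⟨U, hU, V, hV, fun f hf p hp => ?_⟩
  rw [normalOp, normalOp]
  refine integral_congr_ae ((ae_gnorm_eq_one g hn p).mono fun θ hθ => ?_)
  have hT : MeasurableSet (maxTimes D p θ) :=
    (hD.preimage ((continuous_fibre p).comp
      (continuous_id.smul continuous_const : Continuous fun t : ℝ => t • θ))).measurableSet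
  simp only [xray]
  rw [← integral_const_mul, ← integral_const_mul]
  refine (setIntegral_eq_of_subset_of_forall_sdiff_eq_zero hT (fun t ht => hOD ht.2) ?_)
  intro t ht
  by_contra hne
  rw [← mul_assoc] at hne
  have h1 : (p, expAt exp p (t • θ)) ∈ U ×ˢ V := ⟨hp, hf _ (right_ne_zero_of_mul hne)⟩
  exact ht.2 (hUV h1 θ t hθ ht.1 rfl (left_ne_zero_of_mul hne))

end FibreIntegral

/-! ### Volumes and weights in charts -/

section VolumeWeights

variable {n : ℕ} {M : Type*} [TopologicalSpace M] [ChartedSpace (Eu n) M] [IsManifold (𝓡 n) ∞ M]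
  {g : RiemMetric n M} {D : Set (TangentBundle (𝓡 n) M)} {exp : TangentBundle (𝓡 n) M → M}
  {κs κ : TangentBundle (𝓡 n) M → ℂ} {p₀ q₀ : M}

/-- The volume of `T_pM` in the linear coordinates given by the preferred chart at `c`. -/
lemma fibreVolume_eq_map (g : RiemMetric n M) (c : M) {x : Eu n}
    (hx : x ∈ (extChartAt (𝓡 n) c).target) :
    fibreVolume g ((extChartAt (𝓡 n) c).symm x) =
      Measure.map (chartVec c x) (ENNReal.ofReal (Real.sqrt (coordDet g c x)) • volume) := by
  obtain ⟨e, he⟩ := isInvertible_chartVec c hx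
  have hdet : (chartVec c x).det ≠ 0 := by
    rw [← he]; exact (LinearEquiv.isUnit_det' e.toLinearEquiv).ne_zero
  have h1 := Measure.map_linearMap_addHaar_eq_smul_addHaar
    (volume : Measure (Eu n)) (f := (chartVec c x : Eu n →ₗ[ℝ] Eu n)) hdet
  have h2 : Measure.map (chartVec c x) (volume : Measure (Eu n)) =
      ENNReal.ofReal |((chartVec c x).det)⁻¹| • volume := h1
  rw [Measure.map_smul, h2, smul_smul, fibreVolume, ← ENNReal.ofReal_mul (Real.sqrt_nonneg _),
    coordDet_eq_fibreDet, Real.sqrt_mul (sq_nonneg _), Real.sqrt_sq_eq_abs, abs_inv]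
  congr 2
  field_simp

section ChartVolume

variable [MeasurableSpace M] [BorelSpace M]

/-- Integration with respect to the Riemannian volume in a chart. -/
lemma integral_chartVolume (g : RiemMetric n M) (c : M) {h : M → ℂ}
    (hh : IntegrableOn (fun y => ((Real.sqrt (coordDet g c y) : ℝ) : ℂ) *
      h ((extChartAt (𝓡 n) c).symm y)) (extChartAt (𝓡 n) c).target) :
    Integrable h (chartVolume g c) ∧ ∫ q, h q ∂(chartVolume g c) =
      ∫ y in (extChartAt (𝓡 n) c).target, ((Real.sqrt (coordDet g c y) : ℝ) : ℂ) *
        h ((extChartAt (𝓡 n) c).symm y) := by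
  set ψ := extChartAt (𝓡 n) c with hψ
  have htm : MeasurableSet ψ.target := (isOpen_extChartAt_target c).measurableSet
  have hdens : AEMeasurable (fun y => ENNReal.ofReal (Real.sqrt (coordDet g c y)))
      (volume.restrict ψ.target) := by
    have h1 : ContinuousOn (fun y => coordDet g c y) ψ.target := fun y hy =>
      (smoothNear_coordDet g c hy).continuousAt.continuousWithinAt
    exact ((Real.continuous_sqrt.comp_continuousOn h1).aemeasurable htm).ennreal_ofReal
  have hfin : ∀ᵐ y ∂(volume.restrict ψ.target),
      ENNReal.ofReal (Real.sqrt (coordDet g c y)) < ⊤ := ae_of_all _ fun y => ENNReal.ofReal_lt_top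
  set μ : Measure (Eu n) := (volume.restrict ψ.target).withDensity
    fun y => ENNReal.ofReal (Real.sqrt (coordDet g c y)) with hμ
  have hac : μ ≪ volume.restrict ψ.target := withDensity_absolutelyContinuous _ _
  have hsymm : AEMeasurable ψ.symm μ :=
    ((continuousOn_extChartAt_symm c).aemeasurable htm).mono_ac hac
  have hmem : ∀ᵐ y ∂μ, y ∈ ψ.target := hac.ae_le (ae_restrict_mem htm)
  have hsmul : ∀ y, (ENNReal.ofReal (Real.sqrt (coordDet g c y))).toReal • h (ψ.symm y) =
      ((Real.sqrt (coordDet g c y) : ℝ) : ℂ) * h (ψ.symm y) := fun y => by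
    rw [ENNReal.toReal_ofReal (Real.sqrt_nonneg _), Complex.real_smul]
  have hint : Integrable (fun y => h (ψ.symm y)) μ := by
    rw [hμ, integrable_withDensity_iff_integrable_smul₀' hdens hfin]
    simp only [hsmul]
    exact hh
  have hsrc : ∀ᵐ q ∂(chartVolume g c), q ∈ ψ.source :=
    (ae_map_iff hsymm (isOpen_extChartAt_source c).measurableSet).2
      (hmem.mono fun y hy => ψ.map_target hy)
  have hψm : AEMeasurable ψ (chartVolume g c) := by
    rw [← Measure.restrict_eq_self_of_ae_mem hsrc]
    exact (continuousOn_extChartAt c).aemeasurable (isOpen_extChartAt_source c).measurableSet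
  have hmap : Measure.map ψ (chartVolume g c) = μ := by
    have h1 : Measure.map ψ (Measure.map ψ.symm μ) = Measure.map (ψ ∘ ψ.symm) μ :=
      AEMeasurable.map_map_of_aemeasurable hψm hsymm
    have h2 : ψ ∘ ψ.symm =ᵐ[μ] id := hmem.mono fun y hy => ψ.right_inv hy
    rw [chartVolume, h1, Measure.map_congr h2, Measure.map_id]
  have hmeas : AEStronglyMeasurable h (chartVolume g c) := by
    have h1 : AEStronglyMeasurable (fun y => h (ψ.symm y)) (Measure.map ψ (chartVolume g c)) := by
      rw [hmap]; exact hint.1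
    refine (h1.comp_aemeasurable hψm).congr (hsrc.mono fun q hq => ?_)
    simp only [Function.comp]
    rw [ψ.left_inv hq]
  refine ⟨(integrable_map_measure hmeas hsymm).2 hint, ?_⟩
  rw [chartVolume, integral_map hsymm hmeas,
    integral_withDensity_eq_integral_toReal_smul₀ hdens hfin]
  simp only [hsmul]

end ChartVolume

lemma smoothNear_comp_bundleChart (c : M)
    (hκ : ContMDiffOn (𝓡 n).tangent 𝓘(ℝ, ℂ) ∞ κ {x | x.2 ≠ 0}) {z : Eu n × Eu n}
    (hz : z.1 ∈ (extChartAt (𝓡 n) c).target) (hz0 : z.2 ≠ 0) :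
    SmoothNear (fun z => κ (bundleChart c z)) z := by
  have hs : {z : Eu n × Eu n | z.1 ∈ (extChartAt (𝓡 n) c).target ∧ z.2 ≠ 0} ∈ 𝓝 z :=
    (continuousAt_fst.eventually ((isOpen_extChartAt_target c).mem_nhds hz)).and
      (continuousAt_snd.eventually_ne hz0)
  refine SmoothNear.of_contDiffOn (s := {z : Eu n × Eu n |
    z.1 ∈ (extChartAt (𝓡 n) c).target ∧ z.2 ≠ 0}) hs ?_
  exact (hκ.comp ((contMDiffOn_bundleChart c).mono fun z hz => ⟨hz.1, trivial⟩)
    fun z hz => (bundleChart_snd_ne_zero hz.1).2 hz.2).contDiffOn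

/-- The weight `W_Σ` is a smooth function of the tangent vector. -/
lemma smoothNear_weightSigma (hexp : IsRegularExp D exp)
    (hκs : ContMDiffOn (𝓡 n).tangent 𝓘(ℝ, ℂ) ∞ κs {x | x.2 ≠ 0})
    (hκ : ContMDiffOn (𝓡 n).tangent 𝓘(ℝ, ℂ) ∞ κ {x | x.2 ≠ 0}) (hn : 0 < n) {z : Eu n × Eu n}
    (hz : z ∈ expDomain D exp p₀ q₀) :
    SmoothNear (fun z => weightSigma g exp κs κ (bundleChart p₀ z)) z := by
  set ρ : Eu n × Eu n → ℝ := fun z => Real.sqrt (metricChart g p₀ z.1 z.2 z.2) with hρ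
  have hpos := metricChart_pos g p₀ hz.1 z.2 hz.2.2.1
  have hG : SmoothNear (metricChart g p₀) z.1 :=
    SmoothNear.of_contDiffOn ((isOpen_extChartAt_target p₀).mem_nhds hz.1)
      (contDiffOn_metricChart g p₀)
  have hG' : SmoothNear (fun z : Eu n × Eu n => metricChart g p₀ z.1 z.2 z.2) z :=
    ((SmoothNear.comp (f := fun z : Eu n × Eu n => z.1) hG SmoothNear.fst).clm_apply
      SmoothNear.snd).clm_apply SmoothNear.snd
  have hρs : SmoothNear ρ z := hG'.sqrt hpos.ne'
  have hρ0 : 0 < ρ z := Real.sqrt_pos.2 hpos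
  have hρi : SmoothNear (fun z => (ρ z)⁻¹) z := hρs.inv hρ0.ne'
  have h1 : SmoothNear (fun z => κs (bundleChart p₀ (z.1, (ρ z)⁻¹ • z.2))) z := by
    refine SmoothNear.comp (g := fun z => κs (bundleChart p₀ z))
      (f := fun z : Eu n × Eu n => (z.1, (ρ z)⁻¹ • z.2)) ?_
      (SmoothNear.fst.prodMk (hρi.smul SmoothNear.snd))
    exact smoothNear_comp_bundleChart p₀ hκs hz.1 (smul_ne_zero (inv_ne_zero hρ0.ne') hz.2.2.1)
  have h2 : SmoothNear (fun z => κ (bundleChart q₀ (expCoord exp p₀ q₀ z,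
      (ρ z)⁻¹ • dexpCoord exp p₀ q₀ z z.2))) z := by
    refine SmoothNear.comp (g := fun z => κ (bundleChart q₀ z))
      (f := fun z : Eu n × Eu n => (expCoord exp p₀ q₀ z,
        (ρ z)⁻¹ • dexpCoord exp p₀ q₀ z z.2)) ?_
      ((smoothNear_expCoord hexp hz).prodMk
        (hρi.smul ((smoothNear_dexpCoord hexp hz).clm_apply SmoothNear.snd)))
    refine smoothNear_comp_bundleChart q₀ hκ (expCoord_mem_target hz)
      (smul_ne_zero (inv_ne_zero hρ0.ne') fun h0 => ?_)
    have h3 := hexp.velocity_ne_zero ((extChartAt (𝓡 n) p₀).symm z.1) (chartVec p₀ z.1 z.2) 1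
      ((bundleChart_snd_ne_zero hz.1).2 hz.2.2.1) (by rw [one_smul]; exact hz.2.1)
    have h4 : ∀ a b : TangentBundle (𝓡 n) M, a = b → (a.2 : Eu n) ≠ 0 → (b.2 : Eu n) ≠ 0 := by
      rintro a _ rfl h; exact h
    refine h4 _ _ (velocity_eq hexp hz) h3 ?_
    change chartVec q₀ _ (dexpCoord exp p₀ q₀ z z.2) = 0
    rw [h0, map_zero]
  have h3 : SmoothNear (fun z => (((ρ z ^ (n - 1))⁻¹ : ℝ) : ℂ)) z :=
    (SmoothNear.inv (a := fun z => ρ z ^ (n - 1)) (hρs.mono fun _ h => h.pow _)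
      (pow_ne_zero _ hρ0.ne')).ofReal
  refine ((h3.mul h1).mul h2).congr ?_
  filter_upwards [(isOpen_expDomain hexp).mem_nhds hz] with u hu'
  have hu : u ∈ expDomain D exp p₀ q₀ := hu'
  have h4 : (ρ u ^ (1 - (n : ℤ)) : ℝ) = (ρ u ^ (n - 1))⁻¹ := by
    rw [← zpow_natCast, ← zpow_neg, Nat.cast_sub hn]
    congr 1; simp
  have h5 : (⟨(extChartAt (𝓡 n) p₀).symm u.1, (ρ u)⁻¹ • chartVec p₀ u.1 u.2⟩ :
      TangentBundle (𝓡 n) M) = bundleChart p₀ (u.1, (ρ u)⁻¹ • u.2) := by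
    have : (ρ u)⁻¹ • chartVec p₀ u.1 u.2 = chartVec p₀ u.1 ((ρ u)⁻¹ • u.2) := (map_smul _ _ _).symm
    exact congrArg (fun w : Eu n =>
      (⟨(extChartAt (𝓡 n) p₀).symm u.1, w⟩ : TangentBundle (𝓡 n) M)) this
  have h6 : (⟨expAt exp ((extChartAt (𝓡 n) p₀).symm u.1) (chartVec p₀ u.1 u.2), (ρ u)⁻¹ •
      (velocity exp ((extChartAt (𝓡 n) p₀).symm u.1) (chartVec p₀ u.1 u.2) 1).2⟩ :
        TangentBundle (𝓡 n) M) = bundleChart q₀ (expCoord exp p₀ q₀ u,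
      (ρ u)⁻¹ • dexpCoord exp p₀ q₀ u u.2) := by
    have h7 : ∀ (a b : TangentBundle (𝓡 n) M) (r : ℝ), a = b →
        (⟨a.1, r • (a.2 : Eu n)⟩ : TangentBundle (𝓡 n) M) = ⟨b.1, r • (b.2 : Eu n)⟩ := by
      rintro a _ r rfl; rfl
    have h8 := h7 _ _ (ρ u)⁻¹ (velocity_eq hexp hu)
    have h9 : (velocity exp ((extChartAt (𝓡 n) p₀).symm u.1) (chartVec p₀ u.1 u.2) 1).1 =
        expAt exp ((extChartAt (𝓡 n) p₀).symm u.1) (chartVec p₀ u.1 u.2) := by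
      simp only [velocity, one_smul]
    have h10 : ∀ (q q' : M) (w : Eu n), q = q' →
      (⟨q, w⟩ : TangentBundle (𝓡 n) M) = ⟨q', w⟩ := by rintro q _ w rfl; rfl
    refine (h10 _ _ _ h9.symm).trans (h8.trans ?_)
    have h11 : (ρ u)⁻¹ • chartVec q₀ (expCoord exp p₀ q₀ u) (dexpCoord exp p₀ q₀ u u.2) =
        chartVec q₀ (expCoord exp p₀ q₀ u) ((ρ u)⁻¹ • dexpCoord exp p₀ q₀ u u.2) :=
      (map_smul _ _ _).symm
    exact congrArg (fun w : Eu n => (⟨(extChartAt (𝓡 n) q₀).symm (expCoord exp p₀ q₀ u), w⟩ :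
      TangentBundle (𝓡 n) M)) h11
  symm
  change ((ρ u ^ (1 - (n : ℤ)) : ℝ) : ℂ) *
    κs ⟨(extChartAt (𝓡 n) p₀).symm u.1, (ρ u)⁻¹ • chartVec p₀ u.1 u.2⟩ *
    κ ⟨expAt exp ((extChartAt (𝓡 n) p₀).symm u.1) (chartVec p₀ u.1 u.2), (ρ u)⁻¹ •
      (velocity exp ((extChartAt (𝓡 n) p₀).symm u.1) (chartVec p₀ u.1 u.2) 1).2⟩ = _
  rw [h4, h5, h6]

end VolumeWeights

/-! ### The coefficient of the singularity -/

section Coefficient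

variable {Z F : Type} [NormedAddCommGroup Z] [NormedSpace ℝ Z] [NormedAddCommGroup F]
  [NormedSpace ℝ F] [FiniteDimensional ℝ F]

/-- A smooth function of `(s, b)` near `s = 0` is its value at `s = 0` plus `s` times a smooth
function. -/
lemma SmoothNear.exists_remainder {a : ℝ × F → ℂ} {b : F} (ha : SmoothNear a (0, b)) :
    ∃ R : ℝ × F → ℂ, ContDiff ℝ ∞ R ∧ ∀ᶠ u in 𝓝 ((0 : ℝ), b), a u = a (0, u.2) + u.1 * R u := by
  obtain ⟨f, hf, hfa⟩ := ha.exists_contDiff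
  obtain ⟨q, hq, -, hqf⟩ := exists_smooth_slope hf
  refine ⟨fun u => q ((0, u.2), (u.1, 0)) (1, 0), ?_, ?_⟩
  · exact (hq.comp ((contDiff_const.prodMk contDiff_snd).prodMk
      (contDiff_fst.prodMk contDiff_const))).clm_apply contDiff_const
  · have ht : Tendsto (fun u : ℝ × F => ((0 : ℝ), u.2)) (𝓝 ((0 : ℝ), b)) (𝓝 ((0 : ℝ), b)) :=
      (continuous_const.prodMk continuous_snd).tendsto' _ _ rfl
    filter_upwards [hfa, ht.eventually hfa] with u h1 h2
    have h3 := hqf (0, u.2) (u.1, 0)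
    have h4 : ((0 : ℝ), u.2) + (u.1, (0 : F)) = u := by ext <;> simp
    have h5 : ((u.1, 0) : ℝ × F) = u.1 • ((1 : ℝ), (0 : F)) := by ext <;> simp
    rw [h4, h1, h2] at h3
    rw [h3]
    congr 1
    have h6 := (q ((0, u.2), (u.1, 0))).map_smul u.1 (1, 0)
    rw [← h5, Complex.real_smul] at h6
    exact h6

/-- The same with a relative remainder, if the value at `s = 0` does not vanish. -/
lemma SmoothNear.exists_relative_remainder {a : ℝ × F → ℂ} {b : F} (ha : SmoothNear a (0, b))
    (h0 : a (0, b) ≠ 0) :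
    ∃ R : ℝ × F → ℂ, ContDiff ℝ ∞ R ∧
      ∀ᶠ u in 𝓝 ((0 : ℝ), b), a u = a (0, u.2) * (1 + u.1 * R u) := by
  obtain ⟨R, hR, hRa⟩ := ha.exists_remainder
  have h1 : SmoothNear (fun u : ℝ × F => a (0, u.2)) (0, b) :=
    ha.comp_of_eq ((SmoothNear.const 0).prodMk SmoothNear.snd) rfl
  obtain ⟨R', hR', hRR⟩ := ((SmoothNear.of_contDiff hR).div h1 h0).exists_contDiff
  refine ⟨R', hR', ?_⟩
  filter_upwards [hRa, hRR, h1.continuousAt.eventually_ne h0] with u h2 h3 h4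
  rw [h3, mul_add, mul_one, mul_left_comm, mul_div_cancel₀ _ h4, ← h2]

/-- The coefficient `a(s, b)` of the kernel: the sum over the two preimages `Υ (± s, b)` of the
weight divided by the Jacobian factor `k`, normalized by the value of `k` on the fold. -/
def foldCoef (W : Z → ℂ) (k : Z → ℝ) (Υ : ℝ × F → Z) (u : ℝ × F) : ℂ :=
  ((k (Υ (0, u.2)) / 2 : ℝ) : ℂ) *
    (W (Υ u) / (k (Υ u) : ℝ) + W (Υ (-u.1, u.2)) / (k (Υ (-u.1, u.2)) : ℝ))

lemma foldCoef_zero {W : Z → ℂ} {k : Z → ℝ} {Υ : ℝ × F → Z} {b : F} (hk : k (Υ (0, b)) ≠ 0) :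
    foldCoef W k Υ (0, b) = W (Υ (0, b)) := by
  have hk' : (k (Υ (0, b)) : ℂ) ≠ 0 := by exact_mod_cast hk
  simp only [foldCoef, neg_zero]
  push_cast
  field_simp
  ring

lemma smoothNear_foldCoef {W : Z → ℂ} {k : Z → ℝ} {Υ : ℝ × F → Z} {b : F}
    (hΥ : SmoothNear Υ (0, b)) (hW : SmoothNear W (Υ (0, b))) (hk : SmoothNear k (Υ (0, b)))
    (hk0 : k (Υ (0, b)) ≠ 0) : SmoothNear (foldCoef W k Υ) (0, b) := by
  have hk0' : (k (Υ (0, b)) : ℂ) ≠ 0 := by exact_mod_cast hk0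
  have hG : SmoothNear (fun u => W (Υ u) / (k (Υ u) : ℝ)) ((0 : ℝ), b) :=
    (hW.comp hΥ).div (hk.comp hΥ).ofReal hk0'
  have h1 : SmoothNear (fun u : ℝ × F => ((-u.1, u.2) : ℝ × F)) ((0 : ℝ), b) :=
    (SmoothNear.fst.neg).prodMk SmoothNear.snd
  have h2 : SmoothNear (fun u : ℝ × F => ((0, u.2) : ℝ × F)) ((0 : ℝ), b) :=
    (SmoothNear.const 0).prodMk SmoothNear.snd
  have hG2 : SmoothNear (fun u : ℝ × F => W (Υ (-u.1, u.2)) / (k (Υ (-u.1, u.2)) : ℝ)) (0, b) :=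
    hG.comp_of_eq h1 (by simp)
  have hk2 : SmoothNear (fun u : ℝ × F => k (Υ (0, u.2))) (0, b) :=
    (hk.comp hΥ).comp_of_eq h2 rfl
  exact (hk2.div (SmoothNear.const (2 : ℝ)) two_ne_zero).ofReal.mul (hG.add hG2)

lemma sqrt_two_div_sqrt {k ζ c : ℝ} (hk : 0 < k) (hc : c = k ^ 2 / 2) :
    Real.sqrt 2 / Real.sqrt (c * ζ) = 2 / (k * Real.sqrt ζ) := by
  rw [hc, Real.sqrt_mul (by positivity), Real.sqrt_div (sq_nonneg k), Real.sqrt_sq hk.le]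
  have h2 : Real.sqrt 2 ≠ 0 := by positivity
  by_cases hζ : Real.sqrt ζ = 0
  · simp [hζ]
  · field_simp
    exact Real.sq_sqrt (by norm_num)

end Coefficient

/-! ### Localization near the fold vector -/

section Localization

variable {P V : Type} [NormedAddCommGroup P] [NormedSpace ℝ P] [NormedAddCommGroup V]
  [NormedSpace ℝ V] [FiniteDimensional ℝ P] [FiniteDimensional ℝ V]

/-- In some neighbourhood `S` of the fold point the fold is a branched double cover: points of `S`
over a point near `y₀` are close to the fold point, and they are determined by the square root `X`
of `ζ`, which may be prescribed. -/
lemma IsFoldModel.exists_localization {E : P × V → V} {G : V → V →L[ℝ] V →L[ℝ] ℝ} {x₀ : P}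
    {w₀ y₀ α : V} {ζ X : P × V → ℝ} {N : P × V → V} {Γ : ℝ × P × V → V}
    {Lt : P × V → V →L[ℝ] V} (h : IsFoldModel E G x₀ w₀ y₀ α ζ X N Γ Lt) :
    ∃ S ∈ 𝓝 (x₀, w₀), (∀ z ∈ S, ζ (z.1, E z) = X z ^ 2 ∧ jacQuot X Lt z ≠ 0 ∧
        (fderiv ℝ (fun w => E (z.1, w)) z.2).det = X z * jacQuot X Lt z) ∧
      ∀ B ∈ 𝓝 (x₀, w₀), ∀ᶠ p in 𝓝 (x₀, y₀),
        (∀ w, (p.1, w) ∈ S → E (p.1, w) = p.2 → (p.1, w) ∈ B) ∧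
        ∀ s : ℝ, s ^ 2 = ζ p → ∃ w, (p.1, w) ∈ B ∧ E (p.1, w) = p.2 ∧ X (p.1, w) = s := by
  -- any choice of coordinates on the caustic will do
  obtain ⟨π, hπ, hd⟩ := exists_complement h.fderiv_ζ_ne
  have hπd : ∀ u, fderiv ℝ π (x₀, y₀) u = π u := fun u => by rw [π.fderiv]
  obtain ⟨Υ, hΥ⟩ := h.exists_isFoldParam (F := LinearMap.ker (fderiv ℝ ζ (x₀, y₀) : P × V →ₗ[ℝ] ℝ))
    (by rw [hd, Module.finrank_prod]) (SmoothNear.of_contDiff π.contDiff)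
    (fun u hu h0 => hπ u hu (by rw [← hπd]; exact h0))
  refine ⟨_, h.ζ_E.and ((h.smooth_jacQuot.continuousAt.eventually_ne h.jacQuot_ne).and
    (h.det_eq_mul_jacQuot.and hΥ.left_inv)), fun z hz => ⟨hz.1, hz.2.1, hz.2.2.1⟩, fun B hB => ?_⟩
  have hΥB : ∀ᶠ u in 𝓝 ((0 : ℝ), π (x₀, y₀)), Υ u ∈ B := by
    have h1 : Tendsto Υ (𝓝 ((0 : ℝ), π (x₀, y₀))) (𝓝 (x₀, w₀)) := by
      have := hΥ.smooth.continuousAt; rwa [ContinuousAt, hΥ.base] at this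
    exact h1.eventually hB
  filter_upwards [hΥ.preimage, eventually_forall_sq_eq h.smooth_ζ.continuousAt h.ζ_base
    π.continuous.continuousAt hΥB] with p h1 h2
  refine ⟨fun w hw hwE => ?_, fun s hs => ?_⟩
  · have h3 := hw.1
    have h4 := hw.2.2.2
    simp only [hwE] at h3 h4
    have h5 := h2 _ h3.symm
    rwa [h4] at h5
  · obtain ⟨h3, h4, h5⟩ := h1 s hs
    refine ⟨(Υ (s, π p)).2, ?_⟩
    have h6 : (p.1, (Υ (s, π p)).2) = Υ (s, π p) := Prod.ext h3.symm rfl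
    rw [h6]
    exact ⟨h2 s hs, h4, h5⟩

end Localization

/-! ### The signed distance to the caustic -/

section SignedDistance

variable {n : ℕ} {M : Type*} [TopologicalSpace M] [ChartedSpace (Eu n) M]
  {D O : Set (TangentBundle (𝓡 n) M)} {exp : TangentBundle (𝓡 n) M → M} {p₀ q₀ : M}

/-- The part of the domain of the bundle chart that corresponds to `O`. -/
def chartPreimage (p₀ : M) (O : Set (TangentBundle (𝓡 n) M)) : Set (Eu n × Eu n) :=
  {z | z.1 ∈ (extChartAt (𝓡 n) p₀).target ∧ bundleChart p₀ z ∈ O}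

lemma exists_chartPreimage {S : Set (Eu n × Eu n)} (hS : S ⊆ expDomain D exp p₀ q₀)
    (hO : O ⊆ bundleChart p₀ '' S) {x : Eu n} (hx : x ∈ (extChartAt (𝓡 n) p₀).target) {v : Eu n}
    (hv : (⟨(extChartAt (𝓡 n) p₀).symm x, v⟩ : TangentBundle (𝓡 n) M) ∈ O) :
    ∃ w, (x, w) ∈ S ∧ (x, w) ∈ chartPreimage p₀ O ∧ chartVec p₀ x w = v := by
  obtain ⟨z, hz, hzv⟩ := hO hv
  have h1 : (extChartAt (𝓡 n) p₀).symm z.1 = (extChartAt (𝓡 n) p₀).symm x :=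
    congrArg Bundle.TotalSpace.proj hzv
  have h2 : z.1 = x := by
    rw [← (extChartAt (𝓡 n) p₀).right_inv (hS hz).1, h1, (extChartAt (𝓡 n) p₀).right_inv hx]
  have h3 : (x, z.2) = z := Prod.ext h2.symm rfl
  refine ⟨z.2, by rwa [h3], ⟨hx, by rw [h3, hzv]; exact hv⟩, ?_⟩
  have h4 : ∀ a b : TangentBundle (𝓡 n) M, a = b → (a.2 : Eu n) = b.2 := by rintro a _ rfl; rfl
  have h5 := h4 _ _ hzv
  rw [← h2]
  exact h5

lemma chartPreimage_subset {S : Set (Eu n × Eu n)} (hS : S ⊆ expDomain D exp p₀ q₀)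
    (hO : O ⊆ bundleChart p₀ '' S) (hinj : ∀ x ∈ (extChartAt (𝓡 n) p₀).target,
      Function.Injective (chartVec p₀ x)) : chartPreimage p₀ O ⊆ S := by
  rintro ⟨x, w⟩ ⟨hx, hw⟩
  obtain ⟨w', h1, -, h2⟩ := exists_chartPreimage hS hO hx hw
  rwa [hinj x hx h2] at h1

variable [IsManifold (𝓡 n) ∞ M]

lemma isOpen_chartPreimage (hO : IsOpen O) : IsOpen (chartPreimage p₀ O) := by
  have h1 : IsOpen ((extChartAt (𝓡 n) p₀).target ×ˢ (univ : Set (Eu n))) :=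
    (isOpen_extChartAt_target p₀).prod isOpen_univ
  have h2 := (contMDiffOn_bundleChart p₀).continuousOn.isOpen_inter_preimage h1 hO
  convert h2 using 1
  ext z
  simp [chartPreimage]

/-- Near the fold, the signed distance is the function `ζ` of the fold model: the range of `exp_p`
is `{ζ ≥ 0}` and the conjugate locus is `{ζ = 0}`. -/
theorem eventually_signedDist_eq [T2Space M] {g : RiemMetric n M} {x₀ w₀ y₀ α : Eu n}
    {ζ X : Eu n × Eu n → ℝ} {N : Eu n × Eu n → Eu n} {Γ : ℝ × Eu n × Eu n → Eu n}
    {Lt : Eu n × Eu n → Eu n →L[ℝ] Eu n} (hexp : IsRegularExp D exp)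
    (h : IsFoldModel (expCoord exp p₀ q₀) (metricChart g q₀) x₀ w₀ y₀ α ζ X N Γ Lt)
    (hx₀ : x₀ ∈ (extChartAt (𝓡 n) p₀).target) (hy₀ : y₀ = extChartAt (𝓡 n) q₀ q₀)
    {S : Set (Eu n × Eu n)} (hSd : S ⊆ expDomain D exp p₀ q₀)
    (hS : ∀ z ∈ S, ζ (z.1, expCoord exp p₀ q₀ z) = X z ^ 2 ∧ jacQuot X Lt z ≠ 0 ∧
        (dexpCoord exp p₀ q₀ z).det = X z * jacQuot X Lt z)
    (hloc : ∀ B ∈ 𝓝 (x₀, w₀), ∀ᶠ p in 𝓝 (x₀, y₀), ∀ s : ℝ, s ^ 2 = ζ p → ∃ w, (p.1, w) ∈ B ∧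
      expCoord exp p₀ q₀ (p.1, w) = p.2 ∧ X (p.1, w) = s)
    (hO : IsOpen O) (hOS : O ⊆ bundleChart p₀ '' S) (hbase : bundleChart p₀ (x₀, w₀) ∈ O) :
    ∀ᶠ p : Eu n × Eu n in 𝓝 (x₀, y₀),
      signedDist g D exp O ((extChartAt (𝓡 n) p₀).symm p.1, (extChartAt (𝓡 n) q₀).symm p.2) = ζ p ∧
      ((extChartAt (𝓡 n) q₀).symm p.2 ∈ conjLocus D exp O ((extChartAt (𝓡 n) p₀).symm p.1) ↔
        ζ p = 0) := by
  set φ := extChartAt (𝓡 n) p₀ with hφ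
  set ψ := extChartAt (𝓡 n) q₀ with hψ
  have hsub : chartPreimage p₀ O ⊆ S :=
    chartPreimage_subset hSd hOS fun x hx => chartVec_injective p₀ hx
  have hB : chartPreimage p₀ O ∈ 𝓝 (x₀, w₀) := (isOpen_chartPreimage hO).mem_nhds ⟨hx₀, hbase⟩
  have hy₀t : y₀ ∈ ψ.target := hy₀ ▸ mem_extChartAt_target q₀
  have hxt : ∀ᶠ p : Eu n × Eu n in 𝓝 (x₀, y₀), p.1 ∈ φ.target :=
    continuousAt_fst.eventually ((isOpen_extChartAt_target p₀).mem_nhds hx₀)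
  have hyt : ∀ᶠ p : Eu n × Eu n in 𝓝 (x₀, y₀), p.2 ∈ ψ.target :=
    continuousAt_snd.eventually ((isOpen_extChartAt_target q₀).mem_nhds hy₀t)
  -- points of `O` in coordinates
  have hpt : ∀ z ∈ S, expAt exp (φ.symm z.1) (chartVec p₀ z.1 z.2) =
      ψ.symm (expCoord exp p₀ q₀ z) := fun z hz => (symm_expCoord (hSd hz)).symm
  have hcut : ∀ q : M, ∀ x ∈ φ.target, q ∈ conjLocus D exp O (φ.symm x) →
      q ∈ ψ.source ∧ ζ (x, ψ q) = 0 := by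
    rintro q x hx ⟨v, ⟨hvO, hv⟩, rfl⟩
    obtain ⟨w, hwS, -, rfl⟩ := exists_chartPreimage hSd hOS hx hvO
    have h1 := (mem_conjVectors_iff hexp (hSd hwS)).1 hv
    obtain ⟨h2, h3, h4⟩ := hS _ hwS
    rw [h4, mul_eq_zero, or_iff_left h3] at h1
    refine ⟨(hSd hwS).2.2.2, ?_⟩
    rw [h1] at h2
    exact h2.trans (by norm_num)
  have hcut' : ∀ᶠ p : Eu n × Eu n in 𝓝 (x₀, y₀), ζ p = 0 →
      ψ.symm p.2 ∈ conjLocus D exp O (φ.symm p.1) := by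
    filter_upwards [hloc _ hB] with p h1 h2
    obtain ⟨w, h3, h4, h5⟩ := h1 0 (by rw [h2]; norm_num)
    refine ⟨chartVec p₀ p.1 w, ⟨h3.2, (mem_conjVectors_iff hexp (hSd (hsub h3))).2 ?_⟩, ?_⟩
    · rw [(hS _ (hsub h3)).2.2, h5, zero_mul]
    · rw [hpt _ (hsub h3), h4]
  have hΓ : Tendsto (fun p : Eu n × Eu n => (p.1, Γ (0, p))) (𝓝 (x₀, y₀)) (𝓝 (x₀, y₀)) := by
    have h1 : Tendsto (fun p : Eu n × Eu n => Γ (0, p)) (𝓝 (x₀, y₀)) (𝓝 y₀) := by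
      have h2 := h.smooth_Γ.continuousAt
      rw [ContinuousAt, h.Γ_base] at h2
      exact h2.comp ((continuous_const.prodMk continuous_id).tendsto' _ _ rfl)
    exact (continuous_fst.tendsto' _ _ rfl).prodMk_nhds h1
  have hdist := eventually_distTo_eq h hy₀
  filter_upwards [hxt, hyt, hdist, hcut', hΓ.eventually hcut', hΓ.eventually hyt, h.char_zero,
    hloc _ hB] with p hpx hpy hd hc hΓc hΓt hch hl
  have hψp : ψ (ψ.symm p.2) = p.2 := ψ.right_inv hpy
  have hd' := hd (conjLocus D exp O (φ.symm p.1)) (fun q hq => hcut q p.1 hpx hq) (hΓc hch.1)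
  refine ⟨?_, fun h1 => ?_, hc⟩
  · have hrange : ψ.symm p.2 ∈ expRange exp O (φ.symm p.1) ↔ 0 ≤ ζ p := by
      constructor
      · rintro ⟨v, hv, hvp⟩
        obtain ⟨w, hwS, -, rfl⟩ := exists_chartPreimage hSd hOS hpx hv
        have h1 : expCoord exp p₀ q₀ (p.1, w) = p.2 := by
          rw [← hψp, ← hvp]; rfl
        have h2 := (hS _ hwS).1
        simp only [h1] at h2
        rw [show p = (p.1, p.2) from rfl, h2]
        positivity
      · intro h1
        obtain ⟨w, h3, h4, -⟩ := hl (Real.sqrt (ζ p)) (Real.sq_sqrt h1)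
        exact ⟨chartVec p₀ p.1 w, h3.2, by rw [hpt _ (hsub h3), h4]⟩
    rw [signedDist]
    by_cases h1 : 0 ≤ ζ p
    · rw [if_pos (hrange.2 h1), hd', abs_of_nonneg h1]
    · rw [if_neg fun h2 => h1 (hrange.1 h2), hd', abs_of_neg (not_le.1 h1), neg_neg]
  · have h2 := (hcut _ _ hpx h1).2
    rwa [hψp] at h2

end SignedDistance

/-! ### The kernel near the caustic -/

section Kernel

variable {n : ℕ} {M : Type*} [TopologicalSpace M] [ChartedSpace (Eu n) M] [IsManifold (𝓡 n) ∞ M]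
  {g : RiemMetric n M} {D O : Set (TangentBundle (𝓡 n) M)} {exp : TangentBundle (𝓡 n) M → M}
  {κs κ : TangentBundle (𝓡 n) M → ℂ} {p₀ q₀ : M}

/-- Integration over a part of `T_pM` in the linear coordinates given by a chart. -/
lemma setIntegral_fibreVolume (g : RiemMetric n M) (c : M) {x : Eu n}
    (hx : x ∈ (extChartAt (𝓡 n) c).target) {H : Eu n → ℂ} {s : Set (Eu n)}
    (hint : IntegrableOn (fun w => ((Real.sqrt (coordDet g c x) : ℝ) : ℂ) * H (chartVec c x w))
      (chartVec c x ⁻¹' s)) :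
    IntegrableOn H s (fibreVolume g ((extChartAt (𝓡 n) c).symm x)) ∧
      ∫ v in s, H v ∂(fibreVolume g ((extChartAt (𝓡 n) c).symm x)) =
        ∫ w in chartVec c x ⁻¹' s,
          ((Real.sqrt (coordDet g c x) : ℝ) : ℂ) * H (chartVec c x w) := by
  have hpos : 0 < Real.sqrt (coordDet g c x) := Real.sqrt_pos.2 (coordDet_pos g c hx)
  have hc : ((Real.sqrt (coordDet g c x) : ℝ) : ℂ) ≠ 0 := by exact_mod_cast hpos.ne'
  have he : MeasurableEmbedding (chartVec c x) := by
    obtain ⟨e, he⟩ := isInvertible_chartVec c hx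
    rw [← he]
    exact e.toHomeomorph.measurableEmbedding
  have hint' : IntegrableOn (fun w => H (chartVec c x w)) (chartVec c x ⁻¹' s) := by
    refine (Integrable.const_mul hint ((Real.sqrt (coordDet g c x) : ℝ) : ℂ)⁻¹).congr
      (ae_of_all _ fun w => ?_)
    simp only
    rw [inv_mul_cancel_left₀ hc]
  rw [fibreVolume_eq_map g c hx]
  refine ⟨he.integrableOn_map_iff.2 ?_, ?_⟩
  · rw [IntegrableOn, Measure.restrict_smul]
    exact Integrable.smul_measure hint' ENNReal.ofReal_ne_top
  · rw [he.setIntegral_map, Measure.restrict_smul, integral_smul_measure,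
      ENNReal.toReal_ofReal hpos.le, integral_const_mul, Complex.real_smul]

/-- The factor by which the Jacobian determinant of `exp_p`, with respect to the Riemannian volumes,
is divisible by the square root `X` of the defining function of the caustic. -/
def volJac (g : RiemMetric n M) (exp : TangentBundle (𝓡 n) M → M) (p₀ q₀ : M)
    (X : Eu n × Eu n → ℝ) (Lt : Eu n × Eu n → Eu n →L[ℝ] Eu n) (z : Eu n × Eu n) : ℝ :=
  |Real.sqrt (coordDet g q₀ (expCoord exp p₀ q₀ z) / coordDet g p₀ z.1) * jacQuot X Lt z|

section Model

variable {x₀ w₀ y₀ α : Eu n} {ζ X : Eu n × Eu n → ℝ} {N : Eu n × Eu n → Eu n}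
  {Γ : ℝ × Eu n × Eu n → Eu n} {Lt : Eu n × Eu n → Eu n →L[ℝ] Eu n}

lemma volJac_pos_of_mem {z : Eu n × Eu n} (hz : z ∈ expDomain D exp p₀ q₀)
    (hj : jacQuot X Lt z ≠ 0) : 0 < volJac g exp p₀ q₀ X Lt z :=
  abs_pos.2 (mul_ne_zero (Real.sqrt_pos.2
    (div_pos (coordDet_pos g q₀ (expCoord_mem_target hz)) (coordDet_pos g p₀ hz.1))).ne' hj)

lemma smoothNear_volJac (hexp : IsRegularExp D exp)
    (h : IsFoldModel (expCoord exp p₀ q₀) (metricChart g q₀) x₀ w₀ y₀ α ζ X N Γ Lt)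
    (hz : (x₀, w₀) ∈ expDomain D exp p₀ q₀) :
    SmoothNear (volJac g exp p₀ q₀ X Lt) (x₀, w₀) :=
  ((smoothNear_volumeRatio hexp hz).mul h.smooth_jacQuot).abs
    (abs_pos.1 (volJac_pos_of_mem (g := g) hz h.jacQuot_ne))

open Classical in
/-- The kernel in coordinates: the sum over the two preimages, in the form of a fold kernel. -/
lemma eventually_foldKernel_eq {F : Type} [NormedAddCommGroup F] [NormedSpace ℝ F]
    (hexp : IsRegularExp D exp)
    (h : IsFoldModel (expCoord exp p₀ q₀) (metricChart g q₀) x₀ w₀ y₀ α ζ X N Γ Lt)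
    (hz : (x₀, w₀) ∈ expDomain D exp p₀ q₀) {zz : Eu n × Eu n → F} (hzz : SmoothNear zz (x₀, y₀))
    {Υ : ℝ × F → Eu n × Eu n} (hΥ : IsFoldParam (expCoord exp p₀ q₀) ζ X zz Υ x₀ w₀ y₀)
    (W : Eu n × Eu n → ℂ) :
    ∀ᶠ p : Eu n × Eu n in 𝓝 (x₀, y₀), 0 < ζ p →
      ((Real.sqrt (coordDet g q₀ p.2) : ℝ) : ℂ) *
        (((Real.sqrt 2 / Real.sqrt (invA g exp (bundleChart p₀ (Υ (0, zz p))).1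
          (bundleChart p₀ (Υ (0, zz p))).2 * invD g exp (bundleChart p₀ (Υ (0, zz p))).1
          (bundleChart p₀ (Υ (0, zz p))).2 * ζ p) : ℝ) : ℂ) *
          foldCoef W (volJac g exp p₀ q₀ X Lt) Υ (Real.sqrt (ζ p), zz p)) =
      (((Real.sqrt (coordDet g p₀ (Υ (Real.sqrt (ζ p), zz p)).1) : ℝ) : ℂ) *
          W (Υ (Real.sqrt (ζ p), zz p)) / (|jacQuot X Lt (Υ (Real.sqrt (ζ p), zz p))| : ℝ) +
        ((Real.sqrt (coordDet g p₀ (Υ (-Real.sqrt (ζ p), zz p)).1) : ℝ) : ℂ) *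
          W (Υ (-Real.sqrt (ζ p), zz p)) / (|jacQuot X Lt (Υ (-Real.sqrt (ζ p), zz p))| : ℝ)) /
        (Real.sqrt (ζ p) : ℝ) := by
  have hΥt : Tendsto Υ (𝓝 ((0 : ℝ), zz (x₀, y₀))) (𝓝 (x₀, w₀)) := by
    have := hΥ.smooth.continuousAt; rwa [ContinuousAt, hΥ.base] at this
  have h0t : Tendsto (fun p => ((0 : ℝ), zz p)) (𝓝 (x₀, y₀)) (𝓝 ((0 : ℝ), zz (x₀, y₀))) :=
    tendsto_const_nhds.prodMk_nhds hzz.continuousAt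
  have hj : ∀ᶠ z in 𝓝 (x₀, w₀), jacQuot X Lt z ≠ 0 :=
    h.smooth_jacQuot.continuousAt.eventually_ne h.jacQuot_ne
  have hd : ∀ᶠ z in 𝓝 (x₀, w₀), z ∈ expDomain D exp p₀ q₀ := (isOpen_expDomain hexp).mem_nhds hz
  filter_upwards [h0t.eventually (hΥt.eventually (invA_mul_invD hexp h hz)),
    h0t.eventually hΥ.right_inv, h0t.eventually (hΥt.eventually (hj.and hd)), hΥ.preimage,
    eventually_forall_sq_eq h.smooth_ζ.continuousAt h.ζ_base hzz.continuousAt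
      (hΥt.eventually (hj.and hd))] with p h1 h2 h3 h4 h5 hζ
  obtain ⟨-, -, hAD⟩ := h1 h2.1
  have hs := Real.sq_sqrt hζ.le
  have hs' : (-Real.sqrt (ζ p)) ^ 2 = ζ p := by rw [neg_sq, hs]
  obtain ⟨ha1, ha2, -⟩ := h4 _ hs
  obtain ⟨hb1, hb2, -⟩ := h4 _ hs'
  obtain ⟨ha3, ha4⟩ := h5 _ hs
  obtain ⟨hb3, hb4⟩ := h5 _ hs'
  have hk0 := volJac_pos_of_mem (g := g) h3.2 h3.1
  set k₀ := volJac g exp p₀ q₀ X Lt (Υ (0, zz p)) with hk₀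
  have hAD' : invA g exp (bundleChart p₀ (Υ (0, zz p))).1 (bundleChart p₀ (Υ (0, zz p))).2 *
      invD g exp (bundleChart p₀ (Υ (0, zz p))).1 (bundleChart p₀ (Υ (0, zz p))).2 =
        k₀ ^ 2 / 2 := by
    rw [hk₀, volJac, sq_abs]; exact hAD
  rw [sqrt_two_div_sqrt hk0 hAD']
  have hcp : 0 < coordDet g p₀ p.1 := by
    have := coordDet_pos g p₀ ha4.1; rwa [ha1] at this
  have hcq : 0 < coordDet g q₀ p.2 := by
    have := coordDet_pos g q₀ (expCoord_mem_target ha4); rwa [ha2] at this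
  have hka : volJac g exp p₀ q₀ X Lt (Υ (Real.sqrt (ζ p), zz p)) =
      Real.sqrt (coordDet g q₀ p.2) / Real.sqrt (coordDet g p₀ p.1) *
        |jacQuot X Lt (Υ (Real.sqrt (ζ p), zz p))| := by
    rw [volJac, ha1, ha2, abs_mul, abs_of_nonneg (Real.sqrt_nonneg _), Real.sqrt_div hcq.le]
  have hkb : volJac g exp p₀ q₀ X Lt (Υ (-Real.sqrt (ζ p), zz p)) =
      Real.sqrt (coordDet g q₀ p.2) / Real.sqrt (coordDet g p₀ p.1) *
        |jacQuot X Lt (Υ (-Real.sqrt (ζ p), zz p))| := by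
    rw [volJac, hb1, hb2, abs_mul, abs_of_nonneg (Real.sqrt_nonneg _), Real.sqrt_div hcq.le]
  simp only [foldCoef]
  rw [← hk₀, hka, hkb, ha1, hb1]
  have e1 : ((Real.sqrt (coordDet g q₀ p.2) : ℝ) : ℂ) ≠ 0 := by
    exact_mod_cast (Real.sqrt_pos.2 hcq).ne'
  have e2 : ((Real.sqrt (coordDet g p₀ p.1) : ℝ) : ℂ) ≠ 0 := by
    exact_mod_cast (Real.sqrt_pos.2 hcp).ne'
  have e3 : ((Real.sqrt (ζ p) : ℝ) : ℂ) ≠ 0 := by exact_mod_cast (Real.sqrt_pos.2 hζ).ne'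
  have e4 : (k₀ : ℂ) ≠ 0 := by exact_mod_cast hk0.ne'
  have e5 : ((|jacQuot X Lt (Υ (Real.sqrt (ζ p), zz p))| : ℝ) : ℂ) ≠ 0 := by
    exact_mod_cast (abs_pos.2 ha3).ne'
  have e6 : ((|jacQuot X Lt (Υ (-Real.sqrt (ζ p), zz p))| : ℝ) : ℂ) ≠ 0 := by
    exact_mod_cast (abs_pos.2 hb3).ne'
  push_cast
  field_simp

variable [MeasurableSpace M] [BorelSpace M]

/-- The part of `N` near a fold vector has a fold kernel, for any coefficient that agrees with
`foldCoef` near the fold. -/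
theorem hasKernelNear_timesIn (hn : 0 < n) (hexp : IsRegularExp D exp)
    (h : IsFoldModel (expCoord exp p₀ q₀) (metricChart g q₀) x₀ w₀ y₀ α ζ X N Γ Lt)
    (hz : (x₀, w₀) ∈ expDomain D exp p₀ q₀)
    (hx₀ : x₀ = extChartAt (𝓡 n) p₀ p₀) (hy₀ : y₀ = extChartAt (𝓡 n) q₀ q₀)
    {S : Set (Eu n × Eu n)} (hSd : S ⊆ expDomain D exp p₀ q₀)
    (hloc : ∀ B ∈ 𝓝 (x₀, w₀), ∀ᶠ p : Eu n × Eu n in 𝓝 (x₀, y₀), ∀ w, (p.1, w) ∈ S →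
      expCoord exp p₀ q₀ (p.1, w) = p.2 → (p.1, w) ∈ B)
    (hO : IsOpen O) (hOS : O ⊆ bundleChart p₀ '' S) (hbase : bundleChart p₀ (x₀, w₀) ∈ O)
    {z' : M × M → ℝ} (hz' : ∀ᶠ p : Eu n × Eu n in 𝓝 (x₀, y₀),
      z' ((extChartAt (𝓡 n) p₀).symm p.1, (extChartAt (𝓡 n) q₀).symm p.2) = ζ p)
    {z'' : M × M → Eu (2 * n - 1)} {zz : Eu n × Eu n → Eu (2 * n - 1)}
    (hzz' : ∀ p, zz p = z'' ((extChartAt (𝓡 n) p₀).symm p.1, (extChartAt (𝓡 n) q₀).symm p.2))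
    (hzz : SmoothNear zz (x₀, y₀)) {Υ : ℝ × Eu (2 * n - 1) → Eu n × Eu n}
    (hΥ : IsFoldParam (expCoord exp p₀ q₀) ζ X zz Υ x₀ w₀ y₀)
    (hκs : ContMDiffOn (𝓡 n).tangent 𝓘(ℝ, ℂ) ∞ κs {x | x.2 ≠ 0})
    (hκ : ContMDiffOn (𝓡 n).tangent 𝓘(ℝ, ℂ) ∞ κ {x | x.2 ≠ 0})
    {a : ℝ → Eu (2 * n - 1) → ℂ} (ha : ∀ᶠ u in 𝓝 ((0 : ℝ), zz (x₀, y₀)), a u.1 u.2 =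
      foldCoef (fun z => weightSigma g exp κs κ (bundleChart p₀ z)) (volJac g exp p₀ q₀ X Lt) Υ u) :
    HasKernelNear g (normalOp g exp κs κ (timesIn O))
      (foldKernel g exp z' z'' (fun b => bundleChart p₀ (Υ (0, b))) a) p₀ q₀ := by
  classical
  set φ := extChartAt (𝓡 n) p₀ with hφ
  set ψ := extChartAt (𝓡 n) q₀ with hψ
  have hsub : chartPreimage p₀ O ⊆ S :=
    chartPreimage_subset hSd hOS fun x hx => chartVec_injective p₀ hx
  have hOp := isOpen_chartPreimage (p₀ := p₀) hO
  have hx₀t : x₀ ∈ φ.target := hx₀ ▸ mem_extChartAt_target p₀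
  set W : Eu n × Eu n → ℂ := fun z => ((Real.sqrt (coordDet g p₀ z.1) : ℝ) : ℂ) *
    weightSigma g exp κs κ (bundleChart p₀ z) with hW
  have hWs : SmoothNear W (x₀, w₀) :=
    (((smoothNear_coordDet g p₀ hx₀t).comp (f := fun z : Eu n × Eu n => z.1)
      SmoothNear.fst).sqrt (coordDet_pos g p₀ hx₀t).ne').ofReal.mul
        (smoothNear_weightSigma hexp hκs hκ hn hz)
  obtain ⟨U₁, hU₁, V₁, hV₁, hfold⟩ := integral_fold volume hΥ h.smooth_E h.E_base h.smooth_ζ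
    h.smooth_X h.X_base hzz h.ζ_E h.dX h.smooth_jacQuot.continuousAt h.jacQuot_ne
    h.det_eq_mul_jacQuot hWs hOp ⟨hx₀t, hbase⟩ (fun B hB => (hloc B hB).mono
      fun p hp w hw => hp w (hsub hw))
  have hker : ∀ᶠ p : Eu n × Eu n in 𝓝 (x₀, y₀), ((Real.sqrt (coordDet g q₀ p.2) : ℝ) : ℂ) *
      foldKernel g exp z' z'' (fun b => bundleChart p₀ (Υ (0, b))) a (φ.symm p.1, ψ.symm p.2) =
      if 0 < ζ p then
        (W (Υ (Real.sqrt (ζ p), zz p)) / (|jacQuot X Lt (Υ (Real.sqrt (ζ p), zz p))| : ℝ) +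
          W (Υ (-Real.sqrt (ζ p), zz p)) / (|jacQuot X Lt (Υ (-Real.sqrt (ζ p), zz p))| : ℝ)) /
          (Real.sqrt (ζ p) : ℝ)
      else 0 := by
    filter_upwards [hz', eventually_foldKernel_eq hexp h hz hzz hΥ
      (fun z => weightSigma g exp κs κ (bundleChart p₀ z)),
      eventually_forall_sq_eq h.smooth_ζ.continuousAt h.ζ_base hzz.continuousAt ha] with p h1 h2 h3
    have hfk : ∀ (c : ℝ) (b : Eu (2 * n - 1)), z' (φ.symm p.1, ψ.symm p.2) = c →
        z'' (φ.symm p.1, ψ.symm p.2) = b →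
        foldKernel g exp z' z'' (fun b => bundleChart p₀ (Υ (0, b))) a (φ.symm p.1, ψ.symm p.2) =
        if 0 < c then ((Real.sqrt 2 / Real.sqrt (invA g exp (bundleChart p₀ (Υ (0, b))).1
          (bundleChart p₀ (Υ (0, b))).2 * invD g exp (bundleChart p₀ (Υ (0, b))).1
          (bundleChart p₀ (Υ (0, b))).2 * c) : ℝ) : ℂ) * a (Real.sqrt c) b else 0 := by
      rintro _ _ rfl rfl; rfl
    rw [hfk _ _ h1 (hzz' p).symm]
    by_cases hζ : 0 < ζ p
    · have h4 : a (Real.sqrt (ζ p)) (zz p) = _ := h3 _ (Real.sq_sqrt hζ.le)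
      rw [if_pos hζ, if_pos hζ, h4]
      exact h2 hζ
    · rw [if_neg hζ, if_neg hζ, mul_zero]
  rw [nhds_prod_eq] at hker
  obtain ⟨U₂, hU₂, V₂, hV₂, hker'⟩ := mem_prod_iff.1 hker
  refine ⟨φ.source ∩ φ ⁻¹' (U₁ ∩ U₂), inter_mem (extChartAt_source_mem_nhds p₀)
    ((continuousAt_extChartAt p₀).preimage_mem_nhds ?_), ψ.source ∩ ψ ⁻¹' (V₁ ∩ V₂),
    inter_mem (extChartAt_source_mem_nhds q₀)
      ((continuousAt_extChartAt q₀).preimage_mem_nhds ?_), fun q hq => hq.1, ?_⟩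
  · rw [← hφ, ← hx₀]; exact inter_mem hU₁ hU₂
  · rw [← hψ, ← hy₀]; exact inter_mem hV₁ hV₂
  intro f hf hfc hfV p hp
  obtain ⟨x, hx, hxU, rfl⟩ : ∃ x ∈ φ.target, x ∈ U₁ ∩ U₂ ∧ φ.symm x = p :=
    ⟨φ p, φ.map_source hp.1, hp.2, φ.left_inv hp.1⟩
  have htm : MeasurableSet ψ.target := (isOpen_extChartAt_target q₀).measurableSet
  -- the test function in the chart
  set f' : Eu n → ℂ := ψ.target.indicator fun y => f (ψ.symm y) with hf'
  have hf'm : Measurable f' := by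
    rw [hf', ← piecewise_eq_indicator]
    exact (hf.continuous.comp_continuousOn (continuousOn_extChartAt_symm q₀)).measurable_piecewise
      continuousOn_const htm
  have hf'b : ∃ C, ∀ y, ‖f' y‖ ≤ C := by
    obtain ⟨C, hC⟩ := hf.continuous.bounded_above_of_compact_support hfc
    refine ⟨C, fun y => ?_⟩
    exact (norm_indicator_le_norm_self _ _).trans (hC _)
  have hf's : ∀ y, f' y ≠ 0 → y ∈ V₁ ∩ V₂ := by
    intro y hy
    have hyt : y ∈ ψ.target := mem_of_indicator_ne_zero hy
    rw [hf', indicator_of_mem hyt] at hy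
    have h1 := (hfV (subset_tsupport _ (Function.mem_support.2 hy))).2
    rwa [mem_preimage, ψ.right_inv hyt] at h1
  obtain ⟨hI1, hI2, hI3⟩ := hfold x hxU.1 f' hf'm hf'b fun y hy => (hf's y hy).1
  -- the operator as an integral over the fibre
  have hfib : ∀ w, (x, w) ∈ chartPreimage p₀ O →
      ((Real.sqrt (coordDet g p₀ x) : ℝ) : ℂ) *
        (weightSigma g exp κs κ ⟨φ.symm x, chartVec p₀ x w⟩ *
          f (expAt exp (φ.symm x) (chartVec p₀ x w))) =
      W (x, w) * f' (expCoord exp p₀ q₀ (x, w)) := by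
    intro w hw
    have h1 := hSd (hsub hw)
    rw [hf', indicator_of_mem (expCoord_mem_target h1), symm_expCoord h1, ← mul_assoc]
    rfl
  have hset : chartVec p₀ x ⁻¹' {v : Eu n | (⟨φ.symm x, v⟩ : TangentBundle (𝓡 n) M) ∈ O} =
      {w | (x, w) ∈ chartPreimage p₀ O} :=
    Set.ext fun w => ⟨fun hw => ⟨hx, hw⟩, fun hw => hw.2⟩
  have hsm : MeasurableSet {w | (x, w) ∈ chartPreimage p₀ O} :=
    (hOp.preimage (continuous_const.prodMk continuous_id)).measurableSet
  obtain ⟨hJ1, hJ2⟩ := setIntegral_fibreVolume g p₀ hx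
    (H := fun v : Eu n => weightSigma g exp κs κ ⟨φ.symm x, v⟩ * f (expAt exp (φ.symm x) v))
    (s := {v : Eu n | (⟨φ.symm x, v⟩ : TangentBundle (𝓡 n) M) ∈ O}) (by
      rw [hset]
      exact (integrableOn_congr_fun (fun w hw => hfib w hw) hsm).2 hI1)
  have hop : normalOp g exp κs κ (timesIn O) f (φ.symm x) =
      ∫ w in {w | (x, w) ∈ chartPreimage p₀ O}, W (x, w) * f' (expCoord exp p₀ q₀ (x, w)) := by
    rw [normalOp_timesIn_eq hn hO f (φ.symm x) hJ1, hJ2, hset]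
    exact setIntegral_congr_fun hsm fun w hw => hfib w hw
  -- the integral over the chart
  set Kc : Eu n → ℂ := fun y => if 0 < ζ (x, y) then
      (W (Υ (Real.sqrt (ζ (x, y)), zz (x, y))) /
          (|jacQuot X Lt (Υ (Real.sqrt (ζ (x, y)), zz (x, y)))| : ℝ) +
        W (Υ (-Real.sqrt (ζ (x, y)), zz (x, y))) /
          (|jacQuot X Lt (Υ (-Real.sqrt (ζ (x, y)), zz (x, y)))| : ℝ)) /
        (Real.sqrt (ζ (x, y)) : ℝ)
    else 0 with hKc
  have hkf : ∀ y ∈ ψ.target, ((Real.sqrt (coordDet g q₀ y) : ℝ) : ℂ) *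
      (foldKernel g exp z' z'' (fun b => bundleChart p₀ (Υ (0, b))) a (φ.symm x, ψ.symm y) *
        f (ψ.symm y)) = Kc y * f' y := fun y hy => by
    have h2 : f' y = f (ψ.symm y) := by rw [hf', indicator_of_mem hy]
    by_cases h0 : f' y = 0
    · rw [← h2, h0, mul_zero, mul_zero, mul_zero]
    · have h1 := hker' (show (x, y) ∈ U₂ ×ˢ V₂ from ⟨hxU.2, (hf's y h0).2⟩)
      rw [← mul_assoc, ← h2]
      exact congrArg (· * f' y) h1
  obtain ⟨hK1, hK2⟩ := integral_chartVolume g q₀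
    (h := fun q =>
      foldKernel g exp z' z'' (fun b => bundleChart p₀ (Υ (0, b))) a (φ.symm x, q) * f q)
    ((integrableOn_congr_fun hkf htm).2 hI2.integrableOn)
  refine ⟨hK1, ?_⟩
  rw [hop, hI3, hK2, setIntegral_congr_fun htm hkf]
  refine (setIntegral_eq_integral_of_forall_compl_eq_zero fun y hy => ?_).symm
  rw [hf', indicator_of_notMem hy, mul_zero]

end Model

/-- Operators that agree near the given points have the same kernel there. -/
lemma HasKernelNear.congr [MeasurableSpace M] {T T' : (M → ℂ) → M → ℂ} {K : M × M → ℂ}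
    (hT : HasKernelNear g T K p₀ q₀) (h : ∃ U ∈ 𝓝 p₀, ∃ V ∈ 𝓝 q₀, ∀ f : M → ℂ,
      (∀ q, f q ≠ 0 → q ∈ V) → ∀ p ∈ U, T' f p = T f p) : HasKernelNear g T' K p₀ q₀ := by
  obtain ⟨U, hU, V, hV, hVs, hK⟩ := hT
  obtain ⟨U', hU', V', hV', hTT⟩ := h
  refine ⟨U ∩ U', inter_mem hU hU', V ∩ V', inter_mem hV hV', fun q hq => hVs hq.1,
    fun f hf hfc hfV p hp => ?_⟩
  obtain ⟨h1, h2⟩ := hK f hf hfc (hfV.trans inter_subset_left) p hp.1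
  refine ⟨h1, ?_⟩
  rw [hTT f (fun q hq => (hfV (subset_tsupport _ (Function.mem_support.2 hq))).2) p hp.2, h2]

end Kernel

/-! ### Functions on `M × M` in charts -/

section PairChart

variable {n : ℕ} {M : Type*} [TopologicalSpace M] [ChartedSpace (Eu n) M]
  {W : Type} [NormedAddCommGroup W] [NormedSpace ℝ W]

lemma tendsto_pairChart (p₀ q₀ : M) :
    Tendsto (fun m : M × M => (extChartAt (𝓡 n) p₀ m.1, extChartAt (𝓡 n) q₀ m.2)) (𝓝 (p₀, q₀))
      (𝓝 (extChartAt (𝓡 n) p₀ p₀, extChartAt (𝓡 n) q₀ q₀)) :=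
  ((continuousAt_extChartAt p₀).tendsto.comp (continuous_fst.tendsto' (p₀, q₀) p₀ rfl)).prodMk_nhds
    ((continuousAt_extChartAt q₀).tendsto.comp (continuous_snd.tendsto' (p₀, q₀) q₀ rfl))

/-- Statements about nearby coordinates are statements about nearby points. -/
lemma eventually_of_pairChart {p₀ q₀ : M} {Q : Eu n × Eu n → M × M → Prop}
    (h : ∀ᶠ p in 𝓝 (extChartAt (𝓡 n) p₀ p₀, extChartAt (𝓡 n) q₀ q₀),
      Q p ((extChartAt (𝓡 n) p₀).symm p.1, (extChartAt (𝓡 n) q₀).symm p.2)) :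
    ∀ᶠ m : M × M in 𝓝 (p₀, q₀), Q (extChartAt (𝓡 n) p₀ m.1, extChartAt (𝓡 n) q₀ m.2) m := by
  filter_upwards [(tendsto_pairChart p₀ q₀).eventually h,
    continuousAt_fst.eventually (extChartAt_source_mem_nhds (I := 𝓡 n) p₀),
    continuousAt_snd.eventually (extChartAt_source_mem_nhds (I := 𝓡 n) q₀)] with m h1 h2 h3
  have h2' : m.1 ∈ (extChartAt (𝓡 n) p₀).source := h2
  have h3' : m.2 ∈ (extChartAt (𝓡 n) q₀).source := h3
  simp only [(extChartAt (𝓡 n) p₀).left_inv h2', (extChartAt (𝓡 n) q₀).left_inv h3'] at h1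
  exact h1

lemma mfderiv_eq_fderiv_chart {p₀ : M} {f : M → W} (hf : MDifferentiableAt (𝓡 n) 𝓘(ℝ, W) f p₀)
    (u : Eu n) : (mfderiv (𝓡 n) 𝓘(ℝ, W) f p₀ : Eu n →L[ℝ] W) u =
      fderiv ℝ (fun x => f ((extChartAt (𝓡 n) p₀).symm x)) (extChartAt (𝓡 n) p₀ p₀) u := by
  have h1 : fderivWithin ℝ (writtenInExtChartAt (𝓡 n) 𝓘(ℝ, W) p₀ f) (range (𝓡 n))
      (extChartAt (𝓡 n) p₀ p₀) =
      fderiv ℝ (fun x => f ((extChartAt (𝓡 n) p₀).symm x)) (extChartAt (𝓡 n) p₀ p₀) := by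
    rw [ModelWithCorners.range_eq_univ, fderivWithin_univ]
    rfl
  exact congrArg (fun L : Eu n →L[ℝ] W => L u) (hf.mfderiv.trans h1)

lemma mfderiv_eq_fderiv_pairChart {p₀ q₀ : M} {f : M × M → W}
    (hf : MDifferentiableAt ((𝓡 n).prod (𝓡 n)) 𝓘(ℝ, W) f (p₀, q₀)) (u : Eu n × Eu n) :
    (mfderiv ((𝓡 n).prod (𝓡 n)) 𝓘(ℝ, W) f (p₀, q₀) : Eu n × Eu n →L[ℝ] W) u =
      fderiv ℝ (fun p : Eu n × Eu n =>
        f ((extChartAt (𝓡 n) p₀).symm p.1, (extChartAt (𝓡 n) q₀).symm p.2))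
        (extChartAt (𝓡 n) p₀ p₀, extChartAt (𝓡 n) q₀ q₀) u := by
  have h1 : fderivWithin ℝ (writtenInExtChartAt ((𝓡 n).prod (𝓡 n)) 𝓘(ℝ, W) (p₀, q₀) f)
      (range ((𝓡 n).prod (𝓡 n))) (extChartAt ((𝓡 n).prod (𝓡 n)) (p₀, q₀) (p₀, q₀)) =
      fderiv ℝ (fun p : Eu n × Eu n =>
        f ((extChartAt (𝓡 n) p₀).symm p.1, (extChartAt (𝓡 n) q₀).symm p.2))
        (extChartAt (𝓡 n) p₀ p₀, extChartAt (𝓡 n) q₀ q₀) := by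
    rw [ModelWithCorners.range_eq_univ, fderivWithin_univ]
    rfl
  exact congrArg (fun L : Eu n × Eu n →L[ℝ] W => L u) (hf.mfderiv.trans h1)

variable [IsManifold (𝓡 n) ∞ M]

/-- A function given near `(p₀, q₀)` by a smooth function of the coordinates is smooth there. -/
lemma eventually_contMDiffAt_of_pairChart {p₀ q₀ : M} {f : M × M → W} {F : Eu n × Eu n → W}
    (hF : SmoothNear F (extChartAt (𝓡 n) p₀ p₀, extChartAt (𝓡 n) q₀ q₀))
    (hf : ∀ᶠ p in 𝓝 (extChartAt (𝓡 n) p₀ p₀, extChartAt (𝓡 n) q₀ q₀),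
      f ((extChartAt (𝓡 n) p₀).symm p.1, (extChartAt (𝓡 n) q₀).symm p.2) = F p) :
    ∀ᶠ m in 𝓝 (p₀, q₀), ContMDiffAt ((𝓡 n).prod (𝓡 n)) 𝓘(ℝ, W) ∞ f m := by
  have h1 : ∀ᶠ m : M × M in 𝓝 (p₀, q₀),
      f m = F (extChartAt (𝓡 n) p₀ m.1, extChartAt (𝓡 n) q₀ m.2) :=
    eventually_of_pairChart (Q := fun p m => f m = F p) hf
  filter_upwards [h1.eventually_nhds, (tendsto_pairChart p₀ q₀).eventually hF,
    continuousAt_fst.eventually (extChartAt_source_mem_nhds (I := 𝓡 n) p₀),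
    continuousAt_snd.eventually (extChartAt_source_mem_nhds (I := 𝓡 n) q₀)] with m h2 h3 h4 h5
  have h4' : ContMDiffAt (𝓡 n) 𝓘(ℝ, Eu n) ∞ (extChartAt (𝓡 n) p₀) m.1 :=
    contMDiffAt_extChartAt' (by rw [← extChartAt_source (𝓡 n)]; exact h4)
  have h5' : ContMDiffAt (𝓡 n) 𝓘(ℝ, Eu n) ∞ (extChartAt (𝓡 n) q₀) m.2 :=
    contMDiffAt_extChartAt' (by rw [← extChartAt_source (𝓡 n)]; exact h5)
  have h6 : ContMDiffAt ((𝓡 n).prod (𝓡 n)) 𝓘(ℝ, Eu n × Eu n) ∞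
      (fun m : M × M => (extChartAt (𝓡 n) p₀ m.1, extChartAt (𝓡 n) q₀ m.2)) m :=
    (h4'.comp m contMDiffAt_fst).prodMk_space (h5'.comp m contMDiffAt_snd)
  have h7 : ContMDiffAt ((𝓡 n).prod (𝓡 n)) 𝓘(ℝ, W) ∞
      (F ∘ fun m : M × M => (extChartAt (𝓡 n) p₀ m.1, extChartAt (𝓡 n) q₀ m.2)) m :=
    ContMDiffAt.comp m h3.contMDiffAt h6
  exact h7.congr_of_eventuallyEq h2

lemma smoothNear_pairChart {p₀ q₀ : M} {f : M × M → W} {s : Set (M × M)} (hs : s ∈ 𝓝 (p₀, q₀))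
    (hf : ContMDiffOn ((𝓡 n).prod (𝓡 n)) 𝓘(ℝ, W) ∞ f s) :
    SmoothNear (fun p : Eu n × Eu n =>
        f ((extChartAt (𝓡 n) p₀).symm p.1, (extChartAt (𝓡 n) q₀).symm p.2))
      (extChartAt (𝓡 n) p₀ p₀, extChartAt (𝓡 n) q₀ q₀) := by
  set T : Set (Eu n × Eu n) := (extChartAt (𝓡 n) p₀).target ×ˢ (extChartAt (𝓡 n) q₀).target
  set Ψ : Eu n × Eu n → M × M := fun p =>
    ((extChartAt (𝓡 n) p₀).symm p.1, (extChartAt (𝓡 n) q₀).symm p.2) with hΨ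
  have hT : T ∈ 𝓝 (extChartAt (𝓡 n) p₀ p₀, extChartAt (𝓡 n) q₀ q₀) :=
    prod_mem_nhds (extChartAt_target_mem_nhds p₀) (extChartAt_target_mem_nhds q₀)
  have h1 : ContMDiffOn 𝓘(ℝ, Eu n × Eu n) ((𝓡 n).prod (𝓡 n)) ∞ Ψ T := by
    have ha : ContMDiffOn 𝓘(ℝ, Eu n × Eu n) (𝓡 n) ∞
        (fun p : Eu n × Eu n => (extChartAt (𝓡 n) p₀).symm p.1) T :=
      (contMDiffOn_extChartAt_symm p₀).comp contDiff_fst.contMDiff.contMDiffOn fun p hp => hp.1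
    have hb : ContMDiffOn 𝓘(ℝ, Eu n × Eu n) (𝓡 n) ∞
        (fun p : Eu n × Eu n => (extChartAt (𝓡 n) q₀).symm p.2) T :=
      (contMDiffOn_extChartAt_symm q₀).comp contDiff_snd.contMDiff.contMDiffOn fun p hp => hp.2
    exact ha.prodMk hb
  have h2 : Ψ ⁻¹' s ∈ 𝓝 (extChartAt (𝓡 n) p₀ p₀, extChartAt (𝓡 n) q₀ q₀) := by
    refine (h1.continuousOn.continuousAt hT).preimage_mem_nhds ?_
    simp only [hΨ, extChartAt_to_inv]
    exact hs
  refine SmoothNear.of_contDiffOn (inter_mem hT h2) ?_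
  exact (hf.comp (h1.mono inter_subset_left) fun p hp => hp.2).contDiffOn

end PairChart

end FoldCaustic

end

open FoldCaustic in
theorem mainTheorem5 {n : ℕ} {M : Type*} [TopologicalSpace M] [T2Space M]
    [SecondCountableTopology M] [ChartedSpace (Eu n) M] [IsManifold (𝓡 n) ∞ M]
    [MeasurableSpace M] [BorelSpace M] (g : RiemMetric n M)
    (D : Set (TangentBundle (𝓡 n) M)) (exp : TangentBundle (𝓡 n) M → M)
    (hexp : IsRegularExp D exp) (p₀ : M) (v₀ : Eu n) (hfold : IsFold D exp p₀ v₀)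
    (q₀ : M) (hq₀ : q₀ = expAt exp p₀ v₀) :
    ∃ O₀ ∈ 𝓝 (⟨p₀, v₀⟩ : TangentBundle (𝓡 n) M), O₀ ⊆ {x | x ∈ D ∧ x.2 ≠ 0} ∧
    ∀ O : Set (TangentBundle (𝓡 n) M), IsOpen O → ⟨p₀, v₀⟩ ∈ O → O ⊆ O₀ →
    -- `z'` is a smooth defining function of `Σ` near `(p₀, q₀)`
    (∃ s ∈ 𝓝 (p₀, q₀),
      ContMDiffOn ((𝓡 n).prod (𝓡 n)) 𝓘(ℝ, ℝ) ∞ (signedDist g D exp O) s ∧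
      ∀ x ∈ s, signedDist g D exp O x = 0 ↔ x.2 ∈ conjLocus D exp O x.1) ∧
    mfderiv (𝓡 n) 𝓘(ℝ, ℝ) (fun q => signedDist g D exp O (p₀, q)) q₀ ≠ 0 ∧
    -- any choice of `z''` that completes `z'` to coordinates near `(p₀, q₀)`
    ∀ z'' : M × M → Eu (2 * n - 1),
    (∃ s ∈ 𝓝 (p₀, q₀),
      ContMDiffOn ((𝓡 n).prod (𝓡 n)) 𝓘(ℝ, Eu (2 * n - 1)) ∞ z'' s) →
    (∀ X : TangentSpace ((𝓡 n).prod (𝓡 n)) (p₀, q₀),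
      mfderiv ((𝓡 n).prod (𝓡 n)) 𝓘(ℝ, ℝ) (signedDist g D exp O) (p₀, q₀) X = 0 →
      mfderiv ((𝓡 n).prod (𝓡 n)) 𝓘(ℝ, Eu (2 * n - 1)) z'' (p₀, q₀) X = 0 → X = 0) →
    -- the parametrization `σ` of `S` (hence of `Σ`) by `z''`
    ∃ σ : Eu (2 * n - 1) → TangentBundle (𝓡 n) M, σ (z'' (p₀, q₀)) = ⟨p₀, v₀⟩ ∧
    (∃ Z ∈ 𝓝 (z'' (p₀, q₀)),
      ContMDiffOn 𝓘(ℝ, Eu (2 * n - 1)) (𝓡 n).tangent ∞ σ Z ∧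
      ∀ ζ ∈ Z, σ ζ ∈ O ∧ (σ ζ).2 ∈ conjVectors D exp (σ ζ).1 ∧
        z'' ((σ ζ).1, exp (σ ζ)) = ζ ∧
        0 < invA g exp (σ ζ).1 (σ ζ).2 ∧ 0 < invD g exp (σ ζ).1 (σ ζ).2) ∧
    -- the weights
    ∀ κs κ : TangentBundle (𝓡 n) M → ℂ,
    ContMDiffOn (𝓡 n).tangent 𝓘(ℝ, ℂ) ∞ κs {x | x.2 ≠ 0} →
    ContMDiffOn (𝓡 n).tangent 𝓘(ℝ, ℂ) ∞ κ {x | x.2 ≠ 0} →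
    -- the kernel of the part of `N` near `(p₀, v₀)`, and of `N` itself for localized weights
    ∀ 𝒩 : (M → ℂ) → M → ℂ,
    (𝒩 = normalOp g exp κs κ (timesIn O) ∨
      (WeightsLocalized g D exp κs κ O p₀ q₀ ∧ 𝒩 = normalOp g exp κs κ (maxTimes D))) →
    (∃ R : ℝ × Eu (2 * n - 1) → ℂ, ContDiff ℝ ∞ R ∧
      HasKernelNear g 𝒩
        (foldKernel g exp (signedDist g D exp O) z'' σ
          fun s ζ => weightSigma g exp κs κ (σ ζ) + s * R (s, ζ)) p₀ q₀) ∧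
    (weightSigma g exp κs κ ⟨p₀, v₀⟩ ≠ 0 →
      ∃ R : ℝ × Eu (2 * n - 1) → ℂ, ContDiff ℝ ∞ R ∧
        HasKernelNear g 𝒩
          (foldKernel g exp (signedDist g D exp O) z'' σ
            fun s ζ => weightSigma g exp κs κ (σ ζ) * (1 + s * R (s, ζ))) p₀ q₀) := by
  subst hq₀
  set q₀ := expAt exp p₀ v₀ with hq₀
  set x₀ := extChartAt (𝓡 n) p₀ p₀ with hx₀
  set y₀ := extChartAt (𝓡 n) q₀ q₀ with hy₀
  have hconj := hfold.1.1
  have hdom : (x₀, v₀) ∈ expDomain D exp p₀ q₀ := base_mem_expDomain hconj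
  have hn : 0 < n := by
    rcases Nat.eq_zero_or_pos n with h | h
    · subst h; exact absurd (Subsingleton.elim _ _) hconj.1
    · exact h
  obtain ⟨α, ζ, X, N, Γ, Lt, hmod⟩ := exists_isFoldModel_of_isFold g hexp hfold
  obtain ⟨S₁, hS₁, hS, hloc⟩ := hmod.exists_localization
  set S : Set (Eu n × Eu n) := S₁ ∩ expDomain D exp p₀ q₀
  have hSd : S ⊆ expDomain D exp p₀ q₀ := inter_subset_right
  have hSn : S ∈ 𝓝 (x₀, v₀) := inter_mem hS₁ ((isOpen_expDomain hexp).mem_nhds hdom)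
  have hbase : bundleChart p₀ (x₀, v₀) = ⟨p₀, v₀⟩ := bundleChart_base p₀ v₀
  have hx₀t : x₀ ∈ (extChartAt (𝓡 n) p₀).target := mem_extChartAt_target p₀
  refine ⟨bundleChart p₀ '' S, hbase ▸ image_bundleChart_mem_nhds p₀ hx₀t hSn, ?_, ?_⟩
  · rintro _ ⟨z, hz, rfl⟩
    exact ⟨(hSd hz).2.1, (bundleChart_snd_ne_zero (hSd hz).1).2 (hSd hz).2.2.1⟩
  intro O hO hO0 hOS
  have hOD : O ⊆ D := fun v hv => by
    obtain ⟨z, hz, rfl⟩ := hOS hv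
    exact (hSd hz).2.1
  have hsub : chartPreimage p₀ O ⊆ S :=
    chartPreimage_subset hSd hOS fun x hx => chartVec_injective p₀ hx
  -- the signed distance in coordinates
  have hsd := eventually_signedDist_eq hexp hmod hx₀t rfl hSd (fun z hz => hS z hz.1)
    (fun B hB => (hloc B hB).mono fun p hp => hp.2) hO hOS (hbase ▸ hO0)
  have hsd1 : ∀ᶠ p : Eu n × Eu n in 𝓝 (x₀, y₀), signedDist g D exp O
      ((extChartAt (𝓡 n) p₀).symm p.1, (extChartAt (𝓡 n) q₀).symm p.2) = ζ p :=
    hsd.mono fun p hp => hp.1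
  have hsdM := eventually_contMDiffAt_of_pairChart hmod.smooth_ζ hsd1
  have hsdM0 : ContMDiffAt ((𝓡 n).prod (𝓡 n)) 𝓘(ℝ, ℝ) ∞ (signedDist g D exp O) (p₀, q₀) :=
    hsdM.self_of_nhds
  have hsdD := hsdM0.mdifferentiableAt (by simp)
  have hcut : ∀ᶠ m : M × M in 𝓝 (p₀, q₀),
      signedDist g D exp O m = 0 ↔ m.2 ∈ conjLocus D exp O m.1 := by
    have h1 := eventually_of_pairChart (p₀ := p₀) (q₀ := q₀) (Q := fun p m =>
      signedDist g D exp O m = ζ p ∧ (m.2 ∈ conjLocus D exp O m.1 ↔ ζ p = 0)) hsd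
    filter_upwards [h1] with m hm
    rw [hm.1, hm.2]
  refine ⟨⟨_, hsdM.and hcut, fun m hm => ContMDiffAt.contMDiffWithinAt hm.1, fun m hm => hm.2⟩,
    ?_, ?_⟩
  · intro h0
    have h1 : MDifferentiableAt (𝓡 n) 𝓘(ℝ, ℝ) (fun q => signedDist g D exp O (p₀, q)) q₀ :=
      (hsdM0.comp q₀ (contMDiffAt_const.prodMk contMDiffAt_id)).mdifferentiableAt (by simp)
    refine hmod.dζ_ne (ContinuousLinearMap.ext fun u => ?_)
    have h2 := mfderiv_eq_fderiv_chart h1 u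
    have h3 : (fun y => signedDist g D exp O (p₀, (extChartAt (𝓡 n) q₀).symm y)) =ᶠ[𝓝 y₀]
        fun y => ζ (x₀, y) := by
      have ht : Tendsto (fun y : Eu n => (x₀, y)) (𝓝 y₀) (𝓝 (x₀, y₀)) :=
        (continuous_const.prodMk continuous_id).tendsto' _ _ rfl
      filter_upwards [ht.eventually hsd1] with y hy
      rw [← hy, hx₀, extChartAt_to_inv]
    rw [h3.fderiv_eq] at h2
    rw [← h2]
    exact congrArg (fun L : Eu n →L[ℝ] ℝ => L u) h0
  -- the parametrization by `z''`
  rintro z'' ⟨s, hs, hz''⟩ hinj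
  set zz : Eu n × Eu n → Eu (2 * n - 1) := fun p =>
    z'' ((extChartAt (𝓡 n) p₀).symm p.1, (extChartAt (𝓡 n) q₀).symm p.2) with hzz
  have hzzs : SmoothNear zz (x₀, y₀) := smoothNear_pairChart hs hz''
  have hzz0 : zz (x₀, y₀) = z'' (p₀, q₀) := by simp only [hzz, hx₀, hy₀, extChartAt_to_inv]
  have hz''D : MDifferentiableAt ((𝓡 n).prod (𝓡 n)) 𝓘(ℝ, Eu (2 * n - 1)) z'' (p₀, q₀) :=
    (hz''.contMDiffAt hs).mdifferentiableAt (by simp)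
  obtain ⟨Υ, hΥ⟩ := hmod.exists_isFoldParam (F := Eu (2 * n - 1))
    (by simp only [finrank_euclideanSpace_fin]; omega) hzzs (fun u h1 h2 => by
      refine hinj u ?_ ?_
      · refine (mfderiv_eq_fderiv_pairChart hsdD u).trans ?_
        rw [Filter.EventuallyEq.fderiv_eq hsd1]
        exact h1
      · exact (mfderiv_eq_fderiv_pairChart hz''D u).trans h2)
  have hΥt : Tendsto Υ (𝓝 ((0 : ℝ), zz (x₀, y₀))) (𝓝 (x₀, v₀)) := by
    have := hΥ.smooth.continuousAt; rwa [ContinuousAt, hΥ.base] at this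
  have h0t : Tendsto (fun b : Eu (2 * n - 1) => ((0 : ℝ), b)) (𝓝 (zz (x₀, y₀)))
      (𝓝 ((0 : ℝ), zz (x₀, y₀))) := (continuous_const.prodMk continuous_id).tendsto' _ _ rfl
  have hOn : chartPreimage p₀ O ∈ 𝓝 (x₀, v₀) :=
    (isOpen_chartPreimage hO).mem_nhds ⟨hx₀t, hbase ▸ hO0⟩
  refine ⟨fun b => bundleChart p₀ (Υ (0, b)), ?_, ?_, ?_⟩
  · rw [← hzz0]
    exact (congrArg (bundleChart p₀) hΥ.base).trans hbase
  · rw [← hzz0]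
    refine ⟨_, (h0t.eventually hΥ.smooth).and ((h0t.eventually hΥ.right_inv).and
      ((h0t.eventually (hΥt.eventually hOn)).and
        (h0t.eventually (hΥt.eventually (invA_mul_invD hexp hmod hdom))))), ?_, ?_⟩
    · rintro b ⟨h1, -, h2, -⟩
      have h3 : ContDiffAt ℝ ∞ (fun b => Υ (0, b)) b :=
        ContDiffAt.comp b h1 (contDiffAt_const.prodMk contDiffAt_id)
      exact ((contMDiffAt_bundleChart p₀ h2.1).comp b h3.contMDiffAt).contMDiffWithinAt
    · rintro b ⟨-, h1, h2, h3⟩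
      obtain ⟨hA, hDp, -⟩ := h3 h1.1
      have h4 := hS _ (hsub h2).1
      have h5 := hSd (hsub h2)
      refine ⟨h2.2, (mem_conjVectors_iff hexp h5).2 ?_, ?_, hA, hDp⟩
      · exact h4.2.2.trans (by rw [h1.1, zero_mul])
      · have h6 := h1.2
        simp only [hzz] at h6
        rw [symm_expCoord h5] at h6
        exact h6
  -- the kernel
  intro κs κ hκs hκ 𝒩 h𝒩
  set w : Eu n × Eu n → ℂ := fun z => weightSigma g exp κs κ (bundleChart p₀ z) with hw
  set k := volJac g exp p₀ q₀ X Lt with hk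
  have hws : SmoothNear w (Υ (0, zz (x₀, y₀))) := by
    rw [hΥ.base]; exact smoothNear_weightSigma hexp hκs hκ hn hdom
  have hks : SmoothNear k (Υ (0, zz (x₀, y₀))) := by
    rw [hΥ.base]; exact smoothNear_volJac hexp hmod hdom
  have hk0 : k (Υ (0, zz (x₀, y₀))) ≠ 0 := by
    rw [hΥ.base]; exact (volJac_pos_of_mem hdom hmod.jacQuot_ne).ne'
  have hcoef := smoothNear_foldCoef hΥ.smooth hws hks hk0
  have hcoef0 : ∀ᶠ u : ℝ × Eu (2 * n - 1) in 𝓝 ((0 : ℝ), zz (x₀, y₀)),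
      foldCoef w k Υ (0, u.2) = w (Υ (0, u.2)) := by
    have h1 : ContinuousAt (fun u : ℝ × Eu (2 * n - 1) => k (Υ (0, u.2))) (0, zz (x₀, y₀)) :=
      ((hks.comp hΥ.smooth).comp_of_eq ((SmoothNear.const (0 : ℝ)).prodMk SmoothNear.snd)
        rfl).continuousAt
    filter_upwards [h1.eventually_ne hk0] with u hu using foldCoef_zero hu
  have hkernel : ∀ a : ℝ → Eu (2 * n - 1) → ℂ,
      (∀ᶠ u in 𝓝 ((0 : ℝ), zz (x₀, y₀)), a u.1 u.2 = foldCoef w k Υ u) →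
      HasKernelNear g 𝒩 (foldKernel g exp (signedDist g D exp O) z''
        (fun b => bundleChart p₀ (Υ (0, b))) a) p₀ q₀ := by
    intro a ha
    have h1 := hasKernelNear_timesIn hn hexp hmod hdom rfl rfl hSd
      (fun B hB => (hloc B hB).mono fun p hp w hw => hp.1 w hw.1) hO hOS (hbase ▸ hO0) hsd1
      (fun p => rfl) hzzs hΥ hκs hκ ha
    rcases h𝒩 with rfl | ⟨hl, rfl⟩
    · exact h1
    · exact h1.congr (normalOp_maxTimes_eq hn hexp.isOpen_domain hOD hl)
  refine ⟨?_, fun hne => ?_⟩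
  · obtain ⟨R, hR, hRa⟩ := hcoef.exists_remainder
    refine ⟨R, hR, hkernel _ ?_⟩
    filter_upwards [hRa, hcoef0] with u h1 h2
    rw [h1, h2]
  · obtain ⟨R, hR, hRa⟩ := hcoef.exists_relative_remainder (by
      rw [foldCoef_zero hk0, hΥ.base]
      exact fun h1 => hne (hbase ▸ h1))
    refine ⟨R, hR, hkernel _ ?_⟩
    filter_upwards [hRa, hcoef0] with u h1 h2
    rw [h1, h2]
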